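/- **Setting.** Let $\mathcal H$ be a separable complex Hilbert space, $B(\mathcal H)$ its bounded operators, $(\cdot,\cdot)$ linear in the first argument, $\mathcal I=(a,b)$ a bounded interval with $a<b$ and $0\in\bar{\mathcal I}=[a,b]$, $D=d/dt$ (one-sided at the ends). Put $\Re A=\frac12(A+A^*)$, $\Im A=\frac1{2i}(A-A^*)$. Let $r\ge1$, $n=[r/2]$, and let $s$ be even, $0\le s\le r$. A differential expression of order $r$ is $l[y]=\sum_{k=0}^r i^k l_k[y]$, $l_{2j}=D^jp_jD^j$, $l_{2j-1}=\frac12D^{j-1}\{Dq_j+s_jD\}D^{j-1}$, with $p_j,q_j,s_j\in C^j(\bar{\mathcal I},B(\mathcal H))$. Its form at $t$ is $$l\{h,g\}=\sum_{j=0}^{[r/2]}(p_jh_j,g_j)+\tfrac i2\sum_{j=1}^{[(r+1)/2]}\big((s_jh_j,g_{j-1})-(q_jh_{j-1},g_j)\big),$$ and $l\{y,y\}$ means $h_j=g_j=y^{(j)}(t)$. Its quasi-derivatives $y^{[k]}=y^{[k]}(t|l)$ are $y^{[k]}=y^{(k)}$ for $k<n$; $y^{[n]}=p_ny^{(n)}-\frac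 i2q_ny^{(n-1)}$ if $r=2n$, $y^{[n]}=-\frac i2q_{n+1}y^{(n)}$ if $r=2n+1$; and $y^{[r-j]}=-Dy^{[r-j-1]}+p_jy^{(j)}+\frac i2[s_{j+1}y^{(j+1)}-q_jy^{(j-1)}]$, $0\le j\le[\frac{r-1}2]$ ($q_0=0$). The same definitions apply to orders $0$ and $s$. Let $l_\lambda$ be a family of expressions of order $r$ with coefficients $p_j(t,\lambda),q_j(t,\lambda),s_j(t,\lambda)$, and let $\mathcal B\supseteq\mathbb C\setminus\mathbb R$ be such that every point of $\mathcal B$ has a neighbourhood, independent of $t\in\bar{\mathcal I}$, in which all coefficients are analytic in $\lambda$, and for $\lambda\in\mathcal B$, $t\in\bar{\mathcal I}$: the coefficients are of class $C^j$ in $t$ as above; $p_n^{-1}\in B(\mathcal H)$ if $r=2n$, $(q_{n+1}+s_{n+1})^{-1}\in B(\mathcal H)$ if $r=2n+1$; $p_j(t,\lambda)=p_j(t,\bar\lambda)^*$, $q_j(t,\lambda)=s_j(t,\bar\lambda)^*$. Let $m$ be an expression of order $s$, independent of $\lambda$, with coefficients $\tilde p_j=\tilde p_j^*$, $\tilde q_j$,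 $\tilde s_j=\tilde q_j^*$ of class $C^j$, such that for all $h_0,h_1,\ldots\in\mathcal H$, $t\in\bar{\mathcal I}$, $\Im\lambda\ne0$, $$0\le m\{h,h\}\le-\frac{\Im\,(l_\lambda\{h,h\})}{\Im\lambda}.$$ *First order system.* Write $x\in\mathcal H^r$ as $(x_0,\dots,x_{n-1},u_0,\dots,u_{n-1})$ if $r=2n$, with a further component $w$ if $r=2n+1$. Put $g_j=x_j$ $(j<n)$, $g_n=p_n^{-1}(u_{n-1}+\frac i2q_nx_{n-1})$ if $r=2n$, $g_n=iw$ if $r=2n+1>1$, and $g_0=w$ if $r=1$. Let $T(t,l)x=(g_0,\dots,g_n)$. Let $Q(t,l)=\begin{pmatrix}0&iI_n\\-iI_n&0\end{pmatrix}$ if $r=2n$ and $Q(t,l)=\begin{pmatrix}0&iI_n\\-iI_n&0\end{pmatrix}\oplus q_{n+1}(t)$ if $r=2n+1$. Let $H(t,l)$ be given by: for $0\le j<n$, with $u_{-1}=0$, $q_0=0$, $$(Hx)_j=-p_jg_j-\tfrac i2(s_{j+1}g_{j+1}-q_jg_{j-1})+u_{j-1},\qquad (Hx)_{n+j}=g_{j+1},$$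 and, if $r=2n+1>1$, $(Hx)_{2n}=i(p_ng_n-\frac i2q_ng_{n-1}-u_{n-1})$; if $r=1$, $H=-p_0$. Let $W(t,l,m)=T(t,l)^*\,\mathbf m(t)\,T(t,l)$ with $(\mathbf mg)_j=\tilde p_jg_j+\frac i2(\tilde s_{j+1}g_{j+1}-\tilde q_jg_{j-1})$, $0\le j\le n$, coefficients with index greater than $s/2$, and $\tilde q_0$, being zero. For $f\in C^s(\bar{\mathcal I},\mathcal H)$ let $F(t,l,m)\in\mathcal H^r$ be $(f,\dots,f^{(n-1)},f^{[r-1]}(t|l),\dots,f^{[n]}(t|l))$ if $r=s=2n$; $f$ if $r=1$; $(f,\dots,f^{(n-1)},0,\dots,0,-if^{(n)})$ if $r=2n+1>1$, $s=2n$; $(f,\dots,f^{(s/2)},0,\dots,0)$ otherwise. Let $$\vec y(t,l,m,f)=\big(y,\dots,y^{(n-1)},\;y^{[r-1]}(t|l)-f^{[s-1]}(t|m),\dots,y^{[r-n]}(t|l)-f^{[s-n]}(t|m)\big)$$ (with $f^{[k]}(t|m):=0$ for $k<s/2$), followed by $-iy^{(n)}$ if $r=2n+1>1$; $\vec y=y$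 if $r=1$. Let $X_\lambda(t)\in B(\mathcal H^r)$ solve $\frac i2\big((Q(t,l_\lambda)X)'+Q(t,l_\lambda)^*X'\big)-H(t,l_\lambda)X=0$ on $\bar{\mathcal I}$, $X_\lambda(0)=I_r$; $G=\Re Q(0,l_\lambda)$. For $M(\lambda)\in B(\mathcal H^r)$ and an $\mathcal H^r$-valued $g$ put $$(\mathcal G_\lambda g)(t)=\int_a^bX_\lambda(t)\Big\{M(\lambda)-\tfrac12\operatorname{sgn}(\tau-t)(iG)^{-1}\Big\}X_{\bar\lambda}(\tau)^*g(\tau)\,d\tau .$$ An analytic function $M(\lambda)=M(\bar\lambda)^*\in B(\mathcal H^r)$ of nonreal $\lambda$ is a *characteristic operator* if for all $\Im\lambda\neq0$ and all $F\in L^2_{W_\lambda}(\mathcal I)$, $W_\lambda=\Im H(t,l_\lambda)/\Im\lambda$, the function $x=\mathcal G_\lambda(W_\lambda F)$ satisfies $\Im\lambda\,\big((\Re Q(b,l_\lambda)x(b),x(b))-(\Re Q(a,l_\lambda)x(a),x(a))\big)\le0$. Its *resolvent* $R(\lambda)$ maps $f\in H:=C^s(\bar{\mathcal I},\mathcal H)$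 to the first component $R(\lambda)f$ of $\mathcal G_\lambda\big(W(\cdot,l_{\bar\lambda},m)F(\cdot,l_{\bar\lambda},m)\big)$. Assume finally that for some $\lambda_0\in\mathcal B$, some $\alpha,\beta\in\bar{\mathcal I}$ with $0\in[\alpha,\beta]$ and some $\delta>0$, $$-\int_\alpha^\beta\Big(\frac{\Im l_{\lambda_0}}{\Im\lambda_0}\Big)\{y,y\}\,dt\ge\delta\,\|\vec y(0,l_{\lambda_0},m,0)\|^2$$ for every solution $y\in C^r(\bar{\mathcal I},\mathcal H)$ of $l_{\lambda_0}[y]=0$, where $(\Im l_\lambda/\Im\lambda)\{y,y\}=\Im(l_\lambda\{y,y\})/\Im\lambda$ for nonreal $\lambda$, and $\Im l_{\lambda}/\Im\lambda$ means $\partial l_\lambda/\partial\lambda$ for real $\lambda$. **Theorem 3.2.** For nonreal $\lambda$ the solution $X_\lambda$ exists, and $X_\lambda(a)$, $X_\lambda(b)$, $G$ are boundedly invertible. Consider operator functions $\mathcal M_\lambda,\mathcal N_\lambda\in B(\mathcal H^r)$, analytic in nonreal $\lambda$, such that for $\Im\lambda\ne0$: (i) $\mathcal M_{\bar\lambda}^*[\Re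 Q(a,l_\lambda)]\mathcal M_\lambda=\mathcal N_{\bar\lambda}^*[\Re Q(b,l_\lambda)]\mathcal N_\lambda$; (ii) $\|\mathcal M_\lambda h\|+\|\mathcal N_\lambda h\|>0$ for $0\ne h\in\mathcal H^r$; (iii) $\{\mathcal M_\lambda h\oplus\mathcal N_\lambda h\mid h\in\mathcal H^r\}$ is a maximal $\mathcal Q$-nonnegative subspace of $\mathcal H^{2r}$, $\mathcal Q=(\Im\lambda)\operatorname{diag}(\Re Q(a,l_\lambda),-\Re Q(b,l_\lambda))$. 1°. For such $\mathcal M_\lambda,\mathcal N_\lambda$ one has $\Im\lambda\,(\mathcal N_\lambda^*[\Re Q(b,l_\lambda)]\mathcal N_\lambda-\mathcal M_\lambda^*[\Re Q(a,l_\lambda)]\mathcal M_\lambda)\le0$ and $(X_\lambda^{-1}(a)\mathcal M_\lambda-X_\lambda^{-1}(b)\mathcal N_\lambda)^{-1}\in B(\mathcal H^r)$ for $\Im\lambda\neq0$; the function $$M(\lambda)=-\tfrac12\big(X_\lambda^{-1}(a)\mathcal M_\lambda+X_\lambda^{-1}(b)\mathcal N_\lambda\big)\big(X_\lambda^{-1}(a)\mathcal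 M_\lambda-X_\lambda^{-1}(b)\mathcal N_\lambda\big)^{-1}(iG)^{-1}$$ is a characteristic operator; and for every $f\in H$, $\Im\lambda\ne0$, the boundary problem $$l_\lambda[y]=m[f]\ \text{on }\bar{\mathcal I},\qquad \exists\,h\in\mathcal H^r:\ \vec y(a,l_\lambda,m,f)=\mathcal M_\lambda h,\quad\vec y(b,l_\lambda,m,f)=\mathcal N_\lambda h$$ has exactly one solution in $C^r(\bar{\mathcal I},\mathcal H)$, namely $R(\lambda)f$, where $R(\lambda)$ is the resolvent of this $M(\lambda)$. 2°. Conversely, for every characteristic operator $M(\lambda)$ there are $\mathcal M_\lambda,\mathcal N_\lambda$, analytic in nonreal $\lambda$ and satisfying (i)–(iii), such that for all $f\in H$ and $\Im\lambda\ne0$ the function $R(\lambda)f$ belongs to $C^r(\bar{\mathcal I},\mathcal H)$ and solves this boundary problem, $R(\lambda)$ being the resolvent of $M(\lambda)$. -/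

import Mathlib

open Set MeasureTheory ComplexConjugate

noncomputable section

/-- The Hilbert space `E^r`, the orthogonal sum of `r` copies of `E`. -/
abbrev BlockSpace (E : Type*) [NormedAddCommGroup E] (r : ℕ) : Type _ :=
  PiLp 2 (fun _ : Fin r => E)

section Operators

variable {V : Type*} [NormedAddCommGroup V] [InnerProductSpace ℂ V] [CompleteSpace V]

/-- `ℜ A = (A + A*) / 2`. -/
def reOp (A : V →L[ℂ] V) : V →L[ℂ] V := (1 / 2 : ℂ) • (A + ContinuousLinearMap.adjoint A)

/-- `ℑ A = (A - A*) / (2 i)`. -/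
def imOp (A : V →L[ℂ] V) : V →L[ℂ] V :=
  (1 / (2 * Complex.I)) • (A - ContinuousLinearMap.adjoint A)

/-- The real number `(A x, x)` for a self-adjoint operator `A`. -/
def quadForm (A : V →L[ℂ] V) (x : V) : ℝ := (inner ℂ x (A x)).re

/-- `X` is an operator solution on `[a, b]` of the homogeneous equation
`(i/2) ((Q x)' + Q* x') - H x = 0` with `X(0) = I` (derivatives at the ends are one-sided). -/
def IsOperatorSolution (a b : ℝ) (Q H : ℝ → V →L[ℂ] V) (X : ℝ → V →L[ℂ] V) : Prop :=
  ContDiffOn ℝ 1 X (Icc a b) ∧ X 0 = 1 ∧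
  ∀ t ∈ Icc a b,
    (Complex.I / 2) • (derivWithin (fun τ => Q τ ∘L X τ) (Icc a b) t +
        ContinuousLinearMap.adjoint (Q t) ∘L derivWithin X (Icc a b) t) - H t ∘L X t = 0

/-- The operator solution `X(t)`, `X(0) = I`, of the homogeneous equation. Only its values on
`[a, b]`, where it is unique, matter. -/
def operatorSolution (a b : ℝ) (Q H : ℝ → V →L[ℂ] V) : ℝ → V →L[ℂ] V :=
  Classical.epsilon (IsOperatorSolution a b Q H)

/-- For the operator function `M`, the coefficients `Q_z`, `H_z` (`z` is the spectral parameter)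
and the right-hand side `g`, the vector function
`t ↦ ∫_a^b X_z(t) {M(z) - (1/2) sgn(σ - t) (i G)⁻¹} X_{z̄}(σ)* g(σ) dσ`, `G = ℜ Q(0)`. -/
def greenIntegral (a b : ℝ) (Q H : ℂ → ℝ → V →L[ℂ] V) (M : ℂ → V →L[ℂ] V) (z : ℂ)
    (g : ℝ → V) (t : ℝ) : V :=
  ∫ σ in a..b,
    operatorSolution a b (Q z) (H z) t
      ((M z - ((1 / 2 * Real.sign (σ - t) : ℝ) : ℂ) • Ring.inverse (Complex.I • reOp (Q z 0)))
        (ContinuousLinearMap.adjoint (operatorSolution a b (Q (conj z)) (H (conj z)) σ) (g σ)))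

/-- The weight `W_z(t) = ℑ H_z(t) / ℑ z`. -/
def nevWeight (H : ℂ → ℝ → V →L[ℂ] V) (z : ℂ) (t : ℝ) : V →L[ℂ] V :=
  ((1 / z.im : ℝ) : ℂ) • imOp (H z t)

/-- `M` is a characteristic operator on the bounded interval `(a, b)` of the equation
`(i/2) ((Q x)' + Q* x') - H_z x = W_z F`, `W_z = ℑ H_z / ℑ z`: it is an analytic operator function
of nonreal `z`, `M(z) = M(z̄)*`, and for every `F ∈ L²_{W_z}(a, b)` the solution `x = x_z(t, F)`
given by `greenIntegral` with `g = W_z F` satisfies `ℑ z (U[x(b)] - U[x(a)]) ≤ 0`,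
`U[x(t)] = (ℜ Q(t) x(t), x(t))`. Since `[a, b]` is compact and `x` is continuous on it, no
restriction on supports is needed, and the values at the ends are the limits at the ends. -/
structure IsCharacteristicOperator (a b : ℝ) (Q H : ℂ → ℝ → V →L[ℂ] V)
    (M : ℂ → V →L[ℂ] V) : Prop where
  analytic : AnalyticOnNhd ℂ M {z | z.im ≠ 0}
  symm : ∀ z : ℂ, z.im ≠ 0 → M z = ContinuousLinearMap.adjoint (M (conj z))
  dissipative : ∀ z : ℂ, z.im ≠ 0 → ∀ F : ℝ → V,
    AEStronglyMeasurable F (volume.restrict (Icc a b)) →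
    IntegrableOn (fun t => quadForm (nevWeight H z t) (F t)) (Icc a b) →
    z.im * (quadForm (reOp (Q z b)) (greenIntegral a b Q H M z (fun t => nevWeight H z t (F t)) b)
      - quadForm (reOp (Q z a))
          (greenIntegral a b Q H M z (fun t => nevWeight H z t (F t)) a)) ≤ 0

/-- A linear set `S ⊆ V ⊕ V` is nonnegative for the form `c ((A u, u) - (B v, v))`. -/
def IsNonnegSubspace (c : ℝ) (A B : V →L[ℂ] V) (S : Submodule ℂ (V × V)) : Prop :=
  ∀ w ∈ S, 0 ≤ c * (quadForm A w.1 - quadForm B w.2)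

/-- `S` is a maximal nonnegative subspace for the form `c ((A u, u) - (B v, v))`
(maximality forces it to be closed). -/
def IsMaximalNonnegSubspace (c : ℝ) (A B : V →L[ℂ] V) (S : Submodule ℂ (V × V)) : Prop :=
  IsNonnegSubspace c A B S ∧ ∀ S', IsNonnegSubspace c A B S' → S ≤ S' → S' = S

/-- Analytic boundary operators `𝓜_z`, `𝓝_z` (`z` nonreal) such that
`𝓜_{z̄}* ℜQ(a) 𝓜_z = 𝓝_{z̄}* ℜQ(b) 𝓝_z`, `‖𝓜_z h‖ + ‖𝓝_z h‖ > 0` for `h ≠ 0`, and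
`{𝓜_z h ⊕ 𝓝_z h}` is maximal nonnegative for `ℑ z · diag(ℜQ(a), -ℜQ(b))`. -/
structure IsMaximalDissipativePair (a b : ℝ) (Q : ℂ → ℝ → V →L[ℂ] V)
    (Ma Nb : ℂ → V →L[ℂ] V) : Prop where
  analytic_left : AnalyticOnNhd ℂ Ma {z | z.im ≠ 0}
  analytic_right : AnalyticOnNhd ℂ Nb {z | z.im ≠ 0}
  symm : ∀ z : ℂ, z.im ≠ 0 →
    ContinuousLinearMap.adjoint (Ma (conj z)) ∘L reOp (Q z a) ∘L Ma z =
      ContinuousLinearMap.adjoint (Nb (conj z)) ∘L reOp (Q z b) ∘L Nb z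
  nondegenerate : ∀ z : ℂ, z.im ≠ 0 → ∀ h : V, h ≠ 0 → 0 < ‖Ma z h‖ + ‖Nb z h‖
  maximal : ∀ z : ℂ, z.im ≠ 0 →
    IsMaximalNonnegSubspace z.im (reOp (Q z a)) (reOp (Q z b))
      (LinearMap.range ((Ma z : V →ₗ[ℂ] V).prod (Nb z : V →ₗ[ℂ] V)))

/-- The operator `X_z(a)⁻¹ 𝓜_z`. -/
def pullBack (X : V →L[ℂ] V) (A : V →L[ℂ] V) : V →L[ℂ] V := Ring.inverse X ∘L A

/-- The operator function
`M(z) = -(1/2) (X_z(a)⁻¹ 𝓜_z + X_z(b)⁻¹ 𝓝_z) (X_z(a)⁻¹ 𝓜_z - X_z(b)⁻¹ 𝓝_z)⁻¹ (i G)⁻¹`. -/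
def boundaryCharOp (a b : ℝ) (Q H : ℂ → ℝ → V →L[ℂ] V) (Ma Nb : ℂ → V →L[ℂ] V) (z : ℂ) :
    V →L[ℂ] V :=
  (-(1 / 2) : ℂ) •
    ((pullBack (operatorSolution a b (Q z) (H z) a) (Ma z) +
        pullBack (operatorSolution a b (Q z) (H z) b) (Nb z)) ∘L
      Ring.inverse (pullBack (operatorSolution a b (Q z) (H z) a) (Ma z) -
        pullBack (operatorSolution a b (Q z) (H z) b) (Nb z)) ∘L
      Ring.inverse (Complex.I • reOp (Q z 0)))

end Operators

/-- The coefficients `p_j, q_j, s_j : ℝ → B(E)` of a differential expression in divergent form.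
The order is a separate argument below: an expression of order `r` uses
`p_0, …, p_{[r/2]}` and `q_j, s_j` with `1 ≤ j ≤ [(r+1)/2]`, all other values are ignored. -/
structure DiffExpr (E : Type*) [NormedAddCommGroup E] [InnerProductSpace ℂ E] where
  p : ℕ → ℝ → E →L[ℂ] E
  q : ℕ → ℝ → E →L[ℂ] E
  s : ℕ → ℝ → E →L[ℂ] E

namespace DiffExpr

variable {E : Type*} [NormedAddCommGroup E] [InnerProductSpace ℂ E]

/-- The term `l_k[y]` on the interval `S`: `l_{2j} = D^j p_j D^j` and
`l_{2j-1} = (1/2) D^{j-1} {D q_j + s_j D} D^{j-1}` (for odd `k` one has `j = k / 2 + 1`). -/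
def term (l : DiffExpr E) (S : Set ℝ) (k : ℕ) (y : ℝ → E) : ℝ → E :=
  if Even k then
    iteratedDerivWithin (k / 2) (fun t => l.p (k / 2) t (iteratedDerivWithin (k / 2) y S t)) S
  else fun t => (1 / 2 : ℂ) •
    iteratedDerivWithin (k / 2)
      (fun τ => derivWithin (fun σ => l.q (k / 2 + 1) σ (iteratedDerivWithin (k / 2) y S σ)) S τ +
        l.s (k / 2 + 1) τ (iteratedDerivWithin (k / 2 + 1) y S τ)) S t

/-- The differential expression `l[y] = ∑_{k=0}^r i^k l_k[y]` of order `r` on the interval `S`. -/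
def apply (l : DiffExpr E) (r : ℕ) (S : Set ℝ) (y : ℝ → E) (t : ℝ) : E :=
  ∑ k ∈ Finset.range (r + 1), Complex.I ^ k • l.term S k y t

/-- The quasi-derivatives `y^{[n + d]}(t|l)`, `n = [r/2]`: `y^{[n]} = p_n y^{(n)} - (i/2) q_n y^{(n-1)}`
for `r = 2n`, `y^{[n]} = -(i/2) q_{n+1} y^{(n)}` for `r = 2n+1`, and
`y^{[r-j]} = -D y^{[r-j-1]} + p_j y^{(j)} + (i/2) [s_{j+1} y^{(j+1)} - q_j y^{(j-1)}]`, `q_0 = 0`. -/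
def upperQuasiDeriv (l : DiffExpr E) (r : ℕ) (S : Set ℝ) (y : ℝ → E) : ℕ → ℝ → E
  | 0 => fun t =>
      if Even r then
        l.p (r / 2) t (iteratedDerivWithin (r / 2) y S t) -
          (if r / 2 = 0 then 0
            else (Complex.I / 2) • l.q (r / 2) t (iteratedDerivWithin (r / 2 - 1) y S t))
      else -((Complex.I / 2) • l.q (r / 2 + 1) t (iteratedDerivWithin (r / 2) y S t))
  | d + 1 => fun t =>
      let j := r - (r / 2 + d + 1);
      (-derivWithin (upperQuasiDeriv l r S y d) S t) + l.p j t (iteratedDerivWithin j y S t) +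
        (Complex.I / 2) • (l.s (j + 1) t (iteratedDerivWithin (j + 1) y S t) -
          (if j = 0 then 0 else l.q j t (iteratedDerivWithin (j - 1) y S t)))

/-- The quasi-derivative `y^{[k]}(t|l)`, `0 ≤ k ≤ r`, for the expression `l` of order `r`. -/
def quasiDeriv (l : DiffExpr E) (r : ℕ) (S : Set ℝ) (y : ℝ → E) (k : ℕ) (t : ℝ) : E :=
  if k < r / 2 then iteratedDerivWithin k y S t else l.upperQuasiDeriv r S y (k - r / 2) t

/-- The sesquilinear form
`∑_{j=0}^{[r/2]} (p_j h_j, g_j) + (i/2) ∑_{j=1}^{[(r+1)/2]} {(s_j h_j, g_{j-1}) - (q_j h_{j-1}, g_j)}`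
at the point `t`, with `(·, ·)` linear in the first argument. For `h_j = f^{(j)}(t)`,
`g_j = g^{(j)}(t)` this is `l{f, g}`. -/
def form (l : DiffExpr E) (r : ℕ) (t : ℝ) (h g : ℕ → E) : ℂ :=
  ∑ j ∈ Finset.range (r / 2 + 1), inner ℂ (g j) (l.p j t (h j)) +
    (Complex.I / 2) * ∑ j ∈ Finset.Icc 1 ((r + 1) / 2),
      (inner ℂ (g (j - 1)) (l.s j t (h j)) - inner ℂ (g j) (l.q j t (h (j - 1))))

/-- The coefficients satisfy `p_j, q_j, s_j ∈ C^j([a, b], B(E))`. -/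
def IsSmooth (l : DiffExpr E) (r : ℕ) (a b : ℝ) : Prop :=
  (∀ j, j ≤ r / 2 → ContDiffOn ℝ j (l.p j) (Icc a b)) ∧
  ∀ j, 1 ≤ j → j ≤ (r + 1) / 2 →
    ContDiffOn ℝ j (l.q j) (Icc a b) ∧ ContDiffOn ℝ j (l.s j) (Icc a b)

variable [CompleteSpace E]

/-- The operator on `E^k → E^r` given by an operator matrix. -/
def blockOp {r k : ℕ} (A : ℕ → ℕ → E →L[ℂ] E) : BlockSpace E k →L[ℂ] BlockSpace E r :=
  ((PiLp.continuousLinearEquiv 2 ℂ (fun _ : Fin r => E)).symm :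
      (Fin r → E) →L[ℂ] BlockSpace E r) ∘L
    ContinuousLinearMap.pi fun i : Fin r =>
      ∑ j : Fin k, A i j ∘L PiLp.proj 2 (fun _ : Fin k => E) j

/-- The coefficient `Q(t, l)`, `n = [r/2]`: the operator matrix `J/i = (0, i I_n; -i I_n, 0)` for
`r = 2n`, and `J/i ⊕ q_{n+1}(t)` for `r = 2n + 1` (just `q_1(t)` for `r = 1`). Indices run
from `0`. -/
def Qcoeff (l : DiffExpr E) (r : ℕ) (t : ℝ) : BlockSpace E r →L[ℂ] BlockSpace E r :=
  let n := r / 2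
  blockOp fun i j =>
    if i < n ∧ j = i + n then Complex.I • 1
    else if j < n ∧ i = j + n then -(Complex.I • 1)
    else if i = 2 * n ∧ j = 2 * n then l.q (n + 1) t
    else 0

/-- The entries of `H(t, l)` for `r = 2n`. Indices run from `0`; the four outer cases are the
blocks `h_11`, `h_12`, `h_21`, `h_22`. -/
def HentryEven (l : DiffExpr E) (n : ℕ) (t : ℝ) (i j : ℕ) : E →L[ℂ] E :=
  let P := Ring.inverse (l.p n t)
  if i < n then
    if j < n then
      if i = j then
        (if i + 1 = n then (1 / 4 : ℂ) • (l.s n t ∘L P ∘L l.q n t) else 0) - l.p i t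
      else if i = j + 1 then (Complex.I / 2) • l.q i t
      else if j = i + 1 then -((Complex.I / 2) • l.s j t)
      else 0
    else
      if i = (j - n) + 1 then 1
      else if i = j - n ∧ i + 1 = n then -((Complex.I / 2) • (l.s n t ∘L P))
      else 0
  else
    if j < n then
      if j = (i - n) + 1 then 1
      else if j = i - n ∧ j + 1 = n then (Complex.I / 2) • (P ∘L l.q n t)
      else 0
    else
      if i - n + 1 = n ∧ j - n + 1 = n then P else 0

/-- The entries of `H(t, l)` for `r = 2n + 1`. Indices run from `0`; the four outer cases are the
blocks `h_11`, `h_12`, `h_21`, `h_22`. For `n = 0` the only entry is `-p_0`. -/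
def HentryOdd (l : DiffExpr E) (n : ℕ) (t : ℝ) (i j : ℕ) : E →L[ℂ] E :=
  if i < n then
    if j < n then
      if i = j then -l.p i t
      else if i = j + 1 then (Complex.I / 2) • l.q i t
      else if j = i + 1 then -((Complex.I / 2) • l.s j t)
      else 0
    else
      if i = (j - n) + 1 then 1
      else if i + 1 = n ∧ j - n = n then (1 / 2 : ℂ) • l.s n t
      else 0
  else
    if j < n then
      if j = (i - n) + 1 then 1
      else if i - n = n ∧ j + 1 = n then (1 / 2 : ℂ) • l.q n t
      else 0
    else
      if i - n = n ∧ j - n = n then -l.p n t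
      else if i - n + 1 = n ∧ j - n = n then Complex.I • 1
      else if i - n = n ∧ j - n + 1 = n then -(Complex.I • 1)
      else 0

/-- The coefficient `H(t, l)` of the first order system. -/
def Hcoeff (l : DiffExpr E) (r : ℕ) (t : ℝ) : BlockSpace E r →L[ℂ] BlockSpace E r :=
  blockOp (if Even r then l.HentryEven (r / 2) t else l.HentryOdd (r / 2) t)

/-- The operator matrix in `B(E^{n+1})` of the form `m{·,·}` of the expression `m` of order `σ ≤ 2n`:
tridiagonal with `p̃_j` on the diagonal, `-(i/2) q̃_j` under it and `(i/2) s̃_j` over it;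
coefficients of index greater than `σ/2` count as zero. -/
def formMatrix (m : DiffExpr E) (σ n : ℕ) (t : ℝ) :
    BlockSpace E (n + 1) →L[ℂ] BlockSpace E (n + 1) :=
  blockOp fun i j =>
    if i = j ∧ i ≤ σ / 2 then m.p i t
    else if i = j + 1 ∧ i ≤ σ / 2 then -((Complex.I / 2) • m.q i t)
    else if j = i + 1 ∧ j ≤ σ / 2 then (Complex.I / 2) • m.s j t
    else 0

/-- The operator `E^r → E^{n+1}`, `n = [r/2]`, recovering `(f, f', …, f^{(n)})` from
`(f, …, f^{(n-1)}, f^{[2n-1]}, …, f^{[n]})` if `r = 2n`, where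
`f^{(n)} = p_n⁻¹ (f^{[n]} + (i/2) q_n f^{(n-1)})`, from
`(f, …, f^{(n-1)}, f^{[2n]}, …, f^{[n+1]}, -i f^{(n)})` if `r = 2n+1 > 1`, and from `f`
if `r = 1`. For `r = 2n` these are the rows `1, …, n, 2n` of `C(t, l)⁻¹`, where `C(t, l)` maps
`(f, …, f^{(n-1)}, f^{(2n-1)}, …, f^{(n)})` to the vector of quasi-derivatives. -/
def jetOp (l : DiffExpr E) (r : ℕ) (t : ℝ) : BlockSpace E r →L[ℂ] BlockSpace E (r / 2 + 1) :=
  let n := r / 2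
  blockOp fun i j =>
    if i < n then (if j = i then 1 else 0)
    else if Even r then
      if j + 1 = 2 * n then Ring.inverse (l.p n t)
      else if j + 1 = n then (Complex.I / 2) • (Ring.inverse (l.p n t) ∘L l.q n t)
      else 0
    else if j = 2 * n then (if r = 1 then 1 else Complex.I • 1)
    else 0

/-- The weight `W(t, l, m)`, where `l` has order `r` and `m` has order `σ`. For `r = 2n` it is
`C⁻¹* ‖m_{αβ}‖ C⁻¹` with the operator matrix `‖m_{αβ}‖` that has the matrix of the form `m{·,·}` in the
rows and columns `1, …, n, 2n` and zeros elsewhere, so that only the rows `1, …, n, 2n` of `C⁻¹`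
enter. -/
def Wweight (l m : DiffExpr E) (r σ : ℕ) (t : ℝ) : BlockSpace E r →L[ℂ] BlockSpace E r :=
  ContinuousLinearMap.adjoint (l.jetOp r t) ∘L m.formMatrix σ (r / 2) t ∘L l.jetOp r t

/-- The vector `F(t, l, m) ∈ E^r` built from `f`, where `l` has order `r` and `m` has order `σ`,
`n = [r/2]`:
`(f, …, f^{(n-1)}, f^{[r-1]}(t|l), …, f^{[n]}(t|l))` if `r = σ = 2n`; `f` if `r = 1`;
`(f, …, f^{(n-1)}, 0, …, 0, -i f^{(n)})` if `r = 2n+1 > 1`, `σ = 2n`;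
`(f, …, f^{(σ/2)}, 0, …, 0)` otherwise. -/
def Fvec (l : DiffExpr E) (r σ : ℕ) (S : Set ℝ) (f : ℝ → E) (t : ℝ) : BlockSpace E r :=
  let n := r / 2
  WithLp.toLp 2 fun i : Fin r =>
    if r = 1 then f t
    else if σ = 2 * n then
      if (i : ℕ) < n then iteratedDerivWithin i f S t
      else if Even r then l.quasiDeriv r S f (r - (i - n + 1)) t
      else if (i : ℕ) = 2 * n then -(Complex.I • iteratedDerivWithin n f S t)
      else 0
    else if (i : ℕ) ≤ σ / 2 then iteratedDerivWithin i f S t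
    else 0

/-- The vector `y⃗(t, l, m, f) ∈ E^r`, where `l` has order `r` and `m` has order `σ`, `n = [r/2]`:
`(y, …, y^{(n-1)}, y^{[r-1]}(t|l) - f^{[σ-1]}(t|m), …, y^{[r-n]}(t|l) - f^{[σ-n]}(t|m))`, followed by
`-i y^{(n)}` if `r = 2n+1 > 1`, with `f^{[k]}(t|m) = 0` for `k < σ/2`; and `y` if `r = 1`. -/
def yvec (l m : DiffExpr E) (r σ : ℕ) (S : Set ℝ) (y f : ℝ → E) (t : ℝ) : BlockSpace E r :=
  let n := r / 2
  WithLp.toLp 2 fun i : Fin r =>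
    if r = 1 then y t
    else if (i : ℕ) < n then iteratedDerivWithin i y S t
    else if (i : ℕ) < 2 * n then
      l.quasiDeriv r S y (r - (i - n + 1)) t -
        (if i - n + 1 ≤ σ / 2 then m.quasiDeriv σ S f (σ - (i - n + 1)) t else 0)
    else -(Complex.I • iteratedDerivWithin n y S t)

/-- The coefficients `p_j(t, z), q_j(t, z), s_j(t, z)` of `l_z` form an analytic symmetric family
with regular leading coefficient over `𝓑 ⊇ ℂ \ ℝ`. -/
structure IsAnalyticFamily (L : ℂ → DiffExpr E) (r : ℕ) (a b : ℝ) (B : Set ℂ) : Prop where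
  nonreal_mem : ∀ z : ℂ, z.im ≠ 0 → z ∈ B
  analytic : ∀ z₀ ∈ B, ∃ U : Set ℂ, IsOpen U ∧ z₀ ∈ U ∧ ∀ t ∈ Icc a b,
    (∀ j, j ≤ r / 2 → AnalyticOnNhd ℂ (fun z => (L z).p j t) U) ∧
    ∀ j, 1 ≤ j → j ≤ (r + 1) / 2 →
      AnalyticOnNhd ℂ (fun z => (L z).q j t) U ∧ AnalyticOnNhd ℂ (fun z => (L z).s j t) U
  smooth : ∀ z ∈ B, (L z).IsSmooth r a b
  leading : ∀ z ∈ B, ∀ t ∈ Icc a b,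
    if Even r then IsUnit ((L z).p (r / 2) t)
    else IsUnit ((L z).q (r / 2 + 1) t + (L z).s (r / 2 + 1) t)
  symm_p : ∀ z ∈ B, ∀ t ∈ Icc a b, ∀ j, j ≤ r / 2 →
    (L z).p j t = ContinuousLinearMap.adjoint ((L (conj z)).p j t)
  symm_q : ∀ z ∈ B, ∀ t ∈ Icc a b, ∀ j, 1 ≤ j → j ≤ (r + 1) / 2 →
    (L z).q j t = ContinuousLinearMap.adjoint ((L (conj z)).s j t)

/-- The expression `m` of order `σ` has coefficients `p̃_j = p̃_j*`, `s̃_j = q̃_j*` of class `C^j`. -/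
structure IsSymmetric (m : DiffExpr E) (σ : ℕ) (a b : ℝ) : Prop where
  smooth : m.IsSmooth σ a b
  symm_p : ∀ t ∈ Icc a b, ∀ j, j ≤ σ / 2 → ContinuousLinearMap.adjoint (m.p j t) = m.p j t
  symm_q : ∀ t ∈ Icc a b, ∀ j, 1 ≤ j → j ≤ σ / 2 →
    m.s j t = ContinuousLinearMap.adjoint (m.q j t)

/-- `0 ≤ m{h, h} ≤ -ℑ(l_z{h, h}) / ℑ z` for all `h_0, h_1, … ∈ E`, `t ∈ [a, b]`, `ℑ z ≠ 0`;
in particular `-l_z` is a Nevanlinna family. -/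
def IsDominated (m : DiffExpr E) (L : ℂ → DiffExpr E) (r σ : ℕ) (a b : ℝ) : Prop :=
  ∀ z : ℂ, z.im ≠ 0 → ∀ t ∈ Icc a b, ∀ h : ℕ → E,
    0 ≤ (m.form σ t h h).re ∧ (m.form σ t h h).re ≤ -(((L z).form r t h h).im / z.im)

/-- The form `(ℑ l_z / ℑ z){h, h}` at the point `t`; for real `z` it is understood as the form of the
expression `∂ l_z / ∂ z`. -/
def imRatioForm (L : ℂ → DiffExpr E) (r : ℕ) (z : ℂ) (t : ℝ) (h : ℕ → E) : ℝ :=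
  if z.im ≠ 0 then ((L z).form r t h h).im / z.im
  else (deriv (fun w => (L w).form r t h h) z).re

/-- The definiteness condition: for some `z₀ ∈ 𝓑`, `α, β ∈ [a, b]` with `0 ∈ [α, β]` and `δ > 0`,
`-∫_α^β (ℑ l_{z₀} / ℑ z₀){y, y} dt ≥ δ ‖y⃗(0, l_{z₀}, m, 0)‖²` for all solutions `y` of
`l_{z₀}[y] = 0`. -/
def IsDefinite (L : ℂ → DiffExpr E) (m : DiffExpr E) (r σ : ℕ) (a b : ℝ) (B : Set ℂ) : Prop :=
  ∃ z₀ ∈ B, ∃ α ∈ Icc a b, ∃ β ∈ Icc a b, (0 : ℝ) ∈ Icc α β ∧ ∃ δ : ℝ, 0 < δ ∧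
    ∀ y : ℝ → E, ContDiffOn ℝ r y (Icc a b) →
      (∀ t ∈ Icc a b, (L z₀).apply r (Icc a b) y t = 0) →
      δ * ‖(L z₀).yvec m r σ (Icc a b) y (fun _ => 0) 0‖ ^ 2 ≤
        -∫ t in α..β, imRatioForm L r z₀ t (fun j => iteratedDerivWithin j y (Icc a b) t)

/-- `y ∈ C^r([a, b], E)` solves `l[y] = m[f]` on `[a, b]`, and for some `h ∈ E^r`
`y⃗(a, l, m, f) = A h`, `y⃗(b, l, m, f) = B h`. -/
def SolvesBoundaryProblem (l m : DiffExpr E) (r σ : ℕ) (a b : ℝ)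
    (A B : BlockSpace E r →L[ℂ] BlockSpace E r) (f y : ℝ → E) : Prop :=
  ContDiffOn ℝ r y (Icc a b) ∧
  (∀ t ∈ Icc a b, l.apply r (Icc a b) y t = m.apply σ (Icc a b) f t) ∧
  ∃ h : BlockSpace E r,
    l.yvec m r σ (Icc a b) y f a = A h ∧ l.yvec m r σ (Icc a b) y f b = B h

/-- The family `Q(t, l_z)`. -/
def Qfam (L : ℂ → DiffExpr E) (r : ℕ) (z : ℂ) : ℝ → BlockSpace E r →L[ℂ] BlockSpace E r :=
  (L z).Qcoeff r

/-- The family `H(t, l_z)`. -/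
def Hfam (L : ℂ → DiffExpr E) (r : ℕ) (z : ℂ) : ℝ → BlockSpace E r →L[ℂ] BlockSpace E r :=
  (L z).Hcoeff r

/-- The operator solution `X_z(t)`, `X_z(0) = I`, of
`(i/2) ((Q(t, l_z) x)' + Q(t, l_z)* x') - H(t, l_z) x = 0` on `[a, b]`. -/
def Xfam (L : ℂ → DiffExpr E) (r : ℕ) (a b : ℝ) (z : ℂ) :
    ℝ → BlockSpace E r →L[ℂ] BlockSpace E r :=
  operatorSolution a b (Qfam L r z) (Hfam L r z)

/-- The first component `y_1(t, z, f) = R(z) f` of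
`∫_a^b X_z(t) {M(z) - (1/2) sgn(σ - t) (i G)⁻¹} X_{z̄}(σ)* W(σ, l_{z̄}, m) F(σ, l_{z̄}, m) dσ`. -/
def resolvent (L : ℂ → DiffExpr E) (m : DiffExpr E) (r σ : ℕ) (hr : 0 < r) (a b : ℝ)
    (M : ℂ → BlockSpace E r →L[ℂ] BlockSpace E r) (z : ℂ) (f : ℝ → E) (t : ℝ) : E :=
  (greenIntegral a b (Qfam L r) (Hfam L r) M z
    (fun τ => (L (conj z)).Wweight m r σ τ ((L (conj z)).Fvec r σ (Icc a b) f τ)) t) ⟨0, hr⟩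

/-- `M` is a characteristic operator of the equation `l_z[y] = -(ℑ l_z / ℑ z)[f]` on `(a, b)`, that
is, of the equivalent first order system. -/
def IsCharOp (L : ℂ → DiffExpr E) (r : ℕ) (a b : ℝ)
    (M : ℂ → BlockSpace E r →L[ℂ] BlockSpace E r) : Prop :=
  IsCharacteristicOperator a b (Qfam L r) (Hfam L r) M

/-- `X_z(a)⁻¹ 𝓜_z - X_z(b)⁻¹ 𝓝_z`. -/
def boundaryDiff (L : ℂ → DiffExpr E) (r : ℕ) (a b : ℝ)
    (Ma Nb : ℂ → BlockSpace E r →L[ℂ] BlockSpace E r) (z : ℂ) :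
    BlockSpace E r →L[ℂ] BlockSpace E r :=
  pullBack (Xfam L r a b z a) (Ma z) - pullBack (Xfam L r a b z b) (Nb z)

/-- The operator function `boundaryCharOp` for the family `l_z`. -/
def boundaryM (L : ℂ → DiffExpr E) (r : ℕ) (a b : ℝ)
    (Ma Nb : ℂ → BlockSpace E r →L[ℂ] BlockSpace E r) : ℂ → BlockSpace E r →L[ℂ] BlockSpace E r :=
  boundaryCharOp a b (Qfam L r) (Hfam L r) Ma Nb

end DiffExpr

end

/-! The equation is rewritten as a first order system `i ℜQ x' + (i/2) Q' x - H x = g` in `E^r`, and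
the boundary theory is done for the system. Write `G = ℜQ(0)`, `K = (iG)⁻¹`, `U[x] = (ℜQ x, x)`.
Since `H_{z̄} = H_z*` and `Q` does not depend on `z`, the Lagrange identity gives `X_{z̄}(t)* ℜQ(t)
X_z(t) = G`. Hence `X_z(t)` is invertible, variation of constants holds, and for homogeneous
solutions `U[x(b)] - U[x(a)] = 2 ℑz ∫ (W x, x)`. Definiteness makes this energy, times `ℑz`,
coercive in `x(0)`.

The Green integral with right-hand side `W F` takes the boundary values `X(a)(M - K/2)k` and `X(b)(M
+ K/2)k`, where `k = ∫ X_{z̄}* W F`; by definiteness `k` runs through the whole space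
(`exists_integral_weight_eq`). So `M` is dissipative exactly when the pair `X(a)(M - K/2)`, `X(b)(M
+ K/2)` is, and conversely a pair `𝓜, 𝓝` with `A = X(a)⁻¹𝓜`, `B = X(b)⁻¹𝓝` returns the stated `M`,
provided `A - B` is invertible. Coercivity at `z` bounds `A - B` from below; coercivity at `z̄`
together with maximality makes its range dense (`isUnit_pullBack_sub`). Conversely an invertible
difference forces maximality (`isMaximalNonnegSubspace_of_isUnit`). The symmetry of `M` is condition
(i) in another form (`boundary_symm`).

The dependence on `z` is governed by the domination hypothesis: `z ↦ -l_z{h,h}` is a scalar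
Nevanlinna function for all `t` and `h`. Pick and Harnack inequalities then compare its values at
two points by its imaginary part at one, with a constant independent of `t` and `h`
(`exists_form_compare`). This gives three things: for odd order the leading coefficient does not
depend on `z`; `H_z` is locally Lipschitz in `z` uniformly in `t`, so `X_z` is analytic; and
definiteness at the single point `λ₀` passes to every nonreal `z` by perturbing solutions
(`isDefiniteNevanlinnaSystem`).

The passage between the equation and the system uses a chain: the functions `y^{(j)}` and
`y^{[r-1-j]}` tied by first order relations (`IsChain`). A smooth solution gives a chain. A chain is
automatically smooth by bootstrapping through the invertible leading coefficient, and it is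
equivalent to the system once the quasi-derivatives of `f` with respect to `m` are subtracted
(`Represents`). -/

noncomputable section

set_option linter.unusedSectionVars false

/-! ### Linear equations in a Banach algebra: Volterra inversion and analytic dependence -/

section

namespace LinearODE

variable {𝔸 : Type*} [NormedRing 𝔸] [NormedAlgebra ℂ 𝔸] {a b : ℝ}

/-- The primitive of the constant extension of `u`, vanishing at `0`. -/
def primitive (hab : a ≤ b) (u : C(Icc a b, 𝔸)) (t : ℝ) : 𝔸 :=
  ∫ τ in (0 : ℝ)..t, IccExtend hab u τ

omit [NormedAlgebra ℂ 𝔸] in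
lemma continuous_iccExtend (hab : a ≤ b) (u : C(Icc a b, 𝔸)) : Continuous (IccExtend hab u) :=
  u.continuous.Icc_extend'

lemma hasDerivAt_primitive [CompleteSpace 𝔸] (hab : a ≤ b) (u : C(Icc a b, 𝔸)) (t : ℝ) :
    HasDerivAt (primitive hab u) (IccExtend hab u t) t :=
  ((continuous_iccExtend hab u).integral_hasStrictDerivAt 0 t).hasDerivAt

omit [NormedAlgebra ℂ 𝔸] in
lemma norm_iccExtend_le (hab : a ≤ b) (u : C(Icc a b, 𝔸)) (t : ℝ) : ‖IccExtend hab u t‖ ≤ ‖u‖ :=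
  u.norm_coe_le_norm _

lemma abs_le_of_mem (h0 : (0 : ℝ) ∈ Icc a b) {t : ℝ} (ht : t ∈ Icc a b) : |t| ≤ b - a := by
  obtain ⟨h1, h2⟩ := h0
  obtain ⟨h3, h4⟩ := ht
  rw [abs_le]; constructor <;> linarith

lemma norm_primitive_le (hab : a ≤ b) (h0 : (0 : ℝ) ∈ Icc a b) (u : C(Icc a b, 𝔸))
    {t : ℝ} (ht : t ∈ Icc a b) : ‖primitive hab u t‖ ≤ (b - a) * ‖u‖ := by
  have h1 : ‖primitive hab u t‖ ≤ ‖u‖ * |t - 0| :=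
    intervalIntegral.norm_integral_le_of_norm_le_const fun τ _ => norm_iccExtend_le hab u τ
  rw [sub_zero] at h1
  calc ‖primitive hab u t‖ ≤ ‖u‖ * |t| := h1
    _ ≤ ‖u‖ * (b - a) := by gcongr; exact abs_le_of_mem h0 ht
    _ = _ := mul_comm _ _

variable [CompleteSpace 𝔸]

/-- Integration from `0` as a bounded operator on `C([a, b], 𝔸)`. -/
def integrationOp (𝔸 : Type*) [NormedRing 𝔸] [NormedAlgebra ℂ 𝔸] [CompleteSpace 𝔸]
    (hab : a ≤ b) (h0 : (0 : ℝ) ∈ Icc a b) :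
    C(Icc a b, 𝔸) →L[ℂ] C(Icc a b, 𝔸) :=
  LinearMap.mkContinuous
    { toFun := fun u => ⟨fun t => primitive hab u t, by
        have : Continuous (primitive hab u) :=
          continuous_iff_continuousAt.2 fun t => (hasDerivAt_primitive hab u t).continuousAt
        exact this.comp continuous_subtype_val⟩
      map_add' := fun u v => by
        ext t
        exact intervalIntegral.integral_add
          ((continuous_iccExtend hab u).intervalIntegrable _ _)
          ((continuous_iccExtend hab v).intervalIntegrable _ _)
      map_smul' := fun c u => by
        ext t
        exact intervalIntegral.integral_smul c _ } (b - a) (fun u => by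
      rw [ContinuousMap.norm_le _ (mul_nonneg (sub_nonneg.2 hab) (norm_nonneg _))]
      exact fun t => norm_primitive_le hab h0 u t.2)

/-- The Volterra operator `u ↦ ∫₀ᵗ A u`. -/
def volterra (hab : a ≤ b) (h0 : (0 : ℝ) ∈ Icc a b) (A : C(Icc a b, 𝔸)) :
    C(Icc a b, 𝔸) →L[ℂ] C(Icc a b, 𝔸) :=
  integrationOp 𝔸 hab h0 ∘L ContinuousLinearMap.mul ℂ C(Icc a b, 𝔸) A

/-- Each integration from `0` raises the power of `|t|` by one and divides by the new exponent. The
resulting factorial makes some power of the Volterra operator a strict contraction, however long the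
interval and however large the coefficient. -/
lemma volterra_pow_apply_le (hab : a ≤ b) (h0 : (0 : ℝ) ∈ Icc a b) (A u : C(Icc a b, 𝔸)) (n : ℕ)
    (t : Icc a b) :
    ‖(volterra hab h0 A ^ n) u t‖ ≤ ‖A‖ ^ n * ‖u‖ * (|(t : ℝ)| ^ n / n.factorial) := by
  induction n generalizing t with
  | zero => simpa using u.norm_coe_le_norm t
  | succ n ih =>
    have hsub : ∀ τ ∈ uIoc (0 : ℝ) t, τ ∈ Icc a b := fun τ hτ => by
      have h1 := t.2
      rw [mem_uIoc] at hτ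
      obtain ⟨h2, h3⟩ := h0
      obtain ⟨h4, h5⟩ := h1
      rcases hτ with h | h <;> constructor <;> linarith [h.1, h.2]
    rw [pow_succ', mul_apply_eq_comp]
    set v := (volterra hab h0 A ^ n) u with hv
    have h1 : ‖volterra hab h0 A v t‖ ≤ ∫ τ in uIoc (0 : ℝ) t, ‖IccExtend hab (A * v) τ‖ :=
      intervalIntegral.norm_integral_le_integral_norm_uIoc
    have h2 : (∫ τ in uIoc (0 : ℝ) t, ‖IccExtend hab (A * v) τ‖) ≤
        ∫ τ in uIoc (0 : ℝ) t, ‖A‖ ^ (n + 1) * ‖u‖ / n.factorial * |τ - 0| ^ n := by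
      apply setIntegral_mono_on
      · exact ((continuous_iccExtend hab (A * v)).norm.intervalIntegrable 0 t).def'
      · exact ((by fun_prop : Continuous fun τ : ℝ =>
          ‖A‖ ^ (n + 1) * ‖u‖ / n.factorial * |τ - 0| ^ n).intervalIntegrable 0 t).def'
      · exact measurableSet_uIoc
      · intro τ hτ
        rw [IccExtend_of_mem hab _ (hsub τ hτ), ContinuousMap.mul_apply]
        calc ‖A ⟨τ, hsub τ hτ⟩ * v ⟨τ, hsub τ hτ⟩‖ ≤ ‖A‖ * ‖v ⟨τ, hsub τ hτ⟩‖ :=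
              (norm_mul_le _ _).trans (by gcongr; exact A.norm_coe_le_norm _)
          _ ≤ ‖A‖ * (‖A‖ ^ n * ‖u‖ * (|τ| ^ n / n.factorial)) := by gcongr; exact ih ⟨τ, hsub τ hτ⟩
          _ = _ := by rw [sub_zero]; ring
    refine h1.trans (h2.trans (le_of_eq ?_))
    rw [integral_const_mul, integral_pow_abs_sub_uIoc, sub_zero, Nat.factorial_succ]
    push_cast
    field_simp

omit [NormedAlgebra ℂ 𝔸] in
-- `1 - K^n` is the product of `1 - K` with a finite geometric sum. The factors commute, so if the
-- product is invertible, both factors are.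
lemma isUnit_one_sub_of_norm_pow_lt_one {K : 𝔸} {n : ℕ} (hK : ‖K ^ n‖ < 1) : IsUnit (1 - K) := by
  have h1 : IsUnit (1 - K ^ n) := isUnit_one_sub_of_norm_lt_one hK
  have h2 : Commute (1 - K) (∑ i ∈ Finset.range n, K ^ i) :=
    (Commute.one_left _).sub_left (Commute.sum_right _ _ _ fun i _ => Commute.self_pow K i)
  rw [← mul_neg_geom_sum] at h1
  exact (h2.isUnit_mul_iff.1 h1).1

lemma isUnit_one_sub_of_pow_contracting (K : 𝔸 →L[ℂ] 𝔸) {n : ℕ} {C : ℝ} (hC : 0 ≤ C) (hC1 : C < 1)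
    (h : ∀ u, ‖(K ^ n) u‖ ≤ C * ‖u‖) : IsUnit (1 - K) :=
  isUnit_one_sub_of_norm_pow_lt_one (n := n)
    ((ContinuousLinearMap.opNorm_le_bound _ hC h).trans_lt hC1)

omit [CompleteSpace 𝔸] in
-- The coefficient enters the Volterra operator linearly. Here the algebra stands for `C([a, b], 𝔸)`
-- and `J` for integration, so analyticity is measured in the supremum norm over `t`.
lemma analyticAt_comp_mul (J : 𝔸 →L[ℂ] 𝔸) {A : ℂ → 𝔸} {z : ℂ} (hA : AnalyticAt ℂ A z) :
    AnalyticAt ℂ (fun w => (1 : 𝔸 →L[ℂ] 𝔸) - J ∘L ContinuousLinearMap.mul ℂ 𝔸 (A w)) z :=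
  analyticAt_const.sub ((((ContinuousLinearMap.compL ℂ 𝔸 𝔸 𝔸 J) ∘L
    ContinuousLinearMap.mul ℂ 𝔸).analyticAt (A z)).comp hA)

lemma analyticAt_inverse_apply {T : ℂ → 𝔸 →L[ℂ] 𝔸} {z : ℂ} (hT : AnalyticAt ℂ T z)
    (hu : IsUnit (T z)) (x : 𝔸) : AnalyticAt ℂ (fun w => Ring.inverse (T w) x) z := by
  obtain ⟨w, hw⟩ := hu
  have h2 : AnalyticAt ℂ (fun z => Ring.inverse (T z)) z := by
    refine AnalyticAt.comp (g := Ring.inverse) ?_ hT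
    rw [← hw]
    exact analyticAt_inverse w
  exact ((ContinuousLinearMap.apply ℂ 𝔸 x).analyticAt _).comp h2

lemma isUnit_one_sub_volterra (hab : a ≤ b) (h0 : (0 : ℝ) ∈ Icc a b) (A : C(Icc a b, 𝔸)) :
    IsUnit (1 - volterra hab h0 A) := by
  set K := volterra hab h0 A
  have hba : 0 ≤ b - a := sub_nonneg.2 hab
  obtain ⟨n, hn⟩ : ∃ n : ℕ, (‖A‖ * (b - a)) ^ n / n.factorial < 1 :=
    ((FloorSemiring.tendsto_pow_div_factorial_atTop (‖A‖ * (b - a))).eventually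
      (gt_mem_nhds one_pos)).exists
  refine isUnit_one_sub_of_pow_contracting K (n := n) (by positivity) hn fun u => ?_
  rw [ContinuousMap.norm_le _ (by positivity)]
  intro t
  refine (volterra_pow_apply_le hab h0 A u n t).trans ?_
  have : |(t : ℝ)| ^ n ≤ (b - a) ^ n := by gcongr; exact abs_le_of_mem h0 t.2
  calc ‖A‖ ^ n * ‖u‖ * (|(t : ℝ)| ^ n / n.factorial)
      ≤ ‖A‖ ^ n * ‖u‖ * ((b - a) ^ n / n.factorial) := by gcongr
    _ = _ := by rw [mul_pow]; ring

/-- The solution of `X' = A X`, `X(0) = 1`, as an element of `C([a, b], 𝔸)`. -/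
def fundamentalMap (hab : a ≤ b) (h0 : (0 : ℝ) ∈ Icc a b) (A : C(Icc a b, 𝔸)) : C(Icc a b, 𝔸) :=
  Ring.inverse (1 - volterra hab h0 A) 1

/-- The solution of `X' = A X`, `X(0) = 1` on `[a, b]`, extended to the line. -/
def fundamental (hab : a ≤ b) (h0 : (0 : ℝ) ∈ Icc a b) (A : C(Icc a b, 𝔸)) (t : ℝ) : 𝔸 :=
  1 + primitive hab (A * fundamentalMap hab h0 A) t

lemma fundamentalMap_apply (hab : a ≤ b) (h0 : (0 : ℝ) ∈ Icc a b) (A : C(Icc a b, 𝔸))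
    (t : Icc a b) : fundamentalMap hab h0 A t = fundamental hab h0 A t := by
  have h1 : (1 - volterra hab h0 A) (fundamentalMap hab h0 A) = 1 := by
    have := Ring.mul_inverse_cancel _ (isUnit_one_sub_volterra hab h0 A)
    exact congrArg (fun T : C(Icc a b, 𝔸) →L[ℂ] C(Icc a b, 𝔸) => T 1) this
  have h2 : fundamentalMap hab h0 A = 1 + volterra hab h0 A (fundamentalMap hab h0 A) := by
    rw [← h1]; simp
  have h3 := congrArg (fun u : C(Icc a b, 𝔸) => u t) h2
  exact h3

lemma fundamental_zero (hab : a ≤ b) (h0 : (0 : ℝ) ∈ Icc a b) (A : C(Icc a b, 𝔸)) :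
    fundamental hab h0 A 0 = 1 := by
  simp [fundamental, primitive]

lemma hasDerivAt_fundamental (hab : a ≤ b) (h0 : (0 : ℝ) ∈ Icc a b) (A : C(Icc a b, 𝔸)) {t : ℝ}
    (ht : t ∈ Icc a b) :
    HasDerivAt (fundamental hab h0 A) (A ⟨t, ht⟩ * fundamental hab h0 A t) t := by
  have h := (hasDerivAt_primitive hab (A * fundamentalMap hab h0 A) t).const_add 1
  rwa [IccExtend_of_mem hab _ ht, ContinuousMap.mul_apply, fundamentalMap_apply] at h

lemma contDiff_fundamental (hab : a ≤ b) (h0 : (0 : ℝ) ∈ Icc a b) (A : C(Icc a b, 𝔸)) :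
    ContDiff ℝ 1 (fundamental hab h0 A) := by
  rw [contDiff_one_iff_deriv]
  have h := fun t => (hasDerivAt_primitive hab (A * fundamentalMap hab h0 A) t).const_add 1
  refine ⟨fun t => (h t).differentiableAt, ?_⟩
  have : deriv (fundamental hab h0 A) = IccExtend hab (A * fundamentalMap hab h0 A) :=
    funext fun t => (h t).deriv
  rw [this]
  exact continuous_iccExtend hab _

/-- The fundamental solution depends analytically on the coefficient. -/
lemma analyticOnNhd_fundamental (hab : a ≤ b) (h0 : (0 : ℝ) ∈ Icc a b) {A : ℂ → C(Icc a b, 𝔸)}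
    {S : Set ℂ} (hA : AnalyticOnNhd ℂ A S) {t : ℝ} (ht : t ∈ Icc a b) :
    AnalyticOnNhd ℂ (fun z => fundamental hab h0 (A z) t) S := by
  intro z hz
  -- The solution is `(1 - V)⁻¹ 1` with `V` the Volterra operator of the coefficient, and inversion
  -- is analytic on the invertible operators.
  have h1 : AnalyticAt ℂ (fun z => fundamentalMap hab h0 (A z)) z :=
    analyticAt_inverse_apply (analyticAt_comp_mul (integrationOp 𝔸 hab h0) (hA z hz))
      (isUnit_one_sub_volterra hab h0 (A z)) 1
  have h3 := ((ContinuousMap.evalCLM ℂ (⟨t, ht⟩ : Icc a b)).analyticAt _).comp h1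
  refine h3.congr (Filter.Eventually.of_forall fun w => ?_)
  exact fundamentalMap_apply hab h0 (A w) ⟨t, ht⟩

end LinearODE

end

/-! ### Scalar Nevanlinna functions: Pick and Harnack inequalities -/

section

/-- Scalar symmetric Nevanlinna functions on the nonreal points. -/
structure IsNevanlinna (N : ℂ → ℂ) : Prop where
  differentiableOn : DifferentiableOn ℂ N {z | z.im ≠ 0}
  symm : ∀ z : ℂ, z.im ≠ 0 → N (conj z) = conj (N z)
  nonneg : ∀ z : ℂ, z.im ≠ 0 → 0 ≤ (N z).im / z.im

namespace IsNevanlinna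

/-- This identity turns the pseudo-hyperbolic quotients of Schwarz–Pick into products of imaginary
parts. -/
lemma norm_sub_conj_sq (z w : ℂ) : ‖z - conj w‖ ^ 2 = ‖z - w‖ ^ 2 + 4 * z.im * w.im := by
  rw [Complex.sq_norm, Complex.sq_norm, Complex.normSq_apply, Complex.normSq_apply]
  simp
  ring

lemma sub_conj_ne_zero {u w : ℂ} (hu : 0 < u.im) (hw : 0 < w.im) : u - conj w ≠ 0 := by
  intro h
  have := congrArg Complex.im h
  simp at this
  linarith

lemma norm_sub_le_norm_sub_conj {u w : ℂ} (hu : 0 < u.im) (hw : 0 < w.im) :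
    ‖u - w‖ ≤ ‖u - conj w‖ := by
  have h := norm_sub_conj_sq u w
  have : 0 < u.im * w.im := mul_pos hu hw
  exact (le_abs_self _).trans (abs_le_of_sq_le_sq (by linarith) (norm_nonneg _))

lemma cayley_im {w ζ : ℂ} (hw : 0 < w.im) (hζ : ‖ζ‖ < 1) :
    0 < ((w - conj w * ζ) / (1 - ζ)).im := by
  have h1 : (1 - ζ) ≠ 0 := by
    intro h
    rw [sub_eq_zero] at h
    rw [← h] at hζ
    simp at hζ
  have h2 : 0 < Complex.normSq (1 - ζ) := Complex.normSq_pos.2 h1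
  have h3 : Complex.normSq ζ < 1 := by
    rw [← Complex.sq_norm]
    nlinarith [norm_nonneg ζ]
  rw [Complex.normSq_apply] at h3
  have h4 : ((w - conj w * ζ) / (1 - ζ)).im =
      w.im * (1 - (ζ.re * ζ.re + ζ.im * ζ.im)) / Complex.normSq (1 - ζ) := by
    rw [Complex.div_im]
    simp
    field_simp
    ring
  rw [h4]
  apply div_pos (mul_pos hw (by linarith)) h2

/-- The Schwarz–Pick inequality for functions with positive imaginary part. -/
lemma schwarz_pick {N : ℂ → ℂ} (hN : DifferentiableOn ℂ N {z | 0 < z.im})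
    (hpos : ∀ z : ℂ, 0 < z.im → 0 < (N z).im) {z w : ℂ} (hz : 0 < z.im) (hw : 0 < w.im) :
    ‖N z - N w‖ * ‖z - conj w‖ ≤ ‖z - w‖ * ‖N z - conj (N w)‖ := by
  -- `Φ` maps the unit disc to the upper half-plane with `Φ 0 = w`, and its inverse is `z ↦ (z -
  -- w)/(z - w̄)`. Following `N ∘ Φ` by the Cayley transform centred at `N w` gives a self-map `g`
  -- of the disc fixing `0`, and the Schwarz lemma applies.
  set Φ : ℂ → ℂ := fun ζ => (w - conj w * ζ) / (1 - ζ) with hΦ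
  set g : ℂ → ℂ := fun ζ => (N (Φ ζ) - N w) / (N (Φ ζ) - conj (N w)) with hg
  have him : ∀ ζ ∈ Metric.ball (0 : ℂ) 1, 0 < (Φ ζ).im := fun ζ hζ =>
    cayley_im hw (by simpa using hζ)
  have hne : ∀ ζ ∈ Metric.ball (0 : ℂ) 1, 1 - ζ ≠ 0 := fun ζ hζ h => by
    rw [sub_eq_zero] at h
    rw [← h] at hζ
    simp at hζ
  have hΦd : DifferentiableOn ℂ Φ (Metric.ball 0 1) :=
    DifferentiableOn.div (by fun_prop) (by fun_prop) hne
  have hNΦ : DifferentiableOn ℂ (fun ζ => N (Φ ζ)) (Metric.ball 0 1) := hN.comp hΦd him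
  have hgd : DifferentiableOn ℂ g (Metric.ball 0 1) :=
    (hNΦ.sub_const _).div (hNΦ.sub_const _) fun ζ hζ =>
      sub_conj_ne_zero (hpos _ (him ζ hζ)) (hpos _ hw)
  have hmaps : MapsTo g (Metric.ball 0 1) (Metric.closedBall 0 1) := fun ζ hζ => by
    rw [mem_closedBall_zero_iff, hg, norm_div]
    exact div_le_one_of_le₀ (norm_sub_le_norm_sub_conj (hpos _ (him ζ hζ)) (hpos _ hw))
      (norm_nonneg _)
  have hΦ0 : Φ 0 = w := by simp [hΦ]
  have hg0 : g 0 = 0 := by simp [hg, hΦ0]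
  have hzw : z - conj w ≠ 0 := sub_conj_ne_zero hz hw
  have hζ : ‖(z - w) / (z - conj w)‖ < 1 := by
    rw [norm_div, div_lt_one (norm_pos_iff.2 hzw)]
    have h := norm_sub_conj_sq z w
    have : 0 < z.im * w.im := mul_pos hz hw
    exact lt_of_pow_lt_pow_left₀ 2 (norm_nonneg _) (by linarith)
  have hΦz : Φ ((z - w) / (z - conj w)) = z := by
    have hww : w - conj w ≠ 0 := sub_conj_ne_zero hw hw
    have h1 : 1 - (z - w) / (z - conj w) = (w - conj w) / (z - conj w) := by
      field_simp
      ring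
    simp only [hΦ]
    rw [h1]
    field_simp
    ring
  have key := Complex.norm_le_norm_of_mapsTo_ball hgd hmaps hg0 hζ
  simp only [hg, hΦz] at key
  have h2 := sub_conj_ne_zero (hpos _ hz) (hpos _ hw)
  rw [norm_div, norm_div, div_le_div_iff₀ (norm_pos_iff.2 h2) (norm_pos_iff.2 hzw)] at key
  exact key

/-- After squaring Schwarz–Pick and expanding both conjugate distances by `norm_sub_conj_sq`, the
term `‖N z - N w‖² ‖z - w‖²` cancels. -/
lemma pick_of_pos {N : ℂ → ℂ} (hN : DifferentiableOn ℂ N {z | 0 < z.im})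
    (hpos : ∀ z : ℂ, 0 < z.im → 0 < (N z).im) {z w : ℂ} (hz : 0 < z.im) (hw : 0 < w.im) :
    ‖N z - N w‖ ^ 2 * (z.im * w.im) ≤ ‖z - w‖ ^ 2 * ((N z).im * (N w).im) := by
  have h := pow_le_pow_left₀ (by positivity) (schwarz_pick hN hpos hz hw) 2
  rw [mul_pow, mul_pow, norm_sub_conj_sq, norm_sub_conj_sq] at h
  nlinarith

/-- The function `N + iε` has strictly positive imaginary part; then `ε → 0`. -/
lemma pick_of_nonneg {N : ℂ → ℂ} (hN : DifferentiableOn ℂ N {z | 0 < z.im})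
    (hpos : ∀ z : ℂ, 0 < z.im → 0 ≤ (N z).im) {z w : ℂ} (hz : 0 < z.im) (hw : 0 < w.im) :
    ‖N z - N w‖ ^ 2 * (z.im * w.im) ≤ ‖z - w‖ ^ 2 * ((N z).im * (N w).im) := by
  have h : ∀ ε : ℝ, 0 < ε → ‖N z - N w‖ ^ 2 * (z.im * w.im) ≤
      ‖z - w‖ ^ 2 * (((N z).im + ε) * ((N w).im + ε)) := fun ε hε => by
    have := pick_of_pos (N := fun z => N z + ε * Complex.I) (hN.add_const _)
      (fun z hz => by simpa using add_pos_of_nonneg_of_pos (hpos z hz) hε) hz hw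
    simpa using this
  have hc : Continuous fun ε : ℝ => ‖z - w‖ ^ 2 * (((N z).im + ε) * ((N w).im + ε)) := by fun_prop
  have ht : Filter.Tendsto (fun ε : ℝ => ‖z - w‖ ^ 2 * (((N z).im + ε) * ((N w).im + ε)))
      (nhdsWithin 0 (Ioi 0)) (nhds (‖z - w‖ ^ 2 * (((N z).im + 0) * ((N w).im + 0)))) :=
    (hc.tendsto 0).mono_left nhdsWithin_le_nhds
  rw [add_zero, add_zero] at ht
  exact ge_of_tendsto ht (Filter.eventually_of_mem self_mem_nhdsWithin fun ε hε => h ε hε)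

variable {N : ℂ → ℂ}

lemma im_nonneg (hN : IsNevanlinna N) {z : ℂ} (hz : 0 < z.im) : 0 ≤ (N z).im := by
  have := hN.nonneg z hz.ne'
  rwa [le_div_iff₀ hz, zero_mul] at this

lemma ratio_conj (hN : IsNevanlinna N) {z : ℂ} (hz : z.im ≠ 0) :
    (N (conj z)).im / (conj z).im = (N z).im / z.im := by
  rw [hN.symm z hz, Complex.conj_im, Complex.conj_im, neg_div_neg_eq]

lemma pick_upper (hN : IsNevanlinna N) {z w : ℂ} (hz : 0 < z.im) (hw : 0 < w.im) :
    ‖N z - N w‖ ^ 2 ≤ ‖z - w‖ ^ 2 * ((N z).im / z.im) * ((N w).im / w.im) := by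
  have h := pick_of_nonneg (hN.differentiableOn.mono fun z hz => ne_of_gt hz)
    (fun z hz => hN.im_nonneg hz) hz hw
  have hp : 0 < z.im * w.im := mul_pos hz hw
  have e : ‖z - w‖ ^ 2 * ((N z).im / z.im) * ((N w).im / w.im) =
      ‖z - w‖ ^ 2 * ((N z).im * (N w).im) / (z.im * w.im) := by field_simp
  rw [e, le_div_iff₀ hp]
  exact h

/-- The Pick inequality for a pair of nonreal points, in the same or opposite half-planes. -/
lemma pick (hN : IsNevanlinna N) {z w : ℂ} (hz : z.im ≠ 0) (hw : w.im ≠ 0) :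
    ‖N z - N w‖ ^ 2 ≤ ‖z - w‖ ^ 2 * ((N z).im / z.im) * ((N w).im / w.im) := by
  -- For points in opposite half-planes `norm_sub_conj_sq` adds `4 ℑN(z) ℑN(w)` on the left and `4
  -- ℑz ℑw` times the two ratios on the right. These are equal, so the inequality follows from the
  -- one for a single half-plane.
  have hmixed : ∀ z w : ℂ, 0 < z.im → 0 < w.im →
      ‖N z - N (conj w)‖ ^ 2 ≤ ‖z - conj w‖ ^ 2 * ((N z).im / z.im) * ((N w).im / w.im) := by
    intro z w hz hw
    rw [hN.symm w hw.ne', norm_sub_conj_sq, norm_sub_conj_sq]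
    have h := hN.pick_upper hz hw
    have e : 4 * (N z).im * (N w).im =
        4 * z.im * w.im * ((N z).im / z.im) * ((N w).im / w.im) := by field_simp
    rw [e]
    linarith
  have hconj : ∀ z w : ℂ, z.im ≠ 0 → w.im ≠ 0 → ‖N (conj z) - N (conj w)‖ = ‖N z - N w‖ ∧
      ‖conj z - conj w‖ = ‖z - w‖ := fun z w hz hw => by
    rw [hN.symm z hz, hN.symm w hw, ← map_sub, ← map_sub, RCLike.norm_conj, RCLike.norm_conj]
    exact ⟨rfl, rfl⟩
  have hcpos : ∀ {u : ℂ}, u.im < 0 → 0 < (conj u).im := fun h => by simpa using h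
  rcases lt_or_gt_of_ne hz with hz' | hz' <;> rcases lt_or_gt_of_ne hw with hw' | hw'
  · have h := hN.pick_upper (hcpos hz') (hcpos hw')
    rwa [hN.ratio_conj hz, hN.ratio_conj hw, (hconj z w hz hw).1, (hconj z w hz hw).2] at h
  · have h := hmixed (conj z) w (hcpos hz') hw'
    rwa [hN.ratio_conj hz, (hconj z w hz hw).1, (hconj z w hz hw).2] at h
  · have h := hmixed z (conj w) hz' (hcpos hw')
    rwa [hN.ratio_conj hw, Complex.conj_conj] at h
  · exact hN.pick_upper hz' hw'

lemma abs_im_eq (hN : IsNevanlinna N) {z : ℂ} (hz : z.im ≠ 0) :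
    |(N z).im| = |z.im| * ((N z).im / z.im) := by
  rw [← abs_of_nonneg (hN.nonneg z hz), abs_div]
  have := abs_pos.2 hz
  field_simp

lemma pick_sqrt (hN : IsNevanlinna N) {z w : ℂ} (hz : z.im ≠ 0) (hw : w.im ≠ 0) :
    ‖N z - N w‖ ≤ ‖z - w‖ * √((N z).im / z.im) * √((N w).im / w.im) := by
  refine (le_abs_self _).trans (abs_le_of_sq_le_sq ?_ (by positivity))
  rw [mul_pow, mul_pow, Real.sq_sqrt (hN.nonneg z hz), Real.sq_sqrt (hN.nonneg w hw)]
  exact hN.pick hz hw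

/-- A Harnack inequality. -/
lemma harnack (hN : IsNevanlinna N) {z w : ℂ} (hz : z.im ≠ 0) (hw : w.im ≠ 0) :
    |w.im| * √((N w).im / w.im) ≤ (|z.im| + |w.im| + ‖z - w‖) * √((N z).im / z.im) := by
  set A := √((N z).im / z.im) with hA
  set B := √((N w).im / w.im) with hB
  have hA0 : 0 ≤ A := Real.sqrt_nonneg _
  have hB0 : 0 ≤ B := Real.sqrt_nonneg _
  have h1 : |(N w).im| ≤ |(N z).im| + ‖N z - N w‖ := by
    have h2 : |(N z - N w).im| ≤ ‖N z - N w‖ := Complex.abs_im_le_norm _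
    rw [Complex.sub_im] at h2
    have := abs_sub_abs_le_abs_sub (N w).im (N z).im
    rw [abs_sub_comm] at this
    linarith
  have h3 := hN.pick_sqrt hz hw
  rw [hN.abs_im_eq hz, hN.abs_im_eq hw, ← Real.sq_sqrt (hN.nonneg z hz),
    ← Real.sq_sqrt (hN.nonneg w hw), ← hA, ← hB] at h1
  rw [← hA, ← hB] at h3
  have hzi := abs_nonneg z.im
  have hwi := abs_nonneg w.im
  have hd := norm_nonneg (z - w)
  -- If `B ≤ A` there is nothing to prove. Otherwise `h1` and `h3` give `|ℑw| B² ≤ |ℑz| A² + ‖z - w‖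
  -- A B ≤ (|ℑz| + ‖z - w‖) A B`, and one factor `B > 0` is cancelled.
  rcases le_or_gt B A with h | h
  · have : |w.im| * B ≤ |w.im| * A := by gcongr
    nlinarith [mul_nonneg hzi hA0, mul_nonneg hd hA0]
  · have hBpos : 0 < B := lt_of_le_of_lt hA0 h
    have h4 : |w.im| * B * B ≤ (|z.im| + ‖z - w‖) * A * B := by
      have : |z.im| * A ^ 2 ≤ |z.im| * (A * B) := by
        rw [pow_two]; gcongr
      nlinarith
    have h5 := le_of_mul_le_mul_right h4 hBpos
    nlinarith [mul_nonneg hwi hA0]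

/-- Pick bounds the difference by the ratios at both points, and Harnack trades the ratio at `z` for
that at `w` at the cost of a factor `1/|ℑz|`. Keeping `|ℑz|` on the left leaves an estimate that
stays bounded as `z` approaches the real axis. -/
lemma norm_sub_mul_im_le (hN : IsNevanlinna N) {z w : ℂ} (hz : z.im ≠ 0) (hw : w.im ≠ 0) :
    ‖N z - N w‖ * |z.im| ≤
      ‖z - w‖ * (|w.im| + |z.im| + ‖z - w‖) * ((N w).im / w.im) := by
  have h1 := hN.pick_sqrt hz hw
  have h2 := hN.harnack hw hz
  rw [norm_sub_rev] at h2
  have h3 := Real.mul_self_sqrt (hN.nonneg w hw)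
  set A := √((N z).im / z.im)
  set B := √((N w).im / w.im)
  have hB0 : 0 ≤ B := Real.sqrt_nonneg _
  calc ‖N z - N w‖ * |z.im| ≤ ‖z - w‖ * A * B * |z.im| := by gcongr
    _ = ‖z - w‖ * B * (|z.im| * A) := by ring
    _ ≤ ‖z - w‖ * B * ((|w.im| + |z.im| + ‖z - w‖) * B) := by gcongr
    _ = ‖z - w‖ * (|w.im| + |z.im| + ‖z - w‖) * (B * B) := by ring
    _ = _ := by rw [h3]

/-- At a real point around which `N` is analytic, the values of `N` and of `N'` are controlled by
the imaginary part of `N` at any nonreal point. -/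
lemma real_point_bound (hN : IsNevanlinna N) {z₀ w : ℂ} (hz₀ : z₀.im = 0) (hw : w.im ≠ 0) {ρ : ℝ}
    (hρ : 0 < ρ) {U : Set ℂ} (hU : IsOpen U) (hball : Metric.closedBall z₀ ρ ⊆ U)
    (hd : DifferentiableOn ℂ N U) :
    ‖N z₀ - N w‖ * ρ ^ 2 ≤ 2 * ρ * ((ρ + ‖z₀ - w‖) * (|w.im| + ρ + (ρ + ‖z₀ - w‖))) *
      ((N w).im / w.im) ∧
    ‖deriv N z₀‖ * ρ ^ 2 ≤ 2 * ρ * ((ρ + ‖z₀ - w‖) * (|w.im| + ρ + (ρ + ‖z₀ - w‖))) *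
      ((N w).im / w.im) / ρ := by
  set C := 2 * ρ * ((ρ + ‖z₀ - w‖) * (|w.im| + ρ + (ρ + ‖z₀ - w‖))) * ((N w).im / w.im) with hC
  have hv := hN.nonneg w hw
  have hC0 : 0 ≤ C := by positivity
  -- The bound on `N z - N w` degenerates like `1/|ℑz|` where the circle meets the real axis. The
  -- factor `(z - z₀)² - ρ²` has modulus `2ρ|ℑz|` on the circle and compensates exactly. At the
  -- centre it equals `-ρ²` and its derivative is zero, so the maximum principle and the Cauchy
  -- estimate for `K` bound both `N z₀ - N w` and `N' z₀`.
  set K : ℂ → ℂ := fun z => (N z - N w) * ((z - z₀) ^ 2 - ρ ^ 2) with hK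
  have hKd : DifferentiableOn ℂ K U := (hd.sub_const _).mul (by fun_prop)
  have hKc : DiffContOnCl ℂ K (Metric.ball z₀ ρ) :=
    (hKd.mono (by rwa [closure_ball _ hρ.ne'])).diffContOnCl
  have hsphere : ∀ z ∈ Metric.sphere z₀ ρ, ‖K z‖ ≤ C := by
    intro z hz
    have hzn : ‖z - z₀‖ = ρ := by simpa [dist_eq_norm] using hz
    have e1 : (z - z₀) ^ 2 - (ρ : ℂ) ^ 2 = (z - z₀) * (2 * z.im * Complex.I) := by
      have h1 : ((ρ : ℂ)) ^ 2 = (z - z₀) * conj (z - z₀) := by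
        rw [Complex.mul_conj, Complex.normSq_eq_norm_sq, hzn]; push_cast; rfl
      have h2 : (z - z₀) - conj (z - z₀) = 2 * z.im * Complex.I := by
        rw [Complex.sub_conj, Complex.sub_im, hz₀, sub_zero]; push_cast; ring
      rw [h1, ← h2]; ring
    have e2 : ‖(z - z₀) ^ 2 - (ρ : ℂ) ^ 2‖ = 2 * ρ * |z.im| := by
      rw [e1, norm_mul, hzn]; simp; ring
    simp only [hK]
    rw [norm_mul, e2]
    by_cases hzi : z.im = 0
    · rw [hzi]; simpa using hC0
    have h1 := hN.norm_sub_mul_im_le hzi hw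
    have h2 : ‖z - w‖ ≤ ρ + ‖z₀ - w‖ := by
      calc ‖z - w‖ = ‖(z - z₀) + (z₀ - w)‖ := by congr 1; ring
        _ ≤ _ := (norm_add_le _ _).trans (by rw [hzn])
    have h3 : |z.im| ≤ ρ := by
      have := Complex.abs_im_le_norm (z - z₀)
      rwa [Complex.sub_im, hz₀, sub_zero, hzn] at this
    calc ‖N z - N w‖ * (2 * ρ * |z.im|) = 2 * ρ * (‖N z - N w‖ * |z.im|) := by ring
      _ ≤ 2 * ρ * (‖z - w‖ * (|w.im| + |z.im| + ‖z - w‖) * ((N w).im / w.im)) := by gcongr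
      _ ≤ 2 * ρ * ((ρ + ‖z₀ - w‖) * (|w.im| + ρ + (ρ + ‖z₀ - w‖)) * ((N w).im / w.im)) := by
          gcongr
      _ = C := by rw [hC]; ring
  have hz₀U : z₀ ∈ U := hball (Metric.mem_closedBall_self hρ.le)
  constructor
  · have h1 : ‖K z₀‖ ≤ C := by
      refine Complex.norm_le_of_forall_mem_frontier_norm_le Metric.isBounded_ball hKc ?_
        (subset_closure (Metric.mem_ball_self hρ))
      rw [frontier_ball _ hρ.ne']
      exact hsphere
    simpa [hK, abs_of_pos hρ] using h1
  · have h1 := Complex.norm_deriv_le_of_forall_mem_sphere_norm_le hρ hKc hsphere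
    have hNd : HasDerivAt N (deriv N z₀) z₀ := (hd.differentiableAt (hU.mem_nhds hz₀U)).hasDerivAt
    have h2 : HasDerivAt K (deriv N z₀ * ((z₀ - z₀) ^ 2 - ρ ^ 2) +
        (N z₀ - N w) * (2 * (z₀ - z₀) ^ 1 * 1)) z₀ :=
      (hNd.sub_const _).mul ((((hasDerivAt_id z₀).sub_const z₀).pow 2).sub_const _)
    rw [h2.deriv] at h1
    simpa [abs_of_pos hρ] using h1

/-- Comparison of a Nevanlinna function at an arbitrary point of analyticity with its imaginary part
at a nonreal point. The constant does not depend on the function. -/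
lemma exists_compare (z₀ : ℂ) {w : ℂ} (hw : w.im ≠ 0) {U : Set ℂ} (hU : IsOpen U) (hz₀ : z₀ ∈ U) :
    ∃ C : ℝ, 0 ≤ C ∧ ∀ N : ℂ → ℂ, IsNevanlinna N → DifferentiableOn ℂ N U →
      ‖N z₀ - N w‖ ≤ C * ((N w).im / w.im) ∧
      |if z₀.im ≠ 0 then (N z₀).im / z₀.im else (deriv N z₀).re| ≤ C * ((N w).im / w.im) := by
  by_cases hz : z₀.im = 0
  · obtain ⟨ρ, hρ, hball⟩ := Metric.nhds_basis_closedBall.mem_iff.1 (hU.mem_nhds hz₀)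
    set C₀ := 2 * ρ * ((ρ + ‖z₀ - w‖) * (|w.im| + ρ + (ρ + ‖z₀ - w‖))) with hC₀
    have hC₀0 : 0 ≤ C₀ := by positivity
    refine ⟨C₀ / ρ ^ 2 + C₀ / ρ / ρ ^ 2, by positivity, fun N hN hd => ?_⟩
    obtain ⟨h1, h2⟩ := hN.real_point_bound hz hw hρ hU hball hd
    have hv := hN.nonneg w hw
    rw [← hC₀] at h1 h2
    rw [← le_div_iff₀ (by positivity)] at h1 h2
    have n1 : 0 ≤ C₀ * ((N w).im / w.im) / ρ ^ 2 := by positivity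
    have n2 : 0 ≤ C₀ * ((N w).im / w.im) / ρ / ρ ^ 2 := by positivity
    have e : (C₀ / ρ ^ 2 + C₀ / ρ / ρ ^ 2) * ((N w).im / w.im) =
      C₀ * ((N w).im / w.im) / ρ ^ 2 + C₀ * ((N w).im / w.im) / ρ / ρ ^ 2 := by ring
    rw [e]
    refine ⟨by linarith, ?_⟩
    rw [if_neg (by simpa using hz)]
    have := Complex.abs_re_le_norm (deriv N z₀)
    linarith
  · have hzi : 0 < |z₀.im| := abs_pos.2 hz
    set D := (|w.im| + |z₀.im| + ‖z₀ - w‖) / |z₀.im| with hD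
    have hD0 : 0 ≤ D := by positivity
    refine ⟨‖z₀ - w‖ * D + D ^ 2, by positivity, fun N hN _ => ?_⟩
    have hv := hN.nonneg w hw
    constructor
    · have h1 := hN.norm_sub_mul_im_le hz hw
      rw [← le_div_iff₀ hzi] at h1
      have e : ‖z₀ - w‖ * (|w.im| + |z₀.im| + ‖z₀ - w‖) * ((N w).im / w.im) / |z₀.im| =
        ‖z₀ - w‖ * D * ((N w).im / w.im) := by rw [hD]; ring
      rw [e] at h1
      have : 0 ≤ D ^ 2 * ((N w).im / w.im) := by positivity
      linarith
    · rw [if_pos hz, abs_of_nonneg (hN.nonneg z₀ hz)]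
      have h2 := hN.harnack hw hz
      rw [norm_sub_rev, mul_comm, ← le_div_iff₀ hzi] at h2
      have e : (|w.im| + |z₀.im| + ‖z₀ - w‖) * √((N w).im / w.im) / |z₀.im| =
        D * √((N w).im / w.im) := by rw [hD]; ring
      rw [e] at h2
      have h3 := pow_le_pow_left₀ (Real.sqrt_nonneg _) h2 2
      rw [mul_pow, Real.sq_sqrt (hN.nonneg z₀ hz), Real.sq_sqrt hv] at h3
      have : 0 ≤ ‖z₀ - w‖ * D * ((N w).im / w.im) := by positivity
      linarith

end IsNevanlinna

/-! ### From bounds of quadratic forms to bounds of operators -/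

section Polarization

variable {V : Type*} [NormedAddCommGroup V] [InnerProductSpace ℂ V]

lemma quadForm_add_add_quadForm_sub (W : V →L[ℂ] V) (x y : V) :
    quadForm W (x + y) + quadForm W (x - y) = 2 * quadForm W x + 2 * quadForm W y := by
  simp only [quadForm, map_add, map_sub, inner_add_left, inner_add_right, inner_sub_left,
    inner_sub_right, Complex.add_re, Complex.sub_re]
  ring

lemma quadForm_smul (W : V →L[ℂ] V) (c : ℂ) (x : V) :
    quadForm W (c • x) = ‖c‖ ^ 2 * quadForm W x := by
  simp only [quadForm, map_smul, inner_smul_left, inner_smul_right]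
  rw [← mul_assoc, Complex.mul_conj', ← Complex.ofReal_pow, Complex.re_ofReal_mul]

/-- A bound of the quadratic form of `D` by a nonnegative quadratic form gives a Cauchy–Schwarz type
bound of the sesquilinear form. -/
lemma norm_inner_sq_le_of_quadForm_bound {D W : V →L[ℂ] V} {K : ℝ} (hK : 0 ≤ K)
    (hD : ∀ x, ‖inner ℂ x (D x)‖ ≤ K * quadForm W x) (x y : V) :
    ‖inner ℂ y (D x)‖ ^ 2 ≤ 4 * K ^ 2 * quadForm W x * quadForm W y := by
  -- Polarization writes the sesquilinear form through four values of the quadratic form of `D`; the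
  -- parallelogram law sums the corresponding four values of `W`.
  have hbound : ∀ u v : V, ‖inner ℂ v (D u)‖ ≤ K * (quadForm W u + quadForm W v) := by
    intro u v
    have e : inner ℂ v (D u) = (1 / 4 : ℂ) * (inner ℂ (u + v) (D (u + v)) -
        inner ℂ (u - v) (D (u - v)) +
        Complex.I * inner ℂ (u + Complex.I • v) (D (u + Complex.I • v)) -
        Complex.I * inner ℂ (u - Complex.I • v) (D (u - Complex.I • v))) := by
      simp only [map_add, map_sub, map_smul, inner_add_left, inner_add_right, inner_sub_left,
        inner_sub_right, inner_smul_left, inner_smul_right, Complex.conj_I]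
      ring_nf
      simp only [Complex.I_sq]
      ring
    have q1 := quadForm_add_add_quadForm_sub W u v
    have q2 := quadForm_add_add_quadForm_sub W u (Complex.I • v)
    rw [quadForm_smul, Complex.norm_I, one_pow, one_mul] at q2
    have n1 := hD (u + v)
    have n2 := hD (u - v)
    have n3 := hD (u + Complex.I • v)
    have n4 := hD (u - Complex.I • v)
    rw [e, norm_mul]
    have t1 := norm_sub_le (inner ℂ (u + v) (D (u + v)) - inner ℂ (u - v) (D (u - v)) +
        Complex.I * inner ℂ (u + Complex.I • v) (D (u + Complex.I • v)))
        (Complex.I * inner ℂ (u - Complex.I • v) (D (u - Complex.I • v)))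
    have t2 := norm_add_le (inner ℂ (u + v) (D (u + v)) - inner ℂ (u - v) (D (u - v)))
        (Complex.I * inner ℂ (u + Complex.I • v) (D (u + Complex.I • v)))
    have t3 := norm_sub_le (inner ℂ (u + v) (D (u + v))) (inner ℂ (u - v) (D (u - v)))
    rw [norm_mul, Complex.norm_I, one_mul] at t1 t2
    have h4 : ‖(1 / 4 : ℂ)‖ = 1 / 4 := by norm_num
    rw [h4]
    nlinarith
  -- Replacing `x` by `t x` in `hbound` gives a real quadratic polynomial in `t` that is never
  -- negative, and its discriminant is the asserted inequality.
  have hq : ∀ t : ℝ, 0 ≤ K * quadForm W x * (t * t) + (-‖inner ℂ y (D x)‖) * t +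
      K * quadForm W y := by
    intro t
    have h := hbound ((t : ℂ) • x) y
    rw [quadForm_smul, map_smul, inner_smul_right, norm_mul, Complex.norm_real,
      Real.norm_eq_abs, sq_abs] at h
    have : ‖inner ℂ y (D x)‖ * t ≤ |t| * ‖inner ℂ y (D x)‖ := by
      rw [mul_comm]; gcongr; exact le_abs_self t
    nlinarith
  have := discrim_le_zero hq
  rw [discrim] at this
  nlinarith

lemma quadForm_le (W : V →L[ℂ] V) (x : V) : quadForm W x ≤ ‖W‖ * ‖x‖ ^ 2 := by
  have h1 : quadForm W x ≤ ‖inner ℂ x (W x)‖ := Complex.re_le_norm _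
  have h2 : ‖inner ℂ x (W x)‖ ≤ ‖x‖ * (‖W‖ * ‖x‖) :=
    (norm_inner_le_norm _ _).trans (by gcongr; exact W.le_opNorm x)
  nlinarith

/-- Apply the Cauchy–Schwarz bound with `y = D x` and cancel `‖D x‖²`. The factor `quadForm W x` is
deliberately not estimated by `‖x‖²`: the later perturbation argument needs errors controlled by the
weight itself. -/
lemma norm_sq_le_of_quadForm_bound {D W : V →L[ℂ] V} {K : ℝ} (hK : 0 ≤ K)
    (hD : ∀ x, ‖inner ℂ x (D x)‖ ≤ K * quadForm W x) (hW : ∀ x, 0 ≤ quadForm W x) (x : V) :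
    ‖D x‖ ^ 2 ≤ 4 * K ^ 2 * ‖W‖ * quadForm W x := by
  rcases eq_or_ne (D x) 0 with h0 | h0
  · rw [h0, norm_zero]
    have := hW x
    exact le_trans (by norm_num) (mul_nonneg (by positivity : (0 : ℝ) ≤ 4 * K ^ 2 * ‖W‖) this)
  have h := norm_inner_sq_le_of_quadForm_bound hK hD x (D x)
  have hn : 0 < ‖D x‖ ^ 2 := by positivity
  rw [inner_self_eq_norm_sq_to_K, ← RCLike.ofReal_pow, RCLike.norm_ofReal, abs_of_pos hn] at h
  have h2 : 4 * K ^ 2 * quadForm W x * quadForm W (D x) ≤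
      4 * K ^ 2 * quadForm W x * (‖W‖ * ‖D x‖ ^ 2) := by
    have := hW x
    gcongr
    exact quadForm_le W (D x)
  have h3 : ‖D x‖ ^ 2 * ‖D x‖ ^ 2 ≤ (4 * K ^ 2 * ‖W‖ * quadForm W x) * ‖D x‖ ^ 2 := by nlinarith
  exact le_of_mul_le_mul_right h3 hn

lemma norm_le_of_quadForm_bound {D W : V →L[ℂ] V} {K : ℝ} (hK : 0 ≤ K)
    (hD : ∀ x, ‖inner ℂ x (D x)‖ ≤ K * quadForm W x) (hW : ∀ x, 0 ≤ quadForm W x) :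
    ‖D‖ ≤ 2 * K * ‖W‖ := by
  refine ContinuousLinearMap.opNorm_le_bound _ (by positivity) fun x => ?_
  refine (le_abs_self _).trans (abs_le_of_sq_le_sq ?_ (by positivity))
  calc ‖D x‖ ^ 2 ≤ 4 * K ^ 2 * ‖W‖ * quadForm W x := norm_sq_le_of_quadForm_bound hK hD hW x
    _ ≤ 4 * K ^ 2 * ‖W‖ * (‖W‖ * ‖x‖ ^ 2) := by gcongr; exact quadForm_le W x
    _ = _ := by ring

end Polarization

end

/-! ### First order systems: solvability and the Lagrange identity -/

section

section RealDerivatives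

variable {V W : Type*} [NormedAddCommGroup V] [NormedSpace ℂ V] [NormedAddCommGroup W]
  [NormedSpace ℂ W]

/-- The operators are complex linear while the variable is real; restriction of scalars makes
evaluation a bounded real bilinear map, to which the product rule applies. -/
lemma HasDerivWithinAt.opApply {T : ℝ → V →L[ℂ] W} {T' : V →L[ℂ] W} {x : ℝ → V} {x' : V}
    {s : Set ℝ} {t : ℝ} (hT : HasDerivWithinAt T T' s t) (hx : HasDerivWithinAt x x' s t) :
    HasDerivWithinAt (fun t => T t (x t)) (T' (x t) + T t x') s t := by
  have h1 : HasDerivWithinAt (fun t => ContinuousLinearMap.restrictScalarsL ℂ V W ℝ ℝ (T t))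
      (ContinuousLinearMap.restrictScalarsL ℂ V W ℝ ℝ T') s t :=
    (ContinuousLinearMap.restrictScalarsL ℂ V W ℝ ℝ).hasFDerivAt.comp_hasDerivWithinAt t hT
  exact h1.clm_apply hx

lemma ContDiffOn.opApply {T : ℝ → V →L[ℂ] W} {x : ℝ → V} {s : Set ℝ} {n : WithTop ℕ∞}
    (hT : ContDiffOn ℝ n T s) (hx : ContDiffOn ℝ n x s) :
    ContDiffOn ℝ n (fun t => T t (x t)) s := by
  have h1 : ContDiffOn ℝ n (fun t => ContinuousLinearMap.restrictScalarsL ℂ V W ℝ ℝ (T t)) s :=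
    (ContinuousLinearMap.restrictScalarsL ℂ V W ℝ ℝ).contDiff.comp_contDiffOn hT
  exact h1.clm_apply hx

lemma ContinuousOn.opApply {α : Type*} [TopologicalSpace α] {T : α → V →L[ℂ] W} {x : α → V}
    {s : Set α} (hT : ContinuousOn T s) (hx : ContinuousOn x s) :
    ContinuousOn (fun t => T t (x t)) s := hT.clm_apply hx

end RealDerivatives

section Operators

variable {V : Type*} [NormedAddCommGroup V] [InnerProductSpace ℂ V] [CompleteSpace V]

open ContinuousLinearMap (adjoint)

lemma inner_reOp_comm (A : V →L[ℂ] V) (x y : V) :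
    inner ℂ (reOp A x) y = inner ℂ x (reOp A y) := by
  simp only [reOp, FunLike.coe_smul, FunLike.coe_add, Pi.smul_apply, Pi.add_apply, inner_smul_left,
    inner_smul_right, inner_add_left, inner_add_right, ContinuousLinearMap.adjoint_inner_left,
    ContinuousLinearMap.adjoint_inner_right, map_div₀, map_one, map_ofNat]
  ring

lemma adjoint_reOp (A : V →L[ℂ] V) : adjoint (reOp A) = reOp A := by
  refine (ContinuousLinearMap.eq_adjoint_iff _ _).2 (fun x y => ?_) |>.symm
  exact inner_reOp_comm A x y

lemma quadForm_imOp (A : V →L[ℂ] V) (x : V) : quadForm (imOp A) x = (inner ℂ x (A x)).im := by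
  have h : inner ℂ x (adjoint A x) = conj (inner ℂ x (A x)) := by
    rw [ContinuousLinearMap.adjoint_inner_right, inner_conj_symm]
  simp only [quadForm, imOp, FunLike.coe_smul, FunLike.coe_sub, Pi.smul_apply, Pi.sub_apply,
    inner_smul_right, inner_sub_right, h, Complex.sub_conj]
  have : (1 / (2 * Complex.I)) * (((2 * (inner ℂ x (A x)).im : ℝ) : ℂ) * Complex.I) =
      (((inner ℂ x (A x)).im : ℝ) : ℂ) := by
    have := Complex.I_ne_zero
    push_cast
    field_simp
  rw [this, Complex.ofReal_re]

lemma quadForm_nevWeight (H : ℂ → ℝ → V →L[ℂ] V) (z : ℂ) (t : ℝ) (x : V) :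
    quadForm (nevWeight H z t) x = (inner ℂ x (H z t x)).im / z.im := by
  have : quadForm (nevWeight H z t) x = 1 / z.im * quadForm (imOp (H z t)) x := by
    simp only [quadForm, nevWeight, FunLike.coe_smul, Pi.smul_apply, inner_smul_right,
      Complex.re_ofReal_mul]
  rw [this, quadForm_imOp]
  ring

/-- Regularity of the coefficients of a first order system on `[a, b]`. -/
structure IsRegularSystem (a b : ℝ) (Q H : ℝ → V →L[ℂ] V) : Prop where
  contDiffOn : ContDiffOn ℝ 1 Q (Icc a b)
  continuousOn : ContinuousOn H (Icc a b)
  isUnit : ∀ t ∈ Icc a b, IsUnit (reOp (Q t))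

/-- `x` solves `(i/2) ((Q x)' + Q* x') - H x = g` on `[a, b]`. -/
def IsSystemSolution (a b : ℝ) (Q H : ℝ → V →L[ℂ] V) (g x : ℝ → V) : Prop :=
  ∀ t ∈ Icc a b, ∃ x' : V, HasDerivWithinAt x x' (Icc a b) t ∧
    Complex.I • reOp (Q t) x' + (Complex.I / 2) • derivWithin Q (Icc a b) t (x t) - H t (x t) = g t

/-- The coefficient of the system solved for the derivative. -/
def sysCoeff (a b : ℝ) (Q H : ℝ → V →L[ℂ] V) (t : ℝ) : V →L[ℂ] V :=
  (-Complex.I) • (Ring.inverse (reOp (Q t)) *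
    (H t - (Complex.I / 2) • derivWithin Q (Icc a b) t))

variable {a b : ℝ} {Q H : ℝ → V →L[ℂ] V}

omit [CompleteSpace V] in
lemma inverse_mul_apply {A : V →L[ℂ] V} (hA : IsUnit A) (x : V) : Ring.inverse A (A x) = x :=
  congrArg (fun T : V →L[ℂ] V => T x) (Ring.inverse_mul_cancel A hA)

omit [CompleteSpace V] in
lemma mul_inverse_apply {A : V →L[ℂ] V} (hA : IsUnit A) (x : V) : A (Ring.inverse A x) = x :=
  congrArg (fun T : V →L[ℂ] V => T x) (Ring.mul_inverse_cancel A hA)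

omit [CompleteSpace V] in
lemma eq_inverse_apply_iff {A : V →L[ℂ] V} (hA : IsUnit A) (x y : V) :
    x = Ring.inverse A y ↔ A x = y := by
  constructor
  · rintro rfl; exact mul_inverse_apply hA y
  · rintro rfl; exact (inverse_mul_apply hA x).symm

lemma continuousOn_inverse {A : ℝ → V →L[ℂ] V} {s : Set ℝ} (hA : ContinuousOn A s)
    (hu : ∀ t ∈ s, IsUnit (A t)) : ContinuousOn (fun t => Ring.inverse (A t)) s := by
  intro t ht
  obtain ⟨u, hu⟩ := hu t ht
  have h : ContinuousAt Ring.inverse (A t) := by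
    rw [← hu]; exact NormedRing.inverse_continuousAt u
  exact h.comp_continuousWithinAt (hA t ht)

lemma continuousOn_reOp (hQ : ContinuousOn Q (Icc a b)) :
    ContinuousOn (fun t => reOp (Q t)) (Icc a b) := by
  have h : ContinuousOn (fun t => adjoint (Q t)) (Icc a b) :=
    (ContinuousLinearMap.adjoint (𝕜 := ℂ) (E := V) (F := V)).continuous.comp_continuousOn hQ
  exact (hQ.add h).const_smul (1 / 2 : ℂ)

namespace IsRegularSystem

lemma continuousOn_sysCoeff (hS : IsRegularSystem a b Q H) (hab : a < b) :
    ContinuousOn (sysCoeff a b Q H) (Icc a b) := by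
  have h1 := continuousOn_inverse (continuousOn_reOp hS.contDiffOn.continuousOn) hS.isUnit
  have h2 : ContinuousOn (derivWithin Q (Icc a b)) (Icc a b) :=
    hS.contDiffOn.continuousOn_derivWithin (uniqueDiffOn_Icc hab) le_rfl
  exact (h1.mul (hS.continuousOn.sub (h2.const_smul (Complex.I / 2)))).const_smul (-Complex.I)

lemma hasDerivWithinAt (hS : IsRegularSystem a b Q H) {t : ℝ} (ht : t ∈ Icc a b) :
    HasDerivWithinAt Q (derivWithin Q (Icc a b) t) (Icc a b) t :=
  (hS.contDiffOn.differentiableOn one_ne_zero t ht).hasDerivWithinAt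

/-- Since `ℜQ(t)` is invertible, the implicit system can be solved for the derivative. All
solvability questions go through this explicit form. -/
lemma eq_sysCoeff_iff (hS : IsRegularSystem a b Q H) {t : ℝ} (ht : t ∈ Icc a b) (x x' g : V) :
    Complex.I • reOp (Q t) x' + (Complex.I / 2) • derivWithin Q (Icc a b) t x - H t x = g ↔
      x' = sysCoeff a b Q H t x - Complex.I • Ring.inverse (reOp (Q t)) g := by
  have e : sysCoeff a b Q H t x - Complex.I • Ring.inverse (reOp (Q t)) g =
      Ring.inverse (reOp (Q t)) ((-Complex.I) • (H t x - (Complex.I / 2) •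
        derivWithin Q (Icc a b) t x + g)) := by
    simp only [sysCoeff, FunLike.coe_smul, Pi.smul_apply, mul_apply_eq_comp,
      FunLike.coe_sub, Pi.sub_apply, map_smul, map_add, smul_add, map_sub]
    module
  rw [e, eq_inverse_apply_iff (hS.isUnit t ht)]
  have hI : Complex.I * Complex.I = -1 := Complex.I_mul_I
  constructor
  · rintro rfl
    simp only [smul_add, smul_sub, smul_smul]
    rw [show -Complex.I * Complex.I = 1 by rw [neg_mul, hI, neg_neg]]
    module
  · intro h
    rw [h, smul_smul, mul_neg, hI]
    module

/-- Expanding `(Q X)'` gives `(i/2)((Q X)' + Q* X') = i ℜQ X' + (i/2) Q' X`, which connects the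
symmetric form of the equation with the explicit one. -/
lemma isOperatorSolution_iff (hS : IsRegularSystem a b Q H) (hab : a < b)
    {X : ℝ → V →L[ℂ] V} :
    IsOperatorSolution a b Q H X ↔ ContDiffOn ℝ 1 X (Icc a b) ∧ X 0 = 1 ∧
      ∀ t ∈ Icc a b, HasDerivWithinAt X (sysCoeff a b Q H t * X t) (Icc a b) t := by
  refine and_congr_right fun hX => and_congr_right fun _ => forall₂_congr fun t ht => ?_
  have hud := uniqueDiffOn_Icc hab t ht
  have hXd : HasDerivWithinAt X (derivWithin X (Icc a b) t) (Icc a b) t :=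
    (hX.differentiableOn one_ne_zero t ht).hasDerivWithinAt
  have hprod : derivWithin (fun τ => Q τ ∘L X τ) (Icc a b) t =
      derivWithin Q (Icc a b) t ∘L X t + Q t ∘L derivWithin X (Icc a b) t :=
    ((hS.hasDerivWithinAt ht).mul hXd).derivWithin hud
  rw [hprod]
  have key : (Complex.I / 2) • (derivWithin Q (Icc a b) t ∘L X t + Q t ∘L derivWithin X (Icc a b) t +
      adjoint (Q t) ∘L derivWithin X (Icc a b) t) - H t ∘L X t = 0 ↔
      derivWithin X (Icc a b) t = sysCoeff a b Q H t * X t := by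
    rw [ContinuousLinearMap.ext_iff, ContinuousLinearMap.ext_iff]
    refine forall_congr' fun v => ?_
    have := hS.eq_sysCoeff_iff ht (X t v) (derivWithin X (Icc a b) t v) 0
    rw [map_zero, smul_zero, sub_zero] at this
    rw [mul_apply_eq_comp, ← this]
    simp only [reOp, FunLike.coe_smul, FunLike.coe_sub, FunLike.coe_add, Pi.smul_apply,
      Pi.sub_apply, Pi.add_apply, ContinuousLinearMap.comp_apply, FunLike.coe_zero, Pi.zero_apply]
    rw [← sub_eq_zero, sub_zero]
    constructor <;> intro h <;> rw [← h] <;> module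
  rw [key]
  exact ⟨fun h => h ▸ hXd, fun h => h.derivWithin hud⟩

end IsRegularSystem

/-- A function continuous on `[a, b]` as an element of `C([a, b], F)` (zero otherwise). -/
def restrictMap {F : Type*} [TopologicalSpace F] [Zero F] (a b : ℝ) (f : ℝ → F) :
    C(Icc a b, F) :=
  open Classical in
  if h : ContinuousOn f (Icc a b) then ⟨(Icc a b).domRestrict f, continuousOn_iff_continuous_domRestrict.1 h⟩
  else 0

lemma restrictMap_apply {F : Type*} [TopologicalSpace F] [Zero F] {f : ℝ → F}
    (h : ContinuousOn f (Icc a b)) (t : Icc a b) : restrictMap a b f t = f t := by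
  simp [restrictMap, h, Set.domRestrict]

/-- The operator solution constructed by the Volterra equation. -/
def sysFundamental (hab : a < b) (h0 : (0 : ℝ) ∈ Icc a b) (Q H : ℝ → V →L[ℂ] V) : ℝ → V →L[ℂ] V :=
  LinearODE.fundamental hab.le h0 (restrictMap a b (sysCoeff a b Q H))

namespace IsRegularSystem

lemma isOperatorSolution_sysFundamental (hS : IsRegularSystem a b Q H) (hab : a < b)
    (h0 : (0 : ℝ) ∈ Icc a b) : IsOperatorSolution a b Q H (sysFundamental hab h0 Q H) := by
  refine (hS.isOperatorSolution_iff hab).2 ⟨(LinearODE.contDiff_fundamental _ _ _).contDiffOn,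
    LinearODE.fundamental_zero _ _ _, fun t ht => ?_⟩
  have := (LinearODE.hasDerivAt_fundamental hab.le h0
    (restrictMap a b (sysCoeff a b Q H)) ht).hasDerivWithinAt (s := Icc a b)
  rwa [restrictMap_apply (hS.continuousOn_sysCoeff hab)] at this

lemma isOperatorSolution (hS : IsRegularSystem a b Q H) (hab : a < b)
    (h0 : (0 : ℝ) ∈ Icc a b) : IsOperatorSolution a b Q H (operatorSolution a b Q H) :=
  Classical.epsilon_spec (p := IsOperatorSolution a b Q H)
    ⟨_, hS.isOperatorSolution_sysFundamental hab h0⟩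

end IsRegularSystem

lemma hasDerivWithinAt_reOp (hS : IsRegularSystem a b Q H) {t : ℝ} (ht : t ∈ Icc a b) :
    HasDerivWithinAt (fun t => reOp (Q t)) (reOp (derivWithin Q (Icc a b) t)) (Icc a b) t := by
  have h1 := hS.hasDerivWithinAt ht
  have h2 : HasDerivWithinAt (fun t => star (Q t)) (star (derivWithin Q (Icc a b) t)) (Icc a b) t :=
    h1.star
  exact (h1.add h2).const_smul (1 / 2 : ℂ)

/-- The Lagrange identity. -/
lemma hasDerivWithinAt_inner_reOp {H' : ℝ → V →L[ℂ] V} (hS : IsRegularSystem a b Q H)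
    (hH : ∀ t ∈ Icc a b, H' t = adjoint (H t)) {g₁ g₂ x y : ℝ → V}
    (hx : IsSystemSolution a b Q H g₁ x) (hy : IsSystemSolution a b Q H' g₂ y) {t : ℝ}
    (ht : t ∈ Icc a b) :
    HasDerivWithinAt (fun t => inner ℂ (y t) (reOp (Q t) (x t)))
      (Complex.I * (inner ℂ (g₂ t) (x t) - inner ℂ (y t) (g₁ t))) (Icc a b) t := by
  obtain ⟨x', hx', ex⟩ := hx t ht
  obtain ⟨y', hy', ey⟩ := hy t ht
  have h1 := HasDerivWithinAt.inner ℂ hy' ((hasDerivWithinAt_reOp hS ht).opApply hx')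
  refine h1.congr_deriv ?_
  rw [← ex, ← ey, hH t ht]
  -- The two `H` terms cancel because `H' = H*`, and the halves of `Q'` and `Q'*` contributed by the
  -- two equations cancel the derivative of `ℜQ`. Only the right-hand sides survive.
  simp only [inner_add_right, inner_sub_right, inner_sub_left, inner_add_left, inner_smul_left,
    inner_smul_right, ContinuousLinearMap.adjoint_inner_left, inner_reOp_comm]
  simp only [reOp, FunLike.coe_smul, FunLike.coe_add, Pi.smul_apply, Pi.add_apply,
    inner_smul_right, inner_add_right, ContinuousLinearMap.adjoint_inner_right, Complex.conj_I, map_div₀,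
    map_ofNat]
  ring_nf
  simp only [Complex.I_sq]
  ring

/-- Here the same coefficient `H` acts in both entries, so its self-adjoint part cancels while `ℑH`
remains as the energy density. -/
lemma hasDerivWithinAt_quadForm_reOp (hS : IsRegularSystem a b Q H) {x : ℝ → V}
    (hx : IsSystemSolution a b Q H 0 x) {t : ℝ} (ht : t ∈ Icc a b) :
    HasDerivWithinAt (fun t => quadForm (reOp (Q t)) (x t))
      (2 * (inner ℂ (x t) (H t (x t))).im) (Icc a b) t := by
  obtain ⟨x', hx', ex⟩ := hx t ht
  have h1 := HasDerivWithinAt.inner ℂ hx' ((hasDerivWithinAt_reOp hS ht).opApply hx')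
  have h2 := (Complex.reCLM.hasFDerivAt).comp_hasDerivWithinAt t h1
  refine h2.congr_deriv ?_
  have e1 : H t (x t) = Complex.I • reOp (Q t) x' +
      (Complex.I / 2) • derivWithin Q (Icc a b) t (x t) := by
    rw [Pi.zero_apply, sub_eq_zero] at ex; exact ex.symm
  rw [e1]
  have e2 : (inner ℂ x' (reOp (Q t) (x t))).re = (inner ℂ (x t) (reOp (Q t) x')).re := by
    rw [← inner_reOp_comm, ← inner_conj_symm, Complex.conj_re]
  have e3 : (inner ℂ (x t) (reOp (derivWithin Q (Icc a b) t) (x t))).re =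
      (inner ℂ (x t) (derivWithin Q (Icc a b) t (x t))).re := by
    simp only [reOp, FunLike.coe_smul, FunLike.coe_add, Pi.smul_apply, Pi.add_apply,
      inner_smul_right, inner_add_right, ContinuousLinearMap.adjoint_inner_right]
    have h := Complex.conj_re (inner ℂ (x t) (derivWithin Q (Icc a b) t (x t)))
    rw [inner_conj_symm] at h
    rw [show (1 / 2 : ℂ) = ((1 / 2 : ℝ) : ℂ) by push_cast; rfl, Complex.re_ofReal_mul,
      Complex.add_re, h]
    ring
  simp only [Complex.reCLM_apply, Complex.add_re, inner_add_right, e2, e3, inner_smul_right,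
    Complex.add_im, Complex.mul_im, Complex.I_re, Complex.I_im]
  simp
  ring

end Operators

end

/-! ### Transfer operators: invertibility, variation of constants, energy -/

section

section Calculus

/-- The integrand is continuous only on `[a, b]`. Its constant extension has the same integrals
there and lets the fundamental theorem be used at the end points too. -/
lemma hasDerivWithinAt_integral {F : Type*} [NormedAddCommGroup F] [NormedSpace ℝ F]
    [CompleteSpace F] {a b : ℝ} (hab : a ≤ b) {φ : ℝ → F} (hφ : ContinuousOn φ (Icc a b)) {c t : ℝ}
    (hc : c ∈ Icc a b) (ht : t ∈ Icc a b) :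
    HasDerivWithinAt (fun t => ∫ τ in c..t, φ τ) (φ t) (Icc a b) t := by
  set ψ : ℝ → F := IccExtend hab ((Icc a b).domRestrict φ) with hψ
  have hψc : Continuous ψ := (continuousOn_iff_continuous_domRestrict.1 hφ).Icc_extend'
  have hψe : ∀ τ ∈ Icc a b, ψ τ = φ τ := fun τ hτ => by
    rw [hψ, IccExtend_of_mem hab _ hτ, Set.domRestrict_apply]
  have h := (hψc.integral_hasStrictDerivAt c t).hasDerivAt.hasDerivWithinAt (s := Icc a b)
  rw [hψe t ht] at h
  have heq : ∀ u ∈ Icc a b, (∫ τ in c..u, φ τ) = ∫ τ in c..u, ψ τ := fun u hu =>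
    intervalIntegral.integral_congr fun τ hτ => (hψe τ (uIcc_subset_Icc hc hu hτ)).symm
  exact h.congr heq (heq t ht)

lemma eq_of_hasDerivWithinAt_zero {F : Type*} [NormedAddCommGroup F] [NormedSpace ℝ F] {a b : ℝ}
    (hab : a < b) {f : ℝ → F} (hf : ∀ t ∈ Icc a b, HasDerivWithinAt f 0 (Icc a b) t) {s t : ℝ}
    (hs : s ∈ Icc a b) (ht : t ∈ Icc a b) : f s = f t := by
  have h := constant_of_derivWithin_zero (fun t ht => (hf t ht).differentiableWithinAt)
    (fun t ht => (hf t (Ico_subset_Icc_self ht)).derivWithin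
      (uniqueDiffOn_Icc hab t (Ico_subset_Icc_self ht)))
  rw [h s hs, h t ht]

lemma integral_eq_sub_of_hasDerivWithinAt {F : Type*} [NormedAddCommGroup F] [NormedSpace ℝ F]
    [CompleteSpace F] {a b : ℝ} (hab : a < b) {f f' : ℝ → F}
    (hf : ∀ t ∈ Icc a b, HasDerivWithinAt f (f' t) (Icc a b) t) (hf' : ContinuousOn f' (Icc a b))
    {c t : ℝ} (hc : c ∈ Icc a b) (ht : t ∈ Icc a b) :
    ∫ τ in c..t, f' τ = f t - f c := by
  have h := eq_of_hasDerivWithinAt_zero hab (f := fun t => f t - ∫ τ in c..t, f' τ)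
    (fun t ht => by
      have := (hf t ht).sub (hasDerivWithinAt_integral hab.le hf' hc ht)
      rwa [sub_self] at this) hc ht
  simp only [intervalIntegral.integral_same, sub_zero] at h
  rw [h]; abel

end Calculus

section Operators

variable {V : Type*} [NormedAddCommGroup V] [InnerProductSpace ℂ V] [CompleteSpace V]
  {a b : ℝ} {Q H H' : ℝ → V →L[ℂ] V} {X X' : ℝ → V →L[ℂ] V}

open ContinuousLinearMap (adjoint)

namespace IsRegularSystem

lemma congr {Q₂ : ℝ → V →L[ℂ] V} (hS : IsRegularSystem a b Q H) (hQ : EqOn Q₂ Q (Icc a b)) :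
    IsRegularSystem a b Q₂ H where
  contDiffOn := hS.contDiffOn.congr hQ
  continuousOn := hS.continuousOn
  isUnit t ht := by rw [hQ ht]; exact hS.isUnit t ht

lemma hasDerivWithinAt_solution (hS : IsRegularSystem a b Q H) (hab : a < b)
    (hX : IsOperatorSolution a b Q H X) {t : ℝ} (ht : t ∈ Icc a b) :
    HasDerivWithinAt X (sysCoeff a b Q H t * X t) (Icc a b) t :=
  ((hS.isOperatorSolution_iff hab).1 hX).2.2 t ht

lemma isSystemSolution_apply (hS : IsRegularSystem a b Q H) (hab : a < b)
    (hX : IsOperatorSolution a b Q H X) (v : V) :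
    IsSystemSolution a b Q H 0 (fun t => X t v) := by
  intro t ht
  have h := (hS.hasDerivWithinAt_solution hab hX ht).opApply (hasDerivWithinAt_const t _ v)
  refine ⟨_, h, ?_⟩
  rw [map_zero, add_zero, Pi.zero_apply, hS.eq_sysCoeff_iff ht, map_zero, smul_zero, sub_zero,
    mul_apply_eq_comp]

/-- `X_{z̄}(t)* ℜQ(t) X_z(t) = ℜQ(0)`. -/
lemma adjoint_mul_reOp_mul (hS : IsRegularSystem a b Q H) (hS' : IsRegularSystem a b Q H')
    (hab : a < b) (h0 : (0 : ℝ) ∈ Icc a b) (hH : ∀ t ∈ Icc a b, H' t = adjoint (H t))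
    (hX : IsOperatorSolution a b Q H X) (hX' : IsOperatorSolution a b Q H' X') {t : ℝ}
    (ht : t ∈ Icc a b) : adjoint (X' t) * (reOp (Q t) * X t) = reOp (Q 0) := by
  ext v
  refine ext_inner_left ℂ fun w => ?_
  rw [mul_apply_eq_comp, mul_apply_eq_comp, ContinuousLinearMap.adjoint_inner_right]
  have h := eq_of_hasDerivWithinAt_zero hab (f := fun t => inner ℂ (X' t w) (reOp (Q t) (X t v)))
    (fun t ht => by
      have := hasDerivWithinAt_inner_reOp hS hH (hS.isSystemSolution_apply hab hX v)
        (hS'.isSystemSolution_apply hab hX' w) ht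
      simpa using this) ht h0
  simp only [hX.2.1, hX'.2.1] at h
  exact h

/-- The identity `X'* ℜQ X = G` supplies a left inverse, which is not enough in infinite dimensions.
However, the set of `t` where `X t` is invertible is open, is closed because there the left inverse
is also a right inverse, and contains `0`; connectedness of `[a, b]` finishes. -/
lemma isUnit_solution (hS : IsRegularSystem a b Q H) (hS' : IsRegularSystem a b Q H')
    (hab : a < b) (h0 : (0 : ℝ) ∈ Icc a b) (hH : ∀ t ∈ Icc a b, H' t = adjoint (H t))
    (hX : IsOperatorSolution a b Q H X) (hX' : IsOperatorSolution a b Q H' X') {t : ℝ}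
    (ht : t ∈ Icc a b) : IsUnit (X t) := by
  set L : ℝ → V →L[ℂ] V := fun t => Ring.inverse (reOp (Q 0)) * (adjoint (X' t) * reOp (Q t))
    with hL
  have hG : IsUnit (reOp (Q 0)) := hS.isUnit 0 h0
  have hLX : ∀ t ∈ Icc a b, L t * X t = 1 := fun t ht => by
    rw [hL, mul_assoc, mul_assoc, hS.adjoint_mul_reOp_mul hS' hab h0 hH hX hX' ht,
      Ring.inverse_mul_cancel _ hG]
  have hLc : ContinuousOn L (Icc a b) := by
    have h1 : ContinuousOn (fun t => adjoint (X' t)) (Icc a b) :=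
      (ContinuousLinearMap.adjoint (𝕜 := ℂ) (E := V) (F := V)).continuous.comp_continuousOn
        hX'.1.continuousOn
    exact continuousOn_const.mul (h1.mul (continuousOn_reOp hS.contDiffOn.continuousOn))
  have hXc := hX.1.continuousOn
  have hiff : ∀ t ∈ Icc a b, X t * L t = 1 ↔ IsUnit (X t) := fun t ht => by
    constructor
    · intro h
      exact ⟨⟨X t, L t, h, hLX t ht⟩, rfl⟩
    · rintro ⟨u, hu⟩
      have h1 := hLX t ht
      rw [← hu] at h1 ⊢
      rw [Units.mul_eq_one_iff_eq_inv.1 h1, Units.mul_inv]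
  let S : Set (Icc a b) := {t | IsUnit (X t)}
  have hXr : Continuous fun t : Icc a b => X t := continuousOn_iff_continuous_domRestrict.1 hXc
  have hLr : Continuous fun t : Icc a b => L t := continuousOn_iff_continuous_domRestrict.1 hLc
  have hopen : IsOpen S := Units.isOpen.preimage hXr
  have hclosed : IsClosed S := by
    have : S = {t : Icc a b | X t * L t = 1} := by
      ext t
      exact (hiff t t.2).symm
    rw [this]
    exact isClosed_eq (hXr.mul hLr) continuous_const
  have : PreconnectedSpace (Icc a b) := Subtype.preconnectedSpace isPreconnected_Icc
  rcases isClopen_iff.1 ⟨hclosed, hopen⟩ with h | h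
  · exfalso
    have : (⟨0, h0⟩ : Icc a b) ∈ S := by
      change IsUnit (X 0)
      rw [hX.2.1]
      exact isUnit_one
    rw [h] at this
    exact this
  · have : (⟨t, ht⟩ : Icc a b) ∈ S := by rw [h]; trivial
    exact this

/-- This is the Lagrange identity with the factors in the opposite order, available once `X t` is
invertible. It is what makes differentiation of the variable constant return precisely the
right-hand side. -/
lemma solution_mul_inverse_mul_adjoint (hS : IsRegularSystem a b Q H)
    (hS' : IsRegularSystem a b Q H') (hab : a < b) (h0 : (0 : ℝ) ∈ Icc a b)
    (hH : ∀ t ∈ Icc a b, H' t = adjoint (H t))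
    (hX : IsOperatorSolution a b Q H X) (hX' : IsOperatorSolution a b Q H' X') {t : ℝ}
    (ht : t ∈ Icc a b) :
    X t * (Ring.inverse (reOp (Q 0)) * adjoint (X' t)) = Ring.inverse (reOp (Q t)) := by
  have h1 := hS.adjoint_mul_reOp_mul hS' hab h0 hH hX hX' ht
  obtain ⟨u, hu⟩ := hS.isUnit_solution hS' hab h0 hH hX hX' ht
  obtain ⟨g, hg⟩ := hS.isUnit 0 h0
  obtain ⟨q, hq⟩ := hS.isUnit t ht
  rw [← hu, ← hg, ← hq] at h1
  rw [← hu, ← hg, ← hq, Ring.inverse_unit, Ring.inverse_unit]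
  have h2 : adjoint (X' t) = ↑g * ↑u⁻¹ * ↑q⁻¹ := by
    rw [← h1]
    simp [mul_assoc]
  rw [h2]
  simp [mul_assoc]

/-- Uniqueness for the inhomogeneous system. -/
lemma solution_unique (hS : IsRegularSystem a b Q H) (hS' : IsRegularSystem a b Q H')
    (hab : a < b) (h0 : (0 : ℝ) ∈ Icc a b) (hH : ∀ t ∈ Icc a b, H' t = adjoint (H t))
    (hX : IsOperatorSolution a b Q H X) (hX' : IsOperatorSolution a b Q H' X') {g x₁ x₂ : ℝ → V}
    (h₁ : IsSystemSolution a b Q H g x₁) (h₂ : IsSystemSolution a b Q H g x₂) {t : ℝ}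
    (ht : t ∈ Icc a b) : x₁ t - x₂ t = X t (x₁ 0 - x₂ 0) := by
  have hd : IsSystemSolution a b Q H 0 (fun t => x₁ t - x₂ t - X t (x₁ 0 - x₂ 0)) := by
    intro t ht
    obtain ⟨x₁', h1, e1⟩ := h₁ t ht
    obtain ⟨x₂', h2, e2⟩ := h₂ t ht
    obtain ⟨x₃', h3, e3⟩ := hS.isSystemSolution_apply hab hX (x₁ 0 - x₂ 0) t ht
    refine ⟨_, (h1.sub h2).sub h3, ?_⟩
    rw [Pi.zero_apply] at e3 ⊢
    have : (0 : V) = g t - g t - 0 := by simp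
    rw [this]
    nth_rw 1 [← e1]
    rw [← e2, ← e3]
    simp only [map_sub]
    module
  -- The pairing of the difference with any adjoint solution is constant and vanishes at `0`. Since
  -- `X' t` is onto and `ℜQ(t)` is invertible, the difference itself vanishes.
  have hz : ∀ w, inner ℂ (X' t w) (reOp (Q t) (x₁ t - x₂ t - X t (x₁ 0 - x₂ 0))) = 0 := by
    intro w
    have h := eq_of_hasDerivWithinAt_zero hab
      (f := fun t => inner ℂ (X' t w) (reOp (Q t) (x₁ t - x₂ t - X t (x₁ 0 - x₂ 0))))
      (fun t ht => by
        have := hasDerivWithinAt_inner_reOp hS hH hd (hS'.isSystemSolution_apply hab hX' w) ht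
        simpa using this) ht h0
    rw [h]
    simp [hX.2.1]
  have hu' : IsUnit (X' t) := hS'.isUnit_solution hS hab h0
    (fun t ht => by rw [hH t ht, ContinuousLinearMap.adjoint_adjoint]) hX' hX ht
  have h1 : reOp (Q t) (x₁ t - x₂ t - X t (x₁ 0 - x₂ 0)) = 0 := by
    refine ext_inner_left ℂ fun w => ?_
    rw [inner_zero_right, ← mul_inverse_apply hu' w]
    exact hz _
  have h2 := (eq_inverse_apply_iff (hS.isUnit t ht) _ _).2 h1
  rw [map_zero, sub_eq_zero] at h2
  exact h2

/-- Variation of constants. -/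
lemma isSystemSolution_variation (hS : IsRegularSystem a b Q H) (hS' : IsRegularSystem a b Q H')
    (hab : a < b) (h0 : (0 : ℝ) ∈ Icc a b) (hH : ∀ t ∈ Icc a b, H' t = adjoint (H t))
    (hX : IsOperatorSolution a b Q H X) (hX' : IsOperatorSolution a b Q H' X') {g : ℝ → V}
    (hg : ContinuousOn g (Icc a b)) {c : ℝ} (hc : c ∈ Icc a b) (v : V) :
    IsSystemSolution a b Q H g (fun t => X t (v + Ring.inverse (Complex.I • reOp (Q 0))
      (∫ σ in c..t, adjoint (X' σ) (g σ)))) := by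
  intro t ht
  have hφ : ContinuousOn (fun σ => adjoint (X' σ) (g σ)) (Icc a b) :=
    ((ContinuousLinearMap.adjoint (𝕜 := ℂ) (E := V) (F := V)).continuous.comp_continuousOn
        hX'.1.continuousOn).opApply hg
  have h1 := hasDerivWithinAt_integral hab.le hφ hc ht
  have h2 := ((hasDerivWithinAt_const t (Icc a b) (Ring.inverse (Complex.I • reOp (Q 0)))).opApply
    h1).const_add v
  refine ⟨_, (hS.hasDerivWithinAt_solution hab hX ht).opApply h2, ?_⟩
  rw [hS.eq_sysCoeff_iff ht, mul_apply_eq_comp]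
  have hK : Ring.inverse (Complex.I • reOp (Q 0)) = (-Complex.I) • Ring.inverse (reOp (Q 0)) := by
    obtain ⟨g, hg⟩ := hS.isUnit 0 h0
    rw [← hg, Ring.inverse_unit]
    have e : Complex.I • (g : V →L[ℂ] V) =
        ((⟨Complex.I • g, (-Complex.I) • ↑g⁻¹, by simp [smul_smul], by simp [smul_smul]⟩ :
          (V →L[ℂ] V)ˣ) : V →L[ℂ] V) := rfl
    rw [e, Ring.inverse_unit]
    rfl
  have h3 := hS.solution_mul_inverse_mul_adjoint hS' hab h0 hH hX hX' ht
  rw [← h3, hK]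
  simp only [FunLike.coe_smul, Pi.smul_apply, mul_apply_eq_comp, FunLike.coe_zero, Pi.zero_apply,
    zero_add, map_smul, map_add]
  module

/-- The energy identity. -/
lemma quadForm_sub_quadForm (hS : IsRegularSystem a b Q H) (hab : a < b)
    (hX : IsOperatorSolution a b Q H X) (v : V) :
    quadForm (reOp (Q b)) (X b v) - quadForm (reOp (Q a)) (X a v) =
      2 * ∫ t in a..b, (inner ℂ (X t v) (H t (X t v))).im := by
  have hXv : ContinuousOn (fun t => X t v) (Icc a b) := hX.1.continuousOn.opApply continuousOn_const
  have hc : ContinuousOn (fun t => 2 * (inner ℂ (X t v) (H t (X t v))).im) (Icc a b) :=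
    (Complex.continuous_im.comp_continuousOn (hXv.inner (hS.continuousOn.opApply hXv))).const_mul 2
  have h := integral_eq_sub_of_hasDerivWithinAt hab
    (fun t ht => hasDerivWithinAt_quadForm_reOp hS (hS.isSystemSolution_apply hab hX v) ht) hc
    (left_mem_Icc.2 hab.le) (right_mem_Icc.2 hab.le)
  rw [← h, intervalIntegral.integral_const_mul]

end IsRegularSystem

/-- The Green integral in terms of indefinite integrals. -/
lemma integral_sign_kernel {φ : ℝ → V} (hφ : IntervalIntegrable φ volume a b) {t : ℝ}
    (ht : t ∈ Icc a b) (Y M K : V →L[ℂ] V) :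
    ∫ σ in a..b, Y ((M - ((1 / 2 * Real.sign (σ - t) : ℝ) : ℂ) • K) (φ σ)) =
      Y ((M - (1 / 2 : ℂ) • K) (∫ σ in a..b, φ σ) + K (∫ σ in a..t, φ σ)) := by
  have hat : IntervalIntegrable φ volume a t := hφ.mono_set (by
    rw [uIcc_of_le ht.1, uIcc_of_le (ht.1.trans ht.2)]; exact Icc_subset_Icc_right ht.2)
  have htb : IntervalIntegrable φ volume t b := hφ.mono_set (by
    rw [uIcc_of_le ht.2, uIcc_of_le (ht.1.trans ht.2)]; exact Icc_subset_Icc_left ht.1)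
  -- The sign is zero at `σ = t`, which belongs to the left interval but not to its formula; a
  -- single point does not affect the integral.
  have hne : ∀ᵐ σ ∂(volume : Measure ℝ), σ ≠ t := by simp [ae_iff]
  have h1 : ∀ᵐ σ ∂(volume : Measure ℝ), σ ∈ uIoc a t →
      Y ((M - ((1 / 2 * Real.sign (σ - t) : ℝ) : ℂ) • K) (φ σ)) =
      (Y ∘L (M + (1 / 2 : ℂ) • K)) (φ σ) := by
    filter_upwards [hne] with σ hσ hm
    rw [uIoc_of_le ht.1] at hm
    rw [Real.sign_of_neg (sub_neg.2 (lt_of_le_of_ne hm.2 hσ))]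
    simp
  have h2 : ∀ᵐ σ ∂(volume : Measure ℝ), σ ∈ uIoc t b →
      Y ((M - ((1 / 2 * Real.sign (σ - t) : ℝ) : ℂ) • K) (φ σ)) =
      (Y ∘L (M - (1 / 2 : ℂ) • K)) (φ σ) := by
    refine Filter.Eventually.of_forall fun σ hm => ?_
    rw [uIoc_of_le ht.2] at hm
    rw [Real.sign_of_pos (sub_pos.2 hm.1)]
    simp
  have i1 : IntervalIntegrable
      (fun σ => Y ((M - ((1 / 2 * Real.sign (σ - t) : ℝ) : ℂ) • K) (φ σ))) volume a t := by
    refine IntervalIntegrable.congr_ae (f := (Y ∘L (M + (1 / 2 : ℂ) • K)) ∘ φ)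
      ⟨(Y ∘L (M + (1 / 2 : ℂ) • K)).integrable_comp hat.1,
        (Y ∘L (M + (1 / 2 : ℂ) • K)).integrable_comp hat.2⟩ ?_
    exact (ae_restrict_iff' measurableSet_uIoc).2 (h1.mono fun σ h hm => (h hm).symm)
  have i2 : IntervalIntegrable
      (fun σ => Y ((M - ((1 / 2 * Real.sign (σ - t) : ℝ) : ℂ) • K) (φ σ))) volume t b := by
    refine IntervalIntegrable.congr_ae (f := (Y ∘L (M - (1 / 2 : ℂ) • K)) ∘ φ)
      ⟨(Y ∘L (M - (1 / 2 : ℂ) • K)).integrable_comp htb.1,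
        (Y ∘L (M - (1 / 2 : ℂ) • K)).integrable_comp htb.2⟩ ?_
    exact (ae_restrict_iff' measurableSet_uIoc).2 (h2.mono fun σ h hm => (h hm).symm)
  rw [← intervalIntegral.integral_add_adjacent_intervals i1 i2,
    ← intervalIntegral.integral_add_adjacent_intervals hat htb,
    intervalIntegral.integral_congr_ae h1, intervalIntegral.integral_congr_ae h2,
    ContinuousLinearMap.intervalIntegral_comp_comm _ hat,
    ContinuousLinearMap.intervalIntegral_comp_comm _ htb]
  simp only [ContinuousLinearMap.comp_apply, FunLike.coe_sub, FunLike.coe_add, FunLike.coe_smul,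
    Pi.sub_apply, Pi.add_apply, Pi.smul_apply, map_add, map_sub, map_smul]
  module

end Operators

end

/-! ### Maximal nonnegative boundary subspaces; Cauchy integrals with values in `C(K, F)` -/

section

section BoundaryAlgebra

variable {V : Type*} [NormedAddCommGroup V] [InnerProductSpace ℂ V]

lemma continuous_quadForm (A : V →L[ℂ] V) : Continuous (quadForm A) :=
  Complex.continuous_re.comp (continuous_id.inner A.continuous)

lemma continuousOn_quadForm {s : Set ℝ} {A : ℝ → V →L[ℂ] V} {x : ℝ → V} (hA : ContinuousOn A s)
    (hx : ContinuousOn x s) : ContinuousOn (fun t => quadForm (A t) (x t)) s :=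
  Complex.continuous_re.comp_continuousOn (hx.inner (hA.opApply hx))

variable [CompleteSpace V]

open ContinuousLinearMap (adjoint)

lemma quadForm_reOp_add (R : V →L[ℂ] V) (x y : V) :
    quadForm (reOp R) (x + y) =
      quadForm (reOp R) x + quadForm (reOp R) y + 2 * (inner ℂ x (reOp R y)).re := by
  have h : (inner ℂ y (reOp R x)).re = (inner ℂ x (reOp R y)).re := by
    rw [← inner_reOp_comm, ← inner_conj_symm, Complex.conj_re]
  simp only [quadForm, map_add, inner_add_left, inner_add_right, Complex.add_re, h]
  ring

omit [CompleteSpace V] in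
/-- A maximal nonnegative subspace is closed. -/
lemma IsMaximalNonnegSubspace.isClosed {c : ℝ} {A B : V →L[ℂ] V} {S : Submodule ℂ (V × V)}
    (hS : IsMaximalNonnegSubspace c A B S) : IsClosed (S : Set (V × V)) := by
  have h1 : IsNonnegSubspace c A B S.topologicalClosure := by
    have hc : Continuous fun w : V × V => c * (quadForm A w.1 - quadForm B w.2) :=
      (((continuous_quadForm A).comp continuous_fst).sub
        ((continuous_quadForm B).comp continuous_snd)).const_mul c
    have hcl : IsClosed {w : V × V | 0 ≤ c * (quadForm A w.1 - quadForm B w.2)} :=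
      isClosed_le continuous_const hc
    intro w hw
    exact closure_minimal (fun w hw => hS.1 w hw) hcl hw
  have h2 := hS.2 _ h1 S.le_topologicalClosure
  rw [← h2]
  exact S.isClosed_topologicalClosure

/-- An injective operator with closed range is bounded below, by the open mapping theorem. -/
lemma exists_norm_le_of_isClosed_range {M N : V →L[ℂ] V}
    (hcl : IsClosed (LinearMap.range ((M : V →ₗ[ℂ] V).prod (N : V →ₗ[ℂ] V)) : Set (V × V)))
    (hinj : ∀ h : V, h ≠ 0 → 0 < ‖M h‖ + ‖N h‖) :
    ∃ C : ℝ, 0 ≤ C ∧ ∀ h, ‖h‖ ≤ C * (‖M h‖ + ‖N h‖) := by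
  let T : V →L[ℂ] V × V := M.prod N
  have hi : Function.Injective T := by
    refine (injective_iff_map_eq_zero T).2 fun h hh => ?_
    by_contra hne
    have h1 := hinj h hne
    have h2 : M h = 0 ∧ N h = 0 := Prod.mk_eq_zero.1 hh
    rw [h2.1, h2.2] at h1
    simp at h1
  have hr : IsClosed (Set.range T) := by
    have : Set.range T = (LinearMap.range ((M : V →ₗ[ℂ] V).prod (N : V →ₗ[ℂ] V)) : Set (V × V)) := rfl
    rw [this]; exact hcl
  obtain ⟨K, hK⟩ := (T.antilipschitz_of_injective_of_isClosed_range hi hr)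
  refine ⟨K, K.2, fun h => ?_⟩
  have h1 := hK.le_mul_dist h 0
  rw [map_zero, dist_zero_right, dist_zero_right] at h1
  refine h1.trans ?_
  gcongr
  rw [Prod.norm_def]
  exact max_le (le_add_of_nonneg_right (norm_nonneg _)) (le_add_of_nonneg_left (norm_nonneg _))

/-- Invertibility of `X(a)⁻¹ 𝓜 - X(b)⁻¹ 𝓝` for a maximal nonnegative boundary pair. -/
lemma isUnit_pullBack_sub {y ε : ℝ} (hε : 0 < ε) {Ra Rb G Xa Xb Xa' Xb' M N : V →L[ℂ] V}
    (hXa : IsUnit Xa) (hXb : IsUnit Xb) (hG : IsUnit (reOp G))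
    (hGa : adjoint (Xa') * (reOp Ra * Xa) = reOp G) (hGb : adjoint (Xb') * (reOp Rb * Xb) = reOp G)
    (hE : ∀ c, ε * ‖c‖ ^ 2 ≤ y * (quadForm (reOp Rb) (Xb c) - quadForm (reOp Ra) (Xa c)))
    (hE' : ∀ c, ε * ‖c‖ ^ 2 ≤ -y * (quadForm (reOp Rb) (Xb' c) - quadForm (reOp Ra) (Xa' c)))
    (hnd : ∀ h : V, h ≠ 0 → 0 < ‖M h‖ + ‖N h‖)
    (hmax : IsMaximalNonnegSubspace y (reOp Ra) (reOp Rb)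
      (LinearMap.range ((M : V →ₗ[ℂ] V).prod (N : V →ₗ[ℂ] V)))) :
    IsUnit (pullBack Xa M - pullBack Xb N) := by
  obtain ⟨C, hC0, hC⟩ := exists_norm_le_of_isClosed_range hmax.isClosed hnd
  set A := pullBack Xa M with hA
  set B := pullBack Xb N with hB
  have hAM : ∀ h, Xa (A h) = M h := fun h => mul_inverse_apply hXa (M h)
  have hBN : ∀ h, Xb (B h) = N h := fun h => mul_inverse_apply hXb (N h)
  rw [ContinuousLinearMap.isUnit_iff_bijective,
    ContinuousLinearMap.bijective_iff_dense_range_and_antilipschitz]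
  constructor
  · rw [Submodule.topologicalClosure_eq_top_iff, Submodule.eq_bot_iff]
    intro k hk
    -- Let `k` be orthogonal to the range of `A - B`. The pair `(Xa' c, Xb' c)`, boundary values of
    -- a solution at the conjugate point, is then orthogonal to the boundary subspace in the
    -- indefinite form, by `hGa` and `hGb`, and by `hE'` its own form is at least `ε ‖c‖²`.
    set c := Ring.inverse (reOp G) k with hc
    have hGc : reOp G c = k := mul_inverse_apply hG k
    have hcross : ∀ h, inner ℂ (M h) (reOp Ra (Xa' c)) - inner ℂ (N h) (reOp Rb (Xb' c)) = 0 := by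
      intro h
      have e1 : inner ℂ (M h) (reOp Ra (Xa' c)) = inner ℂ (A h) k := by
        rw [← hAM h, ← inner_reOp_comm, ← ContinuousLinearMap.adjoint_inner_left]
        have := congrArg (fun T : V →L[ℂ] V => T (A h)) hGa
        simp only [mul_apply_eq_comp] at this
        rw [this, inner_reOp_comm, hGc]
      have e2 : inner ℂ (N h) (reOp Rb (Xb' c)) = inner ℂ (B h) k := by
        rw [← hBN h, ← inner_reOp_comm, ← ContinuousLinearMap.adjoint_inner_left]
        have := congrArg (fun T : V →L[ℂ] V => T (B h)) hGb
        simp only [mul_apply_eq_comp] at this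
        rw [this, inner_reOp_comm, hGc]
      rw [e1, e2, ← inner_sub_left]
      exact (Submodule.mem_orthogonal _ _).1 hk _ ⟨h, rfl⟩
    have hform : ε * ‖c‖ ^ 2 ≤ y * (quadForm (reOp Ra) (Xa' c) - quadForm (reOp Rb) (Xb' c)) := by
      linarith [hE' c]
    have hmem : ((Xa' c, Xb' c) : V × V) ∈
        LinearMap.range ((M : V →ₗ[ℂ] V).prod (N : V →ₗ[ℂ] V)) := by
      -- Adjoining a nonnegative vector that is orthogonal to the subspace keeps the form
      -- nonnegative, so by maximality the vector was already inside. It is thus orthogonal to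
      -- itself, and its form vanishes.
      have hnn : IsNonnegSubspace y (reOp Ra) (reOp Rb)
          (LinearMap.range ((M : V →ₗ[ℂ] V).prod (N : V →ₗ[ℂ] V)) ⊔
            Submodule.span ℂ {((Xa' c, Xb' c) : V × V)}) := by
        intro w hw
        obtain ⟨u, hu, v, hv, rfl⟩ := Submodule.mem_sup.1 hw
        obtain ⟨α, rfl⟩ := Submodule.mem_span_singleton.1 hv
        obtain ⟨h, rfl⟩ := hu
        have h1 : 0 ≤ y * (quadForm (reOp Ra) (M h) - quadForm (reOp Rb) (N h)) :=
          hmax.1 _ ⟨h, rfl⟩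
        have h2 : ∀ h, (inner ℂ (M h) (reOp Ra (α • Xa' c))).re -
            (inner ℂ (N h) (reOp Rb (α • Xb' c))).re = 0 := fun h => by
          rw [map_smul, map_smul, inner_smul_right, inner_smul_right, ← Complex.sub_re, ← mul_sub,
            hcross, mul_zero, Complex.zero_re]
        change 0 ≤ y * (quadForm (reOp Ra) (M h + α • Xa' c) -
          quadForm (reOp Rb) (N h + α • Xb' c))
        rw [quadForm_reOp_add, quadForm_reOp_add, quadForm_smul, quadForm_smul]
        have h3 : 0 ≤ ‖α‖ ^ 2 * (y * (quadForm (reOp Ra) (Xa' c) - quadForm (reOp Rb) (Xb' c))) :=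
          mul_nonneg (by positivity) (le_trans (by positivity) hform)
        have h4 := h2 h
        have h5 : (inner ℂ (M h) (reOp Ra (α • Xa' c))).re =
          (inner ℂ (N h) (reOp Rb (α • Xb' c))).re := by linarith
        rw [h5]
        linarith
      have h1 := hmax.2 _ hnn le_sup_left
      rw [← h1]
      exact Submodule.mem_sup_right (Submodule.mem_span_singleton_self _)
    obtain ⟨h, hh⟩ := hmem
    have hh' : M h = Xa' c ∧ N h = Xb' c := Prod.mk.inj hh
    have h1 := hcross h
    have h2 : quadForm (reOp Ra) (Xa' c) - quadForm (reOp Rb) (Xb' c) = 0 := by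
      rw [hh'.1, hh'.2] at h1
      rw [quadForm, quadForm, ← Complex.sub_re, h1, Complex.zero_re]
    rw [h2, mul_zero] at hform
    have h3 : ‖c‖ ^ 2 ≤ 0 := by
      by_contra hlt
      push Not at hlt
      exact absurd (mul_pos hε hlt) (not_lt.2 hform)
    have h4 : c = 0 := by
      have : ‖c‖ ^ 2 = 0 := le_antisymm h3 (by positivity)
      simpa using this
    rw [← hGc, h4, map_zero]
  · -- the lower bound
    set Gb := adjoint Xb * (reOp Rb * Xb) with hGbdef
    have hqb : ∀ c, quadForm (reOp Rb) (Xb c) = (inner ℂ c (Gb c)).re := fun c => by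
      rw [hGbdef, mul_apply_eq_comp, mul_apply_eq_comp, ContinuousLinearMap.adjoint_inner_right]
      rfl
    -- With `c = A h` and `k = A h - B h` one has `M h = Xa c` and `N h = Xb (c - k)`. Nonnegativity
    -- of the pair plus coercivity leaves `ε‖c‖² ≤ y (2 ℜ(Gb c, k) - (Gb k, k))`, which is at most
    -- `3|y| ‖Gb‖ ‖k‖ ‖c‖` when `‖k‖ < ‖c‖`. The summand `1` covers the case `‖c‖ ≤ ‖k‖`.
    set D := 1 + 3 * |y| * ‖Gb‖ / ε with hD
    have hD0 : 0 ≤ D := by positivity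
    have hbound : ∀ h, ‖A h‖ ≤ D * ‖A h - B h‖ := by
      intro h
      set c := A h
      set k := A h - B h with hk
      rcases le_or_gt ‖c‖ ‖k‖ with hle | hlt
      · have : ‖k‖ ≤ D * ‖k‖ := by
          rw [hD]
          have : 0 ≤ 3 * |y| * ‖Gb‖ / ε * ‖k‖ := by positivity
          linarith
        exact hle.trans this
      · have hcpos : 0 < ‖c‖ := lt_of_le_of_lt (norm_nonneg _) hlt
        have h1 : 0 ≤ y * (quadForm (reOp Ra) (M h) - quadForm (reOp Rb) (N h)) :=
          hmax.1 _ ⟨h, rfl⟩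
        have hNh : N h = Xb (c - k) := by rw [← hBN h, hk]; congr 1; abel
        rw [← hAM h, hNh] at h1
        have h2 := hE c
        have e1 : quadForm (reOp Rb) (Xb (c - k)) = quadForm (reOp Rb) (Xb c) +
            quadForm (reOp Rb) (Xb k) - 2 * (inner ℂ k (Gb c)).re := by
          have e2 : Xb (c - k) = -Xb k + Xb c := by rw [map_sub]; abel
          have e3 : quadForm (reOp Rb) (-Xb k) = quadForm (reOp Rb) (Xb k) := by simp [quadForm]
          have e4 : inner ℂ k (Gb c) = inner ℂ (Xb k) (reOp Rb (Xb c)) := by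
            rw [hGbdef, mul_apply_eq_comp, mul_apply_eq_comp,
              ContinuousLinearMap.adjoint_inner_right]
          rw [e2, quadForm_reOp_add, e3, e4, inner_neg_left, Complex.neg_re]
          ring
        rw [e1] at h1
        have h3 : |(inner ℂ k (Gb c)).re| ≤ ‖Gb‖ * ‖k‖ * ‖c‖ := by
          refine (Complex.abs_re_le_norm _).trans ((norm_inner_le_norm _ _).trans ?_)
          have := Gb.le_opNorm c
          nlinarith [norm_nonneg k]
        have h4 : |quadForm (reOp Rb) (Xb k)| ≤ ‖Gb‖ * ‖k‖ * ‖c‖ := by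
          rw [hqb]
          refine (Complex.abs_re_le_norm _).trans ((norm_inner_le_norm _ _).trans ?_)
          have h5 := Gb.le_opNorm k
          calc ‖k‖ * ‖Gb k‖ ≤ ‖k‖ * (‖Gb‖ * ‖k‖) := by gcongr
            _ ≤ ‖k‖ * (‖Gb‖ * ‖c‖) := by gcongr
            _ = _ := by ring
        have h5 : ε * ‖c‖ ^ 2 ≤ y * (2 * (inner ℂ k (Gb c)).re - quadForm (reOp Rb) (Xb k)) := by
          linarith
        have h6 : y * (2 * (inner ℂ k (Gb c)).re - quadForm (reOp Rb) (Xb k)) ≤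
            |y| * (3 * (‖Gb‖ * ‖k‖ * ‖c‖)) := by
          refine (le_abs_self _).trans ?_
          rw [abs_mul]
          gcongr
          refine (abs_sub _ _).trans ?_
          rw [abs_mul, abs_of_pos (two_pos : (0 : ℝ) < 2)]
          linarith
        have h7 : (ε * ‖c‖) * ‖c‖ ≤ (3 * |y| * ‖Gb‖ * ‖k‖) * ‖c‖ := by
          calc (ε * ‖c‖) * ‖c‖ = ε * ‖c‖ ^ 2 := by ring
            _ ≤ _ := h5.trans h6
            _ = _ := by ring
        have h8 := le_of_mul_le_mul_right h7 hcpos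
        have h9 : ‖c‖ ≤ 3 * |y| * ‖Gb‖ / ε * ‖k‖ := by
          rw [div_mul_eq_mul_div, le_div_iff₀ hε]
          linarith
        rw [hD]
        linarith [norm_nonneg k]
    have hfin : ∀ h, ‖h‖ ≤ C * (‖Xa‖ * D + ‖Xb‖ * (D + 1)) * ‖(A - B) h‖ := by
      intro h
      have h1 := hbound h
      have h2 : ‖B h‖ ≤ (D + 1) * ‖A h - B h‖ := by
        have : ‖B h‖ ≤ ‖A h‖ + ‖A h - B h‖ := by
          have e : B h = A h - (A h - B h) := by abel
          nth_rw 1 [e]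
          exact norm_sub_le _ _
        linarith
      have h3 : ‖M h‖ ≤ ‖Xa‖ * (D * ‖A h - B h‖) := by
        rw [← hAM h]
        exact (Xa.le_opNorm _).trans (by gcongr)
      have h4 : ‖N h‖ ≤ ‖Xb‖ * ((D + 1) * ‖A h - B h‖) := by
        rw [← hBN h]
        exact (Xb.le_opNorm _).trans (by gcongr)
      calc ‖h‖ ≤ C * (‖M h‖ + ‖N h‖) := hC h
        _ ≤ C * (‖Xa‖ * (D * ‖A h - B h‖) + ‖Xb‖ * ((D + 1) * ‖A h - B h‖)) := by gcongr
        _ = _ := by rw [FunLike.coe_sub, Pi.sub_apply]; ring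
    have hpos : 0 ≤ C * (‖Xa‖ * D + ‖Xb‖ * (D + 1)) := by positivity
    exact ⟨⟨_, hpos⟩, (A - B).antilipschitz_of_bound hfin⟩

omit [CompleteSpace V] in
/-- Maximality of a nonnegative boundary subspace with `X(a)⁻¹ 𝓜 - X(b)⁻¹ 𝓝` invertible. -/
lemma isMaximalNonnegSubspace_of_isUnit {y ε : ℝ} (hε : 0 < ε) {Ra Rb Xa Xb M N : V →L[ℂ] V}
    (hXa : IsUnit Xa) (hXb : IsUnit Xb)
    (hE : ∀ c, ε * ‖c‖ ^ 2 ≤ y * (quadForm Rb (Xb c) - quadForm Ra (Xa c)))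
    (hU : IsUnit (pullBack Xa M - pullBack Xb N))
    (hnn : ∀ h, 0 ≤ y * (quadForm Ra (M h) - quadForm Rb (N h))) :
    IsMaximalNonnegSubspace y Ra Rb
      (LinearMap.range ((M : V →ₗ[ℂ] V).prod (N : V →ₗ[ℂ] V))) := by
  constructor
  · rintro w ⟨h, rfl⟩
    exact hnn h
  · intro S' hS' hle
    refine le_antisymm ?_ hle
    rintro ⟨u, v⟩ huv
    -- The vector `k` is chosen so that `(u, v) - (M k, N k)` consists of the two boundary values
    -- `(Xa c, Xb c)` of one homogeneous solution. On such pairs the form is at most `-ε‖c‖²`, hence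
    -- nonnegativity forces `c = 0`.
    set k := Ring.inverse (pullBack Xa M - pullBack Xb N) (Ring.inverse Xa u - Ring.inverse Xb v)
      with hk
    have hk' : Ring.inverse Xa (M k) - Ring.inverse Xb (N k) =
        Ring.inverse Xa u - Ring.inverse Xb v := mul_inverse_apply hU _
    have hmem : ((M k, N k) : V × V) ∈ LinearMap.range ((M : V →ₗ[ℂ] V).prod (N : V →ₗ[ℂ] V)) :=
      ⟨k, rfl⟩
    have hd := S'.sub_mem huv (hle hmem)
    set c := Ring.inverse Xa (u - M k) with hc
    have hca : Xa c = u - M k := mul_inverse_apply hXa _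
    have hcb : Xb c = v - N k := by
      have : c = Ring.inverse Xb (v - N k) := by
        rw [hc, map_sub, map_sub, sub_eq_sub_iff_sub_eq_sub, hk']
      rw [this]
      exact mul_inverse_apply hXb _
    have h1 := hS' _ hd
    simp only [Prod.fst_sub, Prod.snd_sub] at h1
    rw [← hca, ← hcb] at h1
    have h2 := hE c
    have h3 : ε * ‖c‖ ^ 2 ≤ 0 := by linarith
    have h4 : c = 0 := by
      by_contra hne
      have : 0 < ‖c‖ := norm_pos_iff.2 hne
      have : 0 < ε * ‖c‖ ^ 2 := by positivity
      linarith
    rw [h4, map_zero] at hca hcb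
    rw [sub_eq_zero.1 hca.symm, sub_eq_zero.1 hcb.symm]
    exact hmem

end BoundaryAlgebra

section AnalyticFamilies

/-- Continuity in the supremum norm makes the Cauchy integral converge in `C(K, F)` and define a
power series there. Evaluating it at a point `k` gives the ordinary Cauchy formula, so the power
series represents `f`. -/
lemma analyticOnNhd_of_eval {K F : Type*} [TopologicalSpace K] [CompactSpace K]
    [NormedAddCommGroup F] [NormedSpace ℂ F] [CompleteSpace F] {f : ℂ → C(K, F)} {S : Set ℂ}
    (hS : IsOpen S) (hc : ContinuousOn f S) (hd : ∀ k, DifferentiableOn ℂ (fun z => f z k) S) :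
    AnalyticOnNhd ℂ f S := by
  intro z hz
  obtain ⟨R, hR, hball⟩ := Metric.nhds_basis_closedBall.mem_iff.1 (hS.mem_nhds hz)
  have hci : CircleIntegrable f z R := by
    refine ContinuousOn.circleIntegrable hR.le (hc.mono ?_)
    exact Metric.sphere_subset_closedBall.trans hball
  have h1 := hasFPowerSeriesOn_cauchy_integral (R := ⟨R, hR.le⟩) hci hR
  refine h1.analyticAt.congr ?_
  filter_upwards [Metric.ball_mem_nhds z hR] with w hw
  ext k
  have hint : CircleIntegrable (fun ζ => (ζ - w)⁻¹ • f ζ) z R := by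
    refine ContinuousOn.circleIntegrable hR.le ?_
    refine ContinuousOn.smul
      (ContinuousOn.inv₀ (continuousOn_id.sub (continuousOn_const (c := w))) ?_) (hc.mono ?_)
    · intro ζ hζ h
      rw [Pi.sub_apply, id, sub_eq_zero] at h
      rw [h] at hζ
      simp only [Metric.mem_sphere, Metric.mem_ball] at hζ hw
      linarith
    · exact Metric.sphere_subset_closedBall.trans hball
  have e1 : (∮ ζ in C(z, R), (ζ - w)⁻¹ • f ζ) k = ∮ ζ in C(z, R), (ζ - w)⁻¹ • f ζ k := by
    have := (ContinuousMap.evalCLM ℂ k).intervalIntegral_comp_comm hint.out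
    exact this.symm
  have e2 := DiffContOnCl.two_pi_i_inv_smul_circleIntegral_sub_inv_smul
    (((hd k).mono (by rwa [closure_ball z hR.ne'])).diffContOnCl) hw
  change ((2 * Real.pi * Complex.I : ℂ)⁻¹ • ∮ ζ in C(z, R), (ζ - w)⁻¹ • f ζ) k = f w k
  rw [ContinuousMap.smul_apply, e1]
  exact e2

end AnalyticFamilies

end

/-! ### Nevanlinna families of systems and analyticity of the transfer operator -/

section

variable {V : Type*} [NormedAddCommGroup V] [InnerProductSpace ℂ V] [CompleteSpace V]

open ContinuousLinearMap (adjoint)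

/-- A symmetric Nevanlinna family of regular first order systems on `[a, b]` whose leading coefficient
does not depend on the spectral parameter. -/
structure IsNevanlinnaSystem (a b : ℝ) (Q H : ℂ → ℝ → V →L[ℂ] V) : Prop where
  regular : ∀ z : ℂ, z.im ≠ 0 → IsRegularSystem a b (Q z) (H z)
  eqOn : ∀ z w : ℂ, z.im ≠ 0 → w.im ≠ 0 → EqOn (Q z) (Q w) (Icc a b)
  symm : ∀ z : ℂ, z.im ≠ 0 → ∀ t ∈ Icc a b, H (conj z) t = adjoint (H z t)
  analytic : ∀ t ∈ Icc a b, DifferentiableOn ℂ (fun z => H z t) {z | z.im ≠ 0}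
  nonneg : ∀ z : ℂ, z.im ≠ 0 → ∀ t ∈ Icc a b, ∀ x, 0 ≤ quadForm (nevWeight H z t) x

lemma analyticAt_smul_mul_sub {𝔹 : Type*} [NormedRing 𝔹] [NormedAlgebra ℂ 𝔹] {f : ℂ → 𝔹} {z : ℂ}
    (hf : AnalyticAt ℂ f z) (c : ℂ) (C₁ C₂ : 𝔹) :
    AnalyticAt ℂ (fun w => c • (C₁ * (f w - C₂))) z :=
  ((c • ContinuousLinearMap.mul ℂ 𝔹 C₁).analyticAt _).comp (hf.sub analyticAt_const)

lemma isOpen_nonreal : IsOpen {z : ℂ | z.im ≠ 0} :=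
  isOpen_ne_fun Complex.continuous_im continuous_const

lemma conj_im_ne_zero {z : ℂ} (hz : z.im ≠ 0) : (conj z).im ≠ 0 := by simpa using hz

lemma exists_norm_le_of_continuousOn {F : Type*} [NormedAddCommGroup F] {a b : ℝ} {f : ℝ → F}
    (hf : ContinuousOn f (Icc a b)) : ∃ C : ℝ, 0 ≤ C ∧ ∀ t ∈ Icc a b, ‖f t‖ ≤ C := by
  obtain ⟨C, hC⟩ := isCompact_Icc.exists_bound_of_continuousOn hf
  exact ⟨max C 0, le_max_right _ _, fun t ht => (hC t ht).trans (le_max_left _ _)⟩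

lemma continuousOn_nevWeight {s : Set ℝ} {H : ℂ → ℝ → V →L[ℂ] V} {z : ℂ} (hH : ContinuousOn (H z) s) :
    ContinuousOn (nevWeight H z) s := by
  have h : ContinuousOn (fun t => adjoint (H z t)) s :=
    (ContinuousLinearMap.adjoint (𝕜 := ℂ) (E := V) (F := V)).continuous.comp_continuousOn hH
  exact ((hH.sub h).const_smul (1 / (2 * Complex.I))).const_smul ((1 / z.im : ℝ) : ℂ)

/-- Needed because `operatorSolution` is merely some chosen solution; properties of the Volterra
solution reach it through uniqueness. -/
lemma IsRegularSystem.operatorSolution_unique {a b : ℝ} {Q H H' : ℝ → V →L[ℂ] V}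
    {X Y X' : ℝ → V →L[ℂ] V} (hS : IsRegularSystem a b Q H) (hS' : IsRegularSystem a b Q H')
    (hab : a < b) (h0 : (0 : ℝ) ∈ Icc a b) (hH : ∀ t ∈ Icc a b, H' t = adjoint (H t))
    (hX : IsOperatorSolution a b Q H X) (hX' : IsOperatorSolution a b Q H' X')
    (hY : IsOperatorSolution a b Q H Y) {t : ℝ} (ht : t ∈ Icc a b) : X t = Y t := by
  ext v
  have h := hS.solution_unique hS' hab h0 hH hX hX' (hS.isSystemSolution_apply hab hX v)
    (hS.isSystemSolution_apply hab hY v) ht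
  simp only [hX.2.1, hY.2.1, sub_self, map_zero] at h
  exact sub_eq_zero.1 h

namespace IsNevanlinnaSystem

variable {a b : ℝ} {Q H : ℂ → ℝ → V →L[ℂ] V} (hN : IsNevanlinnaSystem a b Q H)
include hN

lemma isNevanlinna {t : ℝ} (ht : t ∈ Icc a b) (x : V) :
    IsNevanlinna fun z => inner ℂ x (H z t x) where
  differentiableOn := by
    have h := (innerSL ℂ x).differentiable.comp_differentiableOn
      ((ContinuousLinearMap.apply ℂ V x).differentiable.comp_differentiableOn (hN.analytic t ht))
    exact h
  symm z hz := by
    rw [hN.symm z hz t ht, ContinuousLinearMap.adjoint_inner_right, inner_conj_symm]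
  nonneg z hz := by
    rw [← quadForm_nevWeight]
    exact hN.nonneg z hz t ht x

lemma nevWeight_conj {z : ℂ} (hz : z.im ≠ 0) {t : ℝ} (ht : t ∈ Icc a b) :
    nevWeight H (conj z) t = nevWeight H z t := by
  rw [nevWeight, nevWeight, imOp, imOp, hN.symm z hz t ht, ContinuousLinearMap.adjoint_adjoint]
  have : ((1 / (conj z).im : ℝ) : ℂ) = -((1 / z.im : ℝ) : ℂ) := by
    rw [Complex.conj_im]; push_cast; ring
  rw [this]
  module

/-- Holomorphy is assumed separately for each `t`; uniformity in `t` comes from the Nevanlinna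
property. The scalar estimate bounds the form of `H_w - H_z` by the weight at `z`, whose norm is
bounded on `[a, b]`, and polarization turns this into an operator norm bound. -/
lemma lipschitz {z : ℂ} (hz : z.im ≠ 0) : ∃ C : ℝ, 0 ≤ C ∧ ∀ w : ℂ, ‖w - z‖ < |z.im| / 2 →
    w.im ≠ 0 ∧ ∀ t ∈ Icc a b, ‖H w t - H z t‖ ≤ C * ‖w - z‖ := by
  obtain ⟨C, hC0, hC⟩ := exists_norm_le_of_continuousOn
    (continuousOn_nevWeight (hN.regular z hz).continuousOn)
  -- For `‖w - z‖ < |ℑz|/2` one has `|ℑz|/2 ≤ |ℑw| ≤ 3|ℑz|/2`. The bracket in the scalar estimate is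
  -- then at most `3|ℑz|`; dividing by `|ℑz|/2` gives `6`, and polarization doubles it.
  refine ⟨12 * C, by positivity, fun w hw => ?_⟩
  have hzi : 0 < |z.im| := abs_pos.2 hz
  have h1 : |w.im - z.im| ≤ ‖w - z‖ := by
    rw [← Complex.sub_im]; exact Complex.abs_im_le_norm _
  have h2 : |z.im| / 2 ≤ |w.im| := by
    have := abs_sub_abs_le_abs_sub z.im w.im
    rw [abs_sub_comm] at this
    linarith
  have h3 : |w.im| ≤ 3 / 2 * |z.im| := by
    have := abs_sub_abs_le_abs_sub w.im z.im
    linarith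
  have hwi : w.im ≠ 0 := abs_pos.1 (by linarith)
  refine ⟨hwi, fun t ht => ?_⟩
  have hK : ∀ x, ‖inner ℂ x ((H w t - H z t) x)‖ ≤
      6 * ‖w - z‖ * quadForm (nevWeight H z t) x := by
    intro x
    have h4 := (hN.isNevanlinna ht x).norm_sub_mul_im_le hwi hz
    rw [← quadForm_nevWeight, ← inner_sub_right] at h4
    have h5 := hN.nonneg z hz t ht x
    rw [FunLike.coe_sub, Pi.sub_apply]
    have hn := norm_nonneg (inner ℂ x (H w t x - H z t x))
    have h6 : ‖inner ℂ x (H w t x - H z t x)‖ * (|z.im| / 2) ≤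
        ‖w - z‖ * (3 * |z.im|) * quadForm (nevWeight H z t) x := by
      calc ‖inner ℂ x (H w t x - H z t x)‖ * (|z.im| / 2)
          ≤ ‖inner ℂ x (H w t x - H z t x)‖ * |w.im| := by gcongr
        _ ≤ _ := h4
        _ ≤ _ := by gcongr; linarith
    have h7 : ‖inner ℂ x (H w t x - H z t x)‖ * (|z.im| / 2) ≤
        (6 * ‖w - z‖ * quadForm (nevWeight H z t) x) * (|z.im| / 2) := by linarith
    exact le_of_mul_le_mul_right h7 (by positivity)
  have h8 := norm_le_of_quadForm_bound (by positivity) hK (hN.nonneg z hz t ht)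
  calc ‖H w t - H z t‖ ≤ 2 * (6 * ‖w - z‖) * ‖nevWeight H z t‖ := h8
    _ ≤ 2 * (6 * ‖w - z‖) * C := by gcongr; exact hC t ht
    _ = _ := by ring

lemma analyticOnNhd_restrictMap :
    AnalyticOnNhd ℂ (fun z => restrictMap a b (H z)) {z | z.im ≠ 0} := by
  refine analyticOnNhd_of_eval isOpen_nonreal ?_ fun k => ?_
  · intro z hz
    refine ContinuousAt.continuousWithinAt ?_
    obtain ⟨C, hC0, hC⟩ := hN.lipschitz hz
    rw [ContinuousAt, tendsto_iff_norm_sub_tendsto_zero]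
    have hlim : Filter.Tendsto (fun w : ℂ => C * ‖w - z‖) (nhds z) (nhds 0) := by
      have : Continuous fun w : ℂ => C * ‖w - z‖ := by fun_prop
      simpa using this.tendsto z
    refine squeeze_zero' (Filter.Eventually.of_forall fun w => norm_nonneg _) ?_ hlim
    have hzi : 0 < |z.im| / 2 := by have := abs_pos.2 hz; positivity
    filter_upwards [Metric.ball_mem_nhds z hzi] with w hw
    rw [Metric.mem_ball, dist_eq_norm] at hw
    obtain ⟨hwi, h⟩ := hC w hw
    rw [ContinuousMap.norm_le _ (by positivity)]
    intro t
    rw [ContinuousMap.sub_apply, restrictMap_apply (hN.regular w hwi).continuousOn,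
      restrictMap_apply (hN.regular z hz).continuousOn]
    exact h t t.2
  · refine (hN.analytic k k.2).congr fun z hz => ?_
    exact restrictMap_apply (hN.regular z hz).continuousOn k

/-- The identities relating two solutions are stated for one common `Q`. Since `Q` does not depend
on the parameter, the system at `z̄` may be read with the coefficient `Q z`. -/
lemma regular_conj {z : ℂ} (hz : z.im ≠ 0) : IsRegularSystem a b (Q z) (H (conj z)) :=
  (hN.regular _ (conj_im_ne_zero hz)).congr (hN.eqOn _ _ hz (conj_im_ne_zero hz))

variable (hab : a < b) (h0 : (0 : ℝ) ∈ Icc a b)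

include hab h0 in
lemma isOperatorSolution {z : ℂ} (hz : z.im ≠ 0) :
    IsOperatorSolution a b (Q z) (H z) (operatorSolution a b (Q z) (H z)) :=
  (hN.regular z hz).isOperatorSolution hab h0

lemma isOperatorSolution_congr {z w : ℂ} (hz : z.im ≠ 0) (hw : w.im ≠ 0) {K : ℝ → V →L[ℂ] V}
    {X : ℝ → V →L[ℂ] V} (hX : IsOperatorSolution a b (Q w) K X) :
    IsOperatorSolution a b (Q z) K X := by
  have he := hN.eqOn z w hz hw
  refine ⟨hX.1, hX.2.1, fun t ht => ?_⟩
  rw [← hX.2.2 t ht, he ht]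
  have : derivWithin (fun τ => Q z τ ∘L X τ) (Icc a b) t =
      derivWithin (fun τ => Q w τ ∘L X τ) (Icc a b) t :=
    derivWithin_congr (fun τ hτ => by rw [he hτ]) (by rw [he ht])
  rw [this]

include hab h0

lemma isOperatorSolution_conj {z : ℂ} (hz : z.im ≠ 0) :
    IsOperatorSolution a b (Q z) (H (conj z))
      (operatorSolution a b (Q (conj z)) (H (conj z))) :=
  hN.isOperatorSolution_congr hz (conj_im_ne_zero hz)
    (hN.isOperatorSolution hab h0 (conj_im_ne_zero hz))

lemma isUnit_solution {z : ℂ} (hz : z.im ≠ 0) {t : ℝ} (ht : t ∈ Icc a b) :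
    IsUnit (operatorSolution a b (Q z) (H z) t) :=
  (hN.regular z hz).isUnit_solution (hN.regular_conj hz) hab h0 (hN.symm z hz)
    (hN.isOperatorSolution hab h0 hz) (hN.isOperatorSolution_conj hab h0 hz) ht

lemma adjoint_mul_reOp_mul {z : ℂ} (hz : z.im ≠ 0) {t : ℝ} (ht : t ∈ Icc a b) :
    adjoint (operatorSolution a b (Q (conj z)) (H (conj z)) t) *
      (reOp (Q z t) * operatorSolution a b (Q z) (H z) t) = reOp (Q z 0) :=
  (hN.regular z hz).adjoint_mul_reOp_mul (hN.regular_conj hz) hab h0 (hN.symm z hz)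
    (hN.isOperatorSolution hab h0 hz) (hN.isOperatorSolution_conj hab h0 hz) ht

/-- The operator solution at a point of `[a, b]` is analytic in the spectral parameter. -/
lemma analyticOnNhd_operatorSolution {t : ℝ} (ht : t ∈ Icc a b) :
    AnalyticOnNhd ℂ (fun z => operatorSolution a b (Q z) (H z) t) {z | z.im ≠ 0} := by
  -- The leading coefficient and its derivative are frozen at the arbitrary nonreal point `i`, so
  -- that only `H z` varies and the explicit coefficient is affine in it.
  set Q₀ := Q Complex.I with hQ₀
  have hI : (Complex.I).im ≠ 0 := by simp
  set C₁ := restrictMap a b (fun t => Ring.inverse (reOp (Q₀ t))) with hC₁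
  set C₂ := restrictMap a b (fun t => (Complex.I / 2) • derivWithin Q₀ (Icc a b) t) with hC₂
  have hreg := hN.regular Complex.I hI
  have hc₁ := continuousOn_inverse (continuousOn_reOp hreg.contDiffOn.continuousOn) hreg.isUnit
  have hc₂ : ContinuousOn (fun t => (Complex.I / 2) • derivWithin Q₀ (Icc a b) t) (Icc a b) :=
    (hreg.contDiffOn.continuousOn_derivWithin (uniqueDiffOn_Icc hab) le_rfl).const_smul
      (Complex.I / 2)
  have hA : AnalyticOnNhd ℂ (fun z => (-Complex.I) • (C₁ * (restrictMap a b (H z) - C₂)))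
      {z | z.im ≠ 0} := fun z hz =>
    analyticAt_smul_mul_sub (hN.analyticOnNhd_restrictMap z hz) _ _ _
  have hX := LinearODE.analyticOnNhd_fundamental hab.le h0 hA ht
  refine hX.congr isOpen_nonreal fun z hz => ?_
  have heq : restrictMap a b (sysCoeff a b (Q z) (H z)) =
      (-Complex.I) • (C₁ * (restrictMap a b (H z) - C₂)) := by
    ext1 τ
    rw [restrictMap_apply ((hN.regular z hz).continuousOn_sysCoeff hab), ContinuousMap.smul_apply,
      ContinuousMap.mul_apply, ContinuousMap.sub_apply, restrictMap_apply hc₁,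
      restrictMap_apply hc₂, restrictMap_apply (hN.regular z hz).continuousOn, sysCoeff,
      hN.eqOn z Complex.I hz hI τ.2, derivWithin_congr (hN.eqOn z Complex.I hz hI)
      (hN.eqOn z Complex.I hz hI τ.2)]
  have h1 := (hN.regular z hz).operatorSolution_unique (hN.regular_conj hz) hab h0 (hN.symm z hz)
    ((hN.regular z hz).isOperatorSolution_sysFundamental hab h0)
    (hN.isOperatorSolution_conj hab h0 hz) (hN.isOperatorSolution hab h0 hz) ht
  rw [sysFundamental, heq] at h1
  exact h1

lemma energy {z : ℂ} (hz : z.im ≠ 0) (v : V) :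
    quadForm (reOp (Q z b)) (operatorSolution a b (Q z) (H z) b v) -
        quadForm (reOp (Q z a)) (operatorSolution a b (Q z) (H z) a v) =
      2 * z.im * ∫ t in a..b, quadForm (nevWeight H z t) (operatorSolution a b (Q z) (H z) t v) := by
  rw [(hN.regular z hz).quadForm_sub_quadForm hab (hN.isOperatorSolution hab h0 hz), mul_assoc]
  congr 1
  rw [← intervalIntegral.integral_const_mul]
  refine intervalIntegral.integral_congr fun t _ => ?_
  simp only [quadForm_nevWeight]
  field_simp

end IsNevanlinnaSystem

end

/-! ### Characteristic operators and boundary pairs of a definite system -/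

section

variable {V : Type*} [NormedAddCommGroup V] [InnerProductSpace ℂ V] [CompleteSpace V]

open ContinuousLinearMap (adjoint)

/-- A Nevanlinna system whose weight is definite on the solutions of the homogeneous equation. -/
structure IsDefiniteNevanlinnaSystem (a b : ℝ) (Q H : ℂ → ℝ → V →L[ℂ] V) : Prop
    extends IsNevanlinnaSystem a b Q H where
  definite : ∀ z : ℂ, z.im ≠ 0 → ∃ δ : ℝ, 0 < δ ∧ ∀ v : V, δ * ‖v‖ ^ 2 ≤
    ∫ t in a..b, quadForm (nevWeight H z t) (operatorSolution a b (Q z) (H z) t v)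

omit [CompleteSpace V] in
lemma isUnit_I_smul {G : V →L[ℂ] V} (hG : IsUnit G) : IsUnit (Complex.I • G) ∧
    Ring.inverse (Complex.I • G) = (-Complex.I) • Ring.inverse G := by
  obtain ⟨g, rfl⟩ := hG
  let u : (V →L[ℂ] V)ˣ :=
    ⟨Complex.I • g, (-Complex.I) • ↑g⁻¹, by simp [smul_smul], by simp [smul_smul]⟩
  have e : Complex.I • (g : V →L[ℂ] V) = (u : V →L[ℂ] V) := rfl
  rw [e, Ring.inverse_unit, Ring.inverse_unit]
  exact ⟨u.isUnit, rfl⟩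

lemma inner_nevWeight (H : ℂ → ℝ → V →L[ℂ] V) (z : ℂ) (t : ℝ) (x : V) :
    inner ℂ x (nevWeight H z t x) = (quadForm (nevWeight H z t) x : ℂ) := by
  have h : inner ℂ x (adjoint (H z t) x) = conj (inner ℂ x (H z t x)) := by
    rw [ContinuousLinearMap.adjoint_inner_right, inner_conj_symm]
  rw [quadForm_nevWeight]
  simp only [nevWeight, imOp, FunLike.coe_smul, FunLike.coe_sub, Pi.smul_apply, Pi.sub_apply,
    inner_smul_right, inner_sub_right, h, Complex.sub_conj]
  have := Complex.I_ne_zero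
  push_cast
  field_simp

/-- A nonnegative weight bounds itself in the polarization estimate. This controls `W F` when only
the integral of the form `(W F, F)` is known to be finite. -/
lemma norm_nevWeight_sq_le {H : ℂ → ℝ → V →L[ℂ] V} {z : ℂ} {t : ℝ}
    (h : ∀ x, 0 ≤ quadForm (nevWeight H z t) x) (x : V) :
    ‖nevWeight H z t x‖ ^ 2 ≤ 4 * ‖nevWeight H z t‖ * quadForm (nevWeight H z t) x := by
  have := norm_sq_le_of_quadForm_bound (D := nevWeight H z t) (W := nevWeight H z t) zero_le_one
    (fun x => by
      rw [inner_nevWeight, Complex.norm_real, Real.norm_eq_abs, abs_of_nonneg (h x), one_mul]) h x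
  simpa using this

/-- The matrix of the resolvent kernel is symmetric exactly because of the boundary symmetry. -/
lemma boundary_symm {A B A' B' G : V →L[ℂ] V} (hG : IsUnit (reOp G))
    (hU : IsUnit (A - B)) (hU' : IsUnit (A' - B'))
    (h : adjoint A' * (reOp G * A) = adjoint B' * (reOp G * B)) :
    (-(1 / 2) : ℂ) • ((A + B) ∘L Ring.inverse (A - B) ∘L Ring.inverse (Complex.I • reOp G)) =
      adjoint ((-(1 / 2) : ℂ) • ((A' + B') ∘L Ring.inverse (A' - B') ∘L
        Ring.inverse (Complex.I • reOp G))) := by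
  set P := Ring.inverse (A - B) with hP
  set P' := Ring.inverse (A' - B') with hP'
  set G₀ := reOp G with hG₀
  set Gi := Ring.inverse G₀ with hGi
  have h1 : P * (A - B) = 1 := Ring.inverse_mul_cancel _ hU
  have h1' : (A - B) * P = 1 := Ring.mul_inverse_cancel _ hU
  have h2 : (A' - B') * P' = 1 := Ring.mul_inverse_cancel _ hU'
  have h3 : Gi * G₀ = 1 := Ring.inverse_mul_cancel _ hG
  have h4 : G₀ * Gi = 1 := Ring.mul_inverse_cancel _ hG
  have hsG : star G₀ = G₀ := adjoint_reOp G
  have hsGi : star Gi = Gi := by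
    have : star Gi * G₀ = 1 := by rw [← hsG, ← star_mul, h4, star_one]
    calc star Gi = star Gi * (G₀ * Gi) := by rw [h4, mul_one]
      _ = Gi := by rw [← mul_assoc, this, one_mul]
  have h5 : star P' * star (A' - B') = 1 := by rw [← star_mul, h2, star_one]
  have h' : star A' * G₀ * A = star B' * G₀ * B := by rw [mul_assoc, mul_assoc]; exact h
  -- The equality `A'* G A = B'* G B` is the same as `(A' - B')* G (A + B) = -(A' + B')* G (A - B)`:
  -- expanding the sum of the two products, only the diagonal terms remain, each twice.
  have key : star (A' - B') * G₀ * (A + B) = -(star (A' + B') * G₀ * (A - B)) := by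
    rw [star_sub, star_add]
    have e : (star A' - star B') * G₀ * (A + B) + (star A' + star B') * G₀ * (A - B) =
        (star A' * G₀ * A - star B' * G₀ * B) + (star A' * G₀ * A - star B' * G₀ * B) := by
      noncomm_ring
    rw [h', sub_self, add_zero] at e
    exact eq_neg_of_add_eq_zero_left e
  have key2 : (A + B) * P * Gi = -(Gi * star P' * star (A' + B')) := by
    calc (A + B) * P * Gi
        = Gi * (star P' * star (A' - B')) * G₀ * (A + B) * P * Gi := by
          rw [h5, mul_one, h3, one_mul]
      _ = Gi * star P' * (star (A' - B') * G₀ * (A + B)) * P * Gi := by noncomm_ring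
      _ = -(Gi * star P' * star (A' + B') * G₀ * ((A - B) * P) * Gi) := by
          rw [key]; noncomm_ring
      _ = -(Gi * star P' * star (A' + B') * (G₀ * Gi)) := by rw [h1']; noncomm_ring
      _ = _ := by rw [h4, mul_one]
  rw [(isUnit_I_smul hG).2]
  change (-(1 / 2) : ℂ) • ((A + B) * (P * ((-Complex.I) • Gi))) =
    star ((-(1 / 2) : ℂ) • ((A' + B') * (P' * ((-Complex.I) • Gi))))
  rw [star_smul, star_mul, star_mul, star_smul, hsGi]
  have e1 : star (-(1 / 2) : ℂ) = -(1 / 2) := by simp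
  have e2 : star (-Complex.I) = Complex.I := by simp
  rw [e1, e2, mul_smul_comm, mul_smul_comm, ← mul_assoc, key2, smul_mul_assoc, smul_mul_assoc]
  simp

namespace IsDefiniteNevanlinnaSystem

variable {a b : ℝ} {Q H : ℂ → ℝ → V →L[ℂ] V} (hD : IsDefiniteNevanlinnaSystem a b Q H)
  (hab : a < b) (h0 : (0 : ℝ) ∈ Icc a b)
include hD

lemma isUnit_G {z : ℂ} (hz : z.im ≠ 0) {t : ℝ} (ht : t ∈ Icc a b) : IsUnit (reOp (Q z t)) :=
  (hD.regular z hz).isUnit t ht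

lemma Q_conj {z : ℂ} (hz : z.im ≠ 0) {t : ℝ} (ht : t ∈ Icc a b) : Q (conj z) t = Q z t :=
  hD.eqOn _ _ (conj_im_ne_zero hz) hz ht

include hab h0

/-- Multiplying the energy identity by `ℑz` produces `2 (ℑz)²`, so coercivity has the same sign in
both half-planes. -/
lemma energy_ge {z : ℂ} (hz : z.im ≠ 0) : ∃ ε : ℝ, 0 < ε ∧ ∀ c : V, ε * ‖c‖ ^ 2 ≤
    z.im * (quadForm (reOp (Q z b)) (operatorSolution a b (Q z) (H z) b c) -
      quadForm (reOp (Q z a)) (operatorSolution a b (Q z) (H z) a c)) := by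
  obtain ⟨δ, hδ, h⟩ := hD.definite z hz
  have hz2 : 0 < z.im ^ 2 := by positivity
  refine ⟨2 * z.im ^ 2 * δ, by positivity, fun c => ?_⟩
  rw [hD.energy hab h0 hz]
  calc 2 * z.im ^ 2 * δ * ‖c‖ ^ 2 = 2 * z.im ^ 2 * (δ * ‖c‖ ^ 2) := by ring
    _ ≤ 2 * z.im ^ 2 * ∫ t in a..b, quadForm (nevWeight H z t)
          (operatorSolution a b (Q z) (H z) t c) :=
        mul_le_mul_of_nonneg_left (h c) (by positivity)
    _ = z.im * (2 * z.im * ∫ t in a..b, quadForm (nevWeight H z t)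
          (operatorSolution a b (Q z) (H z) t c)) := by ring

/-- Definiteness is used at both `z` and `z̄`: the former gives the lower bound, the latter the
dense range. Passing to `z̄` changes the sign of the imaginary part but not `Q`. -/
lemma isUnit_boundaryDiff {Ma Nb : ℂ → V →L[ℂ] V} (hp : IsMaximalDissipativePair a b Q Ma Nb)
    {z : ℂ} (hz : z.im ≠ 0) :
    IsUnit (pullBack (operatorSolution a b (Q z) (H z) a) (Ma z) -
      pullBack (operatorSolution a b (Q z) (H z) b) (Nb z)) := by
  have ha := left_mem_Icc.2 hab.le
  have hb := right_mem_Icc.2 hab.le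
  have hz' := conj_im_ne_zero hz
  obtain ⟨ε, hε, hE⟩ := hD.energy_ge hab h0 hz
  obtain ⟨ε', hε', hE'⟩ := hD.energy_ge hab h0 hz'
  rw [Complex.conj_im, hD.Q_conj hz ha, hD.Q_conj hz hb] at hE'
  refine isUnit_pullBack_sub (ε := min ε ε') (lt_min hε hε') (hD.isUnit_solution hab h0 hz ha)
    (hD.isUnit_solution hab h0 hz hb) (hD.isUnit_G hz h0) (hD.adjoint_mul_reOp_mul hab h0 hz ha)
    (hD.adjoint_mul_reOp_mul hab h0 hz hb) (fun c => ?_) (fun c => ?_) (hp.nondegenerate z hz)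
    (hp.maximal z hz)
  · refine le_trans ?_ (hE c)
    gcongr
    exact min_le_left _ _
  · refine le_trans ?_ (hE' c)
    gcongr
    exact min_le_right _ _

/-- The Green integral in terms of the operator solutions. -/
lemma greenIntegral_eq (M : ℂ → V →L[ℂ] V) {z : ℂ} {g : ℝ → V}
    (hg : IntervalIntegrable (fun σ => adjoint (operatorSolution a b (Q (conj z)) (H (conj z)) σ)
      (g σ)) volume a b) {t : ℝ} (ht : t ∈ Icc a b) :
    greenIntegral a b Q H M z g t = operatorSolution a b (Q z) (H z) t
      ((M z - (1 / 2 : ℂ) • Ring.inverse (Complex.I • reOp (Q z 0)))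
        (∫ σ in a..b, adjoint (operatorSolution a b (Q (conj z)) (H (conj z)) σ) (g σ)) +
      Ring.inverse (Complex.I • reOp (Q z 0))
        (∫ σ in a..t, adjoint (operatorSolution a b (Q (conj z)) (H (conj z)) σ) (g σ))) :=
  integral_sign_kernel hg ht _ _ _

lemma greenIntegral_left (M : ℂ → V →L[ℂ] V) {z : ℂ} {g : ℝ → V}
    (hg : IntervalIntegrable (fun σ => adjoint (operatorSolution a b (Q (conj z)) (H (conj z)) σ)
      (g σ)) volume a b) :
    greenIntegral a b Q H M z g a = operatorSolution a b (Q z) (H z) a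
      ((M z - (1 / 2 : ℂ) • Ring.inverse (Complex.I • reOp (Q z 0)))
        (∫ σ in a..b, adjoint (operatorSolution a b (Q (conj z)) (H (conj z)) σ) (g σ))) := by
  rw [hD.greenIntegral_eq hab h0 M hg (left_mem_Icc.2 hab.le), intervalIntegral.integral_same,
    map_zero, add_zero]

lemma greenIntegral_right (M : ℂ → V →L[ℂ] V) {z : ℂ} {g : ℝ → V}
    (hg : IntervalIntegrable (fun σ => adjoint (operatorSolution a b (Q (conj z)) (H (conj z)) σ)
      (g σ)) volume a b) :
    greenIntegral a b Q H M z g b = operatorSolution a b (Q z) (H z) b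
      ((M z + (1 / 2 : ℂ) • Ring.inverse (Complex.I • reOp (Q z 0)))
        (∫ σ in a..b, adjoint (operatorSolution a b (Q (conj z)) (H (conj z)) σ) (g σ))) := by
  rw [hD.greenIntegral_eq hab h0 M hg (right_mem_Icc.2 hab.le)]
  congr 1
  simp only [FunLike.coe_sub, FunLike.coe_add, FunLike.coe_smul, Pi.sub_apply, Pi.add_apply,
    Pi.smul_apply]
  module

lemma continuousOn_adjoint_solution {z : ℂ} (hz : z.im ≠ 0) :
    ContinuousOn (fun σ => adjoint (operatorSolution a b (Q z) (H z) σ)) (Icc a b) :=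
  (ContinuousLinearMap.adjoint (𝕜 := ℂ) (E := V) (F := V)).continuous.comp_continuousOn
    (hD.isOperatorSolution hab h0 hz).1.continuousOn

lemma intervalIntegrable_of_continuousOn {z : ℂ} (hz : z.im ≠ 0) {g : ℝ → V}
    (hg : ContinuousOn g (Icc a b)) :
    IntervalIntegrable (fun σ => adjoint (operatorSolution a b (Q (conj z)) (H (conj z)) σ)
      (g σ)) volume a b := by
  refine ContinuousOn.intervalIntegrable ?_
  rw [uIcc_of_le hab.le]
  exact (hD.continuousOn_adjoint_solution hab h0 (conj_im_ne_zero hz)).opApply hg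

lemma isSystemSolution_greenIntegral (M : ℂ → V →L[ℂ] V) {z : ℂ} (hz : z.im ≠ 0) {g : ℝ → V}
    (hg : ContinuousOn g (Icc a b)) :
    IsSystemSolution a b (Q z) (H z) g (greenIntegral a b Q H M z g) := by
  have hφ := hD.intervalIntegrable_of_continuousOn hab h0 hz hg
  have h := (hD.regular z hz).isSystemSolution_variation (hD.regular_conj hz) hab h0 (hD.symm z hz)
    (hD.isOperatorSolution hab h0 hz) (hD.isOperatorSolution_conj hab h0 hz) hg
    (left_mem_Icc.2 hab.le) ((M z - (1 / 2 : ℂ) • Ring.inverse (Complex.I • reOp (Q z 0)))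
        (∫ σ in a..b, adjoint (operatorSolution a b (Q (conj z)) (H (conj z)) σ) (g σ)))
  intro t ht
  obtain ⟨x', hx', e⟩ := h t ht
  have he := fun t ht => hD.greenIntegral_eq hab h0 M hφ (t := t) ht
  refine ⟨x', hx'.congr he (he t ht), ?_⟩
  rw [he t ht]
  exact e

/-- `F` itself need not be integrable. However, `‖W F‖²` is at most a constant times `(W F, F)`, and
`‖W F‖ ≤ 1 + ‖W F‖²`. -/
lemma intervalIntegrable_weight {z : ℂ} (hz : z.im ≠ 0) {F : ℝ → V}
    (hF : AEStronglyMeasurable F (volume.restrict (Icc a b)))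
    (hi : IntegrableOn (fun t => quadForm (nevWeight H z t) (F t)) (Icc a b)) :
    IntervalIntegrable (fun σ => adjoint (operatorSolution a b (Q (conj z)) (H (conj z)) σ)
      (nevWeight H z σ (F σ))) volume a b := by
  have hW := continuousOn_nevWeight (hD.regular z hz).continuousOn
  have hX := hD.continuousOn_adjoint_solution hab h0 (conj_im_ne_zero hz)
  obtain ⟨C, hC0, hC⟩ := exists_norm_le_of_continuousOn hW
  obtain ⟨D, hD0, hDb⟩ := exists_norm_le_of_continuousOn hX
  rw [intervalIntegrable_iff_integrableOn_Icc_of_le hab.le]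
  have hmeas : AEStronglyMeasurable
      (fun σ => adjoint (operatorSolution a b (Q (conj z)) (H (conj z)) σ)
        (nevWeight H z σ (F σ))) (volume.restrict (Icc a b)) := by
    have m1 := hX.aestronglyMeasurable (μ := volume) measurableSet_Icc
    have m2 := hW.aestronglyMeasurable (μ := volume) measurableSet_Icc
    have happ : Continuous fun p : (V →L[ℂ] V) × V => p.1 p.2 :=
      isBoundedBilinearMap_apply.continuous
    have m3 := happ.comp_aestronglyMeasurable (m2.prodMk hF)
    exact happ.comp_aestronglyMeasurable (m1.prodMk m3)
  have hdom : Integrable (fun σ => D * (1 + 4 * C * quadForm (nevWeight H z σ) (F σ)))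
      (volume.restrict (Icc a b)) :=
    ((integrable_const 1).add (hi.const_mul (4 * C))).const_mul D
  refine hdom.mono' hmeas ?_
  refine (ae_restrict_iff' measurableSet_Icc).2 (Filter.Eventually.of_forall fun σ hσ => ?_)
  have h1 := norm_nevWeight_sq_le (hD.nonneg z hz σ hσ) (F σ)
  have h2 := hD.nonneg z hz σ hσ (F σ)
  have h3 : ‖nevWeight H z σ (F σ)‖ ≤ 1 + 4 * C * quadForm (nevWeight H z σ) (F σ) := by
    have h4 : 4 * ‖nevWeight H z σ‖ * quadForm (nevWeight H z σ) (F σ) ≤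
        4 * C * quadForm (nevWeight H z σ) (F σ) := by gcongr; exact hC σ hσ
    nlinarith [sq_nonneg (‖nevWeight H z σ (F σ)‖ - 1), norm_nonneg (nevWeight H z σ (F σ))]
  calc _ ≤ ‖adjoint (operatorSolution a b (Q (conj z)) (H (conj z)) σ)‖ *
        ‖nevWeight H z σ (F σ)‖ := ContinuousLinearMap.le_opNorm _ _
    _ ≤ D * (1 + 4 * C * quadForm (nevWeight H z σ) (F σ)) := by
        gcongr
        exact hDb σ hσ

/-- The vectors `∫ X_{z̄}* W_z F` exhaust the space. -/
lemma exists_integral_weight_eq {z : ℂ} (hz : z.im ≠ 0) (k : V) :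
    ∃ F : ℝ → V, ContinuousOn F (Icc a b) ∧
      ∫ σ in a..b, adjoint (operatorSolution a b (Q (conj z)) (H (conj z)) σ)
        (nevWeight H z σ (F σ)) = k := by
  have hz' := conj_im_ne_zero hz
  set X := operatorSolution a b (Q (conj z)) (H (conj z)) with hX
  have hXc : ContinuousOn X (Icc a b) := (hD.isOperatorSolution hab h0 hz').1.continuousOn
  have hW := continuousOn_nevWeight (hD.regular z hz).continuousOn
  have hc : ContinuousOn (fun σ => adjoint (X σ) * (nevWeight H z σ * X σ)) (Icc a b) :=
    (hD.continuousOn_adjoint_solution hab h0 hz').mul (hW.mul hXc)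
  have hint : IntervalIntegrable (fun σ => adjoint (X σ) * (nevWeight H z σ * X σ)) volume a b :=
    ContinuousOn.intervalIntegrable (by rwa [uIcc_of_le hab.le])
  -- The Gram operator of the solutions at `z̄` is coercive by definiteness, hence invertible. Then
  -- `F = X_{z̄} Δ⁻¹ k` has the required integral.
  set Δ : V →L[ℂ] V := ∫ σ in a..b, adjoint (X σ) * (nevWeight H z σ * X σ) with hΔ
  have happ : ∀ c, Δ c = ∫ σ in a..b, adjoint (X σ) (nevWeight H z σ (X σ c)) := fun c =>
    ((ContinuousLinearMap.apply ℂ V c).intervalIntegral_comp_comm hint).symm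
  obtain ⟨δ, hδ, hdef⟩ := hD.definite _ hz'
  have hquad : ∀ c, δ * ‖c‖ ^ 2 ≤ (inner ℂ c (Δ c)).re := by
    intro c
    have hint2 : IntervalIntegrable (fun σ => adjoint (X σ) (nevWeight H z σ (X σ c))) volume a b :=
      ⟨(ContinuousLinearMap.apply ℂ V c).integrable_comp hint.1,
        (ContinuousLinearMap.apply ℂ V c).integrable_comp hint.2⟩
    have h1 : inner ℂ c (Δ c) = ∫ σ in a..b, inner ℂ c (adjoint (X σ) (nevWeight H z σ (X σ c))) := by
      rw [happ]
      exact ((innerSL ℂ c).intervalIntegral_comp_comm hint2).symm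
    have hint3 : IntervalIntegrable
        (fun σ => inner ℂ c (adjoint (X σ) (nevWeight H z σ (X σ c)))) volume a b :=
      ⟨(innerSL ℂ c).integrable_comp hint2.1, (innerSL ℂ c).integrable_comp hint2.2⟩
    have h2 : (inner ℂ c (Δ c)).re =
        ∫ σ in a..b, (inner ℂ c (adjoint (X σ) (nevWeight H z σ (X σ c)))).re := by
      rw [h1]
      exact (Complex.reCLM.intervalIntegral_comp_comm hint3).symm
    rw [h2]
    refine (hdef c).trans (le_of_eq ?_)
    refine intervalIntegral.integral_congr fun σ hσ => ?_
    rw [uIcc_of_le hab.le] at hσ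
    rw [ContinuousLinearMap.adjoint_inner_right, hD.nevWeight_conj hz hσ]
    rfl
  have hU : IsUnit Δ := by
    refine ContinuousLinearMap.isUnit_of_forall_le_norm_inner_map Δ (c := ⟨δ, hδ.le⟩) hδ fun c => ?_
    have h1 : (inner ℂ c (Δ c)).re ≤ ‖inner ℂ (Δ c) c‖ := by
      rw [norm_inner_symm]
      exact Complex.re_le_norm _
    calc ‖c‖ ^ 2 * δ = δ * ‖c‖ ^ 2 := mul_comm _ _
      _ ≤ _ := (hquad c).trans h1
  refine ⟨fun σ => X σ (Ring.inverse Δ k), hXc.opApply continuousOn_const, ?_⟩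
  rw [← happ]
  exact mul_inverse_apply hU k

/-- The boundary values of the Green integral depend on `F` only through `k = ∫ X_{z̄}* W F`, and
every `k` occurs. The inequality over all `F` becomes one about operators. -/
lemma dissipative_iff (M : ℂ → V →L[ℂ] V) {z : ℂ} (hz : z.im ≠ 0) :
    (∀ F : ℝ → V, AEStronglyMeasurable F (volume.restrict (Icc a b)) →
      IntegrableOn (fun t => quadForm (nevWeight H z t) (F t)) (Icc a b) →
      z.im * (quadForm (reOp (Q z b))
          (greenIntegral a b Q H M z (fun t => nevWeight H z t (F t)) b)
        - quadForm (reOp (Q z a))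
          (greenIntegral a b Q H M z (fun t => nevWeight H z t (F t)) a)) ≤ 0) ↔
    ∀ k, z.im * (quadForm (reOp (Q z b)) (operatorSolution a b (Q z) (H z) b
        ((M z + (1 / 2 : ℂ) • Ring.inverse (Complex.I • reOp (Q z 0))) k)) -
      quadForm (reOp (Q z a)) (operatorSolution a b (Q z) (H z) a
        ((M z - (1 / 2 : ℂ) • Ring.inverse (Complex.I • reOp (Q z 0))) k))) ≤ 0 := by
  constructor
  · intro h k
    obtain ⟨F, hF, rfl⟩ := hD.exists_integral_weight_eq hab h0 hz k
    have hW := continuousOn_nevWeight (hD.regular z hz).continuousOn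
    have h1 := hF.aestronglyMeasurable (μ := volume) measurableSet_Icc
    have h2 : IntegrableOn (fun t => quadForm (nevWeight H z t) (F t)) (Icc a b) :=
      (continuousOn_quadForm hW hF).integrableOn_Icc
    have h3 := hD.intervalIntegrable_weight hab h0 hz h1 h2
    have h4 := h F h1 h2
    rwa [hD.greenIntegral_left hab h0 M h3, hD.greenIntegral_right hab h0 M h3] at h4
  · intro h F h1 h2
    have h3 := hD.intervalIntegrable_weight hab h0 hz h1 h2
    rw [hD.greenIntegral_left hab h0 M h3, hD.greenIntegral_right hab h0 M h3]
    exact h _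

omit hD hab h0 in
-- Writing the added term as `(A - B)(A - B)⁻¹ G` leaves only `B`; with a minus sign, in the next
-- lemma, only `A` is left. In the application the letter `G` stands for `(iℜQ(0))⁻¹`.
lemma boundaryCharOp_add {A B G : V →L[ℂ] V} (hU : IsUnit (A - B)) :
    (-(1 / 2) : ℂ) • ((A + B) ∘L Ring.inverse (A - B) ∘L G) + (1 / 2 : ℂ) • G =
      -(B ∘L (Ring.inverse (A - B) ∘L G)) := by
  have h : G = (A - B) * (Ring.inverse (A - B) * G) := by
    rw [← mul_assoc, Ring.mul_inverse_cancel _ hU, one_mul]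
  nth_rw 2 [h]
  ext v
  simp only [FunLike.coe_add, FunLike.coe_smul, FunLike.coe_neg, FunLike.coe_sub, Pi.add_apply,
    Pi.smul_apply, Pi.neg_apply, Pi.sub_apply, ContinuousLinearMap.comp_apply, mul_apply_eq_comp]
  module

omit hD hab h0 in
lemma boundaryCharOp_sub {A B G : V →L[ℂ] V} (hU : IsUnit (A - B)) :
    (-(1 / 2) : ℂ) • ((A + B) ∘L Ring.inverse (A - B) ∘L G) - (1 / 2 : ℂ) • G =
      -(A ∘L (Ring.inverse (A - B) ∘L G)) := by
  have h : G = (A - B) * (Ring.inverse (A - B) * G) := by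
    rw [← mul_assoc, Ring.mul_inverse_cancel _ hU, one_mul]
  nth_rw 2 [h]
  ext v
  simp only [FunLike.coe_add, FunLike.coe_smul, FunLike.coe_neg, FunLike.coe_sub, Pi.add_apply,
    Pi.smul_apply, Pi.neg_apply, Pi.sub_apply, ContinuousLinearMap.comp_apply, mul_apply_eq_comp]
  module

lemma solution_pullBack {z : ℂ} (hz : z.im ≠ 0) {t : ℝ} (ht : t ∈ Icc a b) (A : V →L[ℂ] V) (h : V) :
    operatorSolution a b (Q z) (H z) t
      (pullBack (operatorSolution a b (Q z) (H z) t) A h) = A h :=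
  mul_inverse_apply (hD.isUnit_solution hab h0 hz ht) _

/-- Both boundary values come from the same vector `h = -(A - B)⁻¹ (iG)⁻¹ k`, which is exactly
membership in the boundary subspace. -/
lemma exists_boundaryCharOp_apply {Ma Nb : ℂ → V →L[ℂ] V}
    (hp : IsMaximalDissipativePair a b Q Ma Nb) {z : ℂ} (hz : z.im ≠ 0) (k : V) :
    ∃ h : V, operatorSolution a b (Q z) (H z) b ((boundaryCharOp a b Q H Ma Nb z +
        (1 / 2 : ℂ) • Ring.inverse (Complex.I • reOp (Q z 0))) k) = Nb z h ∧
      operatorSolution a b (Q z) (H z) a ((boundaryCharOp a b Q H Ma Nb z -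
        (1 / 2 : ℂ) • Ring.inverse (Complex.I • reOp (Q z 0))) k) = Ma z h := by
  have hU := hD.isUnit_boundaryDiff hab h0 hp hz
  rw [boundaryCharOp, boundaryCharOp_add hU, boundaryCharOp_sub hU]
  refine ⟨-((Ring.inverse (pullBack (operatorSolution a b (Q z) (H z) a) (Ma z) -
      pullBack (operatorSolution a b (Q z) (H z) b) (Nb z)) ∘L
        Ring.inverse (Complex.I • reOp (Q z 0))) k), ?_, ?_⟩
  · rw [FunLike.coe_neg, Pi.neg_apply, map_neg, map_neg, ContinuousLinearMap.comp_apply,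
      hD.solution_pullBack hab h0 hz (right_mem_Icc.2 hab.le)]
  · rw [FunLike.coe_neg, Pi.neg_apply, map_neg, map_neg, ContinuousLinearMap.comp_apply,
      hD.solution_pullBack hab h0 hz (left_mem_Icc.2 hab.le)]

omit hD hab h0 in
lemma dissipative_of_pair {Ma Nb : ℂ → V →L[ℂ] V}
    (hp : IsMaximalDissipativePair a b Q Ma Nb) {z : ℂ} (hz : z.im ≠ 0) (h : V) :
    z.im * (quadForm (reOp (Q z b)) (Nb z h) - quadForm (reOp (Q z a)) (Ma z h)) ≤ 0 := by
  have h1 : 0 ≤ z.im * (quadForm (reOp (Q z a)) (Ma z h) - quadForm (reOp (Q z b)) (Nb z h)) :=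
    (hp.maximal z hz).1 _ ⟨h, rfl⟩
  linarith

omit hab h0 hD in
lemma analyticAt_mul {f g : ℂ → V →L[ℂ] V} {z : ℂ} (hf : AnalyticAt ℂ f z)
    (hg : AnalyticAt ℂ g z) : AnalyticAt ℂ (fun w => f w ∘L g w) z :=
  hf.mul hg

omit hab h0 hD in
lemma analyticAt_const_smul {f : ℂ → V →L[ℂ] V} {z : ℂ} (c : ℂ) (hf : AnalyticAt ℂ f z) :
    AnalyticAt ℂ (fun w => c • f w) z :=
  ((c • ContinuousLinearMap.id ℂ (V →L[ℂ] V)).analyticAt _).comp hf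

omit hab h0 hD in
lemma analyticAt_inverse_comp {f : ℂ → V →L[ℂ] V} {z : ℂ} (hf : AnalyticAt ℂ f z)
    (hu : IsUnit (f z)) : AnalyticAt ℂ (fun w => Ring.inverse (f w)) z := by
  obtain ⟨u, hu⟩ := hu
  refine AnalyticAt.comp (g := Ring.inverse) ?_ hf
  rw [← hu]
  exact analyticAt_inverse u

lemma analyticAt_inverse_G {z : ℂ} (hz : z.im ≠ 0) :
    AnalyticAt ℂ (fun w => Ring.inverse (Complex.I • reOp (Q w 0))) z := by
  refine (analyticAt_const (v := Ring.inverse (Complex.I • reOp (Q z 0)))).congr ?_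
  filter_upwards [isOpen_nonreal.mem_nhds hz] with w hw
  rw [hD.eqOn w z hw hz h0]

/-- The Lagrange identity says that `X(t)` carries the form `G` to `ℜQ(t)`, so condition (i) can be
stated at the initial point, where both ends share the same form. -/
lemma pullBack_symm {z : ℂ} (hz : z.im ≠ 0) {t : ℝ} (ht : t ∈ Icc a b) (A A' : V →L[ℂ] V) :
    adjoint (pullBack (operatorSolution a b (Q (conj z)) (H (conj z)) t) A') *
      (reOp (Q z 0) * pullBack (operatorSolution a b (Q z) (H z) t) A) =
    adjoint A' * (reOp (Q z t) * A) := by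
  set X := operatorSolution a b (Q z) (H z) t with hX
  set X' := operatorSolution a b (Q (conj z)) (H (conj z)) t with hX'
  have h1 : adjoint X' * (reOp (Q z t) * X) = reOp (Q z 0) := hD.adjoint_mul_reOp_mul hab h0 hz ht
  have h2 : X * pullBack X A = A := by
    ext v; exact hD.solution_pullBack hab h0 hz ht A v
  have h3 : X' * pullBack X' A' = A' := by
    ext v; exact hD.solution_pullBack hab h0 (conj_im_ne_zero hz) ht A' v
  have h4 : adjoint (pullBack X' A') * adjoint X' = adjoint A' := by
    have := congrArg star h3
    rw [star_mul] at this
    exact this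
  calc adjoint (pullBack X' A') * (reOp (Q z 0) * pullBack X A)
      = (adjoint (pullBack X' A') * adjoint X') * (reOp (Q z t) * (X * pullBack X A)) := by
        rw [← h1]; noncomm_ring
    _ = _ := by rw [h4, h2]

/-- A maximal dissipative boundary pair gives a characteristic operator. -/
lemma isCharacteristicOperator_boundaryCharOp {Ma Nb : ℂ → V →L[ℂ] V}
    (hp : IsMaximalDissipativePair a b Q Ma Nb) :
    IsCharacteristicOperator a b Q H (boundaryCharOp a b Q H Ma Nb) where
  analytic z hz := by
    have ha := left_mem_Icc.2 hab.le
    have hb := right_mem_Icc.2 hab.le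
    have h1 : AnalyticAt ℂ (fun z => pullBack (operatorSolution a b (Q z) (H z) a) (Ma z)) z :=
      analyticAt_mul (analyticAt_inverse_comp (hD.analyticOnNhd_operatorSolution hab h0 ha z hz)
        (hD.isUnit_solution hab h0 hz ha)) (hp.analytic_left z hz)
    have h2 : AnalyticAt ℂ (fun z => pullBack (operatorSolution a b (Q z) (H z) b) (Nb z)) z :=
      analyticAt_mul (analyticAt_inverse_comp (hD.analyticOnNhd_operatorSolution hab h0 hb z hz)
        (hD.isUnit_solution hab h0 hz hb)) (hp.analytic_right z hz)
    have h3 := analyticAt_inverse_comp (h1.sub h2) (hD.isUnit_boundaryDiff hab h0 hp hz)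
    exact analyticAt_const_smul _ (analyticAt_mul (h1.add h2)
      (analyticAt_mul h3 (hD.analyticAt_inverse_G hab h0 hz)))
  symm z hz := by
    have hz' := conj_im_ne_zero hz
    have h := boundary_symm (hD.isUnit_G hz h0) (hD.isUnit_boundaryDiff hab h0 hp hz)
      (hD.isUnit_boundaryDiff hab h0 hp hz') (by
        rw [hD.pullBack_symm hab h0 hz (left_mem_Icc.2 hab.le),
          hD.pullBack_symm hab h0 hz (right_mem_Icc.2 hab.le)]
        exact hp.symm z hz)
    rw [boundaryCharOp, boundaryCharOp, h, hD.Q_conj hz h0]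
  dissipative z hz := by
    rw [hD.dissipative_iff hab h0 _ hz]
    intro k
    obtain ⟨h, h1, h2⟩ := hD.exists_boundaryCharOp_apply hab h0 hp hz k
    rw [h1, h2]
    exact dissipative_of_pair hp hz h

lemma exists_greenIntegral_boundaryCharOp {Ma Nb : ℂ → V →L[ℂ] V}
    (hp : IsMaximalDissipativePair a b Q Ma Nb) {z : ℂ} (hz : z.im ≠ 0) {g : ℝ → V}
    (hg : ContinuousOn g (Icc a b)) :
    ∃ h : V, greenIntegral a b Q H (boundaryCharOp a b Q H Ma Nb) z g a = Ma z h ∧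
      greenIntegral a b Q H (boundaryCharOp a b Q H Ma Nb) z g b = Nb z h := by
  have hφ := hD.intervalIntegrable_of_continuousOn hab h0 hz hg
  rw [hD.greenIntegral_left hab h0 _ hφ, hD.greenIntegral_right hab h0 _ hφ]
  obtain ⟨h, h1, h2⟩ := hD.exists_boundaryCharOp_apply hab h0 hp hz
    (∫ σ in a..b, adjoint (operatorSolution a b (Q (conj z)) (H (conj z)) σ) (g σ))
  exact ⟨h, h2, h1⟩

/-- Uniqueness for the boundary problem of the first order system. -/
lemma boundary_unique {Ma Nb : ℂ → V →L[ℂ] V}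
    (hp : IsMaximalDissipativePair a b Q Ma Nb) {z : ℂ} (hz : z.im ≠ 0) {g x₁ x₂ : ℝ → V}
    (h₁ : IsSystemSolution a b (Q z) (H z) g x₁) (h₂ : IsSystemSolution a b (Q z) (H z) g x₂)
    {k₁ k₂ : V} (ha₁ : x₁ a = Ma z k₁) (hb₁ : x₁ b = Nb z k₁) (ha₂ : x₂ a = Ma z k₂)
    (hb₂ : x₂ b = Nb z k₂) {t : ℝ} (ht : t ∈ Icc a b) : x₁ t = x₂ t := by
  have ha := left_mem_Icc.2 hab.le
  have hb := right_mem_Icc.2 hab.le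
  have hu := fun t ht => (hD.regular z hz).solution_unique (hD.regular_conj hz) hab h0
    (hD.symm z hz) (hD.isOperatorSolution hab h0 hz) (hD.isOperatorSolution_conj hab h0 hz) h₁ h₂
    (t := t) ht
  set c := x₁ 0 - x₂ 0 with hc
  have e1 : pullBack (operatorSolution a b (Q z) (H z) a) (Ma z) (k₁ - k₂) = c := by
    have := hu a ha
    rw [ha₁, ha₂, ← map_sub] at this
    exact ((eq_inverse_apply_iff (hD.isUnit_solution hab h0 hz ha) _ _).2 this.symm).symm
  have e2 : pullBack (operatorSolution a b (Q z) (H z) b) (Nb z) (k₁ - k₂) = c := by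
    have := hu b hb
    rw [hb₁, hb₂, ← map_sub] at this
    exact ((eq_inverse_apply_iff (hD.isUnit_solution hab h0 hz hb) _ _).2 this.symm).symm
  have e3 : (pullBack (operatorSolution a b (Q z) (H z) a) (Ma z) -
      pullBack (operatorSolution a b (Q z) (H z) b) (Nb z)) (k₁ - k₂) = 0 := by
    rw [FunLike.coe_sub, Pi.sub_apply, e1, e2, sub_self]
  have e4 := (eq_inverse_apply_iff (hD.isUnit_boundaryDiff hab h0 hp hz) _ _).2 e3
  rw [map_zero] at e4
  rw [e4, map_zero] at e1
  have := hu t ht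
  rw [← e1, map_zero, sub_eq_zero] at this
  exact this

/-- Every characteristic operator comes from a maximal dissipative boundary pair. -/
lemma exists_pair_of_isCharacteristicOperator {M : ℂ → V →L[ℂ] V}
    (hM : IsCharacteristicOperator a b Q H M) :
    ∃ Ma Nb : ℂ → V →L[ℂ] V, IsMaximalDissipativePair a b Q Ma Nb ∧
      ∀ z : ℂ, z.im ≠ 0 → ∀ g : ℝ → V, ContinuousOn g (Icc a b) →
        ∃ h : V, greenIntegral a b Q H M z g a = Ma z h ∧
          greenIntegral a b Q H M z g b = Nb z h := by
  have ha := left_mem_Icc.2 hab.le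
  have hb := right_mem_Icc.2 hab.le
  set K : ℂ → V →L[ℂ] V := fun z => Ring.inverse (Complex.I • reOp (Q z 0)) with hK
  set A : ℂ → V →L[ℂ] V := fun z => M z - (1 / 2 : ℂ) • K z with hA
  set B : ℂ → V →L[ℂ] V := fun z => M z + (1 / 2 : ℂ) • K z with hB
  have hKa : ∀ z : ℂ, z.im ≠ 0 → AnalyticAt ℂ K z := fun z hz => hD.analyticAt_inverse_G hab h0 hz
  have hpull : ∀ z : ℂ, z.im ≠ 0 → ∀ t ∈ Icc a b, ∀ T : V →L[ℂ] V,
      pullBack (operatorSolution a b (Q z) (H z) t)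
        (operatorSolution a b (Q z) (H z) t ∘L T) = T := fun z hz t ht T => by
    ext v
    exact inverse_mul_apply (hD.isUnit_solution hab h0 hz ht) (T v)
  have hKu : ∀ z : ℂ, z.im ≠ 0 → IsUnit (K z) := fun z hz =>
    (isUnit_I_smul (hD.isUnit_G hz h0)).1.ringInverse
  have hAB : ∀ z, A z - B z = -K z := fun z => by
    rw [hA, hB]; module
  -- These are the operators producing the boundary values of the Green integral. The difference of
  -- their pull-backs is `-K`, invertible without further argument, which yields maximality.
  refine ⟨fun z => operatorSolution a b (Q z) (H z) a ∘L A z,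
    fun z => operatorSolution a b (Q z) (H z) b ∘L B z, ⟨?_, ?_, ?_, ?_, ?_⟩, ?_⟩
  · intro z hz
    exact analyticAt_mul (hD.analyticOnNhd_operatorSolution hab h0 ha z hz)
      ((hM.analytic z hz).sub (analyticAt_const_smul _ (hKa z hz)))
  · intro z hz
    exact analyticAt_mul (hD.analyticOnNhd_operatorSolution hab h0 hb z hz)
      ((hM.analytic z hz).add (analyticAt_const_smul _ (hKa z hz)))
  · intro z hz
    have hz' := conj_im_ne_zero hz
    have h1 := hD.pullBack_symm hab h0 hz ha
      (operatorSolution a b (Q z) (H z) a ∘L A z)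
      (operatorSolution a b (Q (conj z)) (H (conj z)) a ∘L A (conj z))
    have h2 := hD.pullBack_symm hab h0 hz hb
      (operatorSolution a b (Q z) (H z) b ∘L B z)
      (operatorSolution a b (Q (conj z)) (H (conj z)) b ∘L B (conj z))
    rw [hpull z hz a ha, hpull _ hz' a ha] at h1
    rw [hpull z hz b hb, hpull _ hz' b hb] at h2
    refine h1.symm.trans (Eq.trans ?_ h2)
    have hG := hD.isUnit_G hz h0
    have hKz : K (conj z) = K z := by simp only [hK]; rw [hD.Q_conj hz h0]
    have hMs : star (M (conj z)) = M z := (hM.symm z hz).symm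
    have hKi : K z = (-Complex.I) • Ring.inverse (reOp (Q z 0)) := (isUnit_I_smul hG).2
    set G := reOp (Q z 0) with hGdef
    have hsG : star G = G := adjoint_reOp _
    have h3 : G * Ring.inverse G = 1 := Ring.mul_inverse_cancel _ hG
    -- Because `G K = -i` and `K* G = i`, the two terms linear in `M` cancel in both products,
    -- leaving `M G M + K* G K / 4` at either end.
    have hsKG : star (K z) * G = Complex.I • 1 := by
      have : star (K z) * G = star (G * K z) := by rw [star_mul, hsG]
      rw [this, hKi, mul_smul_comm, h3, star_smul, star_one]
      simp
    have hGK : G * K z = (-Complex.I) • 1 := by rw [hKi, mul_smul_comm, h3]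
    change star (A (conj z)) * (G * A z) = star (B (conj z)) * (G * B z)
    simp only [hA, hB]
    rw [hKz, star_sub, star_add, star_smul, hMs]
    have e1 : star (1 / 2 : ℂ) = 1 / 2 := by simp
    have l1 : (M z - (1 / 2 : ℂ) • star (K z)) * (G * (M z - (1 / 2 : ℂ) • K z)) =
        M z * G * M z - (1 / 2 : ℂ) • (M z * (G * K z)) - (1 / 2 : ℂ) • ((star (K z) * G) * M z) +
        (1 / 4 : ℂ) • ((star (K z) * G) * K z) := by
      simp only [mul_sub, sub_mul, mul_smul_comm, smul_mul_assoc, smul_sub, smul_smul, mul_assoc]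
      module
    have l2 : (M z + (1 / 2 : ℂ) • star (K z)) * (G * (M z + (1 / 2 : ℂ) • K z)) =
        M z * G * M z + (1 / 2 : ℂ) • (M z * (G * K z)) + (1 / 2 : ℂ) • ((star (K z) * G) * M z) +
        (1 / 4 : ℂ) • ((star (K z) * G) * K z) := by
      simp only [mul_add, add_mul, mul_smul_comm, smul_mul_assoc, smul_add, smul_smul, mul_assoc]
      module
    rw [e1, l1, l2, hGK, hsKG, mul_smul_comm, smul_mul_assoc, mul_one, one_mul]
    module
  · intro z hz h hne
    by_contra hlt
    have h1 : ‖operatorSolution a b (Q z) (H z) a (A z h)‖ = 0 ∧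
        ‖operatorSolution a b (Q z) (H z) b (B z h)‖ = 0 := by
      have n1 := norm_nonneg (operatorSolution a b (Q z) (H z) a (A z h))
      have n2 := norm_nonneg (operatorSolution a b (Q z) (H z) b (B z h))
      simp only [ContinuousLinearMap.comp_apply, not_lt] at hlt
      constructor <;> linarith
    rw [norm_eq_zero, norm_eq_zero] at h1
    have e1 := (eq_inverse_apply_iff (hD.isUnit_solution hab h0 hz ha) _ _).2 h1.1
    have e2 := (eq_inverse_apply_iff (hD.isUnit_solution hab h0 hz hb) _ _).2 h1.2
    rw [map_zero] at e1 e2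
    have e3 : (A z - B z) h = 0 := by rw [FunLike.coe_sub, Pi.sub_apply, e1, e2, sub_zero]
    rw [hAB, FunLike.coe_neg, Pi.neg_apply, neg_eq_zero] at e3
    have e4 := (eq_inverse_apply_iff (hKu z hz) _ _).2 e3
    rw [map_zero] at e4
    exact hne e4
  · intro z hz
    obtain ⟨ε, hε, hE⟩ := hD.energy_ge hab h0 hz
    refine isMaximalNonnegSubspace_of_isUnit hε (hD.isUnit_solution hab h0 hz ha)
      (hD.isUnit_solution hab h0 hz hb) hE ?_ ?_
    · rw [hpull z hz a ha, hpull z hz b hb, hAB]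
      exact (hKu z hz).neg
    · intro h
      have := (hD.dissipative_iff hab h0 M hz).1 (hM.dissipative z hz) h
      simp only [ContinuousLinearMap.comp_apply, hA, hB, hK]
      linarith
  · intro z hz g hg
    have hφ := hD.intervalIntegrable_of_continuousOn hab h0 hz hg
    exact ⟨_, hD.greenIntegral_left hab h0 M hφ, hD.greenIntegral_right hab h0 M hφ⟩

end IsDefiniteNevanlinnaSystem

end

/-! ### Operator matrices on the block space -/

section

variable {E : Type*} [NormedAddCommGroup E] [InnerProductSpace ℂ E]

open ContinuousLinearMap (adjoint)

section Regularity

variable {V W F : Type*} [NormedAddCommGroup V] [InnerProductSpace ℂ V] [NormedAddCommGroup W]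
  [InnerProductSpace ℂ W] [NormedAddCommGroup F] [NormedSpace ℂ F]

/-- Continuous differentiability of an operator function of a real variable. -/
def IsContDiffOnOp (n : WithTop ℕ∞) (f : ℝ → V →L[ℂ] W) (s : Set ℝ) : Prop := ContDiffOn ℝ n f s

/-- The derivative of an operator function of a real variable. -/
def opDerivWithin (f : ℝ → V →L[ℂ] W) (s : Set ℝ) (t : ℝ) : V →L[ℂ] W := derivWithin f s t

variable {ι κ : Type*} [Fintype ι] [Fintype κ]

lemma isContDiffOnOp_sum (φ : ι → κ → F →L[ℂ] (V →L[ℂ] W)) {A : ι → κ → ℝ → F} {n : WithTop ℕ∞}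
    {s : Set ℝ} (hA : ∀ i j, ContDiffOn ℝ n (A i j) s) :
    IsContDiffOnOp n (fun t => ∑ i, ∑ j, φ i j (A i j t)) s :=
  ContDiffOn.sum fun i _ => ContDiffOn.sum fun j _ =>
    ((φ i j).contDiff.restrict_scalars ℝ).comp_contDiffOn (hA i j)

lemma opDerivWithin_sum (φ : ι → κ → F →L[ℂ] (V →L[ℂ] W)) {A : ι → κ → ℝ → F} {A' : ι → κ → F}
    {s : Set ℝ} {t : ℝ} (hs : UniqueDiffWithinAt ℝ s t)
    (hA : ∀ i j, HasDerivWithinAt (A i j) (A' i j) s t) :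
    opDerivWithin (fun t => ∑ i, ∑ j, φ i j (A i j t)) s t = ∑ i, ∑ j, φ i j (A' i j) :=
  HasDerivWithinAt.derivWithin (HasDerivWithinAt.fun_sum fun i _ => HasDerivWithinAt.fun_sum fun j _ =>
    ((φ i j).hasFDerivAt.restrictScalars ℝ).comp_hasDerivWithinAt t (hA i j)) hs

lemma differentiableOn_sum_clm (φ : ι → κ → F →L[ℂ] (V →L[ℂ] W)) {A : ι → κ → ℂ → F}
    {s : Set ℂ} (hA : ∀ i j, DifferentiableOn ℂ (A i j) s) :
    DifferentiableOn ℂ (fun t => ∑ i, ∑ j, φ i j (A i j t)) s :=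
  DifferentiableOn.fun_sum fun i _ => DifferentiableOn.fun_sum fun j _ =>
    (φ i j).differentiable.comp_differentiableOn (hA i j)

lemma HasDerivWithinAt.clmApply {x : ℝ → V} {x' : V} {s : Set ℝ} {t : ℝ}
    (hx : HasDerivWithinAt x x' s t) (φ : V →L[ℂ] F) :
    HasDerivWithinAt (fun t => φ (x t)) (φ x') s t :=
  (φ.hasFDerivAt.restrictScalars ℝ).comp_hasDerivWithinAt t hx

end Regularity

namespace BlockSpace

/-- The `i`-th component of a vector of `E^r`, zero for `i ≥ r`. -/
def coord (r i : ℕ) : BlockSpace E r →L[ℂ] E :=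
  if h : i < r then PiLp.proj 2 (fun _ : Fin r => E) ⟨i, h⟩ else 0

lemma coord_apply {r : ℕ} (x : BlockSpace E r) (i : Fin r) : coord r i x = x i := by
  simp [coord]

lemma coord_of_lt {r i : ℕ} (h : i < r) (x : BlockSpace E r) : coord r i x = x ⟨i, h⟩ := by
  simp [coord, h]

lemma coord_of_le {r i : ℕ} (h : r ≤ i) (x : BlockSpace E r) : coord r i x = 0 := by
  simp [coord, not_lt.2 h]

lemma ext_coord {r : ℕ} {x y : BlockSpace E r} (h : ∀ i < r, coord r i x = coord r i y) : x = y := by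
  ext i
  have := h i i.2
  rwa [coord_apply, coord_apply] at this

lemma coord_toLp {r i : ℕ} (h : i < r) (f : Fin r → E) :
    coord r i (WithLp.toLp 2 f : BlockSpace E r) = f ⟨i, h⟩ := by
  rw [coord_of_lt h]

lemma inner_eq_sum_coord {r : ℕ} (x y : BlockSpace E r) :
    inner ℂ x y = ∑ i ∈ Finset.range r, inner ℂ (coord r i x) (coord r i y) := by
  rw [PiLp.inner_apply, Finset.sum_range]
  simp only [coord_apply]

/-- The embedding of the `i`-th component. -/
def embed {r : ℕ} (i : Fin r) : E →L[ℂ] BlockSpace E r :=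
  ((PiLp.continuousLinearEquiv 2 ℂ (fun _ : Fin r => E)).symm :
      (Fin r → E) →L[ℂ] BlockSpace E r) ∘L ContinuousLinearMap.single ℂ (fun _ : Fin r => E) i

/-- The operator matrix with the single entry `A` at the place `(i, j)`, depending linearly on `A`. -/
def entry {r k : ℕ} (i : Fin r) (j : Fin k) :
    (E →L[ℂ] E) →L[ℂ] (BlockSpace E k →L[ℂ] BlockSpace E r) :=
  ((ContinuousLinearMap.compL ℂ (BlockSpace E k) E (BlockSpace E r)) (embed i)) ∘L
    ((ContinuousLinearMap.compL ℂ (BlockSpace E k) E E).flip (PiLp.proj 2 (fun _ : Fin k => E) j))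

end BlockSpace

open BlockSpace

namespace DiffExpr

lemma coord_blockOp {r k i : ℕ} (hi : i < r) (A : ℕ → ℕ → E →L[ℂ] E) (x : BlockSpace E k) :
    coord r i (blockOp A x) = ∑ j ∈ Finset.range k, A i j (coord k j x) := by
  rw [coord_of_lt hi, Finset.sum_range]
  simp [blockOp, coord_apply]

/-- A finite sum of continuous linear images of the entries: continuity, smoothness, holomorphy and
derivatives of an operator matrix reduce to those of its entries. -/
lemma blockOp_eq_sum {r k : ℕ} (A : ℕ → ℕ → E →L[ℂ] E) :
    (blockOp A : BlockSpace E k →L[ℂ] BlockSpace E r) = ∑ i : Fin r, ∑ j : Fin k, entry i j (A i j) := by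
  ext x i
  have h : ∀ (c : Fin r) (j : Fin k), (entry c j (A c j) x : BlockSpace E r) i =
      if c = i then A i j (x j) else 0 := by
    intro c j
    by_cases hc : c = i
    · subst hc; simp [entry, embed]
    · simp [entry, embed, hc, Ne.symm hc]
  simp [blockOp, h]

lemma contDiffOn_blockOp {r k : ℕ} {n : WithTop ℕ∞} {s : Set ℝ} {A : ℝ → ℕ → ℕ → E →L[ℂ] E}
    (hA : ∀ i < r, ∀ j < k, ContDiffOn ℝ n (fun t => A t i j) s) :
    IsContDiffOnOp n (fun t => (blockOp (A t) : BlockSpace E k →L[ℂ] BlockSpace E r)) s := by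
  simp only [blockOp_eq_sum]
  exact isContDiffOnOp_sum _ fun i j => hA i i.2 j j.2

lemma continuousOn_blockOp {α : Type*} [TopologicalSpace α] {r k : ℕ} {s : Set α}
    {A : α → ℕ → ℕ → E →L[ℂ] E} (hA : ∀ i < r, ∀ j < k, ContinuousOn (fun t => A t i j) s) :
    ContinuousOn (fun t => (blockOp (A t) : BlockSpace E k →L[ℂ] BlockSpace E r)) s := by
  simp only [blockOp_eq_sum]
  exact continuousOn_finsetSum _ fun i _ => continuousOn_finsetSum _ fun j _ =>
    (entry i j).continuous.comp_continuousOn (hA i i.2 j j.2)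

lemma differentiableOn_blockOp {r k : ℕ} {s : Set ℂ} {A : ℂ → ℕ → ℕ → E →L[ℂ] E}
    (hA : ∀ i < r, ∀ j < k, DifferentiableOn ℂ (fun t => A t i j) s) :
    DifferentiableOn ℂ (fun t => (blockOp (A t) : BlockSpace E k →L[ℂ] BlockSpace E r)) s := by
  simp only [blockOp_eq_sum]
  exact differentiableOn_sum_clm _ fun i j => hA i i.2 j j.2

lemma derivWithin_blockOp {r k : ℕ} {s : Set ℝ} {t : ℝ} {A : ℝ → ℕ → ℕ → E →L[ℂ] E}
    {A' : ℕ → ℕ → E →L[ℂ] E} (hs : UniqueDiffWithinAt ℝ s t)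
    (hA : ∀ i < r, ∀ j < k, HasDerivWithinAt (fun t => A t i j) (A' i j) s t) :
    opDerivWithin (fun t => (blockOp (A t) : BlockSpace E k →L[ℂ] BlockSpace E r)) s t =
      blockOp A' := by
  simp only [blockOp_eq_sum]
  exact opDerivWithin_sum _ hs fun i j => hA i i.2 j j.2

variable [CompleteSpace E]

lemma adjoint_blockOp {r k : ℕ} (A : ℕ → ℕ → E →L[ℂ] E) :
    adjoint (blockOp A : BlockSpace E k →L[ℂ] BlockSpace E r) =
      blockOp fun i j => adjoint (A j i) := by
  symm
  rw [ContinuousLinearMap.eq_adjoint_iff]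
  intro x y
  rw [inner_eq_sum_coord, inner_eq_sum_coord]
  have h1 : ∀ i ∈ Finset.range k, inner ℂ (coord k i ((blockOp fun i j => adjoint (A j i)) x))
      (coord k i y) = ∑ j ∈ Finset.range r, inner ℂ (coord r j x) (A j i (coord k i y)) := by
    intro i hi
    rw [coord_blockOp (Finset.mem_range.1 hi), sum_inner]
    simp only [ContinuousLinearMap.adjoint_inner_left]
  have h2 : ∀ j ∈ Finset.range r, inner ℂ (coord r j x) (coord r j (blockOp A y)) =
      ∑ i ∈ Finset.range k, inner ℂ (coord r j x) (A j i (coord k i y)) := by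
    intro j hj
    rw [coord_blockOp (Finset.mem_range.1 hj), inner_sum]
  rw [Finset.sum_congr rfl h1, Finset.sum_congr rfl h2, Finset.sum_comm]

end DiffExpr

section Sums

variable {M : Type*} [AddCommMonoid M]

lemma sum_range_ite_eq {k c : ℕ} {p : ℕ → Prop} [DecidablePred p] (f : ℕ → M) (hc : c < k)
    (h : ∀ j < k, (p j ↔ j = c)) : ∑ j ∈ Finset.range k, (if p j then f j else 0) = f c := by
  rw [Finset.sum_eq_single c]
  · rw [if_pos ((h c hc).2 rfl)]
  · intro j hj hne
    rw [if_neg fun hp => hne ((h j (Finset.mem_range.1 hj)).1 hp)]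
  · intro h'
    exact absurd (Finset.mem_range.2 hc) h'

lemma sum_range_ite_zero {k : ℕ} {p : ℕ → Prop} [DecidablePred p] (f : ℕ → M)
    (h : ∀ j < k, ¬p j) : ∑ j ∈ Finset.range k, (if p j then f j else 0) = 0 :=
  Finset.sum_eq_zero fun j hj => if_neg (h j (Finset.mem_range.1 hj))

end Sums

end

/-! ### Rows of the form and rows of the coefficient `H` -/

section

variable {E : Type*} [NormedAddCommGroup E] [InnerProductSpace ℂ E] [CompleteSpace E]

open ContinuousLinearMap (adjoint)
open BlockSpace

namespace DiffExpr

/-- The vector `p_j g_j + (i/2) (s_{j+1} g_{j+1} - q_j g_{j-1})`, `q_0 = 0`. -/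
def formRow (l : DiffExpr E) (t : ℝ) (g : ℕ → E) (j : ℕ) : E :=
  l.p j t (g j) + (Complex.I / 2) •
    (l.s (j + 1) t (g (j + 1)) - if j = 0 then 0 else l.q j t (g (j - 1)))

/-- The vector `p_n g_n - (i/2) q_n g_{n-1}`, `q_0 = 0`. -/
def lastRow (l : DiffExpr E) (t : ℝ) (g : ℕ → E) (n : ℕ) : E :=
  l.p n t (g n) - if n = 0 then 0 else (Complex.I / 2) • l.q n t (g (n - 1))

variable {l : DiffExpr E} {t : ℝ}

lemma ite_clm_apply {p : Prop} [Decidable p] (A : E →L[ℂ] E) (v : E) :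
    (if p then A else 0) v = if p then A v else 0 := by split_ifs <;> simp

/-- The `j`-th component of `T(t, l) x`. -/
def jet (l : DiffExpr E) (r : ℕ) (t : ℝ) (j : ℕ) : BlockSpace E r →L[ℂ] E :=
  coord (r / 2 + 1) j ∘L l.jetOp r t

lemma jet_apply (r j : ℕ) (x : BlockSpace E r) :
    l.jet r t j x = coord (r / 2 + 1) j (l.jetOp r t x) := rfl

lemma jet_of_lt {r j : ℕ} (hj : j < r / 2) (x : BlockSpace E r) :
    l.jet r t j x = coord r j x := by
  rw [jet_apply, jetOp, coord_blockOp (by omega)]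
  simp only [hj, if_true, ite_clm_apply, one_apply_eq_self]
  exact sum_range_ite_eq _ (by omega) fun _ _ => Iff.rfl

/-- For even order the derivative of order `n` is not a component; it is recovered by solving
`u_{n-1} = p_n g_n - (i/2) q_n g_{n-1}` for `g_n`. -/
lemma jet_even {n : ℕ} (hn : n ≠ 0) (x : BlockSpace E (2 * n)) :
    l.jet (2 * n) t n x = Ring.inverse (l.p n t)
      (coord (2 * n) (2 * n - 1) x + (Complex.I / 2) • l.q n t (coord (2 * n) (n - 1) x)) := by
  rw [jet_apply, jetOp, coord_blockOp (by omega)]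
  have h2 : 2 * n / 2 = n := by omega
  have he : Even (2 * n) := even_two_mul n
  simp only [h2, lt_irrefl, if_false, he, if_true]
  have h : ∀ j ∈ Finset.range (2 * n), (if j + 1 = 2 * n then Ring.inverse (l.p n t)
      else if j + 1 = n then (Complex.I / 2) • (Ring.inverse (l.p n t) ∘L l.q n t) else 0)
        (coord (2 * n) j x) = (if j + 1 = 2 * n then Ring.inverse (l.p n t) (coord (2 * n) j x) else 0) +
      (if j + 1 = n then (Complex.I / 2) • Ring.inverse (l.p n t) (l.q n t (coord (2 * n) j x)) else 0) := by
    intro j _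
    split_ifs
    · omega
    · simp
    · simp
    · simp
  rw [Finset.sum_congr rfl h, Finset.sum_add_distrib,
    sum_range_ite_eq (c := 2 * n - 1) _ (by omega) (fun j _ => by omega),
    sum_range_ite_eq (c := n - 1) _ (by omega) (fun j _ => by omega)]
  simp

lemma jet_odd {n : ℕ} (hn : n ≠ 0) (x : BlockSpace E (2 * n + 1)) :
    l.jet (2 * n + 1) t n x =
      Complex.I • coord (2 * n + 1) (2 * n) x := by
  rw [jet_apply, jetOp, coord_blockOp (by omega)]
  have h2 : (2 * n + 1) / 2 = n := by omega
  have he : ¬Even (2 * n + 1) := by simp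
  have h1 : ¬(2 * n + 1 = 1) := by omega
  simp only [h2, lt_irrefl, if_false, he, h1, ite_clm_apply]
  rw [sum_range_ite_eq (c := 2 * n) _ (by omega) (fun j _ => by omega)]
  simp

lemma jet_one (x : BlockSpace E 1) :
    l.jet 1 t 0 x = coord 1 0 x := by
  rw [jet_apply, jetOp, coord_blockOp (by omega)]
  simp

/-- The row with index `σ/2` has no `s`-term, because coefficients of larger index count as zero.
This is why `lastRow` is kept separate from `formRow`. -/
lemma coord_formMatrix {m : DiffExpr E} {σ n i : ℕ} (hσ : σ / 2 ≤ n) (hi : i < n + 1)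
    (g : BlockSpace E (n + 1)) :
    coord (n + 1) i (m.formMatrix σ n t g) =
      if i ≤ σ / 2 then (if i < σ / 2 then m.formRow t (fun j => coord (n + 1) j g) i
        else m.lastRow t (fun j => coord (n + 1) j g) i) else 0 := by
  rw [formMatrix, coord_blockOp hi]
  set x := fun j => coord (n + 1) j g with hx
  have h : ∀ j ∈ Finset.range (n + 1), (if i = j ∧ i ≤ σ / 2 then m.p i t
      else if i = j + 1 ∧ i ≤ σ / 2 then -((Complex.I / 2) • m.q i t)
      else if j = i + 1 ∧ j ≤ σ / 2 then (Complex.I / 2) • m.s j t else 0) (x j) =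
      (if i = j ∧ i ≤ σ / 2 then m.p i t (x j) else 0) +
      (if i = j + 1 ∧ i ≤ σ / 2 then -((Complex.I / 2) • m.q i t (x j)) else 0) +
      (if j = i + 1 ∧ j ≤ σ / 2 then (Complex.I / 2) • m.s j t (x j) else 0) := by
    intro j _
    split_ifs <;> first | omega | simp
  rw [Finset.sum_congr rfl h, Finset.sum_add_distrib, Finset.sum_add_distrib]
  by_cases h1 : i ≤ σ / 2
  · rw [if_pos h1, sum_range_ite_eq (c := i) _ hi (fun j _ => by omega)]
    have e2 : (∑ j ∈ Finset.range (n + 1),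
        if i = j + 1 ∧ i ≤ σ / 2 then -((Complex.I / 2) • m.q i t (x j)) else 0) =
        -(if i = 0 then 0 else (Complex.I / 2) • m.q i t (x (i - 1))) := by
      by_cases h0 : i = 0
      · rw [if_pos h0, sum_range_ite_zero _ (fun j _ => by omega), neg_zero]
      · rw [if_neg h0, sum_range_ite_eq (c := i - 1) _ (by omega) (fun j _ => by omega)]
    rw [e2]
    by_cases h3 : i < σ / 2
    · rw [if_pos h3, sum_range_ite_eq (c := i + 1) _ (by omega) (fun j _ => by omega), formRow]
      split_ifs
      · simp
      · simp [smul_sub]; abel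
    · rw [if_neg h3, sum_range_ite_zero _ (fun j _ => by omega), lastRow]
      abel
  · rw [if_neg h1, sum_range_ite_zero _ (fun j _ => by omega),
      sum_range_ite_zero _ (fun j _ => by omega), sum_range_ite_zero _ (fun j _ => by omega)]
    simp

lemma formRow_congr {g g' : ℕ → E} {j : ℕ} (h : ∀ i ≤ j + 1, g i = g' i) :
    l.formRow t g j = l.formRow t g' j := by
  rw [formRow, formRow, h j (by omega), h (j + 1) le_rfl, h (j - 1) (by omega)]

lemma lastRow_congr {g g' : ℕ → E} {j : ℕ} (h : ∀ i ≤ j, g i = g' i) :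
    l.lastRow t g j = l.lastRow t g' j := by
  rw [lastRow, lastRow, h j le_rfl, h (j - 1) (by omega)]

/-- The form of even order written through its rows. -/
lemma form_two_mul (n : ℕ) (g h : ℕ → E) :
    l.form (2 * n) t g h = ∑ j ∈ Finset.range n, inner ℂ (h j) (l.formRow t g j) +
      inner ℂ (h n) (l.lastRow t g n) := by
  have h1 : 2 * n / 2 = n := by omega
  have h2 : (2 * n + 1) / 2 = n := by omega
  rw [form, h1, h2]
  have h3 : ∀ n, ∑ j ∈ Finset.Icc 1 n, (inner ℂ (h (j - 1)) (l.s j t (g j)) -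
      inner ℂ (h j) (l.q j t (g (j - 1)))) = ∑ j ∈ Finset.range n,
        (inner ℂ (h j) (l.s (j + 1) t (g (j + 1))) - inner ℂ (h (j + 1)) (l.q (j + 1) t (g j))) := by
    intro n
    rw [← Finset.Ico_add_one_right_eq_Icc, Finset.sum_Ico_eq_sum_range]
    refine Finset.sum_congr (by simp) fun j _ => ?_
    rw [show 1 + j = j + 1 by ring, Nat.add_sub_cancel]
  rw [h3, Finset.mul_sum]
  induction n with
  | zero => simp [lastRow]
  | succ n ih =>
    have ih := ih (by omega) (by omega)
    rw [Finset.sum_range_succ _ (n + 1),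
      Finset.sum_range_succ (fun j => inner ℂ (h j) (l.formRow t g j)) n,
      Finset.sum_range_succ (fun j => Complex.I / 2 * (inner ℂ (h j) (l.s (j + 1) t (g (j + 1))) -
        inner ℂ (h (j + 1)) (l.q (j + 1) t (g j)))) n]
    have h4 : l.lastRow t g (n + 1) = l.p (n + 1) t (g (n + 1)) -
        (Complex.I / 2) • l.q (n + 1) t (g n) := by simp [lastRow]
    -- Passing from `n` to `n + 1`, the former last row gains its `s`-term and becomes an ordinary
    -- row.
    have h5 : l.formRow t g n = l.lastRow t g n + (Complex.I / 2) • l.s (n + 1) t (g (n + 1)) := by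
      rw [formRow, lastRow]; split_ifs
      · simp
      · simp [smul_sub]; abel
    rw [h4, h5, inner_sub_right, inner_add_right, inner_smul_right, inner_smul_right]
    linear_combination ih

lemma form_two_mul_add_one (n : ℕ) (g h : ℕ → E) :
    l.form (2 * n + 1) t g h = l.form (2 * n) t g h + (Complex.I / 2) *
      (inner ℂ (h n) (l.s (n + 1) t (g (n + 1))) - inner ℂ (h (n + 1)) (l.q (n + 1) t (g n))) := by
  have h1 : 2 * n / 2 = n := by omega
  have h2 : (2 * n + 1) / 2 = n := by omega
  have h3 : (2 * n + 1 + 1) / 2 = n + 1 := by omega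
  rw [form, form, h1, h2, h3, Finset.sum_Icc_succ_top (by omega), Nat.add_sub_cancel]
  ring

lemma inner_formMatrix {m : DiffExpr E} {σ n : ℕ} (hσ : 2 * σ ≤ 2 * n) (g h : BlockSpace E (n + 1)) :
    inner ℂ h (m.formMatrix (2 * σ) n t g) =
      m.form (2 * σ) t (fun j => coord (n + 1) j g) (fun j => coord (n + 1) j h) := by
  have h1 : 2 * σ / 2 = σ := by omega
  rw [inner_eq_sum_coord, form_two_mul]
  have h2 : ∀ i ∈ Finset.range (n + 1), inner ℂ (coord (n + 1) i h)
      (coord (n + 1) i (m.formMatrix (2 * σ) n t g)) = if i < σ + 1 then (if i < σ then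
        inner ℂ (coord (n + 1) i h) (m.formRow t (fun j => coord (n + 1) j g) i) else
        inner ℂ (coord (n + 1) i h) (m.lastRow t (fun j => coord (n + 1) j g) i)) else 0 := by
    intro i hi
    rw [coord_formMatrix (by omega) (Finset.mem_range.1 hi), h1]
    split_ifs <;> first | omega | simp
  rw [Finset.sum_congr rfl h2, ← Finset.sum_filter]
  have h3 : (Finset.range (n + 1)).filter (fun i => i < σ + 1) = Finset.range (σ + 1) := by
    ext i; simp; omega
  rw [h3, Finset.sum_range_succ, if_neg (lt_irrefl σ)]
  congr 1
  exact Finset.sum_congr rfl fun i hi => by rw [if_pos (Finset.mem_range.1 hi)]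

lemma Hcoeff_even (n : ℕ) : l.Hcoeff (2 * n) t = blockOp (l.HentryEven n t) := by
  rw [Hcoeff, if_pos (even_two_mul n), show 2 * n / 2 = n by omega]

lemma Hcoeff_odd (n : ℕ) : l.Hcoeff (2 * n + 1) t = blockOp (l.HentryOdd n t) := by
  rw [Hcoeff, if_neg (by simp), show (2 * n + 1) / 2 = n by omega]

/-- The exceptional entries `(1/4) s_n p_n⁻¹ q_n` and `-(i/2) s_n p_n⁻¹` are what `-(i/2) s_n g_n`
becomes when `g_n` is expressed through the components; otherwise the row is that of the form with
the opposite sign plus a shift. -/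
lemma coord_Hcoeff_even_left {n i : ℕ} (hi : i < n)
    (x : BlockSpace E (2 * n)) :
    coord (2 * n) i (l.Hcoeff (2 * n) t x) =
      -l.formRow t (fun j => l.jet (2 * n) t j x) i +
        if i = 0 then 0 else coord (2 * n) (n + (i - 1)) x := by
  set y := fun j => coord (2 * n) j x with hy
  have hg : ∀ j < n, l.jet (2 * n) t j x = y j :=
    fun j hj => jet_of_lt (by omega) x
  have hgn := jet_even (l := l) (t := t) (n := n) (by omega) x
  rw [Hcoeff_even, coord_blockOp (by omega)]
  set P := Ring.inverse (l.p n t) with hP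
  -- The nested case distinction is split into a sum of five families, each supported on at most one
  -- column; every column sum then collapses.
  have h : ∀ j ∈ Finset.range (2 * n), l.HentryEven n t i j (y j) =
      (if j = i then (if i + 1 = n then (1 / 4 : ℂ) • l.s n t (P (l.q n t (y j))) else 0) -
        l.p i t (y j) else 0) +
      (if j + 1 = i then (Complex.I / 2) • l.q i t (y j) else 0) +
      (if j = i + 1 ∧ i + 1 ≠ n then -((Complex.I / 2) • l.s (i + 1) t (y j)) else 0) +
      (if j + 1 = i + n ∧ i ≠ 0 then y j else 0) +
      (if j = i + n ∧ i + 1 = n then -((Complex.I / 2) • l.s n t (P (y j))) else 0) := by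
    intro j hj
    rw [Finset.mem_range] at hj
    rw [HentryEven, if_pos hi]
    simp only [← hP]
    by_cases hj1 : j < n
    · have c4 : ¬(j + 1 = i + n ∧ i ≠ 0) := by omega
      have c5 : ¬(j = i + n ∧ i + 1 = n) := by omega
      rw [if_pos hj1, if_neg c4, if_neg c5]
      rcases lt_trichotomy j i with c | c | c
      · have c1 : ¬(i = j) := by omega
        have c2 : ¬(j = i) := by omega
        have c3 : ¬(j = i + 1) := by omega
        have c7 : ¬(j = i + 1 ∧ i + 1 ≠ n) := by omega
        by_cases c6 : j + 1 = i
        · rw [if_neg c1, if_pos c6.symm, if_neg c2, if_pos c6, if_neg c7]; simp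
        · rw [if_neg c1, if_neg (by omega), if_neg c3, if_neg c2, if_neg c6, if_neg c7]; simp
      · subst c
        have c7 : ¬(n = j) := by omega
        by_cases c6 : j + 1 = n <;> simp [c6, c7]
      · have c1 : ¬(i = j) := by omega
        have c2 : ¬(j = i) := by omega
        have c3 : ¬(j + 1 = i) := by omega
        have c4 : ¬(i = j + 1) := by omega
        by_cases c6 : j = i + 1
        · have c7 : i + 1 ≠ n := by omega
          rw [if_neg c1, if_neg c4, if_pos c6, if_neg c2, if_neg c3, if_pos ⟨c6, c7⟩, c6]
          simp
        · simp [c1, c2, c3, c4, c6]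
    · have c1 : ¬(j = i) := by omega
      have c2 : ¬(j + 1 = i) := by omega
      have c3 : ¬(j = i + 1 ∧ i + 1 ≠ n) := by omega
      rw [if_neg hj1, if_neg c1, if_neg c2, if_neg c3]
      by_cases c4 : i = j - n + 1
      · have c5 : j + 1 = i + n ∧ i ≠ 0 := by omega
        have c6 : ¬(j = i + n ∧ i + 1 = n) := by omega
        rw [if_pos c4, if_pos c5, if_neg c6]
        simp
      · have c5 : ¬(j + 1 = i + n ∧ i ≠ 0) := by omega
        rw [if_neg c4, if_neg c5]
        by_cases c6 : j = i + n ∧ i + 1 = n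
        · rw [if_pos (by omega), if_pos c6]
          simp
        · rw [if_neg (by omega), if_neg c6]
          simp
  rw [Finset.sum_congr rfl h]
  simp only [Finset.sum_add_distrib]
  rw [sum_range_ite_eq (c := i) _ (by omega) (fun j _ => Iff.rfl)]
  have e2 : (∑ j ∈ Finset.range (2 * n), if j + 1 = i then (Complex.I / 2) • l.q i t (y j) else 0) =
      if i = 0 then 0 else (Complex.I / 2) • l.q i t (y (i - 1)) := by
    by_cases c : i = 0
    · rw [if_pos c, sum_range_ite_zero _ (fun j _ => by omega)]
    · rw [if_neg c, sum_range_ite_eq (c := i - 1) _ (by omega) (fun j _ => by omega)]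
  have e4 : (∑ j ∈ Finset.range (2 * n), if j + 1 = i + n ∧ i ≠ 0 then y j else 0) =
      if i = 0 then 0 else y (n + (i - 1)) := by
    by_cases c : i = 0
    · rw [if_pos c, sum_range_ite_zero _ (fun j _ => by omega)]
    · rw [if_neg c, sum_range_ite_eq (c := n + (i - 1)) _ (by omega) (fun j _ => by omega)]
  rw [e2, e4, formRow, hg i hi]
  have e5 : (if i = 0 then (0 : E) else l.q i t
      (l.jet (2 * n) t (i - 1) x)) =
      if i = 0 then 0 else l.q i t (y (i - 1)) := by
    split_ifs
    · rfl
    · rw [hg _ (by omega)]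
  rw [e5]
  by_cases c : i + 1 = n
  · rw [sum_range_ite_zero (p := fun j => j = i + 1 ∧ i + 1 ≠ n) _ (fun j _ => by omega),
      sum_range_ite_eq (c := i + n) _ (by omega) (fun j _ => by omega), if_pos c, c, hgn]
    have e6 : y (i + n) = coord (2 * n) (2 * n - 1) x := by
      rw [show 2 * n - 1 = i + n by omega]
    have e7 : y i = coord (2 * n) (n - 1) x := by
      rw [show n - 1 = i by omega]
    rw [← e6, ← e7]
    have hI : Complex.I / 2 * (Complex.I / 2) = -(1 / 4) := by
      linear_combination (1 / 4 : ℂ) * Complex.I_mul_I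
    simp only [map_add, map_smul, smul_sub, smul_add, smul_smul, hI]
    split_ifs <;> simp <;> abel
  · rw [sum_range_ite_eq (c := i + 1) _ (by omega) (fun j _ => by omega),
      sum_range_ite_zero (p := fun j => j = i + n ∧ i + 1 = n) _ (fun j _ => by omega),
      if_neg c, hg (i + 1) (by omega)]
    split_ifs <;> simp [smul_sub] <;> abel

lemma coord_Hcoeff_even_right {n i : ℕ} (hi : i < n) (x : BlockSpace E (2 * n)) :
    coord (2 * n) (n + i) (l.Hcoeff (2 * n) t x) =
      l.jet (2 * n) t (i + 1) x := by
  rw [Hcoeff_even, coord_blockOp (by omega)]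
  set y := fun j => coord (2 * n) j x with hy
  set P := Ring.inverse (l.p n t) with hP
  have h : ∀ j ∈ Finset.range (2 * n), l.HentryEven n t (n + i) j (y j) =
      (if j = i + 1 ∧ i + 1 ≠ n then y j else 0) +
      (if j = i ∧ i + 1 = n then (Complex.I / 2) • P (l.q n t (y j)) else 0) +
      (if j + 1 = 2 * n ∧ i + 1 = n then P (y j) else 0) := by
    intro j hj
    rw [Finset.mem_range] at hj
    rw [HentryEven, if_neg (by omega : ¬(n + i < n)), Nat.add_sub_cancel_left]
    simp only [← hP]
    by_cases hj1 : j < n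
    · rw [if_pos hj1, if_neg (by omega : ¬(j + 1 = 2 * n ∧ i + 1 = n))]
      by_cases c : j = i + 1
      · rw [if_pos c, if_pos (by omega), if_neg (by omega)]
        simp
      · rw [if_neg c, if_neg (by omega : ¬(j = i + 1 ∧ i + 1 ≠ n))]
        by_cases c2 : j = i ∧ i + 1 = n
        · rw [if_pos (by omega), if_pos c2]; simp
        · rw [if_neg (by omega), if_neg c2]; simp
    · rw [if_neg hj1, if_neg (by omega : ¬(j = i + 1 ∧ i + 1 ≠ n)),
        if_neg (by omega : ¬(j = i ∧ i + 1 = n))]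
      by_cases c : j + 1 = 2 * n ∧ i + 1 = n
      · rw [if_pos (by omega), if_pos c]; simp
      · rw [if_neg (by omega), if_neg c]; simp
  rw [Finset.sum_congr rfl h]
  simp only [Finset.sum_add_distrib]
  by_cases c : i + 1 = n
  · have hgn := jet_even (l := l) (t := t) (n := n) (by omega) x
    rw [sum_range_ite_zero _ (fun j _ => by omega),
      sum_range_ite_eq (c := i) _ (by omega) (fun j _ => by omega),
      sum_range_ite_eq (c := 2 * n - 1) _ (by omega) (fun j _ => by omega), c, hgn,
      show n - 1 = i by omega]
    simp only [map_add, map_smul, hy, hP]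
    abel
  · rw [sum_range_ite_eq (c := i + 1) _ (by omega) (fun j _ => by omega),
      sum_range_ite_zero _ (fun j _ => by omega), sum_range_ite_zero _ (fun j _ => by omega)]
    rw [jet_of_lt (by omega)]
    simp [hy]

/-- The same pattern as in even order, with `g_n = i w`: the entry `s_n/2` is `-(i/2) s_n` times
`i`. -/
lemma coord_Hcoeff_odd_left {n i : ℕ} (hi : i < n) (x : BlockSpace E (2 * n + 1)) :
    coord (2 * n + 1) i (l.Hcoeff (2 * n + 1) t x) =
      -l.formRow t (fun j => l.jet (2 * n + 1) t j x) i +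
        if i = 0 then 0 else coord (2 * n + 1) (n + (i - 1)) x := by
  set y := fun j => coord (2 * n + 1) j x with hy
  have hg : ∀ j < n, l.jet (2 * n + 1) t j x = y j :=
    fun j hj => jet_of_lt (by omega) x
  have hgn := jet_odd (l := l) (t := t) (n := n) (by omega) x
  rw [Hcoeff_odd, coord_blockOp (by omega)]
  have h : ∀ j ∈ Finset.range (2 * n + 1), l.HentryOdd n t i j (y j) =
      (if j = i then -l.p i t (y j) else 0) +
      (if j + 1 = i then (Complex.I / 2) • l.q i t (y j) else 0) +
      (if j = i + 1 ∧ i + 1 ≠ n then -((Complex.I / 2) • l.s (i + 1) t (y j)) else 0) +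
      (if j + 1 = i + n ∧ i ≠ 0 then y j else 0) +
      (if j = 2 * n ∧ i + 1 = n then (1 / 2 : ℂ) • l.s n t (y j) else 0) := by
    intro j hj
    rw [Finset.mem_range] at hj
    rw [HentryOdd, if_pos hi]
    by_cases hj1 : j < n
    · have c4 : ¬(j + 1 = i + n ∧ i ≠ 0) := by omega
      have c5 : ¬(j = 2 * n ∧ i + 1 = n) := by omega
      rw [if_pos hj1, if_neg c4, if_neg c5]
      rcases lt_trichotomy j i with c | c | c
      · have c1 : ¬(i = j) := by omega
        have c2 : ¬(j = i) := by omega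
        have c3 : ¬(j = i + 1) := by omega
        have c7 : ¬(j = i + 1 ∧ i + 1 ≠ n) := by omega
        by_cases c6 : j + 1 = i
        · rw [if_neg c1, if_pos c6.symm, if_neg c2, if_pos c6, if_neg c7]; simp
        · rw [if_neg c1, if_neg (by omega), if_neg c3, if_neg c2, if_neg c6, if_neg c7]; simp
      · subst c
        simp
      · have c1 : ¬(i = j) := by omega
        have c2 : ¬(j = i) := by omega
        have c3 : ¬(j + 1 = i) := by omega
        have c4 : ¬(i = j + 1) := by omega
        by_cases c6 : j = i + 1
        · have c7 : i + 1 ≠ n := by omega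
          rw [if_neg c1, if_neg c4, if_pos c6, if_neg c2, if_neg c3, if_pos ⟨c6, c7⟩, c6]
          simp
        · simp [c1, c2, c3, c4, c6]
    · have c1 : ¬(j = i) := by omega
      have c2 : ¬(j + 1 = i) := by omega
      have c3 : ¬(j = i + 1 ∧ i + 1 ≠ n) := by omega
      rw [if_neg hj1, if_neg c1, if_neg c2, if_neg c3]
      by_cases c4 : i = j - n + 1
      · have c5 : j + 1 = i + n ∧ i ≠ 0 := by omega
        have c6 : ¬(j = 2 * n ∧ i + 1 = n) := by omega
        rw [if_pos c4, if_pos c5, if_neg c6]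
        simp
      · have c5 : ¬(j + 1 = i + n ∧ i ≠ 0) := by omega
        rw [if_neg c4, if_neg c5]
        by_cases c6 : j = 2 * n ∧ i + 1 = n
        · rw [if_pos (by omega), if_pos c6]
          simp
        · rw [if_neg (by omega), if_neg c6]
          simp
  rw [Finset.sum_congr rfl h]
  simp only [Finset.sum_add_distrib]
  rw [sum_range_ite_eq (c := i) _ (by omega) (fun j _ => Iff.rfl)]
  have e2 : (∑ j ∈ Finset.range (2 * n + 1),
      if j + 1 = i then (Complex.I / 2) • l.q i t (y j) else 0) =
      if i = 0 then 0 else (Complex.I / 2) • l.q i t (y (i - 1)) := by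
    by_cases c : i = 0
    · rw [if_pos c, sum_range_ite_zero _ (fun j _ => by omega)]
    · rw [if_neg c, sum_range_ite_eq (c := i - 1) _ (by omega) (fun j _ => by omega)]
  have e4 : (∑ j ∈ Finset.range (2 * n + 1), if j + 1 = i + n ∧ i ≠ 0 then y j else 0) =
      if i = 0 then 0 else y (n + (i - 1)) := by
    by_cases c : i = 0
    · rw [if_pos c, sum_range_ite_zero _ (fun j _ => by omega)]
    · rw [if_neg c, sum_range_ite_eq (c := n + (i - 1)) _ (by omega) (fun j _ => by omega)]
  rw [e2, e4, formRow, hg i hi]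
  have e5 : (if i = 0 then (0 : E) else l.q i t
      (l.jet (2 * n + 1) t (i - 1) x)) =
      if i = 0 then 0 else l.q i t (y (i - 1)) := by
    split_ifs
    · rfl
    · rw [hg _ (by omega)]
  rw [e5]
  by_cases c : i + 1 = n
  · rw [sum_range_ite_zero (p := fun j => j = i + 1 ∧ i + 1 ≠ n) _ (fun j _ => by omega),
      sum_range_ite_eq (c := 2 * n) _ (by omega) (fun j _ => by omega), c, hgn]
    have hI : Complex.I / 2 * Complex.I = -(1 / 2) := by
      linear_combination (1 / 2 : ℂ) * Complex.I_mul_I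
    simp only [map_smul, smul_sub, smul_smul, hI]
    split_ifs <;> simp [hy] <;> abel
  · rw [sum_range_ite_eq (c := i + 1) _ (by omega) (fun j _ => by omega),
      sum_range_ite_zero (p := fun j => j = 2 * n ∧ i + 1 = n) _ (fun j _ => by omega),
      hg (i + 1) (by omega)]
    split_ifs <;> simp [smul_sub] <;> abel

lemma coord_Hcoeff_odd_right {n i : ℕ} (hi : i < n) (x : BlockSpace E (2 * n + 1)) :
    coord (2 * n + 1) (n + i) (l.Hcoeff (2 * n + 1) t x) =
      l.jet (2 * n + 1) t (i + 1) x := by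
  rw [Hcoeff_odd, coord_blockOp (by omega)]
  set y := fun j => coord (2 * n + 1) j x with hy
  have h : ∀ j ∈ Finset.range (2 * n + 1), l.HentryOdd n t (n + i) j (y j) =
      (if j = i + 1 ∧ i + 1 ≠ n then y j else 0) +
      (if j = 2 * n ∧ i + 1 = n then Complex.I • y j else 0) := by
    intro j hj
    rw [Finset.mem_range] at hj
    rw [HentryOdd, if_neg (by omega : ¬(n + i < n)), Nat.add_sub_cancel_left]
    by_cases hj1 : j < n
    · rw [if_pos hj1, if_neg (by omega : ¬(j = 2 * n ∧ i + 1 = n))]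
      by_cases c : j = i + 1
      · rw [if_pos c, if_pos (by omega)]
        simp
      · rw [if_neg c, if_neg (by omega), if_neg (by omega)]
        simp
    · rw [if_neg hj1, if_neg (by omega : ¬(j = i + 1 ∧ i + 1 ≠ n)), if_neg (by omega)]
      by_cases c : j = 2 * n ∧ i + 1 = n
      · rw [if_pos (by omega), if_pos c]; simp
      · rw [if_neg (by omega), if_neg (by omega), if_neg c]; simp
  rw [Finset.sum_congr rfl h]
  simp only [Finset.sum_add_distrib]
  by_cases c : i + 1 = n
  · have hgn := jet_odd (l := l) (t := t) (n := n) (by omega) x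
    rw [sum_range_ite_zero _ (fun j _ => by omega),
      sum_range_ite_eq (c := 2 * n) _ (by omega) (fun j _ => by omega), c, hgn, zero_add]
  · rw [sum_range_ite_eq (c := i + 1) _ (by omega) (fun j _ => by omega),
      sum_range_ite_zero _ (fun j _ => by omega)]
    rw [jet_of_lt (by omega)]
    simp [hy]

lemma coord_Hcoeff_odd_last {n : ℕ} (hn : n ≠ 0) (x : BlockSpace E (2 * n + 1)) :
    coord (2 * n + 1) (2 * n) (l.Hcoeff (2 * n + 1) t x) = Complex.I •
      (l.lastRow t (fun j => l.jet (2 * n + 1) t j x) n -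
        coord (2 * n + 1) (n + (n - 1)) x) := by
  rw [Hcoeff_odd, coord_blockOp (by omega)]
  set y := fun j => coord (2 * n + 1) j x with hy
  have h : ∀ j ∈ Finset.range (2 * n + 1), l.HentryOdd n t (2 * n) j (y j) =
      (if j + 1 = n then (1 / 2 : ℂ) • l.q n t (y j) else 0) +
      (if j = 2 * n then -l.p n t (y j) else 0) +
      (if j + 1 = 2 * n then -(Complex.I • y j) else 0) := by
    intro j hj
    rw [Finset.mem_range] at hj
    rw [HentryOdd, if_neg (by omega : ¬(2 * n < n))]
    by_cases hj1 : j < n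
    · rw [if_pos hj1, if_neg (by omega), if_neg (by omega : ¬(j = 2 * n)),
        if_neg (by omega : ¬(j + 1 = 2 * n))]
      by_cases c : j + 1 = n
      · rw [if_pos (by omega), if_pos c]; simp
      · rw [if_neg (by omega), if_neg c]; simp
    · rw [if_neg hj1, if_neg (by omega : ¬(j + 1 = n))]
      by_cases c : j = 2 * n
      · rw [if_pos (by omega), if_pos c, if_neg (by omega)]; simp
      · rw [if_neg (by omega), if_neg (by omega), if_neg c]
        by_cases c2 : j + 1 = 2 * n
        · rw [if_pos (by omega), if_pos c2]; simp
        · rw [if_neg (by omega), if_neg c2]; simp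
  rw [Finset.sum_congr rfl h]
  simp only [Finset.sum_add_distrib]
  have hgn := jet_odd (l := l) (t := t) (n := n) (by omega) x
  have hg1 := jet_of_lt (l := l) (t := t) (r := 2 * n + 1) (j := n - 1) (by omega) x
  rw [sum_range_ite_eq (c := n - 1) _ (by omega) (fun j _ => by omega),
    sum_range_ite_eq (c := 2 * n) _ (by omega) (fun j _ => by omega),
    sum_range_ite_eq (c := 2 * n - 1) _ (by omega) (fun j _ => by omega), lastRow, if_neg hn,
    hgn, hg1, show n + (n - 1) = 2 * n - 1 by omega]
  have hI : Complex.I * (Complex.I / 2) = -(1 / 2) := by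
    linear_combination (1 / 2 : ℂ) * Complex.I_mul_I
  simp only [map_smul, smul_sub, smul_smul, hI, Complex.I_mul_I]
  simp only [neg_smul, one_smul, hy]
  abel

lemma coord_Hcoeff_one (x : BlockSpace E 1) :
    coord 1 0 (l.Hcoeff 1 t x) = -l.p 0 t (coord 1 0 x) := by
  rw [Hcoeff, coord_blockOp (by omega), if_neg (by simp)]
  simp [HentryOdd]

end DiffExpr

end

/-! ### The identity between `H` and the form of the expression -/

section

variable {E : Type*} [NormedAddCommGroup E] [InnerProductSpace ℂ E] [CompleteSpace E]

open ContinuousLinearMap (adjoint)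
open BlockSpace

/-- A shift of summation index for quantities attached to the neighbouring pair `(j, j - 1)`, with
the top term accounted for separately. It pairs the shifts in `H` here and the `q`-terms of the
expression later. -/
lemma sum_shift_pred {M : Type*} [AddCommMonoid M] (f : ℕ → ℕ → M) (n : ℕ) :
    ∑ j ∈ Finset.range n, (if j = 0 then 0 else f j (j - 1)) + (if n = 0 then 0 else f n (n - 1)) =
      ∑ j ∈ Finset.range n, f (j + 1) j := by
  induction n with
  | zero => simp
  | succ n ih =>
    rw [Finset.sum_range_succ, ih, Finset.sum_range_succ]
    simp

namespace DiffExpr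

variable {l l' : DiffExpr E} {t : ℝ}

/-- The inverse of `p_n` in `g_n` cancels `p_n`, so this combination depends on neither coefficient.
This is how solutions for different parameters are compared later. -/
lemma lastRow_jet_even {n : ℕ} (hn : n ≠ 0) (hu : IsUnit (l.p n t)) (x : BlockSpace E (2 * n)) :
    l.lastRow t (fun j => l.jet (2 * n) t j x) n = coord (2 * n) (n + (n - 1)) x := by
  rw [lastRow, if_neg hn, jet_even hn, mul_inverse_apply hu, jet_of_lt (by omega),
    show n + (n - 1) = 2 * n - 1 by omega]
  abel

/-- The rows of the form contained in `H` cancel against the form, and the shifts re-index into the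
pairings of `g_{j+1}` with `u_j`. Two expressions `l` and `l'` are allowed so that the vectors may
belong to different values of the parameter. -/
lemma inner_rows {r n : ℕ} (hr : n + n ≤ r) (hn : r / 2 = n) (x y : BlockSpace E r)
    (hl : ∀ i < n, coord r i (l.Hcoeff r t x) = -l.formRow t (fun j => l.jet r t j x) i +
      if i = 0 then 0 else coord r (n + (i - 1)) x)
    (hu : ∀ i < n, coord r (n + i) (l.Hcoeff r t x) = l.jet r t (i + 1) x) :
    ∑ i ∈ Finset.range (n + n), inner ℂ (coord r i y) (coord r i (l.Hcoeff r t x)) +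
      ∑ j ∈ Finset.range n, inner ℂ (l'.jet r t j y) (l.formRow t (fun j => l.jet r t j x) j) +
      (if n = 0 then 0 else inner ℂ (l'.jet r t n y) (coord r (n + (n - 1)) x)) =
    ∑ j ∈ Finset.range n, (inner ℂ (l'.jet r t (j + 1) y) (coord r (n + j) x) +
      inner ℂ (coord r (n + j) y) (l.jet r t (j + 1) x)) := by
  rw [Finset.sum_range_add, Finset.sum_add_distrib,
    ← sum_shift_pred (fun i j => inner ℂ (l'.jet r t i y) (coord r (n + j) x)) n]
  have h1 : ∑ i ∈ Finset.range n, inner ℂ (coord r i y) (coord r i (l.Hcoeff r t x)) =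
      -∑ j ∈ Finset.range n, inner ℂ (l'.jet r t j y) (l.formRow t (fun j => l.jet r t j x) j) +
      ∑ j ∈ Finset.range n,
        (if j = 0 then 0 else inner ℂ (l'.jet r t j y) (coord r (n + (j - 1)) x)) := by
    rw [← Finset.sum_neg_distrib, ← Finset.sum_add_distrib]
    refine Finset.sum_congr rfl fun i hi => ?_
    rw [Finset.mem_range] at hi
    rw [hl i hi, jet_of_lt (l := l') (by omega) y, inner_add_right, inner_neg_right]
    split_ifs <;> simp
  have h2 : ∑ i ∈ Finset.range n, inner ℂ (coord r (n + i) y) (coord r (n + i) (l.Hcoeff r t x)) =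
      ∑ i ∈ Finset.range n, inner ℂ (coord r (n + i) y) (l.jet r t (i + 1) x) :=
    Finset.sum_congr rfl fun i hi => by rw [hu i (Finset.mem_range.1 hi)]
  rw [h1, h2]
  ring

/-- The quadratic form of `H` differs from that of the expression by a symmetric bilinear term. -/
lemma inner_Hcoeff_add_form {r : ℕ} (hr : 0 < r) (hl : Even r → IsUnit (l.p (r / 2) t))
    (x y : BlockSpace E r) :
    inner ℂ y (l.Hcoeff r t x) +
      l.form (2 * (r / 2)) t (fun j => l.jet r t j x) (fun j => l'.jet r t j y) =
    ∑ j ∈ Finset.range (r / 2), (inner ℂ (l'.jet r t (j + 1) y) (coord r (r / 2 + j) x) +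
      inner ℂ (coord r (r / 2 + j) y) (l.jet r t (j + 1) x)) := by
  rw [form_two_mul, inner_eq_sum_coord]
  rcases Nat.even_or_odd' r with ⟨n, rfl | rfl⟩
  · have h2 : 2 * n / 2 = n := by omega
    have hn : n ≠ 0 := by omega
    rw [h2] at hl ⊢
    have hu := hl (even_two_mul n)
    rw [← inner_rows (by omega) h2 x y (fun i hi => coord_Hcoeff_even_left hi x)
      (fun i hi => coord_Hcoeff_even_right hi x), lastRow_jet_even hn hu, if_neg hn, ← two_mul]
    ring
  · have h2 : (2 * n + 1) / 2 = n := by omega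
    rw [h2, ← inner_rows (by omega) h2 x y (fun i hi => coord_Hcoeff_odd_left hi x)
      (fun i hi => coord_Hcoeff_odd_right hi x), ← two_mul, Finset.sum_range_succ]
    -- In odd order the extra component supplies the row of index `n`. Since `g_n = i w`, the factor
    -- `i` in that row of `H` turns it into minus the last row of the form plus `u_{n-1}`; for `n =
    -- 0` there is no `u`.
    have h : inner ℂ (coord (2 * n + 1) (2 * n) y)
        (coord (2 * n + 1) (2 * n) (l.Hcoeff (2 * n + 1) t x)) +
        inner ℂ (l'.jet (2 * n + 1) t n y) (l.lastRow t (fun j => l.jet (2 * n + 1) t j x) n) =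
        if n = 0 then 0 else
          inner ℂ (l'.jet (2 * n + 1) t n y) (coord (2 * n + 1) (n + (n - 1)) x) := by
      rcases Nat.eq_zero_or_pos n with rfl | hn
      · rw [if_pos rfl]
        change inner ℂ (coord 1 0 y) (coord 1 0 (l.Hcoeff 1 t x)) + inner ℂ (l'.jet 1 t 0 y)
          (l.lastRow t (fun j => l.jet 1 t j x) 0) = 0
        rw [coord_Hcoeff_one, lastRow, if_pos rfl, jet_one, jet_one]
        simp
      · have hn' : n ≠ 0 := by omega
        rw [if_neg hn', coord_Hcoeff_odd_last hn', jet_odd (l := l') hn', inner_smul_left,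
          inner_smul_left, inner_smul_right, inner_sub_right, Complex.conj_I]
        ring
    rw [← h]
    ring

lemma form_congr {r : ℕ} {g g' h h' : ℕ → E} (hg : ∀ j ≤ (r + 1) / 2, g j = g' j)
    (hh : ∀ j ≤ (r + 1) / 2, h j = h' j) : l.form r t g h = l.form r t g' h' := by
  rw [form, form]
  congr 1
  · refine Finset.sum_congr rfl fun j hj => ?_
    rw [Finset.mem_range] at hj
    rw [hg j (by omega), hh j (by omega)]
  · congr 1
    refine Finset.sum_congr rfl fun j hj => ?_
    rw [Finset.mem_Icc] at hj
    rw [hg j hj.2, hh j hj.2, hg (j - 1) (by omega), hh (j - 1) (by omega)]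

namespace IsAnalyticFamily

variable {L : ℂ → DiffExpr E} {r : ℕ} {a b : ℝ} {B : Set ℂ} (hL : IsAnalyticFamily L r a b B)
include hL

lemma conj_mem {z : ℂ} (hz : z ∈ B) : conj z ∈ B := by
  by_cases h : z.im = 0
  · rwa [Complex.conj_eq_iff_im.2 h]
  · exact hL.nonreal_mem _ (by simpa using h)

lemma p_conj {z : ℂ} (hz : z ∈ B) (ht : t ∈ Icc a b) {j : ℕ} (hj : j ≤ r / 2) :
    (L (conj z)).p j t = adjoint ((L z).p j t) := by
  have := hL.symm_p _ (hL.conj_mem hz) t ht j hj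
  rwa [Complex.conj_conj] at this

lemma q_conj {z : ℂ} (hz : z ∈ B) (ht : t ∈ Icc a b) {j : ℕ} (hj : 1 ≤ j) (hj' : j ≤ (r + 1) / 2) :
    (L (conj z)).q j t = adjoint ((L z).s j t) := by
  have := hL.symm_q _ (hL.conj_mem hz) t ht j hj hj'
  rwa [Complex.conj_conj] at this

lemma s_conj {z : ℂ} (hz : z ∈ B) (ht : t ∈ Icc a b) {j : ℕ} (hj : 1 ≤ j) (hj' : j ≤ (r + 1) / 2) :
    (L (conj z)).s j t = adjoint ((L z).q j t) := by
  rw [hL.symm_q z hz t ht j hj hj', ContinuousLinearMap.adjoint_adjoint]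

lemma conj_form {z : ℂ} (hz : z ∈ B) (ht : t ∈ Icc a b) {k : ℕ} (hk : k / 2 ≤ r / 2)
    (hk' : (k + 1) / 2 ≤ (r + 1) / 2) (g h : ℕ → E) :
    conj ((L z).form k t g h) = (L (conj z)).form k t h g := by
  rw [form, form, map_add, map_mul, map_sum, map_sum]
  have h1 : ∑ j ∈ Finset.range (k / 2 + 1), conj (inner ℂ (h j) ((L z).p j t (g j))) =
      ∑ j ∈ Finset.range (k / 2 + 1), inner ℂ (g j) ((L (conj z)).p j t (h j)) := by
    refine Finset.sum_congr rfl fun j hj => ?_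
    rw [Finset.mem_range] at hj
    rw [inner_conj_symm, hL.p_conj hz ht (by omega), ContinuousLinearMap.adjoint_inner_right]
  have h2 : ∑ j ∈ Finset.Icc 1 ((k + 1) / 2), conj (inner ℂ (h (j - 1)) ((L z).s j t (g j)) -
      inner ℂ (h j) ((L z).q j t (g (j - 1)))) =
      -∑ j ∈ Finset.Icc 1 ((k + 1) / 2), (inner ℂ (g (j - 1)) ((L (conj z)).s j t (h j)) -
      inner ℂ (g j) ((L (conj z)).q j t (h (j - 1)))) := by
    rw [← Finset.sum_neg_distrib]
    refine Finset.sum_congr rfl fun j hj => ?_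
    rw [Finset.mem_Icc] at hj
    rw [map_sub, inner_conj_symm, inner_conj_symm, hL.s_conj hz ht hj.1 (by omega),
      hL.q_conj hz ht hj.1 (by omega), ContinuousLinearMap.adjoint_inner_right,
      ContinuousLinearMap.adjoint_inner_right]
    ring
  rw [h1, h2]
  simp only [map_div₀, Complex.conj_I, map_ofNat]
  ring

lemma isUnit_p {z : ℂ} (hz : z ∈ B) (ht : t ∈ Icc a b) (hr : Even r) :
    IsUnit ((L z).p (r / 2) t) := by
  have := hL.leading z hz t ht
  rwa [if_pos hr] at this

/-- The difference of two values of `H` is expressed through the forms. -/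
lemma inner_Hcoeff_sub (hr : 0 < r) {z w : ℂ} (hz : z ∈ B) (hw : w ∈ B) (ht : t ∈ Icc a b)
    (x y : BlockSpace E r) :
    inner ℂ y ((L w).Hcoeff r t x) - inner ℂ ((L (conj z)).Hcoeff r t y) x =
      (L z).form (2 * (r / 2)) t (fun j => (L w).jet r t j x) (fun j => (L (conj z)).jet r t j y) -
      (L w).form (2 * (r / 2)) t (fun j => (L w).jet r t j x) (fun j => (L (conj z)).jet r t j y) := by
  have hz' := hL.conj_mem hz
  have h1 := inner_Hcoeff_add_form (l' := L (conj z)) hr (hL.isUnit_p hw ht) x y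
  -- The conjugate of the same identity with the vectors exchanged and the parameter conjugated. The
  -- coupling sum is Hermitian symmetric, so it disappears in the difference.
  have h2 := congrArg conj
    (inner_Hcoeff_add_form (l' := L w) hr (hL.isUnit_p hz' ht) y x)
  rw [map_add, inner_conj_symm, hL.conj_form hz' ht (by omega) (by omega), Complex.conj_conj,
    map_sum] at h2
  have h3 : ∑ j ∈ Finset.range (r / 2), conj (inner ℂ ((L w).jet r t (j + 1) x)
        (coord r (r / 2 + j) y) + inner ℂ (coord r (r / 2 + j) x) ((L (conj z)).jet r t (j + 1) y)) =
      ∑ j ∈ Finset.range (r / 2), (inner ℂ ((L (conj z)).jet r t (j + 1) y) (coord r (r / 2 + j) x) +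
        inner ℂ (coord r (r / 2 + j) y) ((L w).jet r t (j + 1) x)) := by
    refine Finset.sum_congr rfl fun j _ => ?_
    rw [map_add, inner_conj_symm, inner_conj_symm, add_comm]
  rw [h3, ← h1] at h2
  linear_combination -h2

lemma Hcoeff_conj (hr : 0 < r) {z : ℂ} (hz : z ∈ B) (ht : t ∈ Icc a b) :
    (L (conj z)).Hcoeff r t = adjoint ((L z).Hcoeff r t) := by
  rw [ContinuousLinearMap.eq_adjoint_iff]
  intro x y
  have h := hL.inner_Hcoeff_sub hr hz hz ht y x
  rw [sub_self, sub_eq_zero] at h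
  exact h.symm

lemma inner_Hcoeff_sub_Hcoeff (hr : 0 < r) {z w : ℂ} (hz : z ∈ B) (hw : w ∈ B) (ht : t ∈ Icc a b)
    (x y : BlockSpace E r) :
    inner ℂ y ((L w).Hcoeff r t x - (L z).Hcoeff r t x) =
      (L z).form (2 * (r / 2)) t (fun j => (L w).jet r t j x) (fun j => (L (conj z)).jet r t j y) -
      (L w).form (2 * (r / 2)) t (fun j => (L w).jet r t j x) (fun j => (L (conj z)).jet r t j y) := by
  rw [← hL.inner_Hcoeff_sub hr hz hw ht, inner_sub_right, hL.Hcoeff_conj hr hz ht,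
    ContinuousLinearMap.adjoint_inner_left]

/-- On the diagonal the coupling sum is real, so `-ℑ(l{·,·})` and `ℑ(H·,·)` agree. This makes the
scalar domination hypothesis a positivity statement for the system. -/
lemma im_inner_Hcoeff (hr : 0 < r) {z : ℂ} (hz : z ∈ B) (ht : t ∈ Icc a b) (x : BlockSpace E r) :
    (inner ℂ x ((L z).Hcoeff r t x)).im = -((L z).form (2 * (r / 2)) t
      (fun j => (L z).jet r t j x) (fun j => (L z).jet r t j x)).im := by
  have h := congrArg Complex.im
    (inner_Hcoeff_add_form (l' := L z) hr (hL.isUnit_p hz ht) x x)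
  rw [Complex.add_im, Complex.im_sum] at h
  have h3 : ∑ j ∈ Finset.range (r / 2), (inner ℂ ((L z).jet r t (j + 1) x) (coord r (r / 2 + j) x) +
        inner ℂ (coord r (r / 2 + j) x) ((L z).jet r t (j + 1) x)).im = 0 := by
    refine Finset.sum_eq_zero fun j _ => ?_
    rw [← inner_conj_symm, Complex.add_im, Complex.conj_im]
    ring
  rw [h3] at h
  linarith

end IsAnalyticFamily

end DiffExpr

end

/-! ### Comparison of the forms at different parameters; the odd leading coefficient -/

section

variable {E : Type*} [NormedAddCommGroup E] [InnerProductSpace ℂ E] [CompleteSpace E]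

open ContinuousLinearMap (adjoint)
open BlockSpace

lemma eq_zero_of_forall_affine_nonneg {A K : ℝ} (h : ∀ τ : ℝ, 0 ≤ A + τ * K) : K = 0 := by
  by_contra hK
  have := h (-(A + 1) / K)
  rw [div_mul_cancel₀ _ hK] at this
  linarith

lemma eq_zero_of_forall_affine_bounded {A : ℝ} {c d : ℂ} (h : ∀ τ : ℝ, ‖c + τ * d‖ ≤ A) : d = 0 := by
  have h1 : ∀ τ : ℝ, 0 ≤ (‖c‖ + A) + τ * (-‖d‖) := by
    intro τ
    rcases le_or_gt 0 τ with h0 | h0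
    · have h2 : ‖(τ : ℂ) * d‖ ≤ ‖c + τ * d‖ + ‖c‖ := by
        simpa using norm_sub_le (c + τ * d) c
      rw [norm_mul, Complex.norm_real, Real.norm_eq_abs, abs_of_nonneg h0] at h2
      linarith [h τ]
    · have h2 : 0 ≤ A := (norm_nonneg _).trans (h 0)
      have h3 := norm_nonneg c
      nlinarith [norm_nonneg d]
  have := eq_zero_of_forall_affine_nonneg h1
  rwa [neg_eq_zero, norm_eq_zero] at this

namespace DiffExpr

variable {t : ℝ}

/-- The nonnegative quadratic form `-ℑ l_w{h, h} / ℑ w`. -/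
def formWeight (L : ℂ → DiffExpr E) (r : ℕ) (w : ℂ) (t : ℝ) (h : ℕ → E) : ℝ :=
  -(((L w).form r t h h).im / w.im)

/-- For odd order the full form also contains an entry of index `n + 1`. Vectors of `E^{n+1}`
extended by zero have none, so the even part of the form suffices for jets. -/
lemma form_of_zero (l : DiffExpr E) {r : ℕ} {g h : ℕ → E} (hg : g (r / 2 + 1) = 0)
    (hh : h (r / 2 + 1) = 0) : l.form (2 * (r / 2)) t g h = l.form r t g h := by
  rcases Nat.even_or_odd' r with ⟨n, rfl | rfl⟩
  · rw [show 2 * n / 2 = n by omega]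
  · rw [show (2 * n + 1) / 2 = n by omega] at hg hh ⊢
    rw [form_two_mul_add_one, hg, hh]
    simp

lemma jet_of_gt (l : DiffExpr E) (r : ℕ) (x : BlockSpace E r) : l.jet r t (r / 2 + 1) x = 0 :=
  coord_of_le le_rfl _

lemma differentiableOn_form {L : ℂ → DiffExpr E} {r : ℕ} {U : Set ℂ}
    (hp : ∀ j, j ≤ r / 2 → DifferentiableOn ℂ (fun z => (L z).p j t) U)
    (hqs : ∀ j, 1 ≤ j → j ≤ (r + 1) / 2 →
      DifferentiableOn ℂ (fun z => (L z).q j t) U ∧ DifferentiableOn ℂ (fun z => (L z).s j t) U)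
    (g h : ℕ → E) : DifferentiableOn ℂ (fun z => (L z).form r t g h) U := by
  have key : ∀ {A : ℂ → E →L[ℂ] E} (_ : DifferentiableOn ℂ A U) (x y : E),
      DifferentiableOn ℂ (fun z => inner ℂ y (A z x)) U := fun hA x y =>
    (innerSL ℂ y).differentiable.comp_differentiableOn
      ((ContinuousLinearMap.apply ℂ E x).differentiable.comp_differentiableOn hA)
  unfold form
  refine DifferentiableOn.fun_add (DifferentiableOn.fun_sum fun j hj => ?_)
    (DifferentiableOn.const_mul (DifferentiableOn.fun_sum fun j hj => ?_) _)
  · rw [Finset.mem_range] at hj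
    exact key (hp j (by omega)) _ _
  · rw [Finset.mem_Icc] at hj
    have := hqs j hj.1 hj.2
    exact (key this.2 _ _).fun_sub (key this.1 _ _)

namespace IsAnalyticFamily

variable {L : ℂ → DiffExpr E} {r : ℕ} {a b : ℝ} {B : Set ℂ} (hL : IsAnalyticFamily L r a b B)
  {m : DiffExpr E} {σ : ℕ} (hdom : m.IsDominated L r σ a b)
include hL

lemma differentiableOn_p (ht : t ∈ Icc a b) {j : ℕ} (hj : j ≤ r / 2) :
    DifferentiableOn ℂ (fun z => (L z).p j t) {z | z.im ≠ 0} := fun z hz => by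
  obtain ⟨U, -, hzU, h⟩ := hL.analytic z (hL.nonreal_mem z hz)
  exact (((h t ht).1 j hj) z hzU).differentiableAt.differentiableWithinAt

lemma differentiableOn_qs (ht : t ∈ Icc a b) {j : ℕ} (hj : 1 ≤ j) (hj' : j ≤ (r + 1) / 2) :
    DifferentiableOn ℂ (fun z => (L z).q j t) {z | z.im ≠ 0} ∧
      DifferentiableOn ℂ (fun z => (L z).s j t) {z | z.im ≠ 0} := by
  constructor <;> intro z hz <;>
    obtain ⟨U, -, hzU, h⟩ := hL.analytic z (hL.nonreal_mem z hz)
  · exact (((h t ht).2 j hj hj').1 z hzU).differentiableAt.differentiableWithinAt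
  · exact (((h t ht).2 j hj hj').2 z hzU).differentiableAt.differentiableWithinAt

include hdom

lemma formWeight_nonneg {z : ℂ} (hz : z.im ≠ 0) (ht : t ∈ Icc a b) (h : ℕ → E) :
    0 ≤ formWeight L r z t h :=
  (hdom z hz t ht h).1.trans (hdom z hz t ht h).2

lemma isNevanlinna_neg_form (ht : t ∈ Icc a b) (h : ℕ → E) :
    IsNevanlinna fun z => -(L z).form r t h h where
  differentiableOn := (differentiableOn_form (fun j hj => hL.differentiableOn_p ht hj)
    (fun j hj hj' => hL.differentiableOn_qs ht hj hj') h h).fun_neg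
  symm z hz := by
    rw [map_neg, hL.conj_form (hL.nonreal_mem z hz) ht le_rfl le_rfl]
  nonneg z hz := by
    rw [Complex.neg_im, neg_div]
    exact hL.formWeight_nonneg hdom hz ht h

/-- The neighbourhood of analyticity does not depend on `t`, and the scalar comparison constant does
not depend on the Nevanlinna function; hence one constant serves all `t` and `h`. For real `z₀` the
second bound concerns the derivative. -/
lemma exists_form_compare {z₀ w : ℂ} (hz₀ : z₀ ∈ B) (hw : w.im ≠ 0) :
    ∃ C : ℝ, 0 ≤ C ∧ ∀ t ∈ Icc a b, ∀ h : ℕ → E,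
      ‖(L z₀).form r t h h - (L w).form r t h h‖ ≤ C * formWeight L r w t h ∧
      |imRatioForm L r z₀ t h| ≤ C * formWeight L r w t h := by
  obtain ⟨U, hU, hzU, hA⟩ := hL.analytic z₀ hz₀
  obtain ⟨C, hC0, hC⟩ := IsNevanlinna.exists_compare z₀ hw hU hzU
  refine ⟨C, hC0, fun t ht h => ?_⟩
  have hd : DifferentiableOn ℂ (fun z => -(L z).form r t h h) U :=
    (differentiableOn_form (fun j hj => ((hA t ht).1 j hj).differentiableOn)
      (fun j hj hj' => ⟨((hA t ht).2 j hj hj').1.differentiableOn,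
        ((hA t ht).2 j hj hj').2.differentiableOn⟩) h h).fun_neg
  obtain ⟨h1, h2⟩ := hC _ (hL.isNevanlinna_neg_form hdom ht h) hd
  have e : (-(L w).form r t h h).im / w.im = formWeight L r w t h := by
    rw [Complex.neg_im, neg_div, formWeight]
  rw [e] at h1 h2
  refine ⟨?_, ?_⟩
  · have h3 : ‖-(L z₀).form r t h h - -(L w).form r t h h‖ ≤ C * formWeight L r w t h := h1
    rwa [neg_sub_neg, norm_sub_rev] at h3
  · have e2 : (if z₀.im ≠ 0 then (-(L z₀).form r t h h).im / z₀.im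
        else (deriv (fun z => -(L z).form r t h h) z₀).re) = -imRatioForm L r z₀ t h := by
      rw [imRatioForm, deriv.fun_neg]
      split_ifs <;> simp [neg_div]
    rwa [e2, abs_neg] at h2

end IsAnalyticFamily

/-- The sequence with `e` at the place `n`, `f` at the place `n + 1` and zeros elsewhere. -/
def pairSeq (n : ℕ) (e f : E) (j : ℕ) : E := if j = n then e else if j = n + 1 then f else 0

lemma form_pairSeq (l : DiffExpr E) (n : ℕ) (e f : E) :
    l.form (2 * n + 1) t (pairSeq n e f) (pairSeq n e f) =
      l.form (2 * n) t (pairSeq n e 0) (pairSeq n e 0) +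
        (Complex.I / 2) * (inner ℂ e (l.s (n + 1) t f) - inner ℂ f (l.q (n + 1) t e)) := by
  rw [form_two_mul_add_one]
  have h1 : l.form (2 * n) t (pairSeq n e f) (pairSeq n e f) =
      l.form (2 * n) t (pairSeq n e 0) (pairSeq n e 0) := by
    refine form_congr ?_ ?_ <;> intro j hj <;> simp only [pairSeq] <;>
      split_ifs <;> first | rfl | omega
  have h2 : pairSeq n e f n = e := by simp [pairSeq]
  have h3 : pairSeq n e f (n + 1) = f := by simp [pairSeq]
  rw [h1, h2, h3]

namespace IsAnalyticFamily

variable {L : ℂ → DiffExpr E} {n : ℕ} {a b : ℝ} {B : Set ℂ}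
  (hL : IsAnalyticFamily L (2 * n + 1) a b B)
  {m : DiffExpr E} {σ : ℕ} (hdom : m.IsDominated L (2 * n + 1) σ a b)
include hL hdom

/-- The entry of index `n + 1` occurs in the form only to first order. Scaling it by real `τ` makes
the nonnegative weight an affine function of `τ`, so its slope vanishes; replacing `f` by `i f`
gives the remaining part of the identity. -/
lemma leading_adjoint_nonreal {z : ℂ} (hz : z.im ≠ 0) (ht : t ∈ Icc a b) :
    (L z).s (n + 1) t = adjoint ((L z).q (n + 1) t) := by
  have hre : ∀ e f : E, (inner ℂ e ((L z).s (n + 1) t f) - inner ℂ f ((L z).q (n + 1) t e)).re = 0 := by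
    intro e f
    set X := inner ℂ e ((L z).s (n + 1) t f) - inner ℂ f ((L z).q (n + 1) t e) with hX
    set c := (L z).form (2 * n) t (pairSeq n e 0) (pairSeq n e 0) with hc
    have h : ∀ τ : ℝ, 0 ≤ -(c.im / z.im) + τ * (-(X.re / 2 / z.im)) := by
      intro τ
      have h1 := hL.formWeight_nonneg hdom hz ht (pairSeq n e ((τ : ℂ) • f))
      have h2 : (L z).form (2 * n + 1) t (pairSeq n e ((τ : ℂ) • f)) (pairSeq n e ((τ : ℂ) • f)) =
          c + (Complex.I / 2) * (τ * X) := by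
        rw [form_pairSeq, hX, map_smul, inner_smul_right, inner_smul_left, Complex.conj_ofReal]
        ring
      have h3 : (c + (Complex.I / 2) * (τ * X)).im = c.im + τ * X.re / 2 := by
        simp [Complex.add_im, Complex.mul_im, Complex.mul_re]
        ring
      rw [formWeight, h2, h3] at h1
      calc (0 : ℝ) ≤ _ := h1
        _ = _ := by ring
    have := eq_zero_of_forall_affine_nonneg h
    rw [neg_eq_zero, div_eq_zero_iff] at this
    rcases this with h | h
    · linarith
    · exact absurd h hz
  rw [ContinuousLinearMap.eq_adjoint_iff]
  intro f e
  rw [← inner_conj_symm]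
  have h1 := hre e f
  have h2 := hre e (Complex.I • f)
  simp only [map_smul, inner_smul_right, inner_smul_left, Complex.conj_I, Complex.sub_re,
    Complex.mul_re, Complex.neg_re, Complex.neg_im, Complex.I_re, Complex.I_im] at h1 h2
  apply Complex.ext
  · rw [Complex.conj_re]; linarith
  · rw [Complex.conj_im]; linarith

lemma leading_adjoint {z : ℂ} (hz : z ∈ B) (ht : t ∈ Icc a b) :
    (L z).s (n + 1) t = adjoint ((L z).q (n + 1) t) := by
  by_cases h : z.im = 0
  · have := hL.s_conj hz ht (j := n + 1) (by omega) (by omega)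
    rwa [Complex.conj_eq_iff_im.2 h] at this
  · exact hL.leading_adjoint_nonreal hdom h ht

lemma form_pairSeq_eq {z : ℂ} (hz : z ∈ B) (ht : t ∈ Icc a b) (e f : E) (τ : ℝ) :
    (L z).form (2 * n + 1) t (pairSeq n e ((τ : ℂ) • f)) (pairSeq n e ((τ : ℂ) • f)) =
      (L z).form (2 * n) t (pairSeq n e 0) (pairSeq n e 0) +
        τ * ((inner ℂ f ((L z).q (n + 1) t e)).im : ℂ) := by
  rw [form_pairSeq, hL.leading_adjoint hdom hz ht, ContinuousLinearMap.adjoint_inner_right,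
    inner_smul_right, inner_smul_left, Complex.conj_ofReal, ← inner_conj_symm _ f,
    ← mul_sub]
  have := Complex.sub_conj (inner ℂ f ((L z).q (n + 1) t e))
  push_cast at this
  linear_combination (-Complex.I / 2 * τ) * this -
    τ * ((inner ℂ f ((L z).q (n + 1) t e)).im : ℂ) * Complex.I_mul_I

/-- By the previous result the term with the top entry is real, so the weight at `w` does not see
that entry. The difference of the forms at `z` and `w` is affine in the top entry but bounded by
this weight, hence constant. This is why `Q` does not depend on the parameter. -/
lemma leading_eq {z w : ℂ} (hz : z ∈ B) (hw : w.im ≠ 0) (ht : t ∈ Icc a b) :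
    (L z).q (n + 1) t = (L w).q (n + 1) t := by
  have hwB := hL.nonreal_mem w hw
  obtain ⟨C, -, hC⟩ := hL.exists_form_compare hdom hz hw
  have him : ∀ e f : E, (inner ℂ f ((L z).q (n + 1) t e)).im =
      (inner ℂ f ((L w).q (n + 1) t e)).im := by
    intro e f
    have h : ∀ τ : ℝ, ‖((L z).form (2 * n) t (pairSeq n e 0) (pairSeq n e 0) -
        (L w).form (2 * n) t (pairSeq n e 0) (pairSeq n e 0)) +
        τ * (((inner ℂ f ((L z).q (n + 1) t e)).im : ℂ) -
          ((inner ℂ f ((L w).q (n + 1) t e)).im : ℂ))‖ ≤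
        C * -(((L w).form (2 * n) t (pairSeq n e 0) (pairSeq n e 0)).im / w.im) := by
      intro τ
      have h1 := (hC t ht (pairSeq n e ((τ : ℂ) • f))).1
      rw [formWeight, hL.form_pairSeq_eq hdom hz ht, hL.form_pairSeq_eq hdom hwB ht] at h1
      have h2 : ∀ (c : ℂ) (y : ℝ), (c + τ * (y : ℂ)).im = c.im := by simp
      rw [h2] at h1
      convert h1 using 2
      ring
    have := eq_zero_of_forall_affine_bounded h
    rw [sub_eq_zero] at this
    exact_mod_cast this
  ext e
  refine ext_inner_left ℂ fun f => ?_
  have h1 := him e f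
  have h2 := him e (Complex.I • f)
  simp only [inner_smul_left, Complex.conj_I, Complex.mul_im, Complex.neg_re, Complex.neg_im,
    Complex.I_re, Complex.I_im] at h2
  apply Complex.ext
  · linarith
  · exact h1

end IsAnalyticFamily

end DiffExpr

end

/-! ### The coefficients `Q` and `H` as a regular Nevanlinna system -/

section

variable {E : Type*} [NormedAddCommGroup E] [InnerProductSpace ℂ E] [CompleteSpace E]

open ContinuousLinearMap (adjoint)
open BlockSpace

namespace DiffExpr

variable {t : ℝ}

lemma blockOp_congr {r k : ℕ} {A A' : ℕ → ℕ → E →L[ℂ] E} (h : ∀ i < r, ∀ j < k, A i j = A' i j) :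
    (blockOp A : BlockSpace E k →L[ℂ] BlockSpace E r) = blockOp A' := by
  rw [blockOp_eq_sum, blockOp_eq_sum]
  exact Finset.sum_congr rfl fun i _ => Finset.sum_congr rfl fun j _ => by rw [h i i.2 j j.2]

/-- The operator matrix `(0, i I_n; -i I_n, 0) ⊕ c`, `n = [r/2]`. -/
def symplecticOp (r : ℕ) (c : E →L[ℂ] E) : BlockSpace E r →L[ℂ] BlockSpace E r :=
  blockOp fun i j =>
    if i < r / 2 ∧ j = i + r / 2 then Complex.I • 1
    else if j < r / 2 ∧ i = j + r / 2 then -(Complex.I • 1)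
    else if i = 2 * (r / 2) ∧ j = 2 * (r / 2) then c
    else 0

lemma Qcoeff_eq (l : DiffExpr E) (r : ℕ) : l.Qcoeff r t = symplecticOp r (l.q (r / 2 + 1) t) := rfl

lemma coord_symplecticOp_left {r i : ℕ} (hi : i < r / 2) (c : E →L[ℂ] E) (x : BlockSpace E r) :
    coord r i (symplecticOp r c x) = Complex.I • coord r (r / 2 + i) x := by
  rw [symplecticOp, coord_blockOp (by omega)]
  have h : ∀ j ∈ Finset.range r, (if i < r / 2 ∧ j = i + r / 2 then Complex.I • (1 : E →L[ℂ] E)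
      else if j < r / 2 ∧ i = j + r / 2 then -(Complex.I • 1)
      else if i = 2 * (r / 2) ∧ j = 2 * (r / 2) then c else 0) (coord r j x) =
      if j = r / 2 + i then Complex.I • coord r j x else 0 := by
    intro j _
    rw [if_neg (by omega : ¬(j < r / 2 ∧ i = j + r / 2)),
      if_neg (by omega : ¬(i = 2 * (r / 2) ∧ j = 2 * (r / 2))), ite_clm_apply]
    by_cases h : j = r / 2 + i
    · rw [if_pos (by omega), if_pos h]; simp
    · rw [if_neg (by omega), if_neg h]
  rw [Finset.sum_congr rfl h, sum_range_ite_eq _ (by omega) (fun j _ => Iff.rfl)]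

lemma coord_symplecticOp_right {r i : ℕ} (hi : i < r / 2) (c : E →L[ℂ] E) (x : BlockSpace E r) :
    coord r (r / 2 + i) (symplecticOp r c x) = -(Complex.I • coord r i x) := by
  rw [symplecticOp, coord_blockOp (by omega)]
  have h : ∀ j ∈ Finset.range r,
      (if r / 2 + i < r / 2 ∧ j = r / 2 + i + r / 2 then Complex.I • (1 : E →L[ℂ] E)
      else if j < r / 2 ∧ r / 2 + i = j + r / 2 then -(Complex.I • 1)
      else if r / 2 + i = 2 * (r / 2) ∧ j = 2 * (r / 2) then c else 0) (coord r j x) =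
      if j = i then -(Complex.I • coord r j x) else 0 := by
    intro j _
    rw [if_neg (by omega : ¬(r / 2 + i < r / 2 ∧ j = r / 2 + i + r / 2)),
      if_neg (by omega : ¬(r / 2 + i = 2 * (r / 2) ∧ j = 2 * (r / 2))), ite_clm_apply]
    by_cases h : j = i
    · rw [if_pos (by omega), if_pos h]; simp
    · rw [if_neg (by omega), if_neg h]
  rw [Finset.sum_congr rfl h, sum_range_ite_eq _ (by omega) (fun j _ => Iff.rfl)]

lemma coord_symplecticOp_last {r : ℕ} (hr : 2 * (r / 2) < r) (c : E →L[ℂ] E) (x : BlockSpace E r) :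
    coord r (2 * (r / 2)) (symplecticOp r c x) = c (coord r (2 * (r / 2)) x) := by
  rw [symplecticOp, coord_blockOp hr]
  have h : ∀ j ∈ Finset.range r,
      (if 2 * (r / 2) < r / 2 ∧ j = 2 * (r / 2) + r / 2 then Complex.I • (1 : E →L[ℂ] E)
      else if j < r / 2 ∧ 2 * (r / 2) = j + r / 2 then -(Complex.I • 1)
      else if 2 * (r / 2) = 2 * (r / 2) ∧ j = 2 * (r / 2) then c else 0) (coord r j x) =
      if j = 2 * (r / 2) then c (coord r j x) else 0 := by
    intro j _
    rw [if_neg (by omega : ¬(2 * (r / 2) < r / 2 ∧ j = 2 * (r / 2) + r / 2)),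
      if_neg (by omega : ¬(j < r / 2 ∧ 2 * (r / 2) = j + r / 2)), ite_clm_apply]
    by_cases h : j = 2 * (r / 2)
    · rw [if_pos ⟨rfl, h⟩, if_pos h]
    · rw [if_neg (by omega), if_neg h]
  rw [Finset.sum_congr rfl h, sum_range_ite_eq _ hr (fun j _ => Iff.rfl)]

lemma lt_cases {r i : ℕ} (hi : i < r) : i < r / 2 ∨ (∃ k < r / 2, i = r / 2 + k) ∨
    (i = 2 * (r / 2) ∧ 2 * (r / 2) < r) := by
  by_cases h1 : i < r / 2
  · exact Or.inl h1
  by_cases h2 : i < r / 2 + r / 2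
  · exact Or.inr (Or.inl ⟨i - r / 2, by omega, by omega⟩)
  · exact Or.inr (Or.inr ⟨by omega, by omega⟩)

/-- The block `(0, iI; -iI, 0)` is its own inverse, so inverting the operator means inverting the
last entry, which is present only in odd order. -/
lemma symplecticOp_mul {r : ℕ} {c c' : E →L[ℂ] E} (h : 2 * (r / 2) < r → c * c' = 1) :
    symplecticOp r c * symplecticOp r c' = 1 := by
  ext1 x
  refine ext_coord fun i hi => ?_
  rw [mul_apply_eq_comp, one_apply_eq_self]
  rcases lt_cases hi with h1 | ⟨k, hk, rfl⟩ | ⟨rfl, h1⟩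
  · rw [coord_symplecticOp_left h1, coord_symplecticOp_right h1, smul_neg, smul_smul,
      Complex.I_mul_I]
    simp
  · rw [coord_symplecticOp_right hk, coord_symplecticOp_left hk, smul_smul, Complex.I_mul_I]
    simp
  · rw [coord_symplecticOp_last h1, coord_symplecticOp_last h1, ← mul_apply_eq_comp, h h1,
      one_apply_eq_self]

lemma isUnit_symplecticOp {r : ℕ} {c : E →L[ℂ] E} (h : 2 * (r / 2) < r → IsUnit c) :
    IsUnit (symplecticOp r c) :=
  ⟨⟨symplecticOp r c, symplecticOp r (Ring.inverse c),
    symplecticOp_mul fun hr => Ring.mul_inverse_cancel _ (h hr),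
    symplecticOp_mul fun hr => Ring.inverse_mul_cancel _ (h hr)⟩, rfl⟩

lemma adjoint_symplecticOp (r : ℕ) (c : E →L[ℂ] E) :
    adjoint (symplecticOp r c) = symplecticOp r (adjoint c) := by
  have hI : adjoint (Complex.I • (1 : E →L[ℂ] E)) = -(Complex.I • 1) := by
    have h : star (Complex.I • (1 : E →L[ℂ] E)) = -(Complex.I • 1) := by
      rw [star_smul, star_one]; simp
    exact h
  rw [symplecticOp, adjoint_blockOp, symplecticOp]
  refine blockOp_congr fun i _ j _ => ?_
  by_cases h1 : i < r / 2 ∧ j = i + r / 2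
  · rw [if_neg (by omega), if_pos h1, if_pos h1, map_neg, hI, neg_neg]
  by_cases h2 : j < r / 2 ∧ i = j + r / 2
  · rw [if_pos h2, if_neg h1, if_pos h2, hI]
  rw [if_neg h2, if_neg h1, if_neg h1, if_neg h2]
  by_cases h3 : i = 2 * (r / 2) ∧ j = 2 * (r / 2)
  · rw [if_pos h3.symm, if_pos h3]
  · rw [if_neg (fun h => h3 h.symm), if_neg h3, map_zero]

lemma reOp_symplecticOp (r : ℕ) (c : E →L[ℂ] E) :
    reOp (symplecticOp r c) = symplecticOp r (reOp c) := by
  rw [reOp, adjoint_symplecticOp]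
  ext1 x
  refine ext_coord fun i hi => ?_
  rw [FunLike.coe_smul, Pi.smul_apply, FunLike.coe_add, Pi.add_apply, map_smul, map_add]
  rcases lt_cases hi with h1 | ⟨k, hk, rfl⟩ | ⟨rfl, h1⟩
  · rw [coord_symplecticOp_left h1, coord_symplecticOp_left h1, coord_symplecticOp_left h1]
    module
  · rw [coord_symplecticOp_right hk, coord_symplecticOp_right hk, coord_symplecticOp_right hk]
    module
  · rw [coord_symplecticOp_last h1, coord_symplecticOp_last h1, coord_symplecticOp_last h1, reOp]
    rfl

/-- The entries of `Q(t, l)`. -/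
def Qentry (l : DiffExpr E) (r : ℕ) (t : ℝ) (i j : ℕ) : E →L[ℂ] E :=
  if i < r / 2 ∧ j = i + r / 2 then Complex.I • 1
  else if j < r / 2 ∧ i = j + r / 2 then -(Complex.I • 1)
  else if i = 2 * (r / 2) ∧ j = 2 * (r / 2) then l.q (r / 2 + 1) t
  else 0

lemma Qcoeff_eq_blockOp (l : DiffExpr E) (r : ℕ) : l.Qcoeff r = fun t => blockOp (l.Qentry r t) := rfl

/-- The entries of `H(t, l)`. -/
def Hentry (l : DiffExpr E) (r : ℕ) (t : ℝ) : ℕ → ℕ → E →L[ℂ] E :=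
  if Even r then l.HentryEven (r / 2) t else l.HentryOdd (r / 2) t

lemma Hcoeff_eq_blockOp (l : DiffExpr E) (r : ℕ) : l.Hcoeff r = fun t => blockOp (l.Hentry r t) := rfl

section Entries

variable {α : Type*} {P : (α → E →L[ℂ] E) → Prop} (hc : ∀ A, P fun _ => A)
  (hneg : ∀ f, P f → P fun x => -f x) (hsub : ∀ f g, P f → P g → P fun x => f x - g x)
  (hsmul : ∀ (c : ℂ) f, P f → P fun x => c • f x)
  (hcomp : ∀ f g, P f → P g → P fun x => f x ∘L g x)
  {l : α → DiffExpr E} {τ : α → ℝ} {n : ℕ}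
include hc hneg hsub hsmul hcomp

/-- The entries of `H` are built from the coefficients and `p_n⁻¹` by finitely many algebraic
operations. One principle for predicates stable under these covers both continuity in `t` and
holomorphy in the parameter. -/
lemma HentryEven_induction (hp : ∀ j ≤ n, P fun x => (l x).p j (τ x))
    (hq : ∀ j, 1 ≤ j → j ≤ n → P fun x => (l x).q j (τ x))
    (hs : ∀ j, 1 ≤ j → j ≤ n → P fun x => (l x).s j (τ x))
    (hi : P fun x => Ring.inverse ((l x).p n (τ x))) (i j : ℕ) :
    P fun x => (l x).HentryEven n (τ x) i j := by
  have h0 : P fun _ => 0 := hc 0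
  have h1 : P fun _ => 1 := hc 1
  simp only [HentryEven]
  split_ifs
  · exact hsub _ _ (hsmul _ _ (hcomp _ _ (hs n (by omega) le_rfl)
      (hcomp _ _ hi (hq n (by omega) le_rfl)))) (hp i (by omega))
  · exact hsub _ _ h0 (hp i (by omega))
  · exact hsmul _ _ (hq i (by omega) (by omega))
  · exact hneg _ (hsmul _ _ (hs j (by omega) (by omega)))
  · exact h0
  · exact h1
  · exact hneg _ (hsmul _ _ (hcomp _ _ (hs n (by omega) le_rfl) hi))
  · exact h0
  · exact h1
  · exact hsmul _ _ (hcomp _ _ hi (hq n (by omega) le_rfl))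
  · exact h0
  · exact hi
  · exact h0

lemma HentryOdd_induction (hp : ∀ j ≤ n, P fun x => (l x).p j (τ x))
    (hq : ∀ j, 1 ≤ j → j ≤ n → P fun x => (l x).q j (τ x))
    (hs : ∀ j, 1 ≤ j → j ≤ n → P fun x => (l x).s j (τ x)) (i j : ℕ) :
    P fun x => (l x).HentryOdd n (τ x) i j := by
  have h0 : P fun _ => 0 := hc 0
  have h1 : P fun _ => 1 := hc 1
  simp only [HentryOdd]
  split_ifs
  · exact hneg _ (hp i (by omega))
  · exact hsmul _ _ (hq i (by omega) (by omega))
  · exact hneg _ (hsmul _ _ (hs j (by omega) (by omega)))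
  · exact h0
  · exact h1
  · exact hsmul _ _ (hs n (by omega) le_rfl)
  · exact h0
  · exact h1
  · exact hsmul _ _ (hq n (by omega) le_rfl)
  · exact h0
  · exact hneg _ (hp n le_rfl)
  · exact hsmul _ _ h1
  · exact hneg _ (hsmul _ _ h1)
  · exact h0

lemma Hcoeff_entry_induction {r : ℕ} (hp : ∀ j ≤ r / 2, P fun x => (l x).p j (τ x))
    (hq : ∀ j, 1 ≤ j → j ≤ (r + 1) / 2 → P fun x => (l x).q j (τ x))
    (hs : ∀ j, 1 ≤ j → j ≤ (r + 1) / 2 → P fun x => (l x).s j (τ x))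
    (hi : Even r → P fun x => Ring.inverse ((l x).p (r / 2) (τ x))) (i j : ℕ) :
    P fun x => (l x).Hentry r (τ x) i j := by
  unfold Hentry
  by_cases hr : Even r
  · simp only [if_pos hr]
    exact HentryEven_induction hc hneg hsub hsmul hcomp hp (fun j h h' => hq j h (by omega))
      (fun j h h' => hs j h (by omega)) (hi hr) i j
  · simp only [if_neg hr]
    exact HentryOdd_induction hc hneg hsub hsmul hcomp hp (fun j h h' => hq j h (by omega))
      (fun j h h' => hs j h (by omega)) i j

end Entries

lemma derivWithin_Qcoeff {l : DiffExpr E} {r : ℕ} {a b : ℝ} (hab : a < b) (ht : t ∈ Icc a b)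
    (hq : 2 * (r / 2) < r → DifferentiableWithinAt ℝ (l.q (r / 2 + 1)) (Icc a b) t) :
    opDerivWithin (l.Qcoeff r) (Icc a b) t = blockOp fun i j =>
      if i = 2 * (r / 2) ∧ j = 2 * (r / 2) then derivWithin (l.q (r / 2 + 1)) (Icc a b) t else 0 := by
  rw [Qcoeff_eq_blockOp]
  refine derivWithin_blockOp (A := l.Qentry r) (uniqueDiffOn_Icc hab t ht) fun i hi j hj => ?_
  unfold Qentry
  by_cases h : i = 2 * (r / 2) ∧ j = 2 * (r / 2)
  · simp only [if_pos h, if_neg (by omega : ¬(i < r / 2 ∧ j = i + r / 2)),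
      if_neg (by omega : ¬(j < r / 2 ∧ i = j + r / 2))]
    exact (hq (by omega)).hasDerivWithinAt
  · simp only [if_neg h]
    exact hasDerivWithinAt_const _ _ _

namespace IsAnalyticFamily

variable {L : ℂ → DiffExpr E} {r : ℕ} {a b : ℝ} {B : Set ℂ} (hL : IsAnalyticFamily L r a b B)
  {m : DiffExpr E} {σ : ℕ} (hdom : m.IsDominated L r σ a b)
include hL

lemma continuousOn_inverse_p {z : ℂ} (hz : z ∈ B) (hr : Even r) :
    ContinuousOn (fun t => Ring.inverse ((L z).p (r / 2) t)) (Icc a b) :=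
  continuousOn_inverse ((hL.smooth z hz).1 _ le_rfl).continuousOn
    fun _ ht => hL.isUnit_p hz ht hr

lemma continuousOn_Hentry {z : ℂ} (hz : z ∈ B) (i j : ℕ) :
    ContinuousOn (fun t => (L z).Hentry r t i j) (Icc a b) := by
  have hs := hL.smooth z hz
  have h1 := fun j hj => (hs.1 j hj).continuousOn
  have h2 := fun j hj hj' => (hs.2 j hj hj').1.continuousOn
  have h3 := fun j hj hj' => (hs.2 j hj hj').2.continuousOn
  have h4 := fun hr => hL.continuousOn_inverse_p hz hr
  refine Hcoeff_entry_induction (P := fun f => ContinuousOn f (Icc a b)) (l := fun _ => L z)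
    (τ := fun t => t) ?_ ?_ ?_ ?_ ?_ h1 h2 h3 h4 i j
  · exact fun _ => continuousOn_const
  · exact fun f hf => hf.neg
  · exact fun f g hf hg => hf.sub hg
  · exact fun c f hf => hf.const_smul c
  · exact fun f g hf hg => hf.clm_comp hg

lemma continuousOn_Hcoeff {z : ℂ} (hz : z ∈ B) : ContinuousOn ((L z).Hcoeff r) (Icc a b) := by
  rw [Hcoeff_eq_blockOp]
  exact continuousOn_blockOp (A := (L z).Hentry r) fun i _ j _ => hL.continuousOn_Hentry hz i j

lemma differentiableOn_inverse_p (ht : t ∈ Icc a b) (hr : Even r) :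
    DifferentiableOn ℂ (fun z => Ring.inverse ((L z).p (r / 2) t)) {z | z.im ≠ 0} := by
  intro z hz
  obtain ⟨u, hu⟩ := hL.isUnit_p (hL.nonreal_mem z hz) ht hr
  have h : DifferentiableAt ℂ Ring.inverse ((L z).p (r / 2) t) := by
    rw [← hu]; exact differentiableAt_inverse u.isUnit
  exact h.comp_differentiableWithinAt z (hL.differentiableOn_p ht le_rfl z hz)

lemma differentiableOn_Hentry (ht : t ∈ Icc a b) (i j : ℕ) :
    DifferentiableOn ℂ (fun z => (L z).Hentry r t i j) {z | z.im ≠ 0} := by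
  have h1 := fun j hj => hL.differentiableOn_p ht (j := j) hj
  have h2 := fun j hj hj' => (hL.differentiableOn_qs ht (j := j) hj hj').1
  have h3 := fun j hj hj' => (hL.differentiableOn_qs ht (j := j) hj hj').2
  refine Hcoeff_entry_induction (P := fun f => DifferentiableOn ℂ f {z | z.im ≠ 0})
    (l := L) (τ := fun _ => t) (fun _ => differentiableOn_const _) (fun f hf => hf.fun_neg)
    (fun f g hf hg => hf.fun_sub hg) (fun c f hf => hf.fun_const_smul c) (fun f g hf hg => ?_)
    h1 h2 h3 (fun hr => hL.differentiableOn_inverse_p ht hr) i j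
  exact hf.clm_comp hg

lemma differentiableOn_Hcoeff (ht : t ∈ Icc a b) :
    DifferentiableOn ℂ (fun z => (L z).Hcoeff r t) {z | z.im ≠ 0} := by
  simp only [Hcoeff_eq_blockOp]
  exact differentiableOn_blockOp (A := fun z => (L z).Hentry r t)
    fun i _ j _ => hL.differentiableOn_Hentry ht i j

include hdom

/-- The hypothesis concerns `q + s`; since `s = q*` this is `2 ℜq`. -/
lemma leading_reOp {z : ℂ} (hz : z ∈ B) (ht : t ∈ Icc a b) (hr : 2 * (r / 2) < r) :
    IsUnit (reOp ((L z).q (r / 2 + 1) t)) := by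
  obtain ⟨n, rfl⟩ : ∃ n, r = 2 * n + 1 := ⟨r / 2, by omega⟩
  have h := hL.leading z hz t ht
  have hn : (2 * n + 1) / 2 = n := by omega
  rw [if_neg (by simp), hn, hL.leading_adjoint hdom hz ht] at h
  rw [reOp, hn]
  obtain ⟨u, hu⟩ := h
  rw [← hu]
  exact ⟨⟨(1 / 2 : ℂ) • u, (2 : ℂ) • ↑u⁻¹, by simp [smul_smul], by simp [smul_smul]⟩, rfl⟩

lemma isRegularSystem {z : ℂ} (hz : z ∈ B) :
    IsRegularSystem a b ((L z).Qcoeff r) ((L z).Hcoeff r) where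
  contDiffOn := by
    rw [Qcoeff_eq_blockOp]
    refine contDiffOn_blockOp (A := (L z).Qentry r) fun i hi j hj => ?_
    unfold Qentry
    by_cases h : i = 2 * (r / 2) ∧ j = 2 * (r / 2)
    · simp only [if_pos h, if_neg (by omega : ¬(i < r / 2 ∧ j = i + r / 2)),
        if_neg (by omega : ¬(j < r / 2 ∧ i = j + r / 2))]
      exact ((hL.smooth z hz).2 _ (by omega) (by omega)).1.of_le (by
        exact_mod_cast (by omega : 1 ≤ r / 2 + 1))
    · simp only [if_neg h]
      exact contDiffOn_const
  continuousOn := hL.continuousOn_Hcoeff hz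
  isUnit t ht := by
    rw [Qcoeff_eq, reOp_symplecticOp]
    exact isUnit_symplecticOp fun hr => hL.leading_reOp hdom hz ht hr

lemma Qcoeff_eqOn {z w : ℂ} (hz : z ∈ B) (hw : w.im ≠ 0) :
    EqOn ((L z).Qcoeff r) ((L w).Qcoeff r) (Icc a b) := by
  intro t ht
  rw [Qcoeff_eq_blockOp, Qcoeff_eq_blockOp]
  refine blockOp_congr fun i hi j hj => ?_
  unfold Qentry
  by_cases h : i = 2 * (r / 2) ∧ j = 2 * (r / 2)
  · obtain ⟨n, rfl⟩ : ∃ n, r = 2 * n + 1 := ⟨r / 2, by omega⟩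
    have hn : (2 * n + 1) / 2 = n := by omega
    rw [hn, hL.leading_eq hdom hz hw ht]
  · simp only [if_neg h]

lemma inner_Hcoeff_im_div (hr : 0 < r) {z : ℂ} (hz : z.im ≠ 0) (ht : t ∈ Icc a b)
    (x : BlockSpace E r) : (inner ℂ x ((L z).Hcoeff r t x)).im / z.im =
      formWeight L r z t (fun j => (L z).jet r t j x) := by
  rw [hL.im_inner_Hcoeff hr (hL.nonreal_mem z hz) ht, form_of_zero _ (jet_of_gt _ _ _)
    (jet_of_gt _ _ _), formWeight, neg_div]

lemma isNevanlinnaSystem (hr : 0 < r) : IsNevanlinnaSystem a b (Qfam L r) (Hfam L r) where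
  regular z hz := hL.isRegularSystem hdom (hL.nonreal_mem z hz)
  eqOn z w hz hw := hL.Qcoeff_eqOn hdom (hL.nonreal_mem z hz) hw
  symm z hz t ht := hL.Hcoeff_conj hr (hL.nonreal_mem z hz) ht
  analytic t ht := hL.differentiableOn_Hcoeff ht
  nonneg z hz t ht x := by
    rw [quadForm_nevWeight]
    have := hL.inner_Hcoeff_im_div hdom hr hz ht x
    rw [Hfam, this]
    exact hL.formWeight_nonneg hdom hz ht _

end IsAnalyticFamily

end DiffExpr

end

/-! ### Quasi-derivatives and the differential expression -/

section

variable {E : Type*} [NormedAddCommGroup E] [InnerProductSpace ℂ E] [CompleteSpace E]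

open ContinuousLinearMap (adjoint)
open BlockSpace

section Calculus

variable {a b : ℝ} {f g : ℝ → E}

lemma ContDiffOn.of_nat_le {F : Type*} [NormedAddCommGroup F] [NormedSpace ℝ F] {f : ℝ → F}
    {S : Set ℝ} {k k' : ℕ} (hf : ContDiffOn ℝ k f S) (h : k' ≤ k) :
    ContDiffOn ℝ k' f S := hf.of_le (by exact_mod_cast h)

lemma ContDiffOn.constSmul {S : Set ℝ} {k : ℕ} (hf : ContDiffOn ℝ k f S) (c : ℂ) :
    ContDiffOn ℝ k (fun t => c • f t) S := hf.const_smul c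

lemma contDiffOn_succ_of_hasDeriv (hab : a < b) {f' : ℝ → E} {k : ℕ}
    (hf : ∀ t ∈ Icc a b, HasDerivWithinAt f (f' t) (Icc a b) t)
    (hf' : ContDiffOn ℝ k f' (Icc a b)) : ContDiffOn ℝ (k + 1 : ℕ) f (Icc a b) := by
  have hu := uniqueDiffOn_Icc hab
  rw [Nat.cast_add, Nat.cast_one, contDiffOn_succ_iff_derivWithin hu]
  refine ⟨fun t ht => (hf t ht).differentiableWithinAt, by simp, hf'.congr fun t ht => ?_⟩
  exact (hf t ht).derivWithin (hu t ht)

lemma ContDiffOn.derivWithin_nat (hab : a < b) {F : Type*} [NormedAddCommGroup F] [NormedSpace ℝ F]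
    {f : ℝ → F} {k : ℕ} (hf : ContDiffOn ℝ (k + 1 : ℕ) f (Icc a b)) :
    ContDiffOn ℝ k (derivWithin f (Icc a b)) (Icc a b) :=
  hf.derivWithin (uniqueDiffOn_Icc hab) (by push_cast; exact le_rfl)

lemma ContDiffOn.hasDerivWithinAt_nat {F : Type*} [NormedAddCommGroup F] [NormedSpace ℝ F]
    {f : ℝ → F} {S : Set ℝ} {k : ℕ} (hf : ContDiffOn ℝ k f S)
    (hk : 1 ≤ k) {t : ℝ} (ht : t ∈ S) :
    HasDerivWithinAt f (derivWithin f S t) S t :=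
  (hf.differentiableOn (by exact_mod_cast (by omega : k ≠ 0)) t ht).hasDerivWithinAt

lemma ContDiffOn.iteratedDerivWithin_nat (hab : a < b) {k : ℕ} (hf : ContDiffOn ℝ k f (Icc a b))
    {j i : ℕ} (h : i + j ≤ k) : ContDiffOn ℝ i (iteratedDerivWithin j f (Icc a b)) (Icc a b) := by
  induction j generalizing i with
  | zero => rw [iteratedDerivWithin_zero]; exact hf.of_nat_le (by omega)
  | succ j ih =>
    rw [iteratedDerivWithin_succ]
    exact (ih (i := i + 1) (by omega)).derivWithin_nat hab

lemma hasDerivWithinAt_iteratedDerivWithin (hab : a < b) {k : ℕ} (hf : ContDiffOn ℝ k f (Icc a b))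
    {j : ℕ} (h : j < k) {t : ℝ} (ht : t ∈ Icc a b) :
    HasDerivWithinAt (iteratedDerivWithin j f (Icc a b)) (iteratedDerivWithin (j + 1) f (Icc a b) t)
      (Icc a b) t := by
  rw [iteratedDerivWithin_succ]
  exact (hf.iteratedDerivWithin_nat hab (i := 1) (by omega)).hasDerivWithinAt_nat le_rfl ht

lemma iteratedDerivWithin_add_nat (hab : a < b) {k : ℕ} (hf : ContDiffOn ℝ k f (Icc a b))
    (hg : ContDiffOn ℝ k g (Icc a b)) {t : ℝ} (ht : t ∈ Icc a b) :
    iteratedDerivWithin k (fun t => f t + g t) (Icc a b) t =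
      iteratedDerivWithin k f (Icc a b) t + iteratedDerivWithin k g (Icc a b) t :=
  iteratedDerivWithin_fun_add ht (uniqueDiffOn_Icc hab) (hf t ht) (hg t ht)

lemma iteratedDerivWithin_smul_nat (hab : a < b) {k : ℕ} (hf : ContDiffOn ℝ k f (Icc a b)) (c : ℂ)
    {t : ℝ} (ht : t ∈ Icc a b) : iteratedDerivWithin k (fun t => c • f t) (Icc a b) t =
      c • iteratedDerivWithin k f (Icc a b) t :=
  iteratedDerivWithin_fun_const_smul ht (uniqueDiffOn_Icc hab) c (hf t ht)

lemma contDiffOn_ringInverse {A : ℝ → E →L[ℂ] E} {k : ℕ} (hA : ContDiffOn ℝ k A (Icc a b))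
    (hu : ∀ t ∈ Icc a b, IsUnit (A t)) :
    ContDiffOn ℝ k (fun t => Ring.inverse (A t)) (Icc a b) := by
  intro t ht
  obtain ⟨u, hu⟩ := hu t ht
  have h : ContDiffAt ℝ k Ring.inverse (A t) := by
    rw [← hu]; exact (contDiffAt_ringInverse ℂ u).restrict_scalars ℝ
  exact h.comp_contDiffWithinAt t (hA t ht)

/-- The sequence `c_0 = G_K`, `c_{d+1} = -c_d' + G_{K-d-1}` in closed form. -/
lemma chain_eq_sum (hab : a < b) {K : ℕ} {G c : ℕ → ℝ → E}
    (hG : ∀ j ≤ K, ContDiffOn ℝ j (G j) (Icc a b)) (h0 : EqOn (c 0) (G K) (Icc a b))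
    (hc : ∀ d < K, ∀ t ∈ Icc a b, c (d + 1) t = -derivWithin (c d) (Icc a b) t + G (K - (d + 1)) t)
    {d : ℕ} (hd : d ≤ K) {t : ℝ} (ht : t ∈ Icc a b) : c d t = ∑ i ∈ Finset.range (d + 1),
      (-1 : ℂ) ^ i • iteratedDerivWithin i (G (K - d + i)) (Icc a b) t := by
  induction d generalizing t with
  | zero => simp [h0 ht]
  | succ d ih =>
    have hu := uniqueDiffOn_Icc hab
    rw [hc d (by omega) t ht, Finset.sum_range_succ']
    have hdiff : ∀ i ∈ Finset.range (d + 1), HasDerivWithinAt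
        (fun t => (-1 : ℂ) ^ i • iteratedDerivWithin i (G (K - d + i)) (Icc a b) t)
        ((-1 : ℂ) ^ i • iteratedDerivWithin (i + 1) (G (K - d + i)) (Icc a b) t) (Icc a b) t := by
      intro i hi
      rw [Finset.mem_range] at hi
      exact (hasDerivWithinAt_iteratedDerivWithin hab (hG (K - d + i) (by omega)) (by omega)
        ht).fun_const_smul _
    have hD := ((HasDerivWithinAt.fun_sum hdiff).congr (fun τ hτ => ih (by omega) hτ)
      (ih (by omega) ht)).derivWithin (hu t ht)
    rw [hD, ← Finset.sum_neg_distrib]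
    congr 1
    · refine Finset.sum_congr rfl fun i hi => ?_
      rw [show K - (d + 1) + (i + 1) = K - d + i by omega, pow_succ]
      simp
    · simp

end Calculus

namespace DiffExpr

variable {l : DiffExpr E} {r : ℕ} {a b : ℝ} {X Ψ : ℕ → ℝ → E} {ρ y : ℝ → E}

lemma contDiffOn_formRow (hl : l.IsSmooth r a b) {j k : ℕ} (hk : k ≤ j) (hj : j < (r + 1) / 2)
    (hX : ∀ i ≤ j + 1, ContDiffOn ℝ k (X i) (Icc a b)) :
    ContDiffOn ℝ k (fun t => l.formRow t (fun i => X i t) j) (Icc a b) := by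
  unfold formRow
  refine ((hl.1 j (by omega)).of_nat_le hk).opApply (hX j (by omega)) |>.add (ContDiffOn.constSmul
    (((hl.2 (j + 1) (by omega) (by omega)).2.of_nat_le (by omega)).opApply
      (hX (j + 1) le_rfl) |>.sub ?_) _)
  split_ifs with h
  · exact contDiffOn_const
  · exact ((hl.2 j (by omega) (by omega)).1.of_nat_le hk).opApply (hX (j - 1) (by omega))

lemma contDiffOn_lastRow (hl : l.IsSmooth r a b) {j k : ℕ} (hk : k ≤ j) (hj : j ≤ r / 2)
    (hX : ∀ i ≤ j, ContDiffOn ℝ k (X i) (Icc a b)) :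
    ContDiffOn ℝ k (fun t => l.lastRow t (fun i => X i t) j) (Icc a b) := by
  unfold lastRow
  refine ((hl.1 j (by omega)).of_nat_le hk).opApply (hX j (by omega)) |>.sub ?_
  split_ifs with h
  · exact contDiffOn_const
  · exact ContDiffOn.constSmul
      (((hl.2 j (by omega) (by omega)).1.of_nat_le hk).opApply (hX (j - 1) (by omega))) _

/-- The lowest nontrivial quasi-derivative expressed through the derivatives. -/
def topRow (l : DiffExpr E) (r : ℕ) (t : ℝ) (g : ℕ → E) : E :=
  if Even r then l.lastRow t g (r / 2) else -((Complex.I / 2) • l.q (r / 2 + 1) t (g (r / 2)))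

lemma contDiffOn_topRow (hl : l.IsSmooth r a b) {k : ℕ} (hk : k ≤ (r + 1) / 2)
    (hX : ∀ i ≤ r / 2, ContDiffOn ℝ k (X i) (Icc a b)) :
    ContDiffOn ℝ k (fun t => l.topRow r t (fun i => X i t)) (Icc a b) := by
  unfold topRow
  split_ifs with h
  · obtain ⟨n, rfl⟩ := even_iff_exists_two_mul.1 h
    exact contDiffOn_lastRow hl (by omega) le_rfl hX
  · rw [Nat.not_even_iff_odd] at h
    obtain ⟨n, rfl⟩ := h
    exact (ContDiffOn.constSmul (((hl.2 _ (by omega) (by omega)).1.of_nat_le (by omega)).opApply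
      (hX _ le_rfl)) _).neg

variable {S : Set ℝ}

lemma upperQuasiDeriv_zero (l : DiffExpr E) (r : ℕ) (S : Set ℝ) (y : ℝ → E) :
    l.upperQuasiDeriv r S y 0 = fun t => l.topRow r t (fun i => iteratedDerivWithin i y S t) := rfl

lemma upperQuasiDeriv_succ (l : DiffExpr E) (r : ℕ) (S : Set ℝ) (y : ℝ → E) (d : ℕ) (t : ℝ) :
    l.upperQuasiDeriv r S y (d + 1) t = -derivWithin (l.upperQuasiDeriv r S y d) S t +
      l.formRow t (fun i => iteratedDerivWithin i y S t) (r - (r / 2 + d + 1)) := by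
  rw [formRow, ← add_assoc]
  rfl

/-- Every step of the recursion costs one derivative. The orders of smoothness required of the
coefficients are exactly those for which the last quasi-derivative is still continuous. -/
lemma contDiffOn_upperQuasiDeriv (hab : a < b) (hl : l.IsSmooth r a b)
    (hy : ContDiffOn ℝ r y (Icc a b)) {d : ℕ} (hd : d ≤ (r + 1) / 2) :
    ContDiffOn ℝ ((r + 1) / 2 - d : ℕ) (l.upperQuasiDeriv r (Icc a b) y d) (Icc a b) := by
  induction d with
  | zero =>
    rw [upperQuasiDeriv_zero]
    exact contDiffOn_topRow (X := fun i => iteratedDerivWithin i y (Icc a b)) hl (by omega)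
      fun i hi => hy.iteratedDerivWithin_nat hab (by omega)
  | succ d ih =>
    have h1 := (ih (by omega))
    rw [show (r + 1) / 2 - d = (r + 1) / 2 - (d + 1) + 1 by omega] at h1
    have h2 := contDiffOn_formRow (X := fun i => iteratedDerivWithin i y (Icc a b)) hl
      (j := r - (r / 2 + d + 1)) (k := (r + 1) / 2 - (d + 1)) (by omega) (by omega)
      fun i hi => hy.iteratedDerivWithin_nat hab (by omega)
    exact ((h1.derivWithin_nat hab).neg.add h2).congr fun t _ => upperQuasiDeriv_succ l r _ y d t

lemma sum_range_two_mul {M : Type*} [AddCommMonoid M] (f : ℕ → M) (n : ℕ) :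
    ∑ k ∈ Finset.range (2 * n), f k = ∑ j ∈ Finset.range n, (f (2 * j) + f (2 * j + 1)) := by
  induction n with
  | zero => simp
  | succ n ih =>
    rw [show 2 * (n + 1) = 2 * n + 1 + 1 by ring, Finset.sum_range_succ, Finset.sum_range_succ, ih,
      Finset.sum_range_succ, add_assoc]

lemma I_pow_two_mul (j : ℕ) : Complex.I ^ (2 * j) = (-1) ^ j := by rw [pow_mul, Complex.I_sq]

/-- The last quasi-derivative is the differential expression itself. -/
lemma apply_eq_upperQuasiDeriv (hab : a < b) (hl : l.IsSmooth r a b)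
    (hy : ContDiffOn ℝ r y (Icc a b)) {t : ℝ} (ht : t ∈ Icc a b) :
    l.apply r (Icc a b) y t = l.upperQuasiDeriv r (Icc a b) y ((r + 1) / 2) t := by
  set S := Icc a b with hS
  set Y := fun i => iteratedDerivWithin i y S with hY
  have hYc : ∀ i k, k + i ≤ r → ContDiffOn ℝ k (Y i) S := fun i k h =>
    hy.iteratedDerivWithin_nat hab h
  set K := (r + 1) / 2 with hK
  set G : ℕ → ℝ → E := fun j t => if j < K then l.formRow t (fun i => Y i t) j
    else l.topRow r t (fun i => Y i t) with hG
  have hGc : ∀ j ≤ K, ContDiffOn ℝ j (G j) S := by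
    intro j hj
    by_cases h : j < K
    · simp only [hG, if_pos h]
      exact contDiffOn_formRow hl le_rfl h fun i hi => hYc _ _ (by omega)
    -- At `j = K` the entry is the lowest nontrivial quasi-derivative, the starting value of the
    -- recursion. In even order it is the last row of the form, in odd order only the `q`-term of
    -- `y^{(n)}`.
    · simp only [hG, if_neg h]
      exact contDiffOn_topRow hl hj fun i hi => hYc _ _ (by omega)
  have hsum := chain_eq_sum hab (K := K) hGc (c := l.upperQuasiDeriv r S y)
    (fun τ _ => by simp only [hG, lt_irrefl, if_false]; rfl)
    (fun d hd τ _ => by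
      rw [upperQuasiDeriv_succ]
      simp only [hG, if_pos (by omega : K - (d + 1) < K)]
      rw [show r - (r / 2 + d + 1) = K - (d + 1) by omega]) le_rfl ht
  rw [hsum, Finset.sum_range_succ, Nat.sub_self]
  simp only [zero_add]
  set α : ℕ → E := fun j => (-1 : ℂ) ^ j • iteratedDerivWithin j (fun t => l.p j t (Y j t)) S t with hα
  set β : ℕ → E := fun j => (-1 : ℂ) ^ j • (Complex.I / 2) •
    iteratedDerivWithin j (fun t => l.s (j + 1) t (Y (j + 1) t)) S t with hβ
  -- The `q`-term of row `j` acts on `y^{(j-1)}`, whereas in the expression it belongs to the odd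
  -- term number `2j - 1`. The second index records the order of the derivative, so that
  -- `sum_shift_pred` can match the two arrangements.
  set γ : ℕ → ℕ → E := fun j i => -((-1 : ℂ) ^ j • (Complex.I / 2) •
    iteratedDerivWithin j (fun t => l.q j t (Y i t)) S t) with hγ
  have cp : ∀ j ≤ r / 2, ContDiffOn ℝ j (fun t => l.p j t (Y j t)) S := fun j hj =>
    (hl.1 j hj).opApply (hYc _ _ (by omega))
  have cs : ∀ j < K, ContDiffOn ℝ j (fun t => l.s (j + 1) t (Y (j + 1) t)) S := fun j hj =>
    ((hl.2 (j + 1) (by omega) (by omega)).2.of_nat_le (by omega)).opApply (hYc _ _ (by omega))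
  have cq : ∀ j, 1 ≤ j → j ≤ K → ContDiffOn ℝ j (fun t => l.q j t (Y (j - 1) t)) S :=
    fun j hj hj' => (hl.2 j hj hj').1.opApply (hYc _ _ (by omega))
  have hlast : ∀ j ≤ r / 2, (-1 : ℂ) ^ j • iteratedDerivWithin j
      (fun t => l.lastRow t (fun i => Y i t) j) S t = α j + if j = 0 then 0 else γ j (j - 1) := by
    intro j hj
    by_cases h0 : j = 0
    · subst h0; simp [lastRow, hα]
    · simp only [lastRow, if_neg h0, sub_eq_add_neg, ← neg_smul]
      rw [iteratedDerivWithin_add_nat hab (cp j hj) (ContDiffOn.constSmul (cq j (by omega) (by omega)) _)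
        ht, iteratedDerivWithin_smul_nat hab (cq j (by omega) (by omega)) _ ht, smul_add]
      simp only [hα, hγ]
      module
  have hrow : ∀ j < K, (-1 : ℂ) ^ j • iteratedDerivWithin j (G j) S t =
      (α j + β j) + if j = 0 then 0 else γ j (j - 1) := by
    intro j hj
    have hlc : ContDiffOn ℝ j (fun t => l.lastRow t (fun i => Y i t) j) S :=
      contDiffOn_lastRow hl le_rfl (by omega) fun i hi => hYc _ _ (by omega)
    have e : G j = fun t => l.lastRow t (fun i => Y i t) j +
        (Complex.I / 2) • l.s (j + 1) t (Y (j + 1) t) := by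
      funext τ
      simp only [hG, if_pos hj, formRow, lastRow]
      split_ifs <;> module
    rw [e, iteratedDerivWithin_add_nat hab hlc (ContDiffOn.constSmul (cs j hj) _) ht,
      iteratedDerivWithin_smul_nat hab (cs j hj) _ ht, smul_add, hlast j (by omega)]
    simp only [hβ]
    abel
  have heven : ∀ j, Complex.I ^ (2 * j) • l.term S (2 * j) y t = α j := by
    intro j
    rw [term, if_pos (even_two_mul j), show 2 * j / 2 = j by omega, I_pow_two_mul]
  have hodd : ∀ j < K, Complex.I ^ (2 * j + 1) • l.term S (2 * j + 1) y t = β j + γ (j + 1) j := by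
    intro j hj
    have cq' := cq (j + 1) (by omega) (by omega)
    rw [Nat.add_sub_cancel] at cq'
    rw [term, if_neg (by simp), show (2 * j + 1) / 2 = j by omega, pow_succ, I_pow_two_mul]
    change ((-1) ^ j * Complex.I) • (1 / 2 : ℂ) • iteratedDerivWithin j (fun τ => derivWithin
      (fun σ => l.q (j + 1) σ (Y j σ)) S τ + l.s (j + 1) τ (Y (j + 1) τ)) S t = _
    rw [iteratedDerivWithin_add_nat hab (cq'.derivWithin_nat hab) (cs j hj) ht,
      ← iteratedDerivWithin_succ']
    simp only [hβ, hγ, pow_succ]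
    module
  rw [Finset.sum_congr rfl fun j hj => hrow j (Finset.mem_range.1 hj), Finset.sum_add_distrib, apply]
  have hGK : G K = fun t => l.topRow r t (fun i => Y i t) := by
    funext τ; simp [hG]
  rw [hGK]
  rcases Nat.even_or_odd' r with ⟨n, rfl | rfl⟩
  · have hKn : K = n := by omega
    have h2 : 2 * n / 2 = n := by omega
    have htop : (fun t => l.topRow (2 * n) t (fun i => Y i t)) =
        fun t => l.lastRow t (fun i => Y i t) n := by
      funext τ; rw [topRow, if_pos (even_two_mul n), h2]
    rw [htop, hKn, hlast n (by omega), Finset.sum_range_succ, sum_range_two_mul, heven n,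
      Finset.sum_congr rfl fun j hj => by
        rw [heven j, hodd j (by rw [Finset.mem_range] at hj; omega)]]
    have h3 := sum_shift_pred γ n
    simp only [Finset.sum_add_distrib] at h3 ⊢
    rw [← h3]
    abel
  · have hKn : K = n + 1 := by omega
    have h2 : (2 * n + 1) / 2 = n := by omega
    have htop : (fun t => l.topRow (2 * n + 1) t (fun i => Y i t)) =
        fun t => (-(Complex.I / 2)) • l.q (n + 1) t (Y n t) := by
      funext τ; rw [topRow, if_neg (by simp), h2, neg_smul]
    have cq' := cq (n + 1) (by omega) (by omega)
    rw [Nat.add_sub_cancel] at cq'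
    rw [htop, hKn, iteratedDerivWithin_smul_nat hab cq' _ ht,
      show 2 * n + 1 + 1 = 2 * (n + 1) by ring, sum_range_two_mul,
      Finset.sum_congr rfl fun j hj => by
        rw [heven j, hodd j (by rw [Finset.mem_range] at hj; omega)]]
    have h3 := sum_shift_pred γ (n + 1)
    have h4 : (-1 : ℂ) ^ (n + 1) • -(Complex.I / 2) • iteratedDerivWithin (n + 1)
        (fun t => l.q (n + 1) t (Y n t)) S t = γ (n + 1) n := by
      simp only [hγ]; module
    rw [if_neg (by omega), Nat.add_sub_cancel] at h3
    rw [h4]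
    simp only [Finset.sum_add_distrib] at h3 ⊢
    rw [← h3]
    abel

end DiffExpr

end

/-! ### Chains of derivatives and quasi-derivatives; regularity by bootstrapping -/

section

variable {E : Type*} [NormedAddCommGroup E] [InnerProductSpace ℂ E] [CompleteSpace E]

open ContinuousLinearMap (adjoint)
open BlockSpace

namespace DiffExpr

/-- The `j`-th derivative and the quasi-derivatives `Ψ_j = y^{[r-1-j]}` of a solution of `l[y] = ρ`
satisfy the following first order relations. -/
structure IsChain (l : DiffExpr E) (r : ℕ) (a b : ℝ) (X Ψ : ℕ → ℝ → E) (ρ : ℝ → E) : Prop where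
  derivX : ∀ j < (r + 1) / 2, ∀ t ∈ Icc a b, HasDerivWithinAt (X j) (X (j + 1) t) (Icc a b) t
  derivΨ : ∀ j < r / 2, ∀ t ∈ Icc a b, HasDerivWithinAt (Ψ j)
    (l.formRow t (fun i => X i t) j - if j = 0 then ρ t else Ψ (j - 1) t) (Icc a b) t
  last : ∀ t ∈ Icc a b, (if Even r then 0 else (Complex.I / 2) •
      ((l.q (r / 2 + 1) t + l.s (r / 2 + 1) t) (X (r / 2 + 1) t) +
        derivWithin (l.q (r / 2 + 1)) (Icc a b) t (X (r / 2) t))) +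
      l.lastRow t (fun i => X i t) (r / 2) = if r / 2 = 0 then ρ t else Ψ (r / 2 - 1) t

variable {l : DiffExpr E} {r : ℕ} {a b : ℝ} {X Ψ : ℕ → ℝ → E} {ρ y : ℝ → E}

/-- The derivatives and quasi-derivatives of a smooth function form a chain. -/
lemma isChain_of_contDiffOn (hab : a < b) (hl : l.IsSmooth r a b)
    (hy : ContDiffOn ℝ r y (Icc a b)) :
    IsChain l r a b (fun j => iteratedDerivWithin j y (Icc a b))
      (fun j => l.upperQuasiDeriv r (Icc a b) y ((r + 1) / 2 - (j + 1)))
      (l.apply r (Icc a b) y) := by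
  have hu := uniqueDiffOn_Icc hab
  have hstep : ∀ d < (r + 1) / 2, ∀ t ∈ Icc a b,
      HasDerivWithinAt (l.upperQuasiDeriv r (Icc a b) y d)
      (l.formRow t (fun i => iteratedDerivWithin i y (Icc a b) t) (r - (r / 2 + d + 1)) -
        l.upperQuasiDeriv r (Icc a b) y (d + 1) t) (Icc a b) t := by
    intro d hd t ht
    rw [upperQuasiDeriv_succ]
    have h := (contDiffOn_upperQuasiDeriv hab hl hy hd.le).hasDerivWithinAt_nat (by omega) ht
    convert h using 1
    abel
  refine ⟨fun j hj t ht => hasDerivWithinAt_iteratedDerivWithin hab hy (by omega) ht,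
    fun j hj t ht => ?_, fun t ht => ?_⟩
  · have h := hstep ((r + 1) / 2 - (j + 1)) (by omega) t ht
    rw [show r - (r / 2 + ((r + 1) / 2 - (j + 1)) + 1) = j by omega,
      show (r + 1) / 2 - (j + 1) + 1 = (r + 1) / 2 - j by omega] at h
    convert h using 2
    split_ifs with h0
    · rw [apply_eq_upperQuasiDeriv hab hl hy ht, h0, Nat.sub_zero]
    · rw [show j - 1 + 1 = j by omega]
  · have hrhs : (if r / 2 = 0 then l.apply r (Icc a b) y t else
        l.upperQuasiDeriv r (Icc a b) y ((r + 1) / 2 - (r / 2 - 1 + 1)) t) =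
        l.upperQuasiDeriv r (Icc a b) y ((r + 1) / 2 - r / 2) t := by
      split_ifs with h0
      · rw [apply_eq_upperQuasiDeriv hab hl hy ht, h0, Nat.sub_zero]
      · rw [show r / 2 - 1 + 1 = r / 2 by omega]
    rw [hrhs]
    rcases Nat.even_or_odd' r with ⟨n, rfl | rfl⟩
    · rw [if_pos (even_two_mul n), zero_add, show (2 * n + 1) / 2 - 2 * n / 2 = 0 by omega,
        upperQuasiDeriv_zero]
      simp only [topRow, if_pos (even_two_mul n)]
    · have h2 : (2 * n + 1) / 2 = n := by omega
      rw [if_neg (by simp), show (2 * n + 1 + 1) / 2 - (2 * n + 1) / 2 = 0 + 1 by omega,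
        upperQuasiDeriv_succ, upperQuasiDeriv_zero, h2, show 2 * n + 1 - (n + 0 + 1) = n by omega]
      have hq := ((hl.2 (n + 1) (by omega) (by omega)).1).hasDerivWithinAt_nat (by omega) ht
      have hY := hasDerivWithinAt_iteratedDerivWithin hab hy (j := n) (by omega) ht
      have htop : (fun t => l.topRow (2 * n + 1) t
          (fun i => iteratedDerivWithin i y (Icc a b) t)) =
          fun t => (-(Complex.I / 2)) • l.q (n + 1) t (iteratedDerivWithin n y (Icc a b) t) := by
        funext τ; rw [topRow, if_neg (by simp), h2, neg_smul]
      have hd := ((hq.opApply hY).fun_const_smul (-(Complex.I / 2))).derivWithin (hu t ht)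
      rw [htop, hd, formRow, lastRow, FunLike.coe_add, Pi.add_apply]
      split_ifs <;> module

namespace IsChain

variable (h : IsChain l r a b X Ψ ρ) (hab : a < b)
include h hab

lemma contDiffOn_lower {k : ℕ} (hk : ContDiffOn ℝ k (X (r / 2)) (Icc a b)) {d j : ℕ}
    (hd : j + d = r / 2) : ContDiffOn ℝ (k + d : ℕ) (X j) (Icc a b) := by
  induction d generalizing j with
  | zero => rw [add_zero] at hd ⊢; rwa [hd]
  | succ d ih =>
    exact contDiffOn_succ_of_hasDeriv hab (h.derivX j (by omega)) (ih (j := j + 1) (by omega))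

/-- The derivative of `Ψ_j` is a row with coefficients at least of class `C^j` in functions at least
of class `C^k`; integrating gains one order, limited by the smaller of the two. -/
lemma contDiffOn_Ψ (hl : l.IsSmooth r a b) (hρ : ContinuousOn ρ (Icc a b)) {k : ℕ}
    (hk : ContDiffOn ℝ k (X (r / 2)) (Icc a b)) {j : ℕ} (hj : j < r / 2) :
    ContDiffOn ℝ (min j k + 1 : ℕ) (Ψ j) (Icc a b) := by
  induction j with
  | zero =>
    refine contDiffOn_succ_of_hasDeriv hab (h.derivΨ 0 hj) (ContDiffOn.sub ?_ ?_)
    · exact contDiffOn_formRow hl (by omega) (by omega) fun i hi =>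
        (h.contDiffOn_lower hab hk (d := r / 2 - i) (by omega)).of_nat_le (by omega)
    · simp only [if_true, Nat.zero_min, Nat.cast_zero]
      exact contDiffOn_zero.2 hρ
  | succ j ih =>
    refine contDiffOn_succ_of_hasDeriv hab (h.derivΨ (j + 1) hj) (ContDiffOn.sub ?_ ?_)
    · exact contDiffOn_formRow hl (by omega) (by omega) fun i hi =>
        (h.contDiffOn_lower hab hk (d := r / 2 - i) (by omega)).of_nat_le (by omega)
    · simp only [Nat.add_eq_zero_iff, one_ne_zero, and_false, if_false, Nat.add_sub_cancel]
      exact (ih (by omega)).of_nat_le (by omega)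

lemma contDiffOn_prev (hl : l.IsSmooth r a b) (hρ : ContinuousOn ρ (Icc a b)) {k : ℕ}
    (hkr : k ≤ r / 2) (hk : ContDiffOn ℝ k (X (r / 2)) (Icc a b)) :
    ContDiffOn ℝ k (fun t => if r / 2 = 0 then ρ t else Ψ (r / 2 - 1) t) (Icc a b) := by
  split_ifs with h0
  · obtain rfl : k = 0 := by omega
    exact contDiffOn_zero.2 hρ
  · exact (h.contDiffOn_Ψ hab hl hρ hk (j := r / 2 - 1) (by omega)).of_nat_le (by omega)

/-- Bootstrap: the last relation gives `X_n = p_n⁻¹(Ψ_{n-1} + (i/2) q_n X_{n-1})`, and both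
functions on the right are one order smoother than `X_n`. The smoothness of the coefficients stops
the gain at order `n`. -/
lemma contDiffOn_top_even (hr : Even r) (hu : ∀ t ∈ Icc a b, IsUnit (l.p (r / 2) t))
    (hl : l.IsSmooth r a b) (hρ : ContinuousOn ρ (Icc a b)) (hr0 : 0 < r)
    (hc : ContinuousOn (X (r / 2)) (Icc a b)) {k : ℕ} (hk : k ≤ r / 2) :
    ContDiffOn ℝ k (X (r / 2)) (Icc a b) := by
  obtain ⟨n, rfl⟩ := even_iff_exists_two_mul.1 hr
  have h2 : 2 * n / 2 = n := by omega
  rw [h2] at hu hc hk ⊢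
  have hn : n ≠ 0 := by omega
  induction k with
  | zero => exact contDiffOn_zero.2 hc
  | succ k ih =>
    have ih := ih (by omega)
    have hΨ := h.contDiffOn_Ψ hab hl hρ (k := k) (by rwa [h2]) (j := n - 1) (by omega)
    have hX := h.contDiffOn_lower hab (k := k) (by rwa [h2]) (d := 1) (j := n - 1) (by omega)
    have hP := contDiffOn_ringInverse (((hl.1 n (by omega)).of_nat_le hk)) hu
    have hq := (hl.2 n (by omega) (by omega)).1.of_nat_le hk
    refine (hP.opApply ((hΨ.of_nat_le (k' := k + 1) (by omega)).add
      (ContDiffOn.constSmul (hq.opApply hX) (Complex.I / 2)))).congr fun t ht => ?_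
    rw [eq_inverse_apply_iff (hu t ht)]
    have := h.last t ht
    rw [if_pos (even_two_mul n), zero_add, h2, lastRow, if_neg hn, if_neg hn] at this
    rw [← this]
    abel

/-- Bootstrap: the last relation is solved for `X_{n+1} = X_n'` by inverting `q_{n+1} + s_{n+1}`.
The right-hand side is as smooth as `X_n`, so each round gains one order, up to `n + 1`. -/
lemma contDiffOn_top_odd (hr : ¬Even r)
    (hu : ∀ t ∈ Icc a b, IsUnit (l.q (r / 2 + 1) t + l.s (r / 2 + 1) t))
    (hl : l.IsSmooth r a b) (hρ : ContinuousOn ρ (Icc a b)) {k : ℕ} (hk : k ≤ r / 2 + 1) :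
    ContDiffOn ℝ k (X (r / 2)) (Icc a b) := by
  obtain ⟨n, rfl⟩ := Nat.not_even_iff_odd.1 hr
  have h2 : (2 * n + 1) / 2 = n := by omega
  have hX := h.derivX n (by omega)
  have hlast := h.last
  have hprev := fun k => h.contDiffOn_prev hab hl hρ (k := k)
  have hlow := fun k => h.contDiffOn_lower hab (k := k)
  rw [h2] at hu hk hlast hprev hlow ⊢
  obtain ⟨hq, hs⟩ := hl.2 (n + 1) (by omega) (by omega)
  induction k with
  | zero =>
    exact contDiffOn_zero.2 fun t ht => (hX t ht).continuousWithinAt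
  | succ k ih =>
    have ih := ih (by omega)
    have hP := contDiffOn_ringInverse ((hq.add hs).of_nat_le (k' := k) (by omega)) hu
    refine contDiffOn_succ_of_hasDeriv hab hX ?_
    have hrow : ContDiffOn ℝ k (fun t => l.lastRow t (fun i => X i t) n) (Icc a b) :=
      contDiffOn_lastRow hl (by omega) (by omega) fun i hi =>
        (hlow k ih (d := n - i) (by omega)).of_nat_le (by omega)
    have hq' := (hq.of_nat_le (k' := k + 1) (by omega)).derivWithin_nat hab
    refine (hP.opApply ((ContDiffOn.constSmul ((hprev k (by omega) ih).sub hrow)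
      (-2 * Complex.I)).sub (hq'.opApply ih))).congr fun t ht => ?_
    rw [eq_inverse_apply_iff (hu t ht)]
    have := hlast t ht
    rw [if_neg hr] at this
    rw [← this]
    have hI : -2 * Complex.I * (Complex.I / 2) = 1 := by
      linear_combination -Complex.I_mul_I
    rw [add_sub_cancel_right, smul_smul, hI, one_smul, add_sub_cancel_right]

/-- A chain consists of the derivatives and quasi-derivatives of a smooth solution. -/
lemma contDiffOn (hu : ∀ t ∈ Icc a b, if Even r then IsUnit (l.p (r / 2) t)
      else IsUnit (l.q (r / 2 + 1) t + l.s (r / 2 + 1) t))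
    (hl : l.IsSmooth r a b) (hρ : ContinuousOn ρ (Icc a b)) (hr0 : 0 < r)
    (hc : ContinuousOn (X (r / 2)) (Icc a b)) : ContDiffOn ℝ r (X 0) (Icc a b) := by
  by_cases hr : Even r
  · simp only [if_pos hr] at hu
    exact (h.contDiffOn_lower hab (h.contDiffOn_top_even hab hr hu hl hρ hr0 hc le_rfl)
      (d := r / 2) (j := 0) (by omega)).of_nat_le (by
        obtain ⟨n, rfl⟩ := even_iff_exists_two_mul.1 hr; omega)
  · simp only [if_neg hr] at hu
    exact (h.contDiffOn_lower hab (h.contDiffOn_top_odd hab hr hu hl hρ le_rfl)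
      (d := r / 2) (j := 0) (by omega)).of_nat_le (by omega)

lemma iteratedDerivWithin_eq {j : ℕ} (hj : j ≤ (r + 1) / 2) :
    EqOn (iteratedDerivWithin j (X 0) (Icc a b)) (X j) (Icc a b) := by
  have hu := uniqueDiffOn_Icc hab
  induction j with
  | zero => rw [iteratedDerivWithin_zero]; exact eqOn_refl _ _
  | succ j ih =>
    intro t ht
    have ih := ih (by omega)
    rw [iteratedDerivWithin_succ, derivWithin_congr ih (ih ht)]
    exact (h.derivX j (by omega) t ht).derivWithin (hu t ht)

/-- The induction starts at `d = 0` for even order and at `d = 1` for odd order. In the odd case the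
quasi-derivative `y^{[n]}` is a multiple of `q_{n+1} y^{(n)}` and is not a member of the chain. -/
lemma upperQuasiDeriv_eq (hl : l.IsSmooth r a b) {d : ℕ} (hd : d ≤ (r + 1) / 2)
    (hd' : (r + 1) / 2 - r / 2 ≤ d) {t : ℝ} (ht : t ∈ Icc a b) :
    l.upperQuasiDeriv r (Icc a b) (X 0) d t =
      if d = (r + 1) / 2 then ρ t else Ψ ((r + 1) / 2 - (d + 1)) t := by
  have hu := uniqueDiffOn_Icc hab
  have hrow : ∀ j < (r + 1) / 2, ∀ t ∈ Icc a b,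
      l.formRow t (fun i => iteratedDerivWithin i (X 0) (Icc a b) t) j =
        l.formRow t (fun i => X i t) j := fun j hj t ht =>
    formRow_congr fun i hi => h.iteratedDerivWithin_eq hab (by omega) ht
  have hbase : ∀ t ∈ Icc a b, l.upperQuasiDeriv r (Icc a b) (X 0) ((r + 1) / 2 - r / 2) t =
      if r / 2 = 0 then ρ t else Ψ (r / 2 - 1) t := by
    intro t ht
    rw [← h.last t ht]
    rcases Nat.even_or_odd' r with ⟨n, rfl | rfl⟩
    · rw [if_pos (even_two_mul n), zero_add, show (2 * n + 1) / 2 - 2 * n / 2 = 0 by omega,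
        upperQuasiDeriv_zero]
      simp only [topRow, if_pos (even_two_mul n)]
      exact lastRow_congr fun i hi => h.iteratedDerivWithin_eq hab (by omega) ht
    · have h2 : (2 * n + 1) / 2 = n := by omega
      rw [if_neg (by simp), show (2 * n + 1 + 1) / 2 - (2 * n + 1) / 2 = 0 + 1 by omega,
        upperQuasiDeriv_succ, upperQuasiDeriv_zero, h2, show 2 * n + 1 - (n + 0 + 1) = n by omega,
        hrow n (by omega) t ht]
      have hq := ((hl.2 (n + 1) (by omega) (by omega)).1).hasDerivWithinAt_nat (by omega) ht
      have hX := h.derivX n (by omega) t ht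
      have htop : EqOn (fun t => l.topRow (2 * n + 1) t
          (fun i => iteratedDerivWithin i (X 0) (Icc a b) t))
          (fun t => (-(Complex.I / 2)) • l.q (n + 1) t (X n t)) (Icc a b) := by
        intro τ hτ
        simp only [topRow, if_neg (by simp : ¬Even (2 * n + 1)), h2, neg_smul]
        rw [h.iteratedDerivWithin_eq hab (by omega) hτ]
      have hd := ((hq.opApply hX).fun_const_smul (-(Complex.I / 2))).derivWithin (hu t ht)
      rw [derivWithin_congr htop (htop ht), hd, formRow, lastRow, FunLike.coe_add, Pi.add_apply]
      split_ifs <;> module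
  induction d, hd' using Nat.le_induction generalizing t with
  | base =>
    rw [hbase t ht]
    by_cases h0 : r / 2 = 0
    · rw [if_pos h0, if_pos (by omega)]
    · rw [if_neg h0, if_neg (by omega),
        show (r + 1) / 2 - ((r + 1) / 2 - r / 2 + 1) = r / 2 - 1 by omega]
  | succ d hd1 ih =>
    have ih' : EqOn (l.upperQuasiDeriv r (Icc a b) (X 0) d) (Ψ ((r + 1) / 2 - (d + 1))) (Icc a b) :=
      fun τ hτ => by rw [ih (by omega) hτ, if_neg (by omega)]
    have hΨ := (h.derivΨ ((r + 1) / 2 - (d + 1)) (by omega) t ht).derivWithin (hu t ht)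
    rw [upperQuasiDeriv_succ, derivWithin_congr ih' (ih' ht), hΨ,
      show r - (r / 2 + d + 1) = (r + 1) / 2 - (d + 1) by omega, hrow _ (by omega) t ht]
    by_cases h0 : d + 1 = (r + 1) / 2
    · rw [if_pos h0, if_pos (by omega)]; abel
    · rw [if_neg h0, if_neg (by omega),
        show (r + 1) / 2 - (d + 1) - 1 = (r + 1) / 2 - (d + 1 + 1) by omega]
      abel

lemma quasiDeriv_eq (hl : l.IsSmooth r a b) {j : ℕ} (hj : j < r / 2) {t : ℝ} (ht : t ∈ Icc a b) :
    l.quasiDeriv r (Icc a b) (X 0) (r - (j + 1)) t = Ψ j t := by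
  rw [quasiDeriv, if_neg (by omega), h.upperQuasiDeriv_eq hab hl (by omega) (by omega) ht,
    if_neg (by omega)]
  congr 1
  omega

lemma apply_eq (hu : ∀ t ∈ Icc a b, if Even r then IsUnit (l.p (r / 2) t)
      else IsUnit (l.q (r / 2 + 1) t + l.s (r / 2 + 1) t))
    (hl : l.IsSmooth r a b) (hρ : ContinuousOn ρ (Icc a b)) (hr0 : 0 < r)
    (hc : ContinuousOn (X (r / 2)) (Icc a b)) {t : ℝ} (ht : t ∈ Icc a b) :
    l.apply r (Icc a b) (X 0) t = ρ t := by
  rw [apply_eq_upperQuasiDeriv hab hl (h.contDiffOn hab hu hl hρ hr0 hc) ht,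
    h.upperQuasiDeriv_eq hab hl le_rfl (by omega) ht, if_pos rfl]

end IsChain

end DiffExpr

end

/-! ### The first order system in terms of a chain and a source -/

section

section VectorDerivative

variable {V F : Type*} [NormedAddCommGroup V] [InnerProductSpace ℂ V]
  [NormedAddCommGroup F] [NormedSpace ℂ F]

/-- Differentiability of a function of a real variable with values in a complex inner product
space. -/
def HasVecDerivWithinAt (x : ℝ → V) (x' : V) (s : Set ℝ) (t : ℝ) : Prop :=
  HasDerivWithinAt x x' s t

lemma hasVecDerivWithinAt_sum {ι : Type*} [Fintype ι] (φ : ι → F →L[ℂ] V) {f : ι → ℝ → F}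
    {f' : ι → F} {s : Set ℝ} {t : ℝ} (h : ∀ i, HasDerivWithinAt (f i) (f' i) s t) :
    HasVecDerivWithinAt (fun t => ∑ i, φ i (f i t)) (∑ i, φ i (f' i)) s t :=
  HasDerivWithinAt.fun_sum fun i _ =>
    ((φ i).hasFDerivAt.restrictScalars ℝ).comp_hasDerivWithinAt t (h i)

end VectorDerivative

variable {E : Type*} [NormedAddCommGroup E] [InnerProductSpace ℂ E] [CompleteSpace E]

open ContinuousLinearMap (adjoint)
open BlockSpace

namespace BlockSpace

lemma coord_embed {r i : ℕ} (hi : i < r) (j : Fin r) (v : E) :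
    coord r i (embed j v) = if (j : ℕ) = i then v else 0 := by
  rw [coord_of_lt hi]
  by_cases h : j = ⟨i, hi⟩
  · subst h; simp [embed]
  · rw [if_neg (fun h' => h (Fin.ext h'))]
    simp [embed, Ne.symm h]

lemma sum_embed_coord {r : ℕ} (x : BlockSpace E r) : ∑ j : Fin r, embed j (coord r j x) = x := by
  refine ext_coord fun i hi => ?_
  rw [map_sum]
  simp only [coord_embed hi]
  rw [Finset.sum_eq_single ⟨i, hi⟩ (fun j _ hj => if_neg fun h => hj (Fin.ext h)) (by simp)]
  simp

lemma hasVecDerivWithinAt_iff {r : ℕ} {x : ℝ → BlockSpace E r} {x' : BlockSpace E r} {s : Set ℝ}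
    {t : ℝ} : HasVecDerivWithinAt x x' s t ↔
      ∀ i < r, HasDerivWithinAt (fun t => coord r i (x t)) (coord r i x') s t := by
  constructor
  · exact fun h i _ => HasDerivWithinAt.clmApply h (coord r i)
  · intro h
    have := hasVecDerivWithinAt_sum (fun j : Fin r => embed (E := E) j) (fun j => h j j.2)
    simpa only [sum_embed_coord] using this

lemma continuousOn_iff_coord {r : ℕ} {x : ℝ → BlockSpace E r} {s : Set ℝ} :
    ContinuousOn x s ↔ ∀ i < r, ContinuousOn (fun t => coord r i (x t)) s := by
  constructor
  · exact fun h i _ => (coord r i).continuous.comp_continuousOn h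
  · intro h
    have : ContinuousOn (fun t => ∑ j : Fin r, embed j (coord r j (x t))) s :=
      continuousOn_finsetSum _ fun j _ => (embed j).continuous.comp_continuousOn (h j j.2)
    simpa only [sum_embed_coord] using this

end BlockSpace

namespace DiffExpr

variable {l : DiffExpr E} {r : ℕ} {a b t : ℝ} {X Ψ φ V : ℕ → ℝ → E} {ρ : ℝ → E}
  {x g : ℝ → BlockSpace E r}

/-- The relations between the rows `V_j` of the form of an expression at `f`, the quasi-derivatives
`φ_j` of `f` and the value `ρ` of the expression at `f`. -/
structure IsSource (n : ℕ) (a b : ℝ) (φ V : ℕ → ℝ → E) (ρ : ℝ → E) : Prop where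
  deriv : ∀ j < n, ∀ t ∈ Icc a b,
    HasDerivWithinAt (φ j) (V j t - if j = 0 then ρ t else φ (j - 1) t) (Icc a b) t
  last : ∀ t ∈ Icc a b, V n t = if n = 0 then ρ t else φ (n - 1) t

/-- The components of the vector `T(t, l_{z̄})* v`, `l = l_z`. -/
structure IsSourceVec (l : DiffExpr E) (r : ℕ) (t : ℝ) (v : ℕ → E) (g : BlockSpace E r) : Prop where
  left : ∀ i < r / 2, coord r i g = v i - if Even r ∧ i + 1 = r / 2 then
    (Complex.I / 2) • l.s (r / 2) t (Ring.inverse (l.p (r / 2) t) (v (r / 2))) else 0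
  right : ∀ i < r / 2, coord r (r / 2 + i) g = if Even r ∧ i + 1 = r / 2 then
    Ring.inverse (l.p (r / 2) t) (v (r / 2)) else 0
  last : ¬Even r → coord r (2 * (r / 2)) g = if r / 2 = 0 then v 0 else -(Complex.I • v (r / 2))

/-- The relation between a solution `x` of the first order system with right-hand side and the
derivatives `X_j` and quasi-derivatives `Ψ_j` of a solution of the scalar equation. -/
structure Represents (l : DiffExpr E) (r : ℕ) (a b : ℝ) (φ V : ℕ → ℝ → E) (x : ℝ → BlockSpace E r)
    (X Ψ : ℕ → ℝ → E) : Prop where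
  lower : ∀ t ∈ Icc a b, ∀ i < r / 2, coord r i (x t) = X i t
  upper : ∀ t ∈ Icc a b, ∀ i < r / 2, coord r (r / 2 + i) (x t) = Ψ i t - φ i t
  top : ∀ t ∈ Icc a b, X (r / 2) t = l.jet r t (r / 2) (x t) +
    if Even r then Ring.inverse (l.p (r / 2) t) (V (r / 2) t) else 0
  next : ¬Even r → ∀ t ∈ Icc a b, X (r / 2 + 1) t = derivWithin (X (r / 2)) (Icc a b) t

/-- The factor relating the last component of a vector of `E^r`, `r` odd, to the derivative of order
`[r/2]`. -/
def topFactor (r : ℕ) : ℂ := if r = 1 then 1 else Complex.I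

lemma topFactor_ne_zero (r : ℕ) : topFactor r ≠ 0 := by
  unfold topFactor; split_ifs <;> simp

lemma jet_top_odd (hr : ¬Even r) (x : BlockSpace E r) :
    l.jet r t (r / 2) x = topFactor r • coord r (2 * (r / 2)) x := by
  obtain ⟨n, rfl⟩ := Nat.not_even_iff_odd.1 hr
  rw [show (2 * n + 1) / 2 = n by omega, topFactor]
  by_cases hn : n = 0
  · subst hn
    rw [if_pos (by omega), one_smul]
    exact jet_one x
  · rw [if_neg (by omega), jet_odd hn]

/-- The rows of the first order system. -/
lemma system_eq_iff (hab : a < b) (ht : t ∈ Icc a b)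
    (hq : 2 * (r / 2) < r → DifferentiableWithinAt ℝ (l.q (r / 2 + 1)) (Icc a b) t)
    (x x' g : BlockSpace E r) :
    Complex.I • reOp (l.Qcoeff r t) x' +
        (Complex.I / 2) • opDerivWithin (l.Qcoeff r) (Icc a b) t x - l.Hcoeff r t x = g ↔
      (∀ i < r / 2, -coord r (r / 2 + i) x' - coord r i (l.Hcoeff r t x) = coord r i g) ∧
      (∀ i < r / 2, coord r i x' - coord r (r / 2 + i) (l.Hcoeff r t x) = coord r (r / 2 + i) g) ∧
      (2 * (r / 2) < r → Complex.I • reOp (l.q (r / 2 + 1) t) (coord r (2 * (r / 2)) x') +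
        (Complex.I / 2) • derivWithin (l.q (r / 2 + 1)) (Icc a b) t (coord r (2 * (r / 2)) x) -
        coord r (2 * (r / 2)) (l.Hcoeff r t x) = coord r (2 * (r / 2)) g) := by
  rw [Qcoeff_eq, reOp_symplecticOp, derivWithin_Qcoeff hab ht hq]
  have hD : ∀ i < r, coord r i (blockOp (r := r) (fun i j => if i = 2 * (r / 2) ∧ j = 2 * (r / 2) then
      derivWithin (l.q (r / 2 + 1)) (Icc a b) t else 0) x) =
      if i = 2 * (r / 2) then
        derivWithin (l.q (r / 2 + 1)) (Icc a b) t (coord r (2 * (r / 2)) x) else 0 := by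
    intro i hi
    rw [coord_blockOp hi]
    simp only [ite_clm_apply]
    by_cases h : i = 2 * (r / 2)
    · rw [if_pos h, sum_range_ite_eq (c := 2 * (r / 2)) _ (by omega) (fun j _ => by omega)]
    · rw [if_neg h, sum_range_ite_zero _ (fun j _ => by omega)]
  have h1 : ∀ i < r / 2, coord r i (Complex.I • symplecticOp r (reOp (l.q (r / 2 + 1) t)) x' +
      (Complex.I / 2) • blockOp (r := r) (fun i j => if i = 2 * (r / 2) ∧ j = 2 * (r / 2) then
      derivWithin (l.q (r / 2 + 1)) (Icc a b) t else 0) x - l.Hcoeff r t x) =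
      -coord r (r / 2 + i) x' - coord r i (l.Hcoeff r t x) := by
    intro i hi
    rw [map_sub, map_add, map_smul, map_smul, hD i (by omega), if_neg (by omega),
      coord_symplecticOp_left hi, smul_smul, Complex.I_mul_I]
    simp
  have h2 : ∀ i < r / 2, coord r (r / 2 + i) (Complex.I • symplecticOp r (reOp (l.q (r / 2 + 1) t)) x' +
      (Complex.I / 2) • blockOp (r := r) (fun i j => if i = 2 * (r / 2) ∧ j = 2 * (r / 2) then
      derivWithin (l.q (r / 2 + 1)) (Icc a b) t else 0) x - l.Hcoeff r t x) =
      coord r i x' - coord r (r / 2 + i) (l.Hcoeff r t x) := by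
    intro i hi
    rw [map_sub, map_add, map_smul, map_smul, hD _ (by omega), if_neg (by omega),
      coord_symplecticOp_right hi, smul_neg, smul_smul, Complex.I_mul_I]
    simp
  have h3 : 2 * (r / 2) < r → coord r (2 * (r / 2))
      (Complex.I • symplecticOp r (reOp (l.q (r / 2 + 1) t)) x' +
      (Complex.I / 2) • blockOp (r := r) (fun i j => if i = 2 * (r / 2) ∧ j = 2 * (r / 2) then
      derivWithin (l.q (r / 2 + 1)) (Icc a b) t else 0) x - l.Hcoeff r t x) =
      Complex.I • reOp (l.q (r / 2 + 1) t) (coord r (2 * (r / 2)) x') +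
        (Complex.I / 2) • derivWithin (l.q (r / 2 + 1)) (Icc a b) t (coord r (2 * (r / 2)) x) -
        coord r (2 * (r / 2)) (l.Hcoeff r t x) := by
    intro h
    rw [map_sub, map_add, map_smul, map_smul, hD _ h, if_pos rfl, coord_symplecticOp_last h]
  constructor
  · intro h
    rw [← h]
    exact ⟨fun i hi => (h1 i hi).symm, fun i hi => (h2 i hi).symm, fun hr => (h3 hr).symm⟩
  · rintro ⟨k1, k2, k3⟩
    refine ext_coord fun i hi => ?_
    rcases lt_cases hi with h | ⟨k, hk, rfl⟩ | ⟨rfl, h⟩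
    · rw [h1 i h, k1 i h]
    · rw [h2 k hk, k2 k hk]
    · rw [h3 h, k3 h]

lemma coord_Hcoeff_left {i : ℕ} (hi : i < r / 2) (x : BlockSpace E r) :
    coord r i (l.Hcoeff r t x) = -l.formRow t (fun j => l.jet r t j x) i +
        if i = 0 then 0 else coord r (r / 2 + (i - 1)) x := by
  rcases Nat.even_or_odd' r with ⟨n, rfl | rfl⟩
  · rw [show 2 * n / 2 = n by omega] at hi ⊢
    exact coord_Hcoeff_even_left hi x
  · rw [show (2 * n + 1) / 2 = n by omega] at hi ⊢
    exact coord_Hcoeff_odd_left hi x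

lemma coord_Hcoeff_right {i : ℕ} (hi : i < r / 2) (x : BlockSpace E r) :
    coord r (r / 2 + i) (l.Hcoeff r t x) = l.jet r t (i + 1) x := by
  rcases Nat.even_or_odd' r with ⟨n, rfl | rfl⟩
  · rw [show 2 * n / 2 = n by omega] at hi ⊢
    exact coord_Hcoeff_even_right hi x
  · rw [show (2 * n + 1) / 2 = n by omega] at hi ⊢
    exact coord_Hcoeff_odd_right hi x

namespace Represents

variable (h : Represents l r a b φ V x X Ψ) (hsrc : IsSource (r / 2) a b φ V ρ)
  (ht : t ∈ Icc a b)
include h ht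

/-- For even order the stored component is `y^{[n]}(l) - f^{[n]}(m)`, not `y^{[n]}(l)`. Solving it
for the derivative of order `n` therefore misses `p_n⁻¹ V_n`, which is put back here. -/
lemma jet_eq {j : ℕ} (hj : j ≤ r / 2) : l.jet r t j (x t) = X j t -
    if Even r ∧ j = r / 2 then Ring.inverse (l.p (r / 2) t) (V (r / 2) t) else 0 := by
  rcases hj.lt_or_eq with h1 | rfl
  · rw [if_neg (by omega), sub_zero, jet_of_lt h1, h.lower t ht j h1]
  · rw [h.top t ht]
    by_cases hr : Even r <;> simp [hr]

lemma formRow_eq {i : ℕ} (hi : i < r / 2) : l.formRow t (fun j => l.jet r t j (x t)) i =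
    l.formRow t (fun j => X j t) i - if Even r ∧ i + 1 = r / 2 then
      (Complex.I / 2) • l.s (r / 2) t (Ring.inverse (l.p (r / 2) t) (V (r / 2) t)) else 0 := by
  rw [formRow, formRow, h.jet_eq ht hi.le, h.jet_eq ht (j := i + 1) hi, h.jet_eq ht (j := i - 1) (by omega),
    if_neg (by omega : ¬(Even r ∧ i = r / 2)), if_neg (by omega : ¬(Even r ∧ i - 1 = r / 2)),
    sub_zero, sub_zero]
  by_cases c : Even r ∧ i + 1 = r / 2
  · rw [if_pos c, if_pos c, map_sub, c.2]
    module
  · rw [if_neg c, if_neg c, sub_zero, sub_zero]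

include hsrc

/-- The equation of the first order system in terms of the derivatives and quasi-derivatives. -/
lemma system_eq_iff (hab : a < b)
    (hq : 2 * (r / 2) < r → DifferentiableWithinAt ℝ (l.q (r / 2 + 1)) (Icc a b) t)
    (hadj : ¬Even r → l.s (r / 2 + 1) t = adjoint (l.q (r / 2 + 1) t))
    (hg : IsSourceVec l r t (fun j => V j t) (g t)) (x' : BlockSpace E r) :
    Complex.I • reOp (l.Qcoeff r t) x' +
        (Complex.I / 2) • opDerivWithin (l.Qcoeff r) (Icc a b) t (x t) - l.Hcoeff r t (x t) = g t ↔
      (∀ i < r / 2, coord r i x' = X (i + 1) t) ∧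
      (∀ i < r / 2, coord r (r / 2 + i) x' =
        (l.formRow t (fun j => X j t) i - if i = 0 then ρ t else Ψ (i - 1) t) -
          (V i t - if i = 0 then ρ t else φ (i - 1) t)) ∧
      (¬Even r → (Complex.I / 2) • ((l.q (r / 2 + 1) t + l.s (r / 2 + 1) t)
          (topFactor r • coord r (2 * (r / 2)) x') +
        derivWithin (l.q (r / 2 + 1)) (Icc a b) t (X (r / 2) t)) +
        l.lastRow t (fun j => X j t) (r / 2) = if r / 2 = 0 then ρ t else Ψ (r / 2 - 1) t) := by
  rw [DiffExpr.system_eq_iff hab ht hq, and_left_comm]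
  refine and_congr ?_ (and_congr ?_ ?_)
  · refine forall₂_congr fun i hi => ?_
    rw [coord_Hcoeff_right hi, hg.right i hi, h.jet_eq ht (j := i + 1) hi, sub_eq_iff_eq_add]
    constructor <;> intro k <;> rw [k] <;> abel
  · refine forall₂_congr fun i hi => ?_
    -- The error in the row of the form equals the extra term of the source vector, so the two
    -- cancel, leaving the relation for the quasi-derivatives.
    rw [coord_Hcoeff_left hi, hg.left i hi, h.formRow_eq ht hi]
    have h1 : (if i = 0 then (0 : E) else coord r (r / 2 + (i - 1)) (x t)) =
        (if i = 0 then ρ t else Ψ (i - 1) t) - if i = 0 then ρ t else φ (i - 1) t := by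
      split_ifs
      · simp
      · rw [h.upper t ht _ (by omega)]
    rw [h1]
    generalize l.formRow t (fun j => X j t) i = A
    generalize (if i = 0 then ρ t else Ψ (i - 1) t) = B'
    generalize (if i = 0 then ρ t else φ (i - 1) t) = C
    generalize (if Even r ∧ i + 1 = r / 2 then _ else (0 : E)) = D
    constructor
    · intro k
      have : coord r (r / 2 + i) x' = -(-coord r (r / 2 + i) x' - (-(A - D) + (B' - C))) + (A - D) - (B' - C) := by
        abel
      rw [this, k]; abel
    · intro k
      rw [k]; abel
  · have hr : 2 * (r / 2) < r ↔ ¬Even r := by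
      rw [Nat.even_iff]; omega
    rw [hr]
    refine forall_congr' fun hr' => ?_
    obtain ⟨n, hn⟩ := Nat.not_even_iff_odd.1 hr'
    have hX : X (r / 2) t = topFactor r • coord r (2 * (r / 2)) (x t) := by
      rw [h.top t ht, if_neg hr', add_zero, jet_top_odd hr']
    have hre : ∀ v : E, reOp (l.q (r / 2 + 1) t) v =
        (1 / 2 : ℂ) • (l.q (r / 2 + 1) t + l.s (r / 2 + 1) t) v := by
      intro v; rw [reOp, hadj hr']; rfl
    rw [hg.last hr', hre]
    by_cases h0 : r / 2 = 0
    · obtain rfl : r = 1 := by omega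
      have hV := hsrc.last t ht
      simp only [Nat.reduceDiv, Nat.mul_zero, Nat.zero_add, if_true, topFactor, one_smul] at hX hV ⊢
      rw [coord_Hcoeff_one, hV, lastRow, if_pos rfl, hX]
      constructor <;> intro k <;> rw [← k] <;> module
    · have hr1 : r ≠ 1 := by omega
      have hV := hsrc.last t ht
      rw [if_neg h0] at hV
      have hH : coord r (2 * (r / 2)) (l.Hcoeff r t (x t)) = Complex.I •
          (l.lastRow t (fun j => X j t) (r / 2) - (Ψ (r / 2 - 1) t - φ (r / 2 - 1) t)) := by
        rw [← h.upper t ht _ (by omega)]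
        have h2 := coord_Hcoeff_odd_last (l := l) (t := t) (n := n) (by omega) (hn ▸ x t)
        have h3 : l.lastRow t (fun j => X j t) (r / 2) =
            l.lastRow t (fun j => l.jet r t j (x t)) (r / 2) := lastRow_congr fun j hj => by
          rw [h.jet_eq ht hj, if_neg (fun hh => hr' hh.1), sub_zero]
        rw [h3]
        subst hn
        rw [show (2 * n + 1) / 2 = n by omega]
        exact h2
      rw [hH, if_neg h0, if_neg h0, hV, hX, topFactor, if_neg hr1]
      simp only [map_smul]
      generalize l.lastRow t (fun j => X j t) (r / 2) = A
      generalize (l.q (r / 2 + 1) t + l.s (r / 2 + 1) t) (coord r (2 * (r / 2)) x') = B'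
      generalize derivWithin (l.q (r / 2 + 1)) (Icc a b) t (coord r (2 * (r / 2)) (x t)) = C
      have hI : Complex.I * Complex.I = -1 := Complex.I_mul_I
      -- The defect of the last chain relation is `i` times the defect of the last row of the
      -- system, so they vanish together.
      have key : (Complex.I / 2) • (Complex.I • B' + Complex.I • C) + A - Ψ (r / 2 - 1) t =
          Complex.I • (Complex.I • (1 / 2 : ℂ) • B' + (Complex.I / 2) • C -
            Complex.I • (A - (Ψ (r / 2 - 1) t - φ (r / 2 - 1) t)) - -(Complex.I • φ (r / 2 - 1) t)) := by
        simp only [smul_add, smul_sub, smul_smul, smul_neg, hI, ← mul_assoc]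
        rw [show Complex.I * (Complex.I / 2) = -(1 / 2) by linear_combination hI / 2,
          show Complex.I / 2 * Complex.I = -(1 / 2) by linear_combination hI / 2]
        module
      constructor
      · intro k
        rw [← sub_eq_zero, key, sub_eq_zero.2 k, smul_zero]
      · intro k
        rw [← sub_eq_zero, key] at k
        exact sub_eq_zero.1 ((smul_eq_zero.1 k).resolve_left Complex.I_ne_zero)

end Represents

end DiffExpr

end

/-! ### Equivalence of chain and system; quasi-derivatives of the source -/

section

variable {E : Type*} [NormedAddCommGroup E] [InnerProductSpace ℂ E] [CompleteSpace E]

open ContinuousLinearMap (adjoint)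
open BlockSpace

namespace DiffExpr

variable {l : DiffExpr E} {r : ℕ} {a b : ℝ} {X Ψ φ V : ℕ → ℝ → E} {ρ : ℝ → E}
  {x g : ℝ → BlockSpace E r}

lemma IsSmooth.differentiableWithinAt_leading (hl : l.IsSmooth r a b) {t : ℝ} (ht : t ∈ Icc a b) :
    2 * (r / 2) < r → DifferentiableWithinAt ℝ (l.q (r / 2 + 1)) (Icc a b) t := fun hr =>
  ((hl.2 (r / 2 + 1) (by omega) (by omega)).1.hasDerivWithinAt_nat (by omega) ht).differentiableWithinAt

lemma isSystemSolution_iff : IsSystemSolution a b (l.Qcoeff r) (l.Hcoeff r) g x ↔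
    ∀ t ∈ Icc a b, ∃ x', HasVecDerivWithinAt x x' (Icc a b) t ∧
      Complex.I • reOp (l.Qcoeff r t) x' +
        (Complex.I / 2) • opDerivWithin (l.Qcoeff r) (Icc a b) t (x t) - l.Hcoeff r t (x t) = g t :=
  Iff.rfl

namespace Represents

variable (h : Represents l r a b φ V x X Ψ) (hsrc : IsSource (r / 2) a b φ V ρ)
  (hab : a < b) (hl : l.IsSmooth r a b)
  (hadj : ¬Even r → ∀ t ∈ Icc a b, l.s (r / 2 + 1) t = adjoint (l.q (r / 2 + 1) t))
  (hg : ∀ t ∈ Icc a b, IsSourceVec l r t (fun j => V j t) (g t))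
include h hsrc hab hl hadj hg

/-- Each component of the system gives one relation of the chain. In even order the closing relation
is algebraic and comes from the definition of the top function instead of a component. -/
lemma isChain (hu : ∀ t ∈ Icc a b, Even r → IsUnit (l.p (r / 2) t)) (hr0 : 0 < r)
    (hx : IsSystemSolution a b (l.Qcoeff r) (l.Hcoeff r) g x) : IsChain l r a b X Ψ ρ := by
  rw [isSystemSolution_iff] at hx
  have hlow : ∀ j < r / 2, ∀ t ∈ Icc a b, HasDerivWithinAt (X j) (X (j + 1) t) (Icc a b) t := by
    intro j hj t ht
    obtain ⟨x', hx', he⟩ := hx t ht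
    rw [h.system_eq_iff hsrc ht hab (hl.differentiableWithinAt_leading ht)
      (fun hr => hadj hr t ht) (hg t ht)] at he
    rw [← he.1 j hj]
    exact ((hasVecDerivWithinAt_iff.1 hx') j (by omega)).congr
      (fun τ hτ => (h.lower τ hτ j hj).symm) (h.lower t ht j hj).symm
  have htop : ∀ t ∈ Icc a b, ∀ x', HasVecDerivWithinAt x x' (Icc a b) t → ¬Even r →
      HasDerivWithinAt (X (r / 2)) (topFactor r • coord r (2 * (r / 2)) x') (Icc a b) t ∧
        X (r / 2 + 1) t = topFactor r • coord r (2 * (r / 2)) x' := by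
    intro t ht x' hx' hr
    have hXx : ∀ τ ∈ Icc a b, X (r / 2) τ = topFactor r • coord r (2 * (r / 2)) (x τ) := fun τ hτ => by
      rw [h.top τ hτ, if_neg hr, add_zero, jet_top_odd hr]
    obtain ⟨n, hn⟩ := Nat.not_even_iff_odd.1 hr
    have h1 : HasDerivWithinAt (X (r / 2)) (topFactor r • coord r (2 * (r / 2)) x') (Icc a b) t :=
      (((hasVecDerivWithinAt_iff.1 hx') (2 * (r / 2)) (by omega)).fun_const_smul (topFactor r)).congr
        hXx (hXx t ht)
    refine ⟨h1, ?_⟩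
    rw [h.next hr t ht, h1.derivWithin (uniqueDiffOn_Icc hab t ht)]
  refine ⟨fun j hj t ht => ?_, fun j hj t ht => ?_, fun t ht => ?_⟩
  · by_cases hj' : j < r / 2
    · exact hlow j hj' t ht
    · obtain rfl : j = r / 2 := by omega
      have hr : ¬Even r := by rw [Nat.even_iff]; omega
      obtain ⟨x', hx', -⟩ := hx t ht
      obtain ⟨h1, h2⟩ := htop t ht x' hx' hr
      rwa [h2]
  · obtain ⟨x', hx', he⟩ := hx t ht
    rw [h.system_eq_iff hsrc ht hab (hl.differentiableWithinAt_leading ht)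
      (fun hr => hadj hr t ht) (hg t ht)] at he
    have h1 := ((hasVecDerivWithinAt_iff.1 hx') (r / 2 + j) (by omega)).add (hsrc.deriv j hj t ht)
    rw [he.2.1 j hj, sub_add_cancel] at h1
    refine h1.congr (fun τ hτ => ?_) ?_
    · rw [Pi.add_apply, h.upper τ hτ j hj, sub_add_cancel]
    · rw [Pi.add_apply, h.upper t ht j hj, sub_add_cancel]
  · by_cases hr : Even r
    · obtain ⟨n, rfl⟩ := even_iff_exists_two_mul.1 hr
      have hn : n ≠ 0 := by omega
      have h2 : 2 * n / 2 = n := by omega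
      have hT := h.top t ht
      have hU := h.upper t ht (n - 1) (by omega)
      have hL := hsrc.last t ht
      have hu := hu t ht hr
      have hlow := h.lower t ht (n - 1) (by omega)
      rw [if_pos hr] at hT
      rw [h2] at hT hU hL hu
      rw [if_neg hn] at hL
      rw [if_pos hr, zero_add, h2, if_neg hn, lastRow, if_neg hn, hT, map_add,
        mul_inverse_apply hu, hL, ← hlow]
      have hj := lastRow_jet_even hn hu (x t)
      rw [hU, lastRow, if_neg hn, jet_of_lt (j := n - 1) (by omega)] at hj
      rw [add_sub_right_comm, hj, sub_add_cancel]
    · obtain ⟨x', hx', he⟩ := hx t ht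
      rw [h.system_eq_iff hsrc ht hab (hl.differentiableWithinAt_leading ht)
        (fun hr => hadj hr t ht) (hg t ht)] at he
      rw [if_neg hr, (htop t ht x' hx' hr).2]
      exact he.2.2 hr

lemma isSystemSolution (hX : IsChain l r a b X Ψ ρ) :
    IsSystemSolution a b (l.Qcoeff r) (l.Hcoeff r) g x := by
  rw [isSystemSolution_iff]
  intro t ht
  let x' : BlockSpace E r := WithLp.toLp 2 fun i : Fin r =>
    if (i : ℕ) < r / 2 then X (i + 1) t else if (i : ℕ) < 2 * (r / 2) then
      (l.formRow t (fun j => X j t) (i - r / 2) -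
        if (i : ℕ) - r / 2 = 0 then ρ t else Ψ (i - r / 2 - 1) t) -
          (V (i - r / 2) t - if (i : ℕ) - r / 2 = 0 then ρ t else φ (i - r / 2 - 1) t)
    else (topFactor r)⁻¹ • X (r / 2 + 1) t
  have c1 : ∀ i < r / 2, coord r i x' = X (i + 1) t := fun i hi => by
    rw [coord_toLp (by omega), if_pos hi]
  have c2 : ∀ i < r / 2, coord r (r / 2 + i) x' =
        (l.formRow t (fun j => X j t) i - if i = 0 then ρ t else Ψ (i - 1) t) -
          (V i t - if i = 0 then ρ t else φ (i - 1) t) := fun i hi => by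
    rw [coord_toLp (by omega), if_neg (by simp), if_pos (by simp; omega)]
    simp only [Nat.add_sub_cancel_left]
  have c3 : 2 * (r / 2) < r → coord r (2 * (r / 2)) x' = (topFactor r)⁻¹ • X (r / 2 + 1) t := by
    intro hr
    rw [coord_toLp hr, if_neg (by simp; omega), if_neg (by simp)]
  refine ⟨x', ?_, ?_⟩
  · rw [hasVecDerivWithinAt_iff]
    intro i hi
    rcases lt_cases hi with h1 | ⟨k, hk, rfl⟩ | ⟨rfl, h1⟩
    · rw [c1 i h1]
      exact (hX.derivX i (by omega) t ht).congr (fun τ hτ => h.lower τ hτ i h1) (h.lower t ht i h1)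
    · rw [c2 k hk]
      exact ((hX.derivΨ k hk t ht).sub (hsrc.deriv k hk t ht)).congr
        (fun τ hτ => h.upper τ hτ k hk) (h.upper t ht k hk)
    · rw [c3 h1]
      have hr : ¬Even r := by rw [Nat.even_iff]; omega
      have hXx : ∀ τ ∈ Icc a b, coord r (2 * (r / 2)) (x τ) = (topFactor r)⁻¹ • X (r / 2) τ :=
        fun τ hτ => by
          rw [h.top τ hτ, if_neg hr, add_zero, jet_top_odd hr, inv_smul_smul₀ (topFactor_ne_zero r)]
      exact ((hX.derivX (r / 2) (by omega) t ht).fun_const_smul (topFactor r)⁻¹).congr hXx (hXx t ht)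
  · rw [h.system_eq_iff hsrc ht hab (hl.differentiableWithinAt_leading ht)
      (fun hr => hadj hr t ht) (hg t ht)]
    refine ⟨c1, c2, fun hr => ?_⟩
    have h1 : 2 * (r / 2) < r := by rw [Nat.even_iff] at hr; omega
    rw [c3 h1, smul_inv_smul₀ (topFactor_ne_zero r)]
    have := hX.last t ht
    rwa [if_neg hr] at this

end Represents

section Source

variable {m : DiffExpr E} {s : ℕ} {f : ℝ → E}

/-- The quasi-derivatives `f^{[s-1-j]}(t|m)`, zero for `j ≥ s/2`. -/
def sourceQuasi (m : DiffExpr E) (s : ℕ) (S : Set ℝ) (f : ℝ → E) (j : ℕ) (t : ℝ) : E :=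
  if j + 1 ≤ s / 2 then m.quasiDeriv s S f (s - (j + 1)) t else 0

/-- The rows of the form of `m` at `f, f', …`. -/
def sourceRow (m : DiffExpr E) (s : ℕ) (S : Set ℝ) (f : ℝ → E) (j : ℕ) (t : ℝ) : E :=
  if j ≤ s / 2 then (if j < s / 2 then m.formRow t (fun i => iteratedDerivWithin i f S t) j
    else m.lastRow t (fun i => iteratedDerivWithin i f S t) j) else 0

/-- Up to index `s/2` these are the chain relations of `f` for the expression `m`; beyond it every
term is zero. This lets an expression of lower order drive a system of order `r` without a separate
case. -/
lemma isSource (hab : a < b) (hs : Even s) {n : ℕ} (hn : s / 2 ≤ n) (hm : m.IsSmooth s a b)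
    (hf : ContDiffOn ℝ s f (Icc a b)) :
    IsSource n a b (m.sourceQuasi s (Icc a b) f) (m.sourceRow s (Icc a b) f)
      (m.apply s (Icc a b) f) := by
  obtain ⟨σ, rfl⟩ := even_iff_exists_two_mul.1 hs
  have hc := isChain_of_contDiffOn hab hm hf
  have h2 : 2 * σ / 2 = σ := by omega
  have h3 : (2 * σ + 1) / 2 = σ := by omega
  have hφ : ∀ j < σ, m.sourceQuasi (2 * σ) (Icc a b) f j =
      m.upperQuasiDeriv (2 * σ) (Icc a b) f ((2 * σ + 1) / 2 - (j + 1)) := by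
    intro j hj
    funext t
    rw [sourceQuasi, if_pos (by omega), quasiDeriv, if_neg (by omega)]
    congr 1
    omega
  have hφ0 : ∀ j, σ ≤ j → m.sourceQuasi (2 * σ) (Icc a b) f j = 0 := by
    intro j hj
    funext t
    rw [sourceQuasi, if_neg (by omega), Pi.zero_apply]
  have hprev : ∀ j ≤ σ, ∀ t, (if j = 0 then m.apply (2 * σ) (Icc a b) f t else
      m.upperQuasiDeriv (2 * σ) (Icc a b) f ((2 * σ + 1) / 2 - (j - 1 + 1)) t) =
      if j = 0 then m.apply (2 * σ) (Icc a b) f t else m.sourceQuasi (2 * σ) (Icc a b) f (j - 1) t := by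
    intro j hj t
    split_ifs
    · rfl
    · rw [hφ (j - 1) (by omega)]
  have hlast : ∀ t ∈ Icc a b, ∀ j, j = σ → m.sourceRow (2 * σ) (Icc a b) f j t =
      if j = 0 then m.apply (2 * σ) (Icc a b) f t else m.sourceQuasi (2 * σ) (Icc a b) f (j - 1) t := by
    rintro t ht j rfl
    have h := hc.last t ht
    rw [if_pos hs, zero_add, h2, hprev j le_rfl] at h
    rw [sourceRow, if_pos (by omega), if_neg (by omega), h]
  refine ⟨fun j hj t ht => ?_, fun t ht => ?_⟩
  · rcases lt_trichotomy j σ with h | h | h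
    · have h1 := hc.derivΨ j (by omega) t ht
      rw [hprev j h.le t] at h1
      rw [hφ j h, sourceRow, if_pos (by omega), if_pos (by omega)]
      exact h1
    -- At the border index the last row of `m` equals the preceding quasi-derivative, or the value
    -- of the expression if the order is zero; the derivative is zero, as it must be since `φ_j = 0`
    -- there.
    · rw [hlast t ht j h, sub_self, hφ0 j h.ge]
      exact hasDerivWithinAt_const _ _ _
    · rw [hφ0 j h.le, sourceRow, if_neg (by omega), if_neg (by omega), hφ0 (j - 1) (by omega),
        Pi.zero_apply, sub_zero]
      exact hasDerivWithinAt_const _ _ _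
  · rcases hn.lt_or_eq with h | h
    · rw [sourceRow, if_neg (by omega), if_neg (by omega), hφ0 (n - 1) (by omega), Pi.zero_apply]
    · exact hlast t ht n (by omega)

lemma continuousOn_sourceRow (hab : a < b) (hs : Even s) (hm : m.IsSmooth s a b)
    (hf : ContDiffOn ℝ s f (Icc a b)) (j : ℕ) :
    ContinuousOn (m.sourceRow s (Icc a b) f j) (Icc a b) := by
  obtain ⟨σ, rfl⟩ := even_iff_exists_two_mul.1 hs
  have hd : ∀ i ≤ σ, ContDiffOn ℝ (0 : ℕ) (iteratedDerivWithin i f (Icc a b)) (Icc a b) := fun i hi =>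
    hf.iteratedDerivWithin_nat hab (by omega)
  unfold sourceRow
  split_ifs with h1 h2
  · exact (contDiffOn_formRow hm (by omega) (by omega) fun i hi => hd i (by omega)).continuousOn
  · exact (contDiffOn_lastRow hm (by omega) (by omega) fun i hi => hd i (by omega)).continuousOn
  · exact continuousOn_const

/-- The various shapes of `F` all serve to give `T F` the components `f, f', …, f^{(s/2)}`. Later
components may differ, but the matrix of `m` does not read them. -/
lemma jet_Fvec {r s : ℕ} (hs : Even s) (hsr : s ≤ r) (hr : 0 < r) {S : Set ℝ} {t : ℝ}
    (hu : Even r → IsUnit (l.p (r / 2) t)) {j : ℕ} (hj : j ≤ s / 2) :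
    l.jet r t j (l.Fvec r s S f t) = iteratedDerivWithin j f S t := by
  obtain ⟨σ, rfl⟩ := even_iff_exists_two_mul.1 hs
  by_cases hjn : j < r / 2
  · rw [jet_of_lt hjn, Fvec, coord_toLp (by omega), if_neg (by omega)]
    by_cases h : 2 * σ = 2 * (r / 2)
    · rw [if_pos h, if_pos hjn]
    · rw [if_neg h, if_pos hj]
  · obtain rfl : j = r / 2 := by omega
    have h : 2 * σ = 2 * (r / 2) := by omega
    rcases Nat.even_or_odd' r with ⟨n, rfl | rfl⟩
    · have hn : n ≠ 0 := by omega
      have h2 : 2 * n / 2 = n := by omega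
      have hu := hu (even_two_mul n)
      rw [h2] at h hu ⊢
      have e1 : coord (2 * n) (n - 1) (l.Fvec (2 * n) (2 * σ) S f t) =
          iteratedDerivWithin (n - 1) f S t := by
        rw [Fvec, coord_toLp (by omega), if_neg (by omega), if_pos (by omega)]
        simp only [h2]
        rw [if_pos (by omega)]
      have e2 : coord (2 * n) (2 * n - 1) (l.Fvec (2 * n) (2 * σ) S f t) =
          l.lastRow t (fun i => iteratedDerivWithin i f S t) n := by
        rw [Fvec, coord_toLp (by omega), if_neg (by omega), if_pos (by omega)]
        simp only [h2]
        rw [if_neg (by omega), if_pos (even_two_mul n), quasiDeriv, if_neg (by omega),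
          show 2 * n - (2 * n - 1 - n + 1) - 2 * n / 2 = 0 by omega, upperQuasiDeriv_zero]
        simp only [topRow, if_pos (even_two_mul n), h2]
      rw [jet_even hn, e1, e2, lastRow, if_neg hn, sub_add_cancel, inverse_mul_apply hu]
    · have h2 : (2 * n + 1) / 2 = n := by omega
      rw [h2] at h ⊢
      by_cases hn : n = 0
      · subst hn
        obtain rfl : σ = 0 := by omega
        have := jet_one (l := l) (t := t) (l.Fvec 1 (2 * 0) S f t)
        refine this.trans ?_
        rw [Fvec, coord_toLp (by omega), if_pos rfl, iteratedDerivWithin_zero]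
      · rw [jet_odd hn, Fvec, coord_toLp (by omega), if_neg (by omega), if_pos (by omega)]
        simp only [h2]
        rw [if_neg (by omega), if_neg (by simp), if_pos trivial, smul_neg, smul_smul, Complex.I_mul_I]
        simp

lemma coord_adjoint_jetOp {r i : ℕ} (hi : i < r) {t : ℝ} (v : BlockSpace E (r / 2 + 1)) :
    coord r i (adjoint (l.jetOp r t) v) = if i < r / 2 then coord (r / 2 + 1) i v +
        (if Even r ∧ i + 1 = r / 2 then adjoint ((Complex.I / 2) • (Ring.inverse (l.p (r / 2) t) ∘L
          l.q (r / 2) t)) (coord (r / 2 + 1) (r / 2) v) else 0)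
      else if Even r then (if i + 1 = 2 * (r / 2) then
        adjoint (Ring.inverse (l.p (r / 2) t)) (coord (r / 2 + 1) (r / 2) v) else 0)
      else if i = 2 * (r / 2) then
        adjoint (if r = 1 then (1 : E →L[ℂ] E) else Complex.I • 1) (coord (r / 2 + 1) (r / 2) v) else 0 := by
  rw [jetOp, adjoint_blockOp, coord_blockOp hi, Finset.sum_range_succ, if_neg (lt_irrefl _)]
  have h1 : ∑ j ∈ Finset.range (r / 2), (adjoint (if j < r / 2 then (if i = j then (1 : E →L[ℂ] E) else 0)
      else if Even r then
        if i + 1 = 2 * (r / 2) then Ring.inverse (l.p (r / 2) t)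
        else if i + 1 = r / 2 then (Complex.I / 2) • (Ring.inverse (l.p (r / 2) t) ∘L l.q (r / 2) t)
        else 0
      else if i = 2 * (r / 2) then (if r = 1 then 1 else Complex.I • 1)
      else 0)) (coord (r / 2 + 1) j v) = if i < r / 2 then coord (r / 2 + 1) i v else 0 := by
    have h2 : ∀ j ∈ Finset.range (r / 2), (adjoint (if j < r / 2 then (if i = j then (1 : E →L[ℂ] E) else 0)
      else if Even r then
        if i + 1 = 2 * (r / 2) then Ring.inverse (l.p (r / 2) t)
        else if i + 1 = r / 2 then (Complex.I / 2) • (Ring.inverse (l.p (r / 2) t) ∘L l.q (r / 2) t)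
        else 0
      else if i = 2 * (r / 2) then (if r = 1 then 1 else Complex.I • 1)
      else 0)) (coord (r / 2 + 1) j v) = if j = i then coord (r / 2 + 1) j v else 0 := by
      intro j hj
      rw [if_pos (Finset.mem_range.1 hj)]
      have h1 : adjoint (1 : E →L[ℂ] E) = 1 := star_one (E →L[ℂ] E)
      by_cases h : j = i
      · rw [if_pos h.symm, if_pos h, h1, one_apply_eq_self]
      · rw [if_neg (Ne.symm h), if_neg h, map_zero]; rfl
    rw [Finset.sum_congr rfl h2]
    split_ifs with h
    · exact sum_range_ite_eq _ h fun _ _ => Iff.rfl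
    · exact sum_range_ite_zero _ fun j _ => by omega
  rw [h1]
  by_cases hi' : i < r / 2
  · rw [if_pos hi', if_pos hi']
    congr 1
    by_cases hr : Even r
    · rw [if_pos hr, if_neg (by omega)]
      by_cases h : i + 1 = r / 2
      · rw [if_pos h, if_pos ⟨hr, h⟩]
      · rw [if_neg h, if_neg (fun h' => h h'.2), map_zero]; rfl
    · rw [if_neg hr, if_neg (by omega), if_neg (fun h' => hr h'.1), map_zero]; rfl
  · rw [if_neg hi', if_neg hi', zero_add]
    by_cases hr : Even r
    · rw [if_pos hr, if_pos hr]
      by_cases h : i + 1 = 2 * (r / 2)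
      · rw [if_pos h, if_pos h]
      · rw [if_neg h, if_neg h, if_neg (by omega), map_zero]; rfl
    · rw [if_neg hr, if_neg hr]
      by_cases h : i = 2 * (r / 2)
      · rw [if_pos h, if_pos h]
      · rw [if_neg h, if_neg h, map_zero]; rfl

end Source

end DiffExpr

end

/-! ### Passage between the scalar equation and the system -/

section

variable {E : Type*} [NormedAddCommGroup E] [InnerProductSpace ℂ E] [CompleteSpace E]

open ContinuousLinearMap (adjoint)
open BlockSpace

lemma adjoint_ringInverse (A : E →L[ℂ] E) : adjoint (Ring.inverse A) = Ring.inverse (adjoint A) :=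
  (Ring.inverse_star A).symm

namespace DiffExpr

namespace IsAnalyticFamily

variable {L : ℂ → DiffExpr E} {r : ℕ} {a b : ℝ} {B : Set ℂ} (hL : IsAnalyticFamily L r a b B)
  {m : DiffExpr E} {s : ℕ} {f y : ℝ → E} {z : ℂ}
include hL

/-- The weight is formed at `z̄`, and its left factor is an adjoint. The symmetry `p(z̄)* = p(z)`,
`q(z̄)* = s(z)` turns it into an expression in the coefficients at `z`, those of the system being
solved. -/
lemma isSourceVec (hs : Even s) (hsr : s ≤ r) (hr : 0 < r) (hz : z ∈ B) {t : ℝ} (ht : t ∈ Icc a b) :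
    IsSourceVec (L z) r t (fun j => m.sourceRow s (Icc a b) f j t)
      ((L (conj z)).Wweight m r s t ((L (conj z)).Fvec r s (Icc a b) f t)) := by
  have hsn : s / 2 ≤ r / 2 := Nat.div_le_div_right hsr
  set v := m.formMatrix s (r / 2) t ((L (conj z)).jetOp r t ((L (conj z)).Fvec r s (Icc a b) f t))
    with hv
  have hW : (L (conj z)).Wweight m r s t ((L (conj z)).Fvec r s (Icc a b) f t) =
      adjoint ((L (conj z)).jetOp r t) v := rfl
  have hrow : ∀ i < r / 2 + 1, coord (r / 2 + 1) i v = m.sourceRow s (Icc a b) f i t := by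
    intro i hi
    have hj : ∀ j ≤ s / 2, coord (r / 2 + 1) j ((L (conj z)).jetOp r t
        ((L (conj z)).Fvec r s (Icc a b) f t)) = iteratedDerivWithin j f (Icc a b) t := fun j hj =>
      jet_Fvec hs hsr hr (fun h => hL.isUnit_p (hL.conj_mem hz) ht h) hj
    rw [hv, coord_formMatrix hsn hi, sourceRow]
    split_ifs with h1 h2
    · exact formRow_congr fun j hj' => hj j (by omega)
    · exact lastRow_congr fun j hj' => hj j (by omega)
    · rfl
  have hP : adjoint (Ring.inverse ((L (conj z)).p (r / 2) t)) = Ring.inverse ((L z).p (r / 2) t) := by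
    rw [adjoint_ringInverse, hL.symm_p z hz t ht _ le_rfl]
  rw [hW]
  refine ⟨fun i hi => ?_, fun i hi => ?_, fun hr' => ?_⟩
  · rw [coord_adjoint_jetOp (by omega), if_pos hi, hrow i (by omega), hrow _ (by omega)]
    by_cases h : Even r ∧ i + 1 = r / 2
    · rw [if_pos h, if_pos h, map_smulₛₗ, ContinuousLinearMap.adjoint_comp, hP,
        hL.q_conj hz ht (by omega) (by omega), ContinuousLinearMap.adjoint_adjoint]
      simp only [map_div₀, Complex.conj_I, map_ofNat, FunLike.coe_smul, Pi.smul_apply,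
        ContinuousLinearMap.comp_apply]
      module
    · rw [if_neg h, if_neg h, sub_zero, add_zero]
  · rw [coord_adjoint_jetOp (by omega), if_neg (by omega), hrow _ (by omega), hP]
    by_cases h : Even r ∧ i + 1 = r / 2
    · rw [if_pos h, if_pos h.1, if_pos (by omega)]
    · rw [if_neg h]
      by_cases h' : Even r
      · rw [if_pos h', if_neg (fun h'' => h ⟨h', by omega⟩)]
      · rw [if_neg h', if_neg (by omega)]
  · have hlt : 2 * (r / 2) < r := by rw [Nat.even_iff] at hr'; omega
    rw [coord_adjoint_jetOp hlt, if_neg (by omega), if_neg hr', if_pos rfl, hrow _ (by omega)]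
    by_cases h0 : r / 2 = 0
    · rw [if_pos h0, if_pos (by omega), h0]
      have h1 : adjoint (1 : E →L[ℂ] E) = 1 := star_one (E →L[ℂ] E)
      rw [h1, one_apply_eq_self]
    · have h1 : adjoint (1 : E →L[ℂ] E) = 1 := star_one (E →L[ℂ] E)
      rw [if_neg h0, if_neg (by omega), map_smulₛₗ, h1]
      simp

lemma continuousOn_sourceVec (hab : a < b) (hs : Even s) (hsr : s ≤ r) (hr : 0 < r) (hz : z ∈ B)
    (hm : m.IsSmooth s a b) (hf : ContDiffOn ℝ s f (Icc a b)) :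
    ContinuousOn (fun t => (L (conj z)).Wweight m r s t ((L (conj z)).Fvec r s (Icc a b) f t))
      (Icc a b) := by
  have hV := fun j => continuousOn_sourceRow hab hs hm hf j
  have hg := fun t ht => hL.isSourceVec (m := m) (f := f) hs hsr hr hz (t := t) ht
  rw [continuousOn_iff_coord]
  intro i hi
  rcases lt_cases hi with h | ⟨k, hk, rfl⟩ | ⟨rfl, h⟩
  · refine ContinuousOn.congr ?_ fun t ht => (hg t ht).left i h
    by_cases c : Even r ∧ i + 1 = r / 2
    · simp only [if_pos c]
      exact (hV i).sub (ContinuousOn.const_smul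
        (((hL.smooth z hz).2 _ (by omega) (by omega)).2.continuousOn.clm_apply
          ((hL.continuousOn_inverse_p hz c.1).clm_apply (hV _))) _)
    · simp only [if_neg c, sub_zero]
      exact hV i
  · refine ContinuousOn.congr ?_ fun t ht => (hg t ht).right k hk
    by_cases c : Even r ∧ k + 1 = r / 2
    · simp only [if_pos c]
      exact (hL.continuousOn_inverse_p hz c.1).clm_apply (hV _)
    · simp only [if_neg c]
      exact continuousOn_const
  · have hr' : ¬Even r := by rw [Nat.even_iff]; omega
    refine ContinuousOn.congr ?_ fun t ht => (hg t ht).last hr'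
    split_ifs
    · exact hV 0
    · exact ((hV _).const_smul _).neg

lemma leading_adjoint_of_odd (hdom : m.IsDominated L r s a b) (hz : z ∈ B) (hr : ¬Even r) {t : ℝ}
    (ht : t ∈ Icc a b) : (L z).s (r / 2 + 1) t = adjoint ((L z).q (r / 2 + 1) t) := by
  obtain ⟨n, rfl⟩ := Nat.not_even_iff_odd.1 hr
  rw [show (2 * n + 1) / 2 = n by omega]
  exact hL.leading_adjoint hdom hz ht

/-- A solution of the scalar equation gives a solution of the first order system. -/
lemma isSystemSolution_yvec (hab : a < b) (hs : Even s) (hsr : s ≤ r) (hr : 0 < r)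
    (hdom : m.IsDominated L r s a b) (hz : z ∈ B) (hm : m.IsSmooth s a b)
    (hf : ContDiffOn ℝ s f (Icc a b)) (hy : ContDiffOn ℝ r y (Icc a b))
    (he : ∀ t ∈ Icc a b, (L z).apply r (Icc a b) y t = m.apply s (Icc a b) f t) :
    IsSystemSolution a b (Qfam L r z) (Hfam L r z)
      (fun t => (L (conj z)).Wweight m r s t ((L (conj z)).Fvec r s (Icc a b) f t))
      ((L z).yvec m r s (Icc a b) y f) := by
  have hsrc := isSource hab hs (n := r / 2) (Nat.div_le_div_right hsr) hm hf
  have hl := hL.smooth z hz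
  have hc0 := isChain_of_contDiffOn hab hl hy
  set Ψ : ℕ → ℝ → E := fun j => (L z).upperQuasiDeriv r (Icc a b) y ((r + 1) / 2 - (j + 1)) with hΨ
  have hc : IsChain (L z) r a b (fun j => iteratedDerivWithin j y (Icc a b)) Ψ
      (m.apply s (Icc a b) f) := by
    refine ⟨hc0.derivX, fun j hj t ht => ?_, fun t ht => ?_⟩
    · rw [← he t ht]; exact hc0.derivΨ j hj t ht
    · rw [← he t ht]; exact hc0.last t ht
  have hupper : ∀ t ∈ Icc a b, ∀ i < r / 2, coord r (r / 2 + i) ((L z).yvec m r s (Icc a b) y f t) =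
      Ψ i t - m.sourceQuasi s (Icc a b) f i t := by
    intro t ht i hi
    rw [yvec, coord_toLp (by omega), if_neg (by omega), if_neg (by simp), if_pos (by simp; omega)]
    simp only [Nat.add_sub_cancel_left, sourceQuasi]
    congr 1
    rw [quasiDeriv, if_neg (by omega), hΨ]
    congr 1
    omega
  have hlower : ∀ t ∈ Icc a b, ∀ i < r / 2, coord r i ((L z).yvec m r s (Icc a b) y f t) =
      iteratedDerivWithin i y (Icc a b) t := by
    intro t ht i hi
    rw [yvec, coord_toLp (by omega), if_neg (by omega), if_pos hi]
  refine Represents.isSystemSolution (X := fun j => iteratedDerivWithin j y (Icc a b)) (Ψ := Ψ)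
    ⟨hlower, hupper, ?_, fun _ t ht => by rw [iteratedDerivWithin_succ]⟩ hsrc hab hl
    (fun hr' t ht => hL.leading_adjoint_of_odd hdom hz hr' ht)
    (fun t ht => hL.isSourceVec hs hsr hr hz ht) hc
  -- In even order the top relation compares two closing relations: `p_n y^{(n)} - (i/2) q_n
  -- y^{(n-1)}` is the lowest quasi-derivative of `y`, and `V_n` is what has been subtracted from
  -- it.
  intro t ht
  rcases Nat.even_or_odd' r with ⟨n, rfl | rfl⟩
  · have hn : n ≠ 0 := by omega
    have h2 : 2 * n / 2 = n := by omega
    have hu := hL.isUnit_p hz ht (even_two_mul n)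
    have hl1 := hc.last t ht
    have hl2 := hsrc.last t ht
    have hU := hupper t ht (n - 1) (by omega)
    have hX := hlower t ht (n - 1) (by omega)
    rw [if_pos (even_two_mul n), zero_add] at hl1
    rw [if_pos (even_two_mul n)]
    rw [h2] at hu hU hl1 hl2 ⊢
    rw [if_neg hn, lastRow, if_neg hn] at hl1
    rw [if_neg hn] at hl2
    rw [jet_even hn, ← map_add, eq_inverse_apply_iff hu, show 2 * n - 1 = n + (n - 1) by omega, hU,
      hX, hl2, ← hl1]
    abel
  · have h2 : (2 * n + 1) / 2 = n := by omega
    rw [if_neg (by simp), add_zero, jet_top_odd (by simp), h2, yvec, coord_toLp (by omega), topFactor]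
    by_cases hn : n = 0
    · subst hn
      rw [if_pos (by omega), if_pos (by omega), one_smul, iteratedDerivWithin_zero]
    · rw [if_neg (by omega), if_neg (by omega)]
      simp only [h2]
      rw [if_neg (by omega), if_neg (by omega), smul_neg, smul_smul, Complex.I_mul_I]
      simp

/-- A solution of the first order system gives a solution of the scalar equation. -/
lemma scalar_of_isSystemSolution (hab : a < b) (hs : Even s) (hsr : s ≤ r) (hr : 0 < r)
    (hdom : m.IsDominated L r s a b) (hz : z ∈ B) (hm : m.IsSmooth s a b)
    (hf : ContDiffOn ℝ s f (Icc a b)) {x : ℝ → BlockSpace E r}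
    (hx : IsSystemSolution a b (Qfam L r z) (Hfam L r z)
      (fun t => (L (conj z)).Wweight m r s t ((L (conj z)).Fvec r s (Icc a b) f t)) x) :
    ContDiffOn ℝ r (fun t => x t ⟨0, hr⟩) (Icc a b) ∧
    (∀ t ∈ Icc a b, (L z).apply r (Icc a b) (fun t => x t ⟨0, hr⟩) t = m.apply s (Icc a b) f t) ∧
    (∀ t ∈ Icc a b, (L z).yvec m r s (Icc a b) (fun t => x t ⟨0, hr⟩) f t = x t) ∧
    ∀ t ∈ Icc a b, ∀ j < r / 2 + 1, iteratedDerivWithin j (fun t => x t ⟨0, hr⟩) (Icc a b) t =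
      (L z).jet r t j (x t) +
        if Even r ∧ j = r / 2 then
          Ring.inverse ((L z).p (r / 2) t) (m.sourceRow s (Icc a b) f (r / 2) t) else 0 := by
  have hsrc := isSource hab hs (n := r / 2) (Nat.div_le_div_right hsr) hm hf
  have hl := hL.smooth z hz
  set V : ℕ → ℝ → E := m.sourceRow s (Icc a b) f with hV
  set φ : ℕ → ℝ → E := m.sourceQuasi s (Icc a b) f with hφ
  let T : ℝ → E := fun t => (L z).jet r t (r / 2) (x t) +
    if Even r then Ring.inverse ((L z).p (r / 2) t) (V (r / 2) t) else 0
  -- `T` is the only possible candidate for `y^{(n)}`. It is not known to be differentiable yet, so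
  -- the function of index `n + 1`, which matters only in odd order, is declared to be its
  -- derivative and justified through the system.
  let X : ℕ → ℝ → E := fun j t => if j < r / 2 then coord r j (x t)
    else if j = r / 2 then T t else derivWithin T (Icc a b) t
  let Ψ : ℕ → ℝ → E := fun j t => coord r (r / 2 + j) (x t) + φ j t
  have hXT : X (r / 2) = T := by
    funext t; simp only [X]; rw [if_neg (lt_irrefl _), if_pos trivial]
  have hX1 : X (r / 2 + 1) = derivWithin T (Icc a b) := by
    funext t; simp only [X]; rw [if_neg (by omega), if_neg (by omega)]
  have hX0 : X 0 = fun t => x t ⟨0, hr⟩ := by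
    funext t
    simp only [X]
    rw [← coord_of_lt hr]
    by_cases h0 : 0 < r / 2
    · rw [if_pos h0]
    · have hne : ¬Even r := by rw [Nat.even_iff]; omega
      rw [if_neg h0, if_pos (by omega)]
      simp only [T]
      rw [if_neg hne, add_zero, jet_top_odd hne, topFactor, if_pos (by omega), one_smul]
      congr 2
      omega
  have hrep : Represents (L z) r a b φ V x X Ψ :=
    ⟨fun t _ i hi => by simp only [X]; rw [if_pos hi],
      fun t _ i hi => by simp only [Ψ]; rw [add_sub_cancel_right],
      fun t _ => by rw [hXT], fun _ t _ => by rw [hX1, hXT]⟩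
  have hc : IsChain (L z) r a b X Ψ (m.apply s (Icc a b) f) := hrep.isChain hsrc hab hl
    (fun hr' t ht => hL.leading_adjoint_of_odd hdom hz hr' ht)
    (fun t ht => hL.isSourceVec hs hsr hr hz ht) (fun t ht h => hL.isUnit_p hz ht h) hr hx
  have hu := hL.leading z hz
  have hxc : ContinuousOn x (Icc a b) := by
    rw [continuousOn_iff_coord]
    intro i hi t ht
    obtain ⟨x', hx', -⟩ := isSystemSolution_iff.1 hx t ht
    exact (hasVecDerivWithinAt_iff.1 hx' i hi).continuousWithinAt
  have hcoord : ∀ i, ContinuousOn (fun t => coord r i (x t)) (Icc a b) := fun i =>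
    (coord r i).continuous.comp_continuousOn hxc
  have hTc : ContinuousOn (X (r / 2)) (Icc a b) := by
    rw [hXT]
    rcases Nat.even_or_odd' r with ⟨n, rfl | rfl⟩
    · have hP := hL.continuousOn_inverse_p hz (even_two_mul n)
      have h2 : 2 * n / 2 = n := by omega
      have hVc := continuousOn_sourceRow hab hs hm hf (2 * n / 2)
      simp only [T, if_pos (even_two_mul n)]
      rw [h2] at hP hVc
      simp only [h2, jet_even (show n ≠ 0 by omega)]
      exact (hP.clm_apply ((hcoord _).add (ContinuousOn.const_smul
        ((hl.2 n (by omega) (by omega)).1.continuousOn.clm_apply (hcoord _)) _))).add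
        (hP.clm_apply hVc)
    · have hne : ¬Even (2 * n + 1) := by simp
      simp only [T, if_neg hne, add_zero, jet_top_odd hne]
      exact (hcoord _).const_smul _
  have hρ : ContinuousOn (m.apply s (Icc a b) f) (Icc a b) := by
    have h0 := contDiffOn_upperQuasiDeriv hab hm hf (d := (s + 1) / 2) le_rfl
    exact h0.continuousOn.congr fun t ht => apply_eq_upperQuasiDeriv hab hm hf ht
  have hcd := hc.contDiffOn hab hu hl hρ hr hTc
  have hap := fun t ht => hc.apply_eq hab hu hl hρ hr hTc (t := t) ht
  rw [← hX0]
  refine ⟨hcd, hap, fun t ht => ?_, fun t ht j hj => ?_⟩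
  · refine ext_coord fun i hi => ?_
    rw [yvec, coord_toLp hi]
    by_cases h1 : r = 1
    · rw [if_pos h1, hX0]
      have : i = 0 := by omega
      subst this
      rw [coord_of_lt hr]
    rw [if_neg h1]
    rcases lt_cases hi with h | ⟨k, hk, rfl⟩ | ⟨rfl, h⟩
    · rw [if_pos h, hc.iteratedDerivWithin_eq hab (j := i) (by omega) ht, hrep.lower t ht i h]
    · rw [if_neg (by simp), if_pos (by simp; omega)]
      simp only [Nat.add_sub_cancel_left]
      rw [hc.quasiDeriv_eq hab hl hk ht, hrep.upper t ht k hk]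
      rfl
    · have hne : ¬Even r := by rw [Nat.even_iff]; omega
      rw [if_neg (by simp; omega), if_neg (by simp), hc.iteratedDerivWithin_eq hab (by omega) ht,
        hXT]
      simp only [T]
      rw [if_neg hne, add_zero, jet_top_odd hne, topFactor, if_neg h1, smul_smul, Complex.I_mul_I]
      simp
  · rw [hc.iteratedDerivWithin_eq hab (by omega) ht, hrep.jet_eq ht (by omega), sub_add_cancel]

end IsAnalyticFamily

end DiffExpr

end

/-! ### Perturbation of solutions and differences of coefficients -/

section

open ContinuousLinearMap (adjoint)

/-- The variance `∫ (u - c)²` about the mean value `c` is nonnegative. -/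
lemma sq_integral_le {a b : ℝ} (hab : a < b) {u : ℝ → ℝ} (hu : ContinuousOn u (Icc a b)) :
    (∫ t in a..b, u t) ^ 2 ≤ (b - a) * ∫ t in a..b, u t ^ 2 := by
  have hd : 0 < b - a := sub_pos.2 hab
  set J := ∫ t in a..b, u t with hJ
  set c := J / (b - a) with hc
  have hi : IntervalIntegrable u volume a b := hu.intervalIntegrable_of_Icc hab.le
  have hi2 : IntervalIntegrable (fun t => u t ^ 2) volume a b :=
    (hu.pow 2).intervalIntegrable_of_Icc hab.le
  have h1 : 0 ≤ ∫ t in a..b, (u t - c) ^ 2 :=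
    intervalIntegral.integral_nonneg hab.le fun t _ => sq_nonneg _
  have h2 : ∫ t in a..b, (u t - c) ^ 2 = (∫ t in a..b, u t ^ 2) - 2 * c * J + (b - a) * c ^ 2 := by
    have e : ∀ t, (u t - c) ^ 2 = u t ^ 2 - 2 * c * u t + c ^ 2 := fun t => by ring
    simp only [e]
    rw [intervalIntegral.integral_add (hi2.sub (hi.const_mul _)) intervalIntegrable_const,
      intervalIntegral.integral_sub hi2 (hi.const_mul _), intervalIntegral.integral_const_mul,
      intervalIntegral.integral_const, smul_eq_mul]
  rw [h2] at h1
  have h3 : c * (b - a) = J := div_mul_cancel₀ _ hd.ne'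
  nlinarith

section Perturbation

variable {V : Type*} [NormedAddCommGroup V] [InnerProductSpace ℂ V] [CompleteSpace V]

lemma norm_sq_add_le (x y : V) : ‖x + y‖ ^ 2 ≤ 2 * ‖x‖ ^ 2 + 2 * ‖y‖ ^ 2 := by
  nlinarith [norm_add_le x y, norm_nonneg (x + y), norm_nonneg x, norm_nonneg y,
    sq_nonneg (‖x‖ - ‖y‖)]

lemma quadForm_add_le {W : V →L[ℂ] V} (hW : ∀ x, 0 ≤ quadForm W x) (x y : V) :
    quadForm W (x + y) ≤ 2 * quadForm W x + 2 * quadForm W y := by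
  have h := hW (x - y)
  simp only [quadForm, map_add, map_sub, inner_add_left, inner_add_right, inner_sub_left,
    inner_sub_right, Complex.add_re, Complex.sub_re] at h ⊢
  linarith

variable {a b : ℝ} {Q H H' X X' : ℝ → V →L[ℂ] V}

lemma IsSystemSolution.congr_left {Q₂ : ℝ → V →L[ℂ] V} {g x : ℝ → V}
    (h : IsSystemSolution a b Q H g x) (hQ : EqOn Q₂ Q (Icc a b)) :
    IsSystemSolution a b Q₂ H g x := by
  intro t ht
  obtain ⟨x', hx', e⟩ := h t ht
  exact ⟨x', hx', by rw [hQ ht, derivWithin_congr hQ (hQ ht), e]⟩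

lemma IsSystemSolution.congr_right {g g₂ x : ℝ → V}
    (h : IsSystemSolution a b Q H g x) (hg : EqOn g₂ g (Icc a b)) :
    IsSystemSolution a b Q H g₂ x := by
  intro t ht
  obtain ⟨x', hx', e⟩ := h t ht
  exact ⟨x', hx', by rw [hg ht, e]⟩

/-- A solution for one parameter solves the system for another, with the difference of the
coefficients as right-hand side. Definiteness is transported this way. -/
lemma IsSystemSolution.change_coeff {K : ℝ → V →L[ℂ] V} {x : ℝ → V}
    (h : IsSystemSolution a b Q K 0 x) :
    IsSystemSolution a b Q H (fun t => K t (x t) - H t (x t)) x := by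
  intro t ht
  obtain ⟨x', hx', e⟩ := h t ht
  refine ⟨x', hx', ?_⟩
  rw [Pi.zero_apply, sub_eq_zero] at e
  rw [e]

lemma norm_integral_le_integral_norm_of_mem {f : ℝ → V} {c d t : ℝ} (hab : a < b)
    (hf : ContinuousOn f (Icc a b)) (hc : c ∈ Icc a b) (ht : t ∈ Icc a b) (hd : c = d) :
    ‖∫ σ in d..t, f σ‖ ≤ ∫ σ in a..b, ‖f σ‖ := by
  subst hd
  have hsub : uIoc c t ⊆ Ioc a b := by
    intro x hx
    rw [uIoc, mem_Ioc] at hx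
    exact ⟨(le_min hc.1 ht.1).trans_lt hx.1, hx.2.trans (max_le hc.2 ht.2)⟩
  refine (intervalIntegral.norm_integral_le_integral_norm_uIoc).trans ?_
  rw [intervalIntegral.integral_of_le hab.le]
  refine setIntegral_mono_set ?_ (Filter.Eventually.of_forall fun _ => norm_nonneg _)
    hsub.eventuallyLE
  exact (hf.norm.integrableOn_Icc).mono_set Ioc_subset_Icc_self

/-- The distance between a solution of the inhomogeneous system and the solution of the homogeneous
system with the same initial value. -/
lemma IsRegularSystem.exists_dist_solution_le (hS : IsRegularSystem a b Q H)
    (hS' : IsRegularSystem a b Q H') (hab : a < b) (h0 : (0 : ℝ) ∈ Icc a b)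
    (hH : ∀ t ∈ Icc a b, H' t = adjoint (H t)) (hX : IsOperatorSolution a b Q H X)
    (hX' : IsOperatorSolution a b Q H' X') :
    ∃ C : ℝ, 0 ≤ C ∧ ∀ g x : ℝ → V, ContinuousOn g (Icc a b) → IsSystemSolution a b Q H g x →
      ∀ t ∈ Icc a b, ‖x t - X t (x 0)‖ ^ 2 ≤ C * ∫ σ in a..b, ‖g σ‖ ^ 2 := by
  obtain ⟨C₁, hC₁, h₁⟩ := exists_norm_le_of_continuousOn hX.1.continuousOn
  obtain ⟨C₂, hC₂, h₂⟩ := exists_norm_le_of_continuousOn hX'.1.continuousOn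
  have hd : 0 < b - a := sub_pos.2 hab
  set Gi := Ring.inverse (Complex.I • reOp (Q 0)) with hGi
  refine ⟨(C₁ * ‖Gi‖ * C₂) ^ 2 * (b - a), by positivity, fun g x hg hx t ht => ?_⟩
  have hvar := hS.isSystemSolution_variation hS' hab h0 hH hX hX' hg h0 (x 0)
  have huniq := hS.solution_unique hS' hab h0 hH hX hX' hx hvar ht
  rw [intervalIntegral.integral_same, map_zero, add_zero, hX.2.1, one_apply_eq_self, sub_self,
    map_zero, sub_eq_zero, map_add] at huniq
  have hf : ContinuousOn (fun σ => adjoint (X' σ) (g σ)) (Icc a b) :=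
    ((ContinuousLinearMap.adjoint (𝕜 := ℂ) (E := V) (F := V)).continuous.comp_continuousOn
        hX'.1.continuousOn).opApply hg
  have h3 : ‖∫ σ in (0 : ℝ)..t, adjoint (X' σ) (g σ)‖ ≤ C₂ * ∫ σ in a..b, ‖g σ‖ := by
    refine (norm_integral_le_integral_norm_of_mem hab hf h0 ht rfl).trans ?_
    rw [← intervalIntegral.integral_const_mul]
    refine intervalIntegral.integral_mono_on hab.le (hf.norm.intervalIntegrable_of_Icc hab.le)
      ((hg.norm.intervalIntegrable_of_Icc hab.le).const_mul _) fun σ hσ => ?_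
    refine ((adjoint (X' σ)).le_opNorm _).trans ?_
    rw [LinearIsometryEquiv.norm_map]
    gcongr
    exact h₂ σ hσ
  have h4 : ‖x t - X t (x 0)‖ ≤ C₁ * ‖Gi‖ * C₂ * ∫ σ in a..b, ‖g σ‖ := by
    rw [huniq, add_sub_cancel_left]
    calc _ ≤ ‖X t‖ * (‖Gi‖ * ‖∫ σ in (0 : ℝ)..t, adjoint (X' σ) (g σ)‖) :=
          ((X t).le_opNorm _).trans (by gcongr; exact Gi.le_opNorm _)
      _ ≤ C₁ * (‖Gi‖ * (C₂ * ∫ σ in a..b, ‖g σ‖)) := by gcongr; exact h₁ t ht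
      _ = _ := by ring
  calc ‖x t - X t (x 0)‖ ^ 2 ≤ (C₁ * ‖Gi‖ * C₂ * ∫ σ in a..b, ‖g σ‖) ^ 2 := by gcongr
    _ = (C₁ * ‖Gi‖ * C₂) ^ 2 * (∫ σ in a..b, ‖g σ‖) ^ 2 := by ring
    _ ≤ (C₁ * ‖Gi‖ * C₂) ^ 2 * ((b - a) * ∫ σ in a..b, ‖g σ‖ ^ 2) := by
        gcongr; exact sq_integral_le hab hg.norm
    _ = _ := by ring

end Perturbation

variable {E : Type*} [NormedAddCommGroup E] [InnerProductSpace ℂ E] [CompleteSpace E]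

open BlockSpace

namespace DiffExpr

lemma formRow_zero (l : DiffExpr E) (t : ℝ) (j : ℕ) : l.formRow t (fun _ => 0) j = 0 := by
  rw [formRow]; simp

lemma lastRow_zero (l : DiffExpr E) (t : ℝ) (j : ℕ) : l.lastRow t (fun _ => 0) j = 0 := by
  rw [lastRow]; simp

lemma iteratedDerivWithin_zero_fun (j : ℕ) (S : Set ℝ) :
    iteratedDerivWithin j (fun _ => (0 : E)) S = fun _ => 0 := by
  induction j with
  | zero => rw [iteratedDerivWithin_zero]
  | succ j ih => funext t; rw [iteratedDerivWithin_succ, ih, derivWithin_fun_const]; rfl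

lemma sourceRow_zero (m : DiffExpr E) (s : ℕ) (S : Set ℝ) (j : ℕ) (t : ℝ) :
    m.sourceRow s S (fun _ => 0) j t = 0 := by
  simp only [sourceRow, iteratedDerivWithin_zero_fun, formRow_zero, lastRow_zero, ite_self]

lemma apply_zero (m : DiffExpr E) (s : ℕ) (S : Set ℝ) (t : ℝ) :
    m.apply s S (fun _ => 0) t = 0 := by
  refine Finset.sum_eq_zero fun k _ => ?_
  simp only [term, iteratedDerivWithin_zero_fun, map_zero, derivWithin_fun_const, add_zero,
    Pi.zero_apply]
  split_ifs <;> simp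

lemma lastRow_jet {l : DiffExpr E} {r : ℕ} {t : ℝ} (hr : 0 < r) (he : Even r)
    (hu : IsUnit (l.p (r / 2) t)) (x : BlockSpace E r) :
    l.lastRow t (fun j => l.jet r t j x) (r / 2) = coord r (r / 2 + (r / 2 - 1)) x := by
  obtain ⟨n, rfl⟩ := even_iff_exists_two_mul.1 he
  have h2 : 2 * n / 2 = n := by omega
  rw [h2] at hu ⊢
  exact lastRow_jet_even (by omega) hu x

/-- The entries of the matrix of the form. -/
def formEntry (l : DiffExpr E) (σ : ℕ) (t : ℝ) (i j : ℕ) : E →L[ℂ] E :=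
  if i = j ∧ i ≤ σ / 2 then l.p i t
  else if i = j + 1 ∧ i ≤ σ / 2 then -((Complex.I / 2) • l.q i t)
  else if j = i + 1 ∧ j ≤ σ / 2 then (Complex.I / 2) • l.s j t
  else 0

lemma continuousOn_formMatrix {l : DiffExpr E} {r : ℕ} {a b : ℝ} (hl : l.IsSmooth r a b) :
    ContinuousOn (l.formMatrix (2 * (r / 2)) (r / 2)) (Icc a b) := by
  refine continuousOn_blockOp (A := l.formEntry (2 * (r / 2))) fun i hi j hj => ?_
  unfold formEntry
  split_ifs with h1 h2 h3
  · exact (hl.1 i (by omega)).continuousOn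
  · exact ((hl.2 i (by omega) (by omega)).1.continuousOn.const_smul (Complex.I / 2)).neg
  · exact (hl.2 j (by omega) (by omega)).2.continuousOn.const_smul (Complex.I / 2)
  · exact continuousOn_const

/-- The entries of the matrix recovering the derivatives. -/
def jetEntry (l : DiffExpr E) (r : ℕ) (t : ℝ) (i j : ℕ) : E →L[ℂ] E :=
  if i < r / 2 then (if j = i then 1 else 0)
  else if Even r then
    if j + 1 = 2 * (r / 2) then Ring.inverse (l.p (r / 2) t)
    else if j + 1 = r / 2 then (Complex.I / 2) • (Ring.inverse (l.p (r / 2) t) ∘L l.q (r / 2) t)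
    else 0
  else if j = 2 * (r / 2) then (if r = 1 then 1 else Complex.I • 1)
  else 0

namespace IsAnalyticFamily

variable {L : ℂ → DiffExpr E} {r : ℕ} {a b : ℝ} {B : Set ℂ} (hL : IsAnalyticFamily L r a b B)
  {m : DiffExpr E} {s : ℕ} (hdom : m.IsDominated L r s a b) {t : ℝ}
include hL

lemma continuousOn_jetOp {z : ℂ} (hz : z ∈ B) : ContinuousOn ((L z).jetOp r) (Icc a b) := by
  refine continuousOn_blockOp (A := (L z).jetEntry r) fun i hi j hj => ?_
  unfold jetEntry
  split_ifs with h1 h2 h3 h4 h5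
  · exact continuousOn_const
  · exact continuousOn_const
  · exact hL.continuousOn_inverse_p hz h3
  · exact ((hL.continuousOn_inverse_p hz h3).clm_comp
      ((hL.smooth z hz).2 (r / 2) (by omega) (by omega)).1.continuousOn).const_smul (Complex.I / 2)
  all_goals exact continuousOn_const

/-- Both jets satisfy `p_n g_n - (i/2) q_n g_{n-1} = u_{n-1}` with the same `u_{n-1}`. They
therefore differ only in the component `n`, only in even order, and by the difference of the two
form matrices applied to one of them. -/
lemma jet_sub_jet {z w : ℂ} (hz : z ∈ B) (hw : w ∈ B) (hr : 0 < r) (ht : t ∈ Icc a b)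
    (x : BlockSpace E r) : (L z).jetOp r t x - (L w).jetOp r t x = if Even r then
      -embed ⟨r / 2, by omega⟩ (Ring.inverse ((L z).p (r / 2) t) (coord (r / 2 + 1) (r / 2)
        (((L z).formMatrix (2 * (r / 2)) (r / 2) t - (L w).formMatrix (2 * (r / 2)) (r / 2) t)
          ((L w).jetOp r t x)))) else 0 := by
  refine ext_coord fun i hi => ?_
  rw [map_sub, ← jet_apply, ← jet_apply]
  by_cases h : i < r / 2
  · rw [jet_of_lt h, jet_of_lt h, sub_self]
    split_ifs
    · rw [map_neg, coord_embed hi, if_neg (by simp; omega), neg_zero]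
    · rw [map_zero]
  · obtain rfl : i = r / 2 := by omega
    by_cases he : Even r
    · rw [if_pos he, map_neg, coord_embed hi, if_pos rfl, FunLike.coe_sub, Pi.sub_apply, map_sub,
        coord_formMatrix (by omega) (by omega), coord_formMatrix (by omega) (by omega)]
      simp only [show 2 * (r / 2) / 2 = r / 2 by omega, le_refl, lt_irrefl, if_true, if_false]
      have hn : r / 2 ≠ 0 := by rw [Nat.even_iff] at he; omega
      have hu := hL.isUnit_p hz ht he
      have e3 : (L w).lastRow t (fun j => (L w).jet r t j x) (r / 2) =
          (L z).lastRow t (fun j => (L z).jet r t j x) (r / 2) := by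
        rw [lastRow_jet hr he hu, lastRow_jet hr he (hL.isUnit_p hw ht he)]
      have e4 : (L z).lastRow t (fun j => (L w).jet r t j x) (r / 2) -
          (L z).lastRow t (fun j => (L z).jet r t j x) (r / 2) =
          (L z).p (r / 2) t ((L w).jet r t (r / 2) x - (L z).jet r t (r / 2) x) := by
        rw [lastRow, lastRow, if_neg hn, if_neg hn, jet_of_lt (j := r / 2 - 1) (by omega),
          jet_of_lt (j := r / 2 - 1) (by omega), map_sub]
        abel
      simp only [← jet_apply]
      rw [e3, e4, inverse_mul_apply hu, neg_sub]
    · rw [if_neg he, map_zero, jet_top_odd he, jet_top_odd he, sub_self]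

lemma Hcoeff_sub_Hcoeff {z w : ℂ} (hz : z ∈ B) (hw : w ∈ B) (hr : 0 < r) (ht : t ∈ Icc a b)
    (x : BlockSpace E r) : (L w).Hcoeff r t x - (L z).Hcoeff r t x =
      adjoint ((L (conj z)).jetOp r t)
        (((L z).formMatrix (2 * (r / 2)) (r / 2) t - (L w).formMatrix (2 * (r / 2)) (r / 2) t)
          ((L w).jetOp r t x)) := by
  refine ext_inner_left ℂ fun y => ?_
  rw [hL.inner_Hcoeff_sub_Hcoeff hr hz hw ht, ContinuousLinearMap.adjoint_inner_right,
    FunLike.coe_sub, Pi.sub_apply, inner_sub_right, inner_formMatrix le_rfl, inner_formMatrix le_rfl]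
  rfl

include hdom

/-- With `s = q*` the odd leading term equals `(i/2)(c̄ - c) = ℑc`, which is real. -/
lemma im_form_eq {z : ℂ} (hz : z ∈ B) (ht : t ∈ Icc a b) (h : ℕ → E) :
    ((L z).form r t h h).im = ((L z).form (2 * (r / 2)) t h h).im := by
  rcases Nat.even_or_odd' r with ⟨n, rfl | rfl⟩
  · rw [show 2 * n / 2 = n by omega]
  · rw [show (2 * n + 1) / 2 = n by omega, form_two_mul_add_one, hL.leading_adjoint hdom hz ht,
      ContinuousLinearMap.adjoint_inner_right, ← inner_conj_symm]
    set c := inner ℂ (h (n + 1)) ((L z).q (n + 1) t (h n)) with hc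
    rw [Complex.add_im]
    simp [Complex.mul_im, Complex.sub_re]

end IsAnalyticFamily

end DiffExpr

end

/-! ### Definiteness at one point implies definiteness at all nonreal points -/

section

open ContinuousLinearMap (adjoint)

variable {E : Type*} [NormedAddCommGroup E] [InnerProductSpace ℂ E] [CompleteSpace E]

open BlockSpace

lemma exists_opNorm_le_of_continuousOn {V W : Type*} [NormedAddCommGroup V] [InnerProductSpace ℂ V]
    [NormedAddCommGroup W] [InnerProductSpace ℂ W] {a b : ℝ} {f : ℝ → V →L[ℂ] W}
    (hf : ContinuousOn f (Icc a b)) : ∃ C : ℝ, 0 ≤ C ∧ ∀ t ∈ Icc a b, ‖f t‖ ≤ C :=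
  exists_norm_le_of_continuousOn hf

namespace DiffExpr

/-- The operator of the form `-ℑ l_w / ℑ w` on `E^{n+1}`, `n = [r/2]`. -/
def weightOp (L : ℂ → DiffExpr E) (r : ℕ) (w : ℂ) (t : ℝ) :
    BlockSpace E (r / 2 + 1) →L[ℂ] BlockSpace E (r / 2 + 1) :=
  nevWeight (fun ζ t => -(L ζ).formMatrix (2 * (r / 2)) (r / 2) t) w t

lemma quadForm_weightOp (L : ℂ → DiffExpr E) (r : ℕ) (w : ℂ) (t : ℝ)
    (g : BlockSpace E (r / 2 + 1)) :
    quadForm (weightOp L r w t) g = formWeight L r w t (fun j => coord (r / 2 + 1) j g) := by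
  rw [weightOp, quadForm_nevWeight, FunLike.coe_neg, Pi.neg_apply, inner_neg_right,
    inner_formMatrix le_rfl, form_of_zero _ (coord_of_le le_rfl g) (coord_of_le le_rfl g), formWeight,
    Complex.neg_im, neg_div]

lemma continuousOn_weightOp {L : ℂ → DiffExpr E} {r : ℕ} {a b : ℝ} {w : ℂ}
    (hl : (L w).IsSmooth r a b) : ContinuousOn (weightOp L r w) (Icc a b) := by
  have h : ContinuousOn (fun t => -(L w).formMatrix (2 * (r / 2)) (r / 2) t) (Icc a b) :=
    (continuousOn_formMatrix hl).neg
  exact continuousOn_nevWeight (H := fun ζ t => -(L ζ).formMatrix (2 * (r / 2)) (r / 2) t) h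

namespace IsAnalyticFamily

variable {L : ℂ → DiffExpr E} {r : ℕ} {a b : ℝ} {B : Set ℂ} (hL : IsAnalyticFamily L r a b B)
  {m : DiffExpr E} {s : ℕ} (hdom : m.IsDominated L r s a b) {t : ℝ}
include hL

lemma exists_norm_inverse_p_le {z : ℂ} (hz : z ∈ B) : ∃ C : ℝ, 0 ≤ C ∧ ∀ t ∈ Icc a b, Even r →
    ‖Ring.inverse ((L z).p (r / 2) t)‖ ≤ C := by
  by_cases he : Even r
  · obtain ⟨C, h0, h⟩ := exists_norm_le_of_continuousOn (hL.continuousOn_inverse_p hz he)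
    exact ⟨C, h0, fun t ht _ => h t ht⟩
  · exact ⟨0, le_rfl, fun t _ h => absurd h he⟩

include hdom

lemma formWeight_congr {w : ℂ} (hw : w.im ≠ 0) (ht : t ∈ Icc a b) {h h' : ℕ → E}
    (hh : ∀ j ≤ r / 2, h j = h' j) : formWeight L r w t h = formWeight L r w t h' := by
  have hj : ∀ j ≤ (2 * (r / 2) + 1) / 2, h j = h' j := fun j hj => hh j (by omega)
  rw [formWeight, formWeight, hL.im_form_eq hdom (hL.nonreal_mem w hw) ht,
    hL.im_form_eq hdom (hL.nonreal_mem w hw) ht, form_congr hj hj]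

/-- The comparison of quadratic forms, fed into the polarization estimate, bounds the square of the
operator difference by the weight at `w`. The factor is `4 C²` times a bound of that weight. -/
lemma exists_formMatrix_bounds {z w : ℂ} (hz : z ∈ B) (hw : w.im ≠ 0) :
    ∃ C K : ℝ, 0 ≤ C ∧ 0 ≤ K ∧ ∀ t ∈ Icc a b, ‖weightOp L r w t‖ ≤ C ∧
      ∀ g, 0 ≤ quadForm (weightOp L r w t) g ∧
      ‖((L z).formMatrix (2 * (r / 2)) (r / 2) t - (L w).formMatrix (2 * (r / 2)) (r / 2) t) g‖ ^ 2 ≤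
        K * quadForm (weightOp L r w t) g := by
  obtain ⟨C, hC0, hC⟩ := hL.exists_form_compare hdom hz hw
  obtain ⟨CW, hCW0, hCW⟩ := exists_opNorm_le_of_continuousOn (f := weightOp L r w)
    (continuousOn_weightOp (hL.smooth w (hL.nonreal_mem w hw)))
  have hW0 : ∀ t ∈ Icc a b, ∀ g, 0 ≤ quadForm (weightOp L r w t) g := fun t ht g => by
    rw [quadForm_weightOp]; exact hL.formWeight_nonneg hdom hw ht _
  refine ⟨CW, 4 * C ^ 2 * CW, hCW0, by positivity, fun t ht => ⟨hCW t ht, fun g => ⟨hW0 t ht g, ?_⟩⟩⟩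
  refine (norm_sq_le_of_quadForm_bound hC0 (fun g => ?_) (hW0 t ht) g).trans
    (mul_le_mul_of_nonneg_right ?_ (hW0 t ht g))
  · rw [FunLike.coe_sub, Pi.sub_apply, inner_sub_right, inner_formMatrix le_rfl,
      inner_formMatrix le_rfl, form_of_zero _ (coord_of_le le_rfl g) (coord_of_le le_rfl g),
      form_of_zero _ (coord_of_le le_rfl g) (coord_of_le le_rfl g), quadForm_weightOp]
    exact (hC t ht _).1
  · gcongr
    exact hCW t ht

lemma exists_Hcoeff_sub_bound (hr : 0 < r) {z w : ℂ} (hz : z ∈ B) (hw : w.im ≠ 0) :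
    ∃ K : ℝ, 0 ≤ K ∧ ∀ t ∈ Icc a b, ∀ x : BlockSpace E r,
      ‖(L w).Hcoeff r t x - (L z).Hcoeff r t x‖ ^ 2 ≤
        K * quadForm (weightOp L r w t) ((L w).jetOp r t x) := by
  obtain ⟨_, K, _, hK0, hK⟩ := hL.exists_formMatrix_bounds hdom hz hw
  obtain ⟨C, hC0, hC⟩ := exists_opNorm_le_of_continuousOn
    (f := (L (conj z)).jetOp r) (hL.continuousOn_jetOp (hL.conj_mem hz))
  refine ⟨C ^ 2 * K, by positivity, fun t ht x => ?_⟩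
  rw [hL.Hcoeff_sub_Hcoeff hz (hL.nonreal_mem w hw) hr ht]
  set u := ((L z).formMatrix (2 * (r / 2)) (r / 2) t - (L w).formMatrix (2 * (r / 2)) (r / 2) t)
    ((L w).jetOp r t x) with hu
  have hKu : ‖u‖ ^ 2 ≤ K * quadForm (weightOp L r w t) ((L w).jetOp r t x) :=
    ((hK t ht).2 ((L w).jetOp r t x)).2
  have h1 : ‖adjoint ((L (conj z)).jetOp r t) u‖ ≤ C * ‖u‖ := by
    refine ((adjoint ((L (conj z)).jetOp r t)).le_opNorm u).trans ?_
    rw [LinearIsometryEquiv.norm_map]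
    exact mul_le_mul_of_nonneg_right (hC t ht) (norm_nonneg u)
  calc ‖adjoint ((L (conj z)).jetOp r t) u‖ ^ 2 ≤ (C * ‖u‖) ^ 2 :=
        pow_le_pow_left₀ (norm_nonneg _) h1 2
    _ = C ^ 2 * ‖u‖ ^ 2 := by ring
    _ ≤ C ^ 2 * (K * quadForm (weightOp L r w t) ((L w).jetOp r t x)) :=
        mul_le_mul_of_nonneg_left hKu (sq_nonneg C)
    _ = _ := by ring

lemma exists_jet_sub_bound (hr : 0 < r) {z w : ℂ} (hz : z ∈ B) (hw : w.im ≠ 0) :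
    ∃ K : ℝ, 0 ≤ K ∧ ∀ t ∈ Icc a b, ∀ x : BlockSpace E r,
      ‖(L z).jetOp r t x - (L w).jetOp r t x‖ ^ 2 ≤
        K * quadForm (weightOp L r w t) ((L w).jetOp r t x) := by
  obtain ⟨_, K, _, hK0, hK⟩ := hL.exists_formMatrix_bounds hdom hz hw
  obtain ⟨C, hC0, hC⟩ := hL.exists_norm_inverse_p_le hz
  obtain ⟨e, he⟩ : ∃ e : E →L[ℂ] BlockSpace E (r / 2 + 1), e = embed ⟨r / 2, by omega⟩ := ⟨_, rfl⟩
  obtain ⟨c, hc⟩ : ∃ c : BlockSpace E (r / 2 + 1) →L[ℂ] E, c = coord (r / 2 + 1) (r / 2) := ⟨_, rfl⟩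
  refine ⟨(‖e‖ * (C * ‖c‖)) ^ 2 * K, by positivity, fun t ht x => ?_⟩
  rw [hL.jet_sub_jet hz (hL.nonreal_mem w hw) hr ht, ← he, ← hc]
  obtain ⟨hq, hKu⟩ := (hK t ht).2 ((L w).jetOp r t x)
  generalize quadForm (weightOp L r w t) ((L w).jetOp r t x) = q at hq hKu ⊢
  generalize ((L z).formMatrix (2 * (r / 2)) (r / 2) t - (L w).formMatrix (2 * (r / 2)) (r / 2) t)
    ((L w).jetOp r t x) = u at hKu ⊢
  split_ifs with hev
  · rw [norm_neg]
    have h1 : ‖e (Ring.inverse ((L z).p (r / 2) t) (c u))‖ ≤ ‖e‖ * (C * ‖c‖) * ‖u‖ := by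
      refine (e.le_opNorm _).trans ?_
      rw [mul_assoc]
      refine mul_le_mul_of_nonneg_left ?_ (norm_nonneg e)
      refine (ContinuousLinearMap.le_opNorm _ _).trans ?_
      rw [mul_assoc]
      exact mul_le_mul (hC t ht hev) (c.le_opNorm u) (norm_nonneg _) hC0
    calc _ ≤ (‖e‖ * (C * ‖c‖) * ‖u‖) ^ 2 := pow_le_pow_left₀ (norm_nonneg _) h1 2
      _ = (‖e‖ * (C * ‖c‖)) ^ 2 * ‖u‖ ^ 2 := by ring
      _ ≤ (‖e‖ * (C * ‖c‖)) ^ 2 * (K * q) := mul_le_mul_of_nonneg_left hKu (sq_nonneg _)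
      _ = _ := by ring
  · rw [norm_zero]
    have : 0 ≤ (‖e‖ * (C * ‖c‖)) ^ 2 * K * q := by positivity
    simpa using this

/-- Two errors are controlled at once by the weight at `w` along a solution: the change of `H`, and
the change of the jet when parameter and vector are both replaced. Only the displacement `d` of the
vector enters through its norm. -/
lemma exists_weight_bounds (hr : 0 < r) {z w : ℂ} (hz : z ∈ B) (hw : w.im ≠ 0) :
    ∃ K : ℝ, 0 ≤ K ∧ ∀ t ∈ Icc a b, ∀ x d : BlockSpace E r,
      ‖(L w).Hcoeff r t x - (L z).Hcoeff r t x‖ ^ 2 ≤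
        K * quadForm (weightOp L r w t) ((L w).jetOp r t x) ∧
      quadForm (weightOp L r w t) ((L z).jetOp r t (x - d)) ≤
        K * (quadForm (weightOp L r w t) ((L w).jetOp r t x) + ‖d‖ ^ 2) := by
  obtain ⟨CW, _, hCW0, _, hCW⟩ := hL.exists_formMatrix_bounds hdom hz hw
  obtain ⟨K₁, hK₁, h₁⟩ := hL.exists_Hcoeff_sub_bound hdom hr hz hw
  obtain ⟨K₂, hK₂, h₂⟩ := hL.exists_jet_sub_bound hdom hr hz hw
  obtain ⟨CZ, hCZ0, hCZ⟩ := exists_opNorm_le_of_continuousOn (f := (L z).jetOp r)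
    (hL.continuousOn_jetOp hz)
  refine ⟨K₁ + (2 + 4 * CW * K₂) + 4 * CW * CZ ^ 2, by positivity, fun t ht x d => ?_⟩
  have hW0 := fun g => ((hCW t ht).2 g).1
  have hWC := (hCW t ht).1
  have he := h₂ t ht x
  have hH := h₁ t ht x
  have hd : ‖(L z).jetOp r t d‖ ^ 2 ≤ CZ ^ 2 * ‖d‖ ^ 2 := by
    rw [← mul_pow]
    exact pow_le_pow_left₀ (norm_nonneg _) ((ContinuousLinearMap.le_opNorm _ _).trans
      (mul_le_mul_of_nonneg_right (hCZ t ht) (norm_nonneg d))) 2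
  have hsplit : (L z).jetOp r t (x - d) =
      (L w).jetOp r t x + (((L z).jetOp r t x - (L w).jetOp r t x) + -((L z).jetOp r t d)) := by
    rw [map_sub]; abel
  rw [hsplit]
  have hq := hW0 ((L w).jetOp r t x)
  generalize (L z).jetOp r t x - (L w).jetOp r t x = e at he ⊢
  generalize (L w).jetOp r t x = u at he hH hq ⊢
  generalize (L z).jetOp r t d = k at hd ⊢
  generalize weightOp L r w t = W at *
  have h1 := quadForm_add_le hW0 u (e + -k)
  have h2 : quadForm W (e + -k) ≤ CW * (2 * ‖e‖ ^ 2 + 2 * ‖k‖ ^ 2) := by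
    refine (quadForm_le W _).trans ?_
    have h3 := norm_sq_add_le e (-k)
    rw [norm_neg] at h3
    exact mul_le_mul hWC h3 (sq_nonneg _) hCW0
  have h3 : CW * (2 * ‖e‖ ^ 2 + 2 * ‖k‖ ^ 2) ≤ CW * (2 * (K₂ * quadForm W u) +
      2 * (CZ ^ 2 * ‖d‖ ^ 2)) := mul_le_mul_of_nonneg_left (by linarith) hCW0
  have h5 : 0 ≤ CW * K₂ := by positivity
  have h6 : 0 ≤ CW * CZ ^ 2 := by positivity
  have h7 : 0 ≤ ‖d‖ ^ 2 := by positivity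
  generalize quadForm W u = q at *
  generalize ‖d‖ ^ 2 = y at *
  refine ⟨hH.trans (mul_le_mul_of_nonneg_right (by linarith) hq), ?_⟩
  have e1 := mul_nonneg hK₁ hq
  have e2 := mul_nonneg h6 hq
  have e3 := mul_nonneg hK₁ h7
  have e4 := mul_nonneg h5 h7
  linarith

/-- A solution of the homogeneous first order system gives a solution of the homogeneous scalar
equation. -/
lemma exists_scalar_solution (hab : a < b) (hs : Even s) (hsr : s ≤ r) (hr : 0 < r)
    (hm : m.IsSmooth s a b) {z : ℂ} (hz : z ∈ B) {x : ℝ → BlockSpace E r}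
    (hx : IsSystemSolution a b (Qfam L r z) (Hfam L r z) 0 x) :
    ∃ y : ℝ → E, ContDiffOn ℝ r y (Icc a b) ∧
    (∀ t ∈ Icc a b, (L z).apply r (Icc a b) y t = 0) ∧
    (∀ t ∈ Icc a b, (L z).yvec m r s (Icc a b) y (fun _ => 0) t = x t) ∧
    ∀ t ∈ Icc a b, ∀ j ≤ r / 2, iteratedDerivWithin j y (Icc a b) t = (L z).jet r t j (x t) := by
  have hg : EqOn (fun t => (L (conj z)).Wweight m r s t
      ((L (conj z)).Fvec r s (Icc a b) (fun _ => 0) t)) 0 (Icc a b) := by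
    intro t ht
    have h := hL.isSourceVec (m := m) (f := fun _ => 0) hs hsr hr hz ht
    simp only [sourceRow_zero] at h
    refine ext_coord fun i hi => ?_
    rw [Pi.zero_apply, map_zero]
    rcases lt_cases hi with h1 | ⟨k, hk, rfl⟩ | ⟨rfl, h1⟩
    · simpa using h.left i h1
    · simpa using h.right k hk
    · have he : ¬Even r := by rw [Nat.even_iff]; omega
      simpa using h.last he
  obtain ⟨h1, h2, h3, h4⟩ := hL.scalar_of_isSystemSolution hab hs hsr hr hdom hz hm
    (f := fun _ => 0) contDiffOn_const (hx.congr_right hg)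
  refine ⟨_, h1, fun t ht => (h2 t ht).trans (apply_zero m s _ t), h3, fun t ht j hj => ?_⟩
  rw [h4 t ht j (by omega), sourceRow_zero, map_zero, ite_self, add_zero]

/-- The definiteness condition at one point implies definiteness for all nonreal values of the
spectral parameter. -/
lemma isDefiniteNevanlinnaSystem (hab : a < b) (h0 : (0 : ℝ) ∈ Icc a b) (hs : Even s) (hsr : s ≤ r)
    (hr : 0 < r) (hm : m.IsSmooth s a b) (hdef : IsDefinite L m r s a b B) :
    IsDefiniteNevanlinnaSystem a b (Qfam L r) (Hfam L r) := by
  have hN := hL.isNevanlinnaSystem hdom hr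
  refine { hN with definite := fun w hw => ?_ }
  obtain ⟨z, hz, α, hα, β, hβ, h0αβ, δ, hδ, hdef⟩ := hdef
  have hαβ : α ≤ β := h0αβ.1.trans h0αβ.2
  have hzc := hL.conj_mem hz
  have hQ := fun {ζ : ℂ} (hζ : ζ ∈ B) => (hL.Qcoeff_eqOn hdom hζ hw)
  -- The point `z` may be real and lies outside the nonreal family. Its system is still regular and,
  -- by independence of the leading coefficient, can be written with the coefficient `Q` at `w`.
  have hS : IsRegularSystem a b (Qfam L r w) (Hfam L r z) :=
    (hL.isRegularSystem hdom hz).congr (hQ hz).symm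
  have hS' : IsRegularSystem a b (Qfam L r w) (Hfam L r (conj z)) :=
    (hL.isRegularSystem hdom hzc).congr (hQ hzc).symm
  have hX := hS.isOperatorSolution hab h0
  have hX' := hS'.isOperatorSolution hab h0
  set X := operatorSolution a b (Qfam L r w) (Hfam L r z) with hXdef
  have hH : ∀ t ∈ Icc a b, Hfam L r (conj z) t = adjoint (Hfam L r z t) := fun t ht =>
    hL.Hcoeff_conj hr hz ht
  obtain ⟨C₁, hC₁, hdist⟩ := hS.exists_dist_solution_le hS' hab h0 hH hX hX'
  obtain ⟨K, hK, hbd⟩ := hL.exists_weight_bounds hdom hr hz hw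
  obtain ⟨C, hC, hcmp⟩ := hL.exists_form_compare hdom hz hw
  have hXw := hN.isOperatorSolution hab h0 hw
  set Y := operatorSolution a b (Qfam L r w) (Hfam L r w) with hYdef
  have hd : 0 < b - a := sub_pos.2 hab
  -- Let `J` be the total weight at `w` along `Y v`. The solution `X v` at `z` stays within `C₁ K J`
  -- of it in square, so the density at `z` is at most `C K (q + C₁ K J)`; integration over `[a, b]`
  -- gives `A J`. Since `A` may vanish, `δ/(A + 1)` is taken as the new constant.
  set A := C * (K * (1 + (b - a) * (C₁ * K))) with hA
  have hA0 : 0 ≤ A := by positivity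
  refine ⟨δ / (A + 1), by positivity, fun v => ?_⟩
  set q : ℝ → ℝ := fun t => quadForm (nevWeight (Hfam L r) w t) (Y t v) with hq
  have hqW : ∀ t ∈ Icc a b, q t = quadForm (weightOp L r w t) ((L w).jetOp r t (Y t v)) := by
    intro t ht
    rw [hq, quadForm_weightOp]
    simp only []
    rw [quadForm_nevWeight]
    exact hL.inner_Hcoeff_im_div hdom hr hw ht _
  have hq0 : ∀ t ∈ Icc a b, 0 ≤ q t := fun t ht => hN.nonneg w hw t ht _
  have hYc : ContinuousOn (fun t => Y t v) (Icc a b) :=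
    hXw.1.continuousOn.opApply continuousOn_const
  have hqc : ContinuousOn q (Icc a b) :=
    Complex.continuous_re.comp_continuousOn (hYc.inner ((continuousOn_nevWeight
      (hN.regular w hw).continuousOn).opApply hYc))
  have hqi : IntervalIntegrable q volume a b := hqc.intervalIntegrable_of_Icc hab.le
  set J := ∫ t in a..b, q t with hJ
  have hJ0 : 0 ≤ J := intervalIntegral.integral_nonneg hab.le hq0
  -- the solution of the system at `z` with the same initial value
  have hsys := (hN.regular w hw).isSystemSolution_apply hab hXw v
  have hpert := hsys.change_coeff (H := Hfam L r z)
  have hgc : ContinuousOn (fun t => Hfam L r w t (Y t v) - Hfam L r z t (Y t v)) (Icc a b) :=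
    ((hN.regular w hw).continuousOn.opApply hYc).sub (hS.continuousOn.opApply hYc)
  have hgJ : ∫ t in a..b, ‖Hfam L r w t (Y t v) - Hfam L r z t (Y t v)‖ ^ 2 ≤ K * J := by
    rw [hJ, ← intervalIntegral.integral_const_mul]
    refine intervalIntegral.integral_mono_on hab.le
      ((hgc.norm.pow 2).intervalIntegrable_of_Icc hab.le) (hqi.const_mul _) fun t ht => ?_
    rw [hqW t ht]
    exact (hbd t ht (Y t v) 0).1
  have hdiff : ∀ t ∈ Icc a b, ‖Y t v - X t v‖ ^ 2 ≤ C₁ * (K * J) := by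
    intro t ht
    have h1 := hdist _ _ hgc hpert t ht
    have hY0 : Y 0 v = v := by rw [hXw.2.1, one_apply_eq_self]
    rw [hY0] at h1
    exact h1.trans (by gcongr)
  have hXs : IsSystemSolution a b (Qfam L r z) (Hfam L r z) 0 (fun t => X t v) :=
    (hS.isSystemSolution_apply hab hX v).congr_left (hQ hz)
  obtain ⟨y, hy, hye, hyv, hyj⟩ := hL.exists_scalar_solution hdom hab hs hsr hr hm hz hXs
  have hfin := hdef y hy hye
  rw [hyv 0 h0, hX.2.1, one_apply_eq_self] at hfin
  have hpt : ∀ t ∈ Icc a b, |imRatioForm L r z t (fun j => iteratedDerivWithin j y (Icc a b) t)| ≤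
      C * (K * (q t + C₁ * (K * J))) := by
    intro t ht
    refine ((hcmp t ht _).2).trans ?_
    rw [hL.formWeight_congr hdom hw ht (h' := fun j => (L z).jet r t j (X t v))
      (fun j hj => hyj t ht j hj)]
    have h1 := (hbd t ht (Y t v) (Y t v - X t v)).2
    rw [sub_sub_cancel, quadForm_weightOp, ← hqW t ht] at h1
    have h2 := hdiff t ht
    gcongr
    exact h1.trans (by gcongr)
  have hint : IntervalIntegrable (fun t => C * (K * (q t + C₁ * (K * J)))) volume a b :=
    ((hqi.add intervalIntegrable_const).const_mul _).const_mul _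
  have hαβi : Icc α β ⊆ Icc a b := Icc_subset_Icc hα.1 hβ.2
  have h1 : -∫ t in α..β, imRatioForm L r z t (fun j => iteratedDerivWithin j y (Icc a b) t) ≤
      ∫ t in α..β, C * (K * (q t + C₁ * (K * J))) := by
    refine (neg_le_abs _).trans ?_
    rw [← Real.norm_eq_abs]
    refine intervalIntegral.norm_integral_le_of_norm_le hαβ ?_ (hint.mono_set ?_)
    · exact Filter.Eventually.of_forall fun t ht => hpt t (hαβi (Ioc_subset_Icc_self ht))
    · rw [uIcc_of_le hαβ, uIcc_of_le hab.le]; exact hαβi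
  have h2 : ∫ t in α..β, C * (K * (q t + C₁ * (K * J))) ≤
      ∫ t in a..b, C * (K * (q t + C₁ * (K * J))) := by
    refine intervalIntegral.integral_mono_interval hα.1 hαβ hβ.2 ?_ hint
    refine (ae_restrict_iff' measurableSet_Ioc).2 (Filter.Eventually.of_forall fun t ht => ?_)
    have := hq0 t (Ioc_subset_Icc_self ht)
    simp only [Pi.zero_apply]
    positivity
  have h3 : ∫ t in a..b, C * (K * (q t + C₁ * (K * J))) = A * J := by
    rw [intervalIntegral.integral_const_mul, intervalIntegral.integral_const_mul,
      intervalIntegral.integral_add hqi intervalIntegrable_const, intervalIntegral.integral_const,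
      smul_eq_mul, ← hJ, hA]
    ring
  have h4 : δ * ‖v‖ ^ 2 ≤ A * J := by linarith
  rw [div_mul_eq_mul_div, div_le_iff₀ (by positivity)]
  nlinarith

end IsAnalyticFamily

end DiffExpr

end

end


/-! ### The theorem -/

theorem theorem3p2 {E : Type*} [NormedAddCommGroup E] [InnerProductSpace ℂ E] [CompleteSpace E]
    [TopologicalSpace.SeparableSpace E]
    (a b : ℝ) (hab : a < b) (h0 : (0 : ℝ) ∈ Set.Icc a b)
    (r s : ℕ) (hr : 0 < r) (hs : Even s) (hsr : s ≤ r)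
    (B : Set ℂ) (L : ℂ → DiffExpr E) (m : DiffExpr E)
    (hL : DiffExpr.IsAnalyticFamily L r a b B) (hm : m.IsSymmetric s a b)
    (hdom : m.IsDominated L r s a b)
    (hdef : DiffExpr.IsDefinite L m r s a b B) :
    -- the operator solution exists, and the operators inverted below are invertible
    (∀ z : ℂ, z.im ≠ 0 →
      IsOperatorSolution a b (DiffExpr.Qfam L r z) (DiffExpr.Hfam L r z)
        (DiffExpr.Xfam L r a b z) ∧
      IsUnit (DiffExpr.Xfam L r a b z a) ∧ IsUnit (DiffExpr.Xfam L r a b z b) ∧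
      IsUnit (Complex.I • reOp (DiffExpr.Qfam L r z 0))) ∧
    -- every maximal dissipative boundary pair gives a uniquely solvable problem
    (∀ Ma Nb : ℂ → BlockSpace E r →L[ℂ] BlockSpace E r,
      IsMaximalDissipativePair a b (DiffExpr.Qfam L r) Ma Nb →
      (∀ z : ℂ, z.im ≠ 0 → ∀ h : BlockSpace E r,
        z.im * (quadForm (reOp (DiffExpr.Qfam L r z b)) (Nb z h) -
          quadForm (reOp (DiffExpr.Qfam L r z a)) (Ma z h)) ≤ 0) ∧
      (∀ z : ℂ, z.im ≠ 0 → IsUnit (DiffExpr.boundaryDiff L r a b Ma Nb z)) ∧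
      DiffExpr.IsCharOp L r a b (DiffExpr.boundaryM L r a b Ma Nb) ∧
      ∀ z : ℂ, z.im ≠ 0 → ∀ f : ℝ → E, ContDiffOn ℝ s f (Set.Icc a b) →
        DiffExpr.SolvesBoundaryProblem (L z) m r s a b (Ma z) (Nb z) f
          (DiffExpr.resolvent L m r s hr a b (DiffExpr.boundaryM L r a b Ma Nb) z f) ∧
        ∀ y : ℝ → E, DiffExpr.SolvesBoundaryProblem (L z) m r s a b (Ma z) (Nb z) f y →
          Set.EqOn y
            (DiffExpr.resolvent L m r s hr a b (DiffExpr.boundaryM L r a b Ma Nb) z f)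
            (Set.Icc a b)) ∧
    -- every resolvent comes from a boundary problem of this kind
    (∀ M : ℂ → BlockSpace E r →L[ℂ] BlockSpace E r, DiffExpr.IsCharOp L r a b M →
      ∃ Ma Nb : ℂ → BlockSpace E r →L[ℂ] BlockSpace E r,
        IsMaximalDissipativePair a b (DiffExpr.Qfam L r) Ma Nb ∧
        ∀ z : ℂ, z.im ≠ 0 → ∀ f : ℝ → E, ContDiffOn ℝ s f (Set.Icc a b) →
          DiffExpr.SolvesBoundaryProblem (L z) m r s a b (Ma z) (Nb z) f
            (DiffExpr.resolvent L m r s hr a b M z f)) := by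
  have hN := hL.isDefiniteNevanlinnaSystem hdom hab h0 hs hsr hr hm.smooth hdef
  have ha := Set.left_mem_Icc.2 hab.le
  have hb := Set.right_mem_Icc.2 hab.le
  have hg : ∀ z : ℂ, z.im ≠ 0 → ∀ f : ℝ → E, ContDiffOn ℝ s f (Set.Icc a b) →
      ContinuousOn (fun t => (L (conj z)).Wweight m r s t
        ((L (conj z)).Fvec r s (Set.Icc a b) f t)) (Set.Icc a b) := fun z hz f hf =>
    hL.continuousOn_sourceVec hab hs hsr hr (hL.nonreal_mem z hz) hm.smooth hf
  -- Shared by both directions: the Green integral solves the system, so its first component solves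
  -- the scalar equation, and the vector formed from that component is the integral itself. Its
  -- boundary values are therefore those of the Green integral.
  have hres : ∀ (M : ℂ → BlockSpace E r →L[ℂ] BlockSpace E r) (A C : BlockSpace E r →L[ℂ] BlockSpace E r)
      (z : ℂ), z.im ≠ 0 → ∀ f : ℝ → E, ContDiffOn ℝ s f (Set.Icc a b) →
      (∃ h, greenIntegral a b (DiffExpr.Qfam L r) (DiffExpr.Hfam L r) M z
          (fun t => (L (conj z)).Wweight m r s t ((L (conj z)).Fvec r s (Set.Icc a b) f t)) a = A h ∧
        greenIntegral a b (DiffExpr.Qfam L r) (DiffExpr.Hfam L r) M z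
          (fun t => (L (conj z)).Wweight m r s t ((L (conj z)).Fvec r s (Set.Icc a b) f t)) b = C h) →
      DiffExpr.SolvesBoundaryProblem (L z) m r s a b A C f
        (DiffExpr.resolvent L m r s hr a b M z f) := by
    intro M A C z hz f hf ⟨h, h1, h2⟩
    obtain ⟨k1, k2, k3, -⟩ := hL.scalar_of_isSystemSolution hab hs hsr hr hdom (hL.nonreal_mem z hz)
      hm.smooth hf (hN.isSystemSolution_greenIntegral hab h0 M hz (hg z hz f hf))
    exact ⟨k1, k2, h, (k3 a ha).trans h1, (k3 b hb).trans h2⟩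
  refine ⟨fun z hz => ⟨hN.isOperatorSolution hab h0 hz, hN.isUnit_solution hab h0 hz ha,
    hN.isUnit_solution hab h0 hz hb, (isUnit_I_smul (hN.isUnit_G hz h0)).1⟩,
    fun Ma Nb hp => ⟨fun z hz h => IsDefiniteNevanlinnaSystem.dissipative_of_pair hp hz h,
      fun z hz => hN.isUnit_boundaryDiff hab h0 hp hz,
      hN.isCharacteristicOperator_boundaryCharOp hab h0 hp, fun z hz f hf => ⟨?_, ?_⟩⟩,
    fun M hM => ?_⟩
  · exact hres _ _ _ z hz f hf (hN.exists_greenIntegral_boundaryCharOp hab h0 hp hz (hg z hz f hf))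
  · rintro y ⟨hy, hye, k, hka, hkb⟩ t ht
    obtain ⟨h, h1, h2⟩ := hN.exists_greenIntegral_boundaryCharOp hab h0 hp hz (hg z hz f hf)
    -- Uniqueness is inherited from the system: the vector of any competing solution solves it with
    -- the same right-hand side and boundary conditions, and `y` is its first component.
    have hys := hL.isSystemSolution_yvec hab hs hsr hr hdom (hL.nonreal_mem z hz) hm.smooth hf hy hye
    have hgs := hN.isSystemSolution_greenIntegral hab h0
      (boundaryCharOp a b (DiffExpr.Qfam L r) (DiffExpr.Hfam L r) Ma Nb) hz (hg z hz f hf)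
    have he := hN.boundary_unique hab h0 hp hz hys hgs hka hkb h1 h2 ht
    have h0' : (L z).yvec m r s (Set.Icc a b) y f t ⟨0, hr⟩ = y t := by
      rw [← BlockSpace.coord_of_lt hr, DiffExpr.yvec, BlockSpace.coord_toLp hr]
      by_cases h1 : r = 1
      · rw [if_pos h1]
      · rw [if_neg h1, if_pos (by simp; omega), iteratedDerivWithin_zero]
    rw [← h0', he]
    rfl
  · obtain ⟨Ma, Nb, hp, hMab⟩ := hN.exists_pair_of_isCharacteristicOperator hab h0 hM
    exact ⟨Ma, Nb, hp, fun z hz f hf => hres M _ _ z hz f hf (hMab z hz _ (hg z hz f hf))⟩
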